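/- Let $K\subset\mathbb R^2$ be a compact convex polygon with non-empty interior and exactly $\kappa\ge 3$ vertices $\mathsf v_1,\dots,\mathsf v_\kappa$, listed counterclockwise; all indices $j$ of sides are cyclic modulo $\kappa$. Side $j$ joins $\mathsf v_j$ to $\mathsf v_{j+1}$ and has length $r_j$; $\theta_j$ is the internal angle between side $j$ and side $j+1$ (at $\mathsf v_{j+1}$). **Constants.** The system $$f_j\,(f_j+f_{j-1})(f_j+f_{j+1})=r_j\,r_{j+1}\sin\theta_j\qquad(1\le j\le\kappa)$$ has exactly one solution $f=(f_1,\dots,f_\kappa)$ with all $f_j>0$. Set $\bar f=\sum_i f_i$, $g_j=f_j/\bar f$ and $$m_j=\frac{\cot\theta_{j-1}+\cot\theta_j}{r_j}(g_j+g_{j-1})+\frac{g_{j+1}+g_j}{r_{j+1}\sin\theta_j}+\frac{g_{j-1}+g_{j-2}}{r_{j-1}\sin\theta_{j-1}} .$$ Let $\Sigma_K^{-1}=(\sigma^{-1}_{i,j})_{1\le i,j\le\kappa-1}$ be the symmetric matrix with $$\sigma^{-1}_{j,j}=\frac1{g_j}+\frac1{g_\kappa}+\mathbb 1_{j\ne1}\Big(\frac1{g_1+g_\kappa}+\frac1{g_{j-1}+g_j}\Big)+\mathbb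 1_{j\ne\kappa-1}\Big(\frac1{g_{\kappa-1}+g_\kappa}+\frac1{g_{j+1}+g_j}\Big),$$ $$\sigma^{-1}_{i,j}=\frac1{g_\kappa}+\frac{\mathbb 1_{j=i+1}}{g_{j-1}+g_j}+\frac{\mathbb 1_{i\ne1}}{g_\kappa+g_1}+\frac{\mathbb 1_{j\ne\kappa-1}}{g_{\kappa-1}+g_\kappa}\qquad(i<j),$$ that is, the matrix of the quadratic form $\sum_{j=1}^{\kappa}\Big(\frac{x_j^2}{g_j}+\frac{(x_j+x_{j+1})^2}{g_j+g_{j+1}}\Big)$ in $x_1,\dots,x_{\kappa-1}$, with $x_\kappa=-\sum_{i<\kappa}x_i$; let $\mathbb d_K=\det\Sigma_K^{-1}$. **Points.** A tuple $z=(z_1,\dots,z_n)$ of points of $K$ is in convex position if no $z_i$ is in the convex hull of the others; it is moreover in canonical order if it is listed counterclockwise starting from its lowest point (the leftmost one of these). For a tuple $z$, let $\ell_j(z)$ be the smallest distance from a point of $z$ to the line carrying side $j$, and let $\mathsf{PCP}(z)$ be the smallest polygon with sides parallel to those of $K$ that contains $z$; it is full-sided if all of its $\kappa$ sides have positive length.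 The contact point $\mathsf{cp}_j$ is the point of $z$ on side $j$ of $\mathsf{PCP}(z)$ (the lexicographically smallest one if there are several), and the size vector $(s_1,\dots,s_\kappa)$ is defined by: $s_j\in\{0,\dots,n-1\}$ is the number of steps from $\mathsf{cp}_j$ to $\mathsf{cp}_{j+1}$ along the cyclically indexed tuple $z$. Let $\widetilde{\mathbb P}_K(n)$ be the probability that $n$ independent uniform points of $K$ are in convex position and have a full-sided $\mathsf{PCP}$. Let $\mathbb D^{(n)}_K$ be the law of $n$ independent uniform points of $K$ conditioned to be in convex position, in canonical order, and to have a full-sided $\mathsf{PCP}$; under it, write $\ell^{(n)}_j=\ell_j(z)$ and $s^{(n)}_j=s_j(z)$. **Theorem.** Assume that $m_j>0$ for all $j$. Then, under $\mathbb D^{(n)}_K$, as $n\to\infty$, $$\Big(n\ell^{(n)}_1,\dots,n\ell^{(n)}_\kappa,\ \tfrac{s^{(n)}_1-ng_1}{\sqrt n},\dots,\tfrac{s^{(n)}_{\kappa-1}-ng_{\kappa-1}}{\sqrt n}\Big)\xrightarrow{(d)}(\bar\ell_1,\dots,\bar\ell_\kappa,x_1,\dots,x_{\kappa-1}),$$ where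 the $\bar\ell_j$ are independent exponential variables with rates $m_j$ and, independently of them, $x=(x_1,\dots,x_{\kappa-1})$ is a centered Gaussian vector whose inverse covariance matrix is the positive definite matrix $\Sigma_K^{-1}$; the limit has joint density $$\prod_{j=1}^\kappa m_je^{-m_j\ell_j}\mathbb 1_{\ell_j\ge0}\cdot\sqrt{\frac{\mathbb d_K}{(2\pi)^{\kappa-1}}}\;e^{-\frac12\,{}^t x\,\Sigma_K^{-1}x}.$$ Moreover $$\widetilde{\mathbb P}_K(n)\underset{n\to\infty}{\sim}\frac1{(2\pi)^{\kappa/2}\sqrt{\mathbb d_K}}\prod_{j=1}^\kappa\Big(\sqrt{\frac{f_j+f_{j-1}}{f_j}}\;\frac1{m_j\sin(\theta_j)\,r_j}\Big)\cdot\frac{e^{2n}\,\bar f^{\,3n}}{\mathrm{Area}(K)^n\,n^{2n+\kappa/2}} .$$ -/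

import Mathlib

open MeasureTheory ProbabilityTheory Filter Topology Asymptotics
open scoped BoundedContinuousFunction

noncomputable section

namespace PCP

/-- The Euclidean plane, with Lebesgue measure as `volume`. -/
abbrev Plane : Type := EuclideanSpace ℝ (Fin 2)

/-- The determinant of two vectors of the plane. -/
def cross (a b : Plane) : ℝ := a 0 * b 1 - a 1 * b 0

/-- For `n ≥ 3`: the points `v 0, …, v (n - 1)` are the vertices of a strictly convex polygon,
listed counterclockwise, that is, every point other than `v i` and its cyclic successor lies
strictly to the left of the oriented line from `v i` to its successor. -/
def IsCcwPolygon {n : ℕ} (v : Fin n → Plane) : Prop :=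
  ∀ i j : Fin n, j ≠ i → j ≠ finRotate n i →
    0 < cross (v (finRotate n i) - v i) (v j - v i)

section Polygon

/-! A polygon with `κ = k + 1` sides is given by its vertices `v`, listed counterclockwise and
indexed by `Fin (k + 1)`, so that `j + 1` and `j - 1` are cyclic. Side `j` joins `v j` to
`v (j + 1)`. -/

variable {k : ℕ} (v : Fin (k + 1) → Plane)

/-- The polygon itself. -/
def polygon : Set Plane := convexHull ℝ (Set.range v)

def area : ℝ := (volume : Measure Plane).real (polygon v)

/-- Length of side `j`. -/
def sideLength (j : Fin (k + 1)) : ℝ := dist (v j) (v (j + 1))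

/-- Internal angle between side `j` and side `j + 1`. -/
def innerAngle (j : Fin (k + 1)) : ℝ :=
  EuclideanGeometry.angle (v j) (v (j + 1)) (v (j + 1 + 1))

/-- The distance of `p` to the line carrying side `j`, counted positively on the side of that
line on which the polygon lies. -/
def lineDist (j : Fin (k + 1)) (p : Plane) : ℝ :=
  cross (v (j + 1) - v j) (p - v j) / sideLength v j

/-- `f` is a positive solution of
`f j * (f j + f (j - 1)) * (f j + f (j + 1)) = r j * r (j + 1) * sin (θ j)` for all `j`. -/
def IsPSSolution (f : Fin (k + 1) → ℝ) : Prop :=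
  (∀ j, 0 < f j) ∧
  ∀ j, f j * (f j + f (j - 1)) * (f j + f (j + 1)) =
    sideLength v j * sideLength v (j + 1) * Real.sin (innerAngle v j)

/-- `g j = f j / ∑ i, f i`. -/
def normalize (f : Fin (k + 1) → ℝ) (j : Fin (k + 1)) : ℝ := f j / ∑ i, f i

/-- The rates `m j`. -/
def rate (g : Fin (k + 1) → ℝ) (j : Fin (k + 1)) : ℝ :=
  (Real.cot (innerAngle v (j - 1)) + Real.cot (innerAngle v j)) / sideLength v j
      * (g j + g (j - 1))
    + 1 / (Real.sin (innerAngle v j) * sideLength v (j + 1)) * (g (j + 1) + g j)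
    + 1 / (Real.sin (innerAngle v (j - 1)) * sideLength v (j - 1)) * (g (j - 1) + g (j - 1 - 1))

/-! ### The parallel containing polygon of a tuple of points -/

variable {n : ℕ} (z : Fin n → Plane)

/-- Side-distance: the smallest distance from a point of `z` to side `j`. -/
def sideDist (j : Fin (k + 1)) : ℝ := ⨅ i, lineDist v j (z i)

/-- The smallest polygon with sides parallel to those of the polygon `v` that contains `z`. -/
def pcp : Set Plane := {p | ∀ j, sideDist v z j ≤ lineDist v j p}

/-- Side `j` of the parallel containing polygon (a segment, possibly reduced to a point). -/
def pcpSide (j : Fin (k + 1)) : Set Plane := {p ∈ pcp v z | lineDist v j p = sideDist v z j}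

/-- Length of side `j` of the parallel containing polygon. -/
def pcpSideLength (j : Fin (k + 1)) : ℝ := Metric.diam (pcpSide v z j)

def FullSided : Prop := ∀ j, 0 < pcpSideLength v z j

/-- Lexicographical order on the plane. -/
def LexLE (p q : Plane) : Prop := p 0 < q 0 ∨ (p 0 = q 0 ∧ p 1 ≤ q 1)

/-- `z i` is the contact point on side `j`: the point of `z` on side `j` of the parallel containing
polygon, and the lexicographically smallest one if there are several. -/
def IsContact (j : Fin (k + 1)) (i : Fin n) : Prop :=
  z i ∈ pcpSide v z j ∧ ∀ i', z i' ∈ pcpSide v z j → LexLE (z i) (z i')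

/-- The index in `{0, …, n - 1}` of the contact point on side `j`. -/
def contactIndex (j : Fin (k + 1)) : ℕ := sInf {i : ℕ | ∃ h : i < n, IsContact v z j ⟨i, h⟩}

/-- The size vector: the number of steps, along the cyclically indexed tuple `z`, from the contact
point on side `j` to the contact point on side `j + 1`. -/
def sizeVector (j : Fin (k + 1)) : ℕ := (contactIndex v z (j + 1) + (n - contactIndex v z j)) % n

/-- `z` is in convex position in the polygon: all points lie in it, and none of them is in the
convex hull of the others. -/
def InConvexPosition : Prop := (∀ i, z i ∈ polygon v) ∧ ConvexIndependent ℝ z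

/-- `z` is in convex position in the polygon and in canonical order: counterclockwise, starting
from the lowest point (the leftmost of the lowest points if there are several). -/
def InCanonicalOrder : Prop :=
  InConvexPosition v z ∧ IsCcwPolygon z ∧
  ∀ i j : Fin n, i.val = 0 → z i 1 < z j 1 ∨ (z i 1 = z j 1 ∧ z i 0 ≤ z j 0)

/-! ### Laws -/

/-- The law of `n` independent uniform points in the polygon. -/
def uniformLaw (n : ℕ) : Measure (Fin n → Plane) :=
  Measure.pi fun _ => ProbabilityTheory.cond volume (polygon v)

/-- The law of `n` independent uniform points, conditioned to be in convex position in canonical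
order and to have a full-sided parallel containing polygon. -/
def conditionedLaw (n : ℕ) : Measure (Fin n → Plane) :=
  ProbabilityTheory.cond (uniformLaw v n) {z | InCanonicalOrder v z ∧ FullSided v z}

/-- The probability that `n` independent uniform points are in convex position and have a
full-sided parallel containing polygon. -/
def fullSidedProb (n : ℕ) : ℝ := (uniformLaw v n).real {z | InConvexPosition v z ∧ FullSided v z}

/-- The rescaled side-distances `n * ℓ j`, for all `k + 1` sides, together with the fluctuations
`(s j - n * g j) / √n` of the size vector, for the first `k` sides. -/
def rescaled (g : Fin (k + 1) → ℝ) (n : ℕ) (z : Fin n → Plane) :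
    (Fin (k + 1) → ℝ) × EuclideanSpace ℝ (Fin k) :=
  (fun j => n * sideDist v z j,
    WithLp.toLp 2 fun a =>
      ((sizeVector v z a.castSucc : ℝ) - n * g a.castSucc) / Real.sqrt n)

end Polygon

/-- The matrix `Σ⁻¹`, of size `κ - 1 = k`. With the sides numbered from `0` to `k`, this is the
matrix of the quadratic form `x ↦ ∑ j, (x j ^ 2 / g j + (x j + x (j + 1)) ^ 2 / (g j + g (j + 1)))`
in the variables `x 0, …, x (k - 1)`, where `x k = - ∑ j < k, x j`. -/
def precision {k : ℕ} (g : Fin (k + 1) → ℝ) : Matrix (Fin k) (Fin k) ℝ :=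
  Matrix.of fun a b =>
    if a = b then
      1 / g a.castSucc + 1 / g (Fin.last k)
        + (if a.val ≠ 0 then
            1 / (g 0 + g (Fin.last k)) + 1 / (g (a.castSucc - 1) + g a.castSucc) else 0)
        + (if a.val + 1 ≠ k then
            1 / (g (Fin.last k - 1) + g (Fin.last k)) + 1 / (g (a.castSucc + 1) + g a.castSucc)
          else 0)
    else
      let i := min a b
      let j := max a b
      1 / g (Fin.last k)
        + (if j.val = i.val + 1 then 1 / (g i.castSucc + g j.castSucc) else 0)
        + (if i.val ≠ 0 then 1 / (g (Fin.last k) + g 0) else 0)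
        + (if j.val + 1 ≠ k then 1 / (g (Fin.last k - 1) + g (Fin.last k)) else 0)

/-- The limit law: independent exponential variables with rates `m j` and, independently, a centered
Gaussian vector with inverse covariance matrix `Q`. -/
def limitLaw {k : ℕ} (m : Fin (k + 1) → ℝ) (Q : Matrix (Fin k) (Fin k) ℝ) :
    Measure ((Fin (k + 1) → ℝ) × EuclideanSpace ℝ (Fin k)) :=
  (Measure.pi fun j => expMeasure (m j)).prod (multivariateGaussian 0 Q⁻¹)

/-- The joint density of the limit. -/
def limitDensity {k : ℕ} (m : Fin (k + 1) → ℝ) (Q : Matrix (Fin k) (Fin k) ℝ)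
    (p : (Fin (k + 1) → ℝ) × EuclideanSpace ℝ (Fin k)) : ℝ :=
  (∏ j, if 0 ≤ p.1 j then m j * Real.exp (-(m j * p.1 j)) else 0)
    * Real.sqrt (Q.det / (2 * Real.pi) ^ k)
    * Real.exp (-(1 / 2) * ((fun a => p.2 a) ⬝ᵥ Q.mulVec (fun a => p.2 a)))

/-- Weak convergence of a sequence of measures, tested on bounded continuous functions. -/
def ConvergesWeakly {E : Type*} [TopologicalSpace E] [MeasurableSpace E]
    (μ : ℕ → Measure E) (ν : Measure E) : Prop :=
  ∀ φ : E →ᵇ ℝ, Tendsto (fun n => ∫ x, φ x ∂(μ n)) atTop (𝓝 (∫ x, φ x ∂ν))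

/-- The constant in the asymptotic equivalent. -/
def equivConst {k : ℕ} (v : Fin (k + 1) → Plane) (f : Fin (k + 1) → ℝ) : ℝ :=
  1 / ((2 * Real.pi) ^ (((k : ℝ) + 1) / 2) * Real.sqrt (precision (normalize f)).det)
    * ∏ j, (Real.sqrt ((f j + f (j - 1)) / f j)
        / (rate v (normalize f) j * Real.sin (innerAngle v j) * sideLength v j))

end PCP

end

/-! Points in convex position are described by one point and by their edge vectors listed by
increasing angle. Almost surely every edge lies in one of the κ open cones spanned by the directions
of two consecutive sides. If `s j` edges lie in cone `j`, the contact point of side `j` is reached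
exactly when the edges of the cones before `j` are used up. Hence `s` is the size vector and the
distances to the sides are affine in the starting point and the edges (`Good.sideDist_eq`,
`Good.sizeVector_eq`). Relabelling the points and permuting a closed family of edges preserve
Lebesgue measure, so the order of the edges can be forgotten at the price of a factor `1 / ∏ j, (s
j)!` (`setLIntegral_goodSet`).

Each edge of cone `j` splits into positive components along sides `j` and `j + 1`. Side `j` of the
containing polygon is then a sum of `N j = s j + s (j - 1)` positive components, and it has positive
length exactly when `N j` is positive. A sum of `N` positive Lebesgue variables has density `c ^ (N
- 1) / (N - 1)!`. The side lengths satisfy two linear relations because the polygon closes up;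
together with its position they are equivalent to the distances `ℓ`, through an affine map whose
determinant is a product of sines. This gives an exact formula for the joint law of `(ℓ, s)`, in
which side `j` contributes a power of `sin θ j`, `1 / (s j)!` and `width ℓ j ^ (N j - 1) / (N j -
1)!` (`coneIntegral_eq`, `setLIntegral_goodSet_eq`).

The equations satisfied by `f` say precisely that this weight is, up to a factor independent of `s`,
a product of 2κ Poisson probabilities: parameter `n * g j` at `s j`, and parameter `n * (g j + g (j
- 1)) * width ℓ j / r j` at `N j - 1` (`weight_eq`). The second parameters are affine in `ℓ`; their
sum decreases by `∑ m j * (n * ℓ j)`, and compensating this in the exponentials produces the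
exponential laws (`sum_sideParam`). At the scale `√n` the local limit theorem for Poisson laws
(`tendsto_poisson`) gives the Gaussian weight with exponent `-(1/2) ∑ (x j ^ 2 / g j + (x j + x (j -
1)) ^ 2 / (g j + g (j - 1)))`, which is the form of `precision g` on vectors of sum zero
(`dotProduct_precision`).

The sum over size vectors is written as an integral by means of integer parts, and the densities are
dominated by an integrable product of exponentials, where positivity of the rates is needed
(`scaledDensity_le`, `tendsto_integral_densityAt`). Dividing by the total mass gives the limit law.
Multiplying the total mass by `n!` and applying Stirling's formula gives the equivalent of the
probability (`isEquivalent_fullSidedProb`).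

The system is the equation for critical points of a strictly convex function built from `t log t -
t`. Strict convexity gives uniqueness, and minimisation over a large cube gives existence
(`system_unique`, `exists_system`). -/

namespace PCP

/-! ### Determinants and dot products in the plane -/

/-- The dot product of two vectors of the plane. -/
noncomputable def dot (a b : Plane) : ℝ := a 0 * b 0 + a 1 * b 1

lemma cross_add_right (a b c : Plane) : cross a (b + c) = cross a b + cross a c := by
  simp only [cross, PiLp.add_apply]; ring

lemma cross_add_left (a b c : Plane) : cross (a + b) c = cross a c + cross b c := by
  simp only [cross, PiLp.add_apply]; ring

lemma cross_sub_right (a b c : Plane) : cross a (b - c) = cross a b - cross a c := by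
  simp only [cross, PiLp.sub_apply]; ring

lemma cross_smul_right (t : ℝ) (a b : Plane) : cross a (t • b) = t * cross a b := by
  simp only [cross, PiLp.smul_apply, smul_eq_mul]; ring

lemma cross_smul_left (t : ℝ) (a b : Plane) : cross (t • a) b = t * cross a b := by
  simp only [cross, PiLp.smul_apply, smul_eq_mul]; ring

lemma cross_neg_right (a b : Plane) : cross a (-b) = -cross a b := by
  simp only [cross, PiLp.neg_apply]; ring

@[simp] lemma cross_self (a : Plane) : cross a a = 0 := by
  simp only [cross]; ring

@[simp] lemma cross_zero_right (a : Plane) : cross a 0 = 0 := by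
  simp [cross]

@[simp] lemma cross_zero_left (a : Plane) : cross 0 a = 0 := by
  simp [cross]

lemma cross_comm (a b : Plane) : cross a b = -cross b a := by
  simp only [cross]; ring

/-- The linear form `cross a`. -/
noncomputable def crossLin (a : Plane) : Plane →ₗ[ℝ] ℝ where
  toFun := cross a
  map_add' := cross_add_right a
  map_smul' t b := cross_smul_right t a b

@[simp] lemma crossLin_apply (a b : Plane) : crossLin a b = cross a b := rfl

lemma cross_sum_right {ι : Type*} (s : Finset ι) (a : Plane) (f : ι → Plane) :
    cross a (∑ i ∈ s, f i) = ∑ i ∈ s, cross a (f i) := map_sum (crossLin a) f s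

lemma plane_ext {a b : Plane} (h0 : a 0 = b 0) (h1 : a 1 = b 1) : a = b := by
  ext i; fin_cases i
  exacts [h0, h1]

lemma plane_eq_zero_iff (a : Plane) : a = 0 ↔ a 0 = 0 ∧ a 1 = 0 :=
  ⟨fun h => by simp [h], fun h => plane_ext (by simp [h.1]) (by simp [h.2])⟩

lemma dot_self_pos {a : Plane} (h : a ≠ 0) : 0 < dot a a := by
  by_contra hc
  apply h
  rw [plane_eq_zero_iff]
  unfold dot at hc
  constructor <;> nlinarith [sq_nonneg (a 0), sq_nonneg (a 1)]

lemma dot_self_eq_norm_sq (a : Plane) : dot a a = ‖a‖ ^ 2 := by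
  rw [EuclideanSpace.real_norm_sq_eq, Fin.sum_univ_two, dot]; ring

lemma inner_eq_dot (a b : Plane) : inner ℝ a b = dot a b := by
  simp [PiLp.inner_apply, Fin.sum_univ_two, dot]; ring

lemma cross_sq_add_dot_sq (a b : Plane) :
    cross a b ^ 2 + dot a b ^ 2 = dot a a * dot b b := by
  simp only [cross, dot]; ring

lemma dot_self_mul_cross (e x y : Plane) :
    dot e e * cross x y = dot e x * cross e y - cross e x * dot e y := by
  simp only [cross, dot]; ring

/-- The coordinates of a vector in a basis of the plane. -/
lemma cross_smul_basis (a b x : Plane) :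
    cross a b • x = cross x b • a + cross a x • b := by
  apply plane_ext <;> simp only [cross, PiLp.smul_apply, PiLp.add_apply, smul_eq_mul] <;> ring

/-! ### Oriented angles with values in `[0, 2π)` -/

/-- The oriented angle from `e` to `x`, in `[0, 2π)`. -/
noncomputable def key (e x : Plane) : ℝ :=
  if 0 ≤ Complex.arg ⟨dot e x, cross e x⟩ then Complex.arg ⟨dot e x, cross e x⟩
  else Complex.arg ⟨dot e x, cross e x⟩ + 2 * Real.pi

lemma key_nonneg (e x : Plane) : 0 ≤ key e x := by
  unfold key
  split_ifs with h
  · exact h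
  · linarith [Complex.neg_pi_lt_arg ⟨dot e x, cross e x⟩, Real.pi_pos]

lemma key_lt (e x : Plane) : key e x < 2 * Real.pi := by
  unfold key
  split_ifs with h
  · linarith [Complex.arg_le_pi ⟨dot e x, cross e x⟩, Real.pi_pos]
  · linarith

lemma exists_polar {e x : Plane} (he : e ≠ 0) (hx : x ≠ 0) :
    ∃ r, 0 < r ∧ dot e x = r * Real.cos (key e x) ∧ cross e x = r * Real.sin (key e x) := by
  have hcos : Real.cos (key e x) = Real.cos (Complex.arg ⟨dot e x, cross e x⟩) := by
    unfold key; split_ifs <;> simp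
  have hsin : Real.sin (key e x) = Real.sin (Complex.arg ⟨dot e x, cross e x⟩) := by
    unfold key; split_ifs <;> simp
  refine ⟨‖(⟨dot e x, cross e x⟩ : ℂ)‖, ?_, ?_, ?_⟩
  · rw [norm_pos_iff]
    intro h
    have h1 := congrArg Complex.re h
    have h2 := congrArg Complex.im h
    simp only [Complex.zero_re, Complex.zero_im] at h1 h2
    have := cross_sq_add_dot_sq e x
    rw [h1, h2] at this
    have := mul_pos (dot_self_pos he) (dot_self_pos hx)
    linarith
  · rw [hcos, Complex.norm_mul_cos_arg]
  · rw [hsin, Complex.norm_mul_sin_arg]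

/-- In polar coordinates around `e`, `dot_self_mul_cross` is the formula for the sine of a
difference. This turns signs of determinants into inequalities between angles. -/
lemma exists_cross_eq_sin {e x y : Plane} (he : e ≠ 0) (hx : x ≠ 0) (hy : y ≠ 0) :
    ∃ r, 0 < r ∧ cross x y = r * Real.sin (key e y - key e x) := by
  obtain ⟨r, hr, h1, h2⟩ := exists_polar he hx
  obtain ⟨s, hs, h3, h4⟩ := exists_polar he hy
  refine ⟨r * s / dot e e, div_pos (mul_pos hr hs) (dot_self_pos he), ?_⟩
  have h := dot_self_mul_cross e x y
  have hd := (dot_self_pos he).ne'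
  rw [h1, h2, h3, h4] at h
  rw [Real.sin_sub]
  field_simp
  linear_combination h

lemma cross_pos_iff {e x y : Plane} (he : e ≠ 0) (hx : x ≠ 0) (hy : y ≠ 0) :
    0 < cross x y ↔ 0 < Real.sin (key e y - key e x) := by
  obtain ⟨r, hr, h⟩ := exists_cross_eq_sin he hx hy
  rw [h, mul_pos_iff_of_pos_left hr]

lemma cos_sin_inj {s t : ℝ} (hs : 0 ≤ s) (hs' : s < 2 * Real.pi) (ht : 0 ≤ t)
    (ht' : t < 2 * Real.pi) (hc : Real.cos s = Real.cos t) (hn : Real.sin s = Real.sin t) :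
    s = t := by
  have h := Real.Angle.cos_sin_inj hc hn
  rw [Real.Angle.angle_eq_iff_two_pi_dvd_sub] at h
  obtain ⟨n, hn⟩ := h
  have h1 : (n : ℝ) < 1 := by
    by_contra hc
    push Not at hc
    nlinarith [Real.pi_pos]
  have h2 : (-1 : ℝ) < n := by
    by_contra hc
    push Not at hc
    nlinarith [Real.pi_pos]
  have h3 : n = 0 := by
    have : n < 1 := by exact_mod_cast h1
    have : -1 < n := by exact_mod_cast h2
    omega
  rw [h3] at hn
  simp at hn
  linarith

lemma key_eq_of_polar {e x : Plane} (he : e ≠ 0) (hx : x ≠ 0) {r t : ℝ} (hr : 0 < r)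
    (ht : 0 ≤ t) (ht' : t < 2 * Real.pi) (h1 : dot e x = r * Real.cos t)
    (h2 : cross e x = r * Real.sin t) : key e x = t := by
  obtain ⟨s, hs, h3, h4⟩ := exists_polar he hx
  have hrs : r = s := by
    have hr2 : r ^ 2 = dot e x ^ 2 + cross e x ^ 2 := by
      rw [h1, h2]; nlinarith [Real.sin_sq_add_cos_sq t]
    have hs2 : s ^ 2 = dot e x ^ 2 + cross e x ^ 2 := by
      rw [h3, h4]; nlinarith [Real.sin_sq_add_cos_sq (key e x)]
    nlinarith
  subst hrs
  apply cos_sin_inj (key_nonneg _ _) (key_lt _ _) ht ht'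
  · exact mul_left_cancel₀ hr.ne' (h3.symm.trans h1)
  · exact mul_left_cancel₀ hr.ne' (h4.symm.trans h2)

lemma key_self {e : Plane} (he : e ≠ 0) : key e e = 0 :=
  key_eq_of_polar he he (dot_self_pos he) le_rfl (by positivity) (by simp) (by simp)

lemma eq_smul_of_key_eq {e x y : Plane} (he : e ≠ 0) (hx : x ≠ 0) (hy : y ≠ 0)
    (h : key e x = key e y) : ∃ c : ℝ, 0 < c ∧ y = c • x := by
  obtain ⟨r, hr, h1, h2⟩ := exists_polar he hx
  obtain ⟨s, hs, h3, h4⟩ := exists_polar he hy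
  refine ⟨s / r, div_pos hs hr, ?_⟩
  rw [← h] at h3 h4
  have hd : dot e y = s / r * dot e x := by rw [h3, h1]; field_simp
  have hc : cross e y = s / r * cross e x := by rw [h4, h2]; field_simp
  have he' := (dot_self_pos he).ne'
  have key0 : ∀ z : Plane, dot e e * z 0 = dot e z * e 0 - cross e z * e 1 := fun z => by
    simp only [dot, cross]; ring
  have key1 : ∀ z : Plane, dot e e * z 1 = dot e z * e 1 + cross e z * e 0 := fun z => by
    simp only [dot, cross]; ring
  apply plane_ext
  · apply mul_left_cancel₀ he'
    rw [key0, PiLp.smul_apply, smul_eq_mul, mul_left_comm, key0, hd, hc]; ring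
  · apply mul_left_cancel₀ he'
    rw [key1, PiLp.smul_apply, smul_eq_mul, mul_left_comm, key1, hd, hc]; ring

/-- Change of reference direction, when the new reference comes first. -/
lemma key_eq_key_sub {e e' x : Plane} (he : e ≠ 0) (he' : e' ≠ 0) (hx : x ≠ 0)
    (h : key e e' ≤ key e x) : key e' x = key e x - key e e' := by
  obtain ⟨r, hr, h1, h2⟩ := exists_polar he hx
  obtain ⟨s, hs, h3, h4⟩ := exists_polar he he'
  have hd := dot_self_pos he
  refine key_eq_of_polar he' hx (r := r * s / dot e e) (by positivity) (by linarith)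
    (by linarith [key_lt e x, key_nonneg e e']) ?_ ?_
  · have : dot e e * dot e' x = dot e e' * dot e x + cross e e' * cross e x := by
      simp only [cross, dot]; ring
    rw [h1, h2, h3, h4] at this
    rw [Real.cos_sub]
    field_simp
    linear_combination this
  · have h := dot_self_mul_cross e e' x
    rw [h1, h2, h3, h4] at h
    rw [Real.sin_sub]
    field_simp
    linear_combination h

lemma measurable_key (e : Plane) : Measurable (key e) := by
  have h0 : Measurable fun x : Plane => dot e x := by unfold dot; fun_prop
  have h1 : Measurable fun x : Plane => cross e x := by unfold cross; fun_prop
  have h2 : Measurable fun x : Plane => Complex.arg ⟨dot e x, cross e x⟩ :=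
    Complex.measurable_arg.comp
      (Complex.measurableEquivRealProd.symm.measurable.comp (h0.prodMk h1))
  exact Measurable.ite (measurableSet_le measurable_const h2) h2 (h2.add_const _)

/-! ### Signs of sines -/

lemma sin_pos_cases {t : ℝ} (h2 : t < 2 * Real.pi)
    (h : 0 < Real.sin t) : (0 < t ∧ t < Real.pi) ∨ t < -Real.pi := by
  by_contra hc
  push Not at hc
  obtain ⟨ha, hb⟩ := hc
  rcases le_or_gt t 0 with h0 | h0
  · exact absurd h (not_lt.mpr (Real.sin_nonpos_of_nonpos_of_neg_pi_le h0 hb))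
  · have h3 := ha h0
    have : Real.sin t = -Real.sin (t - Real.pi) := by rw [Real.sin_sub_pi]; ring
    have h4 := Real.sin_nonneg_of_nonneg_of_le_pi (x := t - Real.pi) (by linarith) (by linarith)
    linarith

lemma sin_pos_of_lt_neg_pi {t : ℝ} (h1 : -(2 * Real.pi) < t) (h2 : t < -Real.pi) :
    0 < Real.sin t := by
  have := Real.sin_pos_of_pos_of_lt_pi (x := t + 2 * Real.pi) (by linarith) (by linarith)
  rwa [Real.sin_add_two_pi] at this

lemma sin_neg_of_pi_lt {t : ℝ} (h1 : Real.pi < t) (h2 : t < 2 * Real.pi) :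
    Real.sin t < 0 := by
  have := sin_pos_of_lt_neg_pi (t := -t) (by linarith) (by linarith)
  rw [Real.sin_neg] at this
  linarith

/-- If `t < t'` are angles and `s` is to the left of `t` and to the right of `t'`, then `s` lies
between `t` and `t'`. -/
lemma between_of_sin_pos {s t t' : ℝ} (hs : 0 ≤ s) (hs' : s < 2 * Real.pi) (ht : 0 ≤ t)
    (htt : t < t') (ht' : t' < 2 * Real.pi) (h1 : 0 < Real.sin (s - t))
    (h2 : 0 < Real.sin (t' - s)) : t < s ∧ s < t' := by
  have hp := Real.pi_pos
  rcases sin_pos_cases (by linarith) h1 with h | h <;>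
  rcases sin_pos_cases (by linarith) h2 with h' | h' <;>
  constructor <;> linarith

/-- If `s` is to the left of `t` and to the right of `0`, then `t < s`. -/
lemma lt_of_sin_pos {s t : ℝ} (hs : 0 ≤ s) (hs' : s < 2 * Real.pi) (ht : 0 ≤ t)
    (ht' : t < 2 * Real.pi) (h1 : 0 < Real.sin (s - t)) (h2 : Real.sin s < 0) : t < s := by
  have hp := Real.pi_pos
  rcases sin_pos_cases (by linarith) h1 with h | h
  · linarith
  · exact absurd h2 (not_lt.mpr (Real.sin_nonneg_of_nonneg_of_le_pi hs (by linarith)))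

/-! ### Partial sums of sines of increasing angles -/

/-- If the angles `α l` increase in `[0, 2π)` and cross `β` at the index `i`, then the partial sums
of `R l * sin (α l - β)`, whose total is zero, are minimal at `i`. -/
lemma sum_sin_le {n : ℕ} {α R : ℕ → ℝ} {β : ℝ} (h0 : ∀ l < n, 0 ≤ α l)
    (h1 : ∀ l < n, α l < 2 * Real.pi) (hβ : 0 ≤ β) (hβ' : β < 2 * Real.pi)
    (hmono : ∀ l l', l ≤ l' → l' < n → α l ≤ α l') (hR : ∀ l < n, 0 ≤ R l)
    {i : ℕ} (hin : i ≤ n) (hlo : ∀ l < i, α l ≤ β) (hhi : ∀ l, i ≤ l → l < n → β ≤ α l)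
    (hsum : ∑ l ∈ Finset.range n, R l * Real.sin (α l - β) = 0) {j : ℕ} (hj : j ≤ n) :
    ∑ l ∈ Finset.range i, R l * Real.sin (α l - β) ≤
      ∑ l ∈ Finset.range j, R l * Real.sin (α l - β) := by
  have hp := Real.pi_pos
  set δ : ℕ → ℝ := fun l => R l * Real.sin (α l - β) with hδ
  rcases le_or_gt i j with hij | hij
  · by_cases hall : ∀ l ∈ Finset.Ico i j, 0 ≤ δ l
    · rw [← Finset.sum_range_add_sum_Ico _ hij]
      linarith [Finset.sum_nonneg hall]
    · push Not at hall
      obtain ⟨l, hl, hneg⟩ := hall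
      rw [Finset.mem_Ico] at hl
      have hs : Real.sin (α l - β) < 0 := by
        by_contra hc
        push Not at hc
        exact absurd hneg (not_lt.mpr (mul_nonneg (hR l (by omega)) hc))
      -- A negative increment after `i` forces an angle beyond `β + π`. All increments from `j` on
      -- are then nonpositive, and so are those before `i`. As the total is zero, the sum up to `j`
      -- is nonnegative and the sum up to `i` is nonpositive.
      have hl1 : Real.pi < α l - β := by
        by_contra hc
        push Not at hc
        exact absurd hs (not_lt.mpr (Real.sin_nonneg_of_nonneg_of_le_pi
          (by linarith [hhi l hl.1 (by omega)]) hc))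
      have ha : ∑ l' ∈ Finset.Ico j n, δ l' ≤ 0 := by
        apply Finset.sum_nonpos
        intro l' hl'
        rw [Finset.mem_Ico] at hl'
        have := hmono l l' (by omega) hl'.2
        exact mul_nonpos_of_nonneg_of_nonpos (hR l' hl'.2)
          (sin_neg_of_pi_lt (by linarith) (by linarith [h1 l' hl'.2])).le
      have hb : ∑ l' ∈ Finset.range i, δ l' ≤ 0 := by
        apply Finset.sum_nonpos
        intro l' hl'
        rw [Finset.mem_range] at hl'
        exact mul_nonpos_of_nonneg_of_nonpos (hR l' (by omega))
          (Real.sin_nonpos_of_nonpos_of_neg_pi_le (by linarith [hlo l' hl'])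
            (by linarith [h0 l' (by omega), h1 l (by omega)]))
      have := Finset.sum_range_add_sum_Ico δ hj
      linarith
  · by_cases hall : ∀ l ∈ Finset.Ico j i, δ l ≤ 0
    · rw [← Finset.sum_range_add_sum_Ico _ hij.le]
      linarith [Finset.sum_nonpos hall]
    · push Not at hall
      obtain ⟨l, hl, hpos⟩ := hall
      rw [Finset.mem_Ico] at hl
      have hs : 0 < Real.sin (α l - β) := by
        by_contra hc
        push Not at hc
        exact absurd hpos (not_lt.mpr
          (mul_nonpos_of_nonneg_of_nonpos (hR l (by omega)) hc))
      have hl1 : α l - β < -Real.pi := by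
        rcases sin_pos_cases (by linarith [h1 l (by omega)]) hs
          with h | h
        · linarith [hlo l hl.2]
        · exact h
      have ha : 0 ≤ ∑ l' ∈ Finset.Ico i n, δ l' := by
        apply Finset.sum_nonneg
        intro l' hl'
        rw [Finset.mem_Ico] at hl'
        have := h0 l (by omega)
        exact mul_nonneg (hR l' hl'.2) (Real.sin_nonneg_of_nonneg_of_le_pi
          (by linarith [hhi l' hl'.1 hl'.2]) (by linarith [h1 l' hl'.2]))
      have hb : 0 ≤ ∑ l' ∈ Finset.range j, δ l' := by
        apply Finset.sum_nonneg
        intro l' hl'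
        rw [Finset.mem_range] at hl'
        have := hmono l' l (by omega) (by omega)
        exact mul_nonneg (hR l' (by omega))
          (sin_pos_of_lt_neg_pi (by linarith [h0 l' (by omega)]) (by linarith)).le
      have := Finset.sum_range_add_sum_Ico δ hin
      linarith

/-- Strict version of `sum_sin_le`, where the angles between the indices `i` and `i'` are allowed to
be equal to `β`. -/
lemma sum_sin_lt {n : ℕ} {α R : ℕ → ℝ} {β : ℝ} (h0 : ∀ l < n, 0 ≤ α l)
    (h1 : ∀ l < n, α l < 2 * Real.pi) (hβ : 0 ≤ β) (hβ' : β < 2 * Real.pi)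
    (hmono : ∀ l l', l < l' → l' < n → α l < α l') (hR : ∀ l < n, 0 < R l)
    {i i' : ℕ} (hii : i ≤ i') (hin : i' ≤ n) (hlo : ∀ l < i, α l < β)
    (hhi : ∀ l, i' ≤ l → l < n → β < α l)
    (heq : ∀ l, i ≤ l → l < i' → α l = β)
    (hsum : ∑ l ∈ Finset.range n, R l * Real.sin (α l - β) = 0) {j : ℕ} (hj : j ≤ n)
    (hne : j < i ∨ i' < j) (hn1 : ¬ (j = n ∧ i = 0)) (hn2 : ¬ (j = 0 ∧ i' = n)) :
    ∑ l ∈ Finset.range i, R l * Real.sin (α l - β) <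
      ∑ l ∈ Finset.range j, R l * Real.sin (α l - β) := by
  have hp := Real.pi_pos
  set δ : ℕ → ℝ := fun l => R l * Real.sin (α l - β) with hδ
  have hi' : ∑ l ∈ Finset.range i', δ l = ∑ l ∈ Finset.range i, δ l := by
    rw [← Finset.sum_range_add_sum_Ico _ hii, add_eq_left]
    apply Finset.sum_eq_zero
    intro l hl
    rw [Finset.mem_Ico] at hl
    simp [hδ, heq l hl.1 hl.2]
  rcases hne with hij | hij
  · by_cases hall : ∀ l ∈ Finset.Ico j i, δ l < 0
    · rw [← Finset.sum_range_add_sum_Ico _ hij.le]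
      linarith [Finset.sum_neg hall (by simpa using hij)]
    · push Not at hall
      obtain ⟨l, hl, hpos⟩ := hall
      rw [Finset.mem_Ico] at hl
      have hs : 0 ≤ Real.sin (α l - β) := by
        by_contra hc
        push Not at hc
        exact absurd hpos (not_le.mpr (mul_neg_of_pos_of_neg (hR l (by omega)) hc))
      have hl1 : α l - β ≤ -Real.pi := by
        by_contra hc
        push Not at hc
        exact absurd hs (not_le.mpr (Real.sin_neg_of_neg_of_neg_pi_lt
          (by linarith [hlo l hl.2]) hc))
      have hc1 : ∀ l' ∈ Finset.Ico i' n, 0 < δ l' := by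
        intro l' hl'
        rw [Finset.mem_Ico] at hl'
        have := h0 l (by omega)
        exact mul_pos (hR l' hl'.2) (Real.sin_pos_of_pos_of_lt_pi
          (by linarith [hhi l' hl'.1 hl'.2]) (by linarith [h1 l' hl'.2]))
      have hc2 : ∀ l' ∈ Finset.range j, 0 < δ l' := by
        intro l' hl'
        rw [Finset.mem_range] at hl'
        have := hmono l' l (by omega) (by omega)
        exact mul_pos (hR l' (by omega))
          (sin_pos_of_lt_neg_pi (by linarith [h0 l' (by omega)]) (by linarith))
      have := Finset.sum_range_add_sum_Ico δ hin
      have ha := Finset.sum_nonneg fun l hl => (hc1 l hl).le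
      have hb := Finset.sum_nonneg fun l hl => (hc2 l hl).le
      -- One of the two ranges is nonempty. Both would be empty only for `j = 0`, `i' = n`, when the
      -- two indices denote the same vertex of a closed chain; this case is excluded by `hn2`.
      rcases Nat.eq_zero_or_pos j with hj0 | hj0
      · have : 0 < ∑ l ∈ Finset.Ico i' n, δ l :=
          Finset.sum_pos hc1 (by simp; omega)
        linarith
      · have : 0 < ∑ l ∈ Finset.range j, δ l :=
          Finset.sum_pos hc2 (by simp; omega)
        linarith
  · rw [← hi']
    by_cases hall : ∀ l ∈ Finset.Ico i' j, 0 < δ l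
    · rw [← Finset.sum_range_add_sum_Ico _ hij.le]
      linarith [Finset.sum_pos hall (by simpa using hij)]
    · push Not at hall
      obtain ⟨l, hl, hneg⟩ := hall
      rw [Finset.mem_Ico] at hl
      have hs : Real.sin (α l - β) ≤ 0 := by
        by_contra hc
        push Not at hc
        exact absurd hneg (not_le.mpr (mul_pos (hR l (by omega)) hc))
      have hl1 : Real.pi ≤ α l - β := by
        by_contra hc
        push Not at hc
        exact absurd hs (not_le.mpr (Real.sin_pos_of_pos_of_lt_pi
          (by linarith [hhi l hl.1 (by omega)]) hc))
      have hc1 : ∀ l' ∈ Finset.Ico j n, δ l' < 0 := by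
        intro l' hl'
        rw [Finset.mem_Ico] at hl'
        have := hmono l l' (by omega) hl'.2
        exact mul_neg_of_pos_of_neg (hR l' hl'.2)
          (sin_neg_of_pi_lt (by linarith) (by linarith [h1 l' hl'.2]))
      have hc2 : ∀ l' ∈ Finset.range i, δ l' < 0 := by
        intro l' hl'
        rw [Finset.mem_range] at hl'
        exact mul_neg_of_pos_of_neg (hR l' (by omega))
          (Real.sin_neg_of_neg_of_neg_pi_lt (by linarith [hlo l' hl'])
            (by linarith [h0 l' (by omega), h1 l (by omega)]))
      have := Finset.sum_range_add_sum_Ico δ hj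
      have ha := Finset.sum_nonpos fun l hl => (hc1 l hl).le
      have hb := Finset.sum_nonpos fun l hl => (hc2 l hl).le
      rcases Nat.eq_zero_or_pos i with hj0 | hj0
      · have : ∑ l ∈ Finset.Ico j n, δ l < 0 :=
          Finset.sum_neg hc1 (by simp; omega)
        linarith
      · have : ∑ l ∈ Finset.range i, δ l < 0 :=
          Finset.sum_neg hc2 (by simp; omega)
        linarith

/-! ### Closed sequences of vectors sorted by angle -/

/-- The height of a closed chain above a line of direction `d` has increments proportional to `sin
(key x - key d)`, so `sum_sin_lt` applies: the chain is lowest where its edge directions pass that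
of `d`. The indices between `i` and `i'` allow for an edge parallel to `d`. -/
lemma cross_partial_lt {e d : Plane} (he : e ≠ 0) (hd : d ≠ 0) {n : ℕ} {x : ℕ → Plane}
    (hx : ∀ l < n, x l ≠ 0)
    (hmono : ∀ l l', l < l' → l' < n → key e (x l) < key e (x l'))
    (hsum : ∑ l ∈ Finset.range n, x l = 0) {i i' : ℕ} (hii : i ≤ i') (hin : i' ≤ n)
    (hlo : ∀ l < i, key e (x l) < key e d) (hhi : ∀ l, i' ≤ l → l < n → key e d < key e (x l))
    (heq : ∀ l, i ≤ l → l < i' → key e (x l) = key e d) {j : ℕ} (hj : j ≤ n)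
    (hne : j < i ∨ i' < j) (hn1 : ¬ (j = n ∧ i = 0)) (hn2 : ¬ (j = 0 ∧ i' = n)) :
    cross d (∑ l ∈ Finset.range i, x l) < cross d (∑ l ∈ Finset.range j, x l) := by
  have hR : ∀ l, ∃ r, l < n → 0 < r ∧ cross d (x l) = r * Real.sin (key e (x l) - key e d) := by
    intro l
    by_cases hl : l < n
    · obtain ⟨r, hr⟩ := exists_cross_eq_sin he hd (hx l hl)
      exact ⟨r, fun _ => hr⟩
    · exact ⟨0, fun h => absurd h hl⟩
  choose R hR using hR
  have hs : ∀ j ≤ n, cross d (∑ l ∈ Finset.range j, x l) =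
      ∑ l ∈ Finset.range j, R l * Real.sin (key e (x l) - key e d) := by
    intro j hj
    rw [cross_sum_right]
    refine Finset.sum_congr rfl fun l hl => (hR l ?_).2
    rw [Finset.mem_range] at hl; omega
  rw [hs i (by omega), hs j hj]
  refine sum_sin_lt (fun l _ => key_nonneg _ _) (fun l _ => key_lt _ _) (key_nonneg _ _)
    (key_lt _ _) hmono (fun l hl => (hR l hl).1) hii hin hlo hhi heq ?_ hj hne hn1 hn2
  rw [← hs n le_rfl, hsum, cross_zero_right]

/-- The weak version has nonnegative coefficients because it serves polygons with prescribed side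
directions, some of whose sides may be reduced to a point. -/
lemma cross_partial_le {e d : Plane} (he : e ≠ 0) (hd : d ≠ 0) {n : ℕ} {x : ℕ → Plane}
    (hx : ∀ l < n, x l ≠ 0) {c : ℕ → ℝ} (hc : ∀ l < n, 0 ≤ c l)
    (hmono : ∀ l l', l ≤ l' → l' < n → key e (x l) ≤ key e (x l'))
    (hsum : ∑ l ∈ Finset.range n, c l • x l = 0) {i : ℕ} (hin : i ≤ n)
    (hlo : ∀ l < i, key e (x l) ≤ key e d) (hhi : ∀ l, i ≤ l → l < n → key e d ≤ key e (x l))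
    {j : ℕ} (hj : j ≤ n) :
    cross d (∑ l ∈ Finset.range i, c l • x l) ≤ cross d (∑ l ∈ Finset.range j, c l • x l) := by
  have hR : ∀ l, ∃ r, l < n → 0 < r ∧ cross d (x l) = r * Real.sin (key e (x l) - key e d) := by
    intro l
    by_cases hl : l < n
    · obtain ⟨r, hr⟩ := exists_cross_eq_sin he hd (hx l hl)
      exact ⟨r, fun _ => hr⟩
    · exact ⟨0, fun h => absurd h hl⟩
  choose R hR using hR
  have hs : ∀ j ≤ n, cross d (∑ l ∈ Finset.range j, c l • x l) =
      ∑ l ∈ Finset.range j, (c l * R l) * Real.sin (key e (x l) - key e d) := by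
    intro j hj
    rw [cross_sum_right]
    refine Finset.sum_congr rfl fun l hl => ?_
    rw [Finset.mem_range] at hl
    rw [cross_smul_right, (hR l (by omega)).2, mul_assoc]
  rw [hs i (by omega), hs j hj]
  refine sum_sin_le (fun l _ => key_nonneg _ _) (fun l _ => key_lt _ _) (key_nonneg _ _)
    (key_lt _ _) hmono (fun l hl => mul_nonneg (hc l hl) (hR l hl).1.le) hin hlo hhi ?_ hj
  rw [← hs n le_rfl, hsum, cross_zero_right]

/-! ### Cyclic tuples of points -/

section Tuple

variable {m : ℕ}

/-- The edges of a closed polygonal line. -/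
def edge (z : Fin (m + 1) → Plane) (i : Fin (m + 1)) : Plane := z (i + 1) - z i

lemma ccw_iff (z : Fin (m + 1) → Plane) : IsCcwPolygon z ↔
    ∀ i j : Fin (m + 1), j ≠ i → j ≠ i + 1 → 0 < cross (edge z i) (z j - z i) := by
  simp [IsCcwPolygon, edge]

lemma sum_range_edge (z : Fin (m + 1) → Plane) (j : ℕ) :
    ∑ l ∈ Finset.range j, edge z (Fin.ofNat (m + 1) l) = z (Fin.ofNat (m + 1) j) - z 0 := by
  induction j with
  | zero => simp
  | succ j ih =>
    rw [Finset.sum_range_succ, ih, edge]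
    have : Fin.ofNat (m + 1) j + 1 = Fin.ofNat (m + 1) (j + 1) := by
      ext; simp [Fin.val_add]
    rw [this]; abel

lemma sum_edge (z : Fin (m + 1) → Plane) : ∑ i, edge z i = 0 := by
  have h := sum_range_edge z (m + 1)
  rw [Finset.sum_range] at h
  have h2 : Fin.ofNat (m + 1) (m + 1) = 0 := by ext; simp
  rw [h2, sub_self] at h
  rw [← h]
  refine Finset.sum_congr rfl fun i _ => ?_
  congr 1; ext; simp

/-- The nonzero edges of `z`, in this order, have increasing angles with `e`. -/
def Sorted (e : Plane) (z : Fin (m + 1) → Plane) : Prop :=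
  (∀ i, edge z i ≠ 0) ∧ StrictMono fun i => key e (edge z i)

lemma ofNat_val (i : Fin (m + 1)) : Fin.ofNat (m + 1) i.val = i := by
  ext; simp

lemma Sorted.key_lt_key {e : Plane} {z : Fin (m + 1) → Plane} (h : Sorted e z) (l l' : ℕ)
    (hl : l < l') (hl' : l' < m + 1) :
    key e (edge z (Fin.ofNat (m + 1) l)) < key e (edge z (Fin.ofNat (m + 1) l')) := by
  apply h.2
  rw [Fin.lt_def]
  simp [Nat.mod_eq_of_lt hl', Nat.mod_eq_of_lt (hl.trans hl'), hl]

/-- The vertices of a sorted polygon lie on one side of the line through `z i` with direction `d`,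
if the direction `d` lies between those of the edges at `z i`. -/
lemma Sorted.cross_pos {e d : Plane} (he : e ≠ 0) (hd : d ≠ 0) {z : Fin (m + 1) → Plane}
    (h : Sorted e z) {i : ℕ} (hi : i ≤ m + 1) (hlo : ∀ l : Fin (m + 1), l.val < i →
      key e (edge z l) < key e d)
    (hhi : ∀ l : Fin (m + 1), i ≤ l.val → key e d < key e (edge z l)) (j : Fin (m + 1))
    (hj : j ≠ Fin.ofNat (m + 1) i) : 0 < cross d (z j - z (Fin.ofNat (m + 1) i)) := by
  have hj' : j.val ≠ i := by rintro rfl; exact hj (ofNat_val j).symm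
  have := cross_partial_lt he hd (n := m + 1) (x := fun l => edge z (Fin.ofNat (m + 1) l))
    (fun l _ => h.1 _) h.key_lt_key
    (by rw [sum_range_edge]; have : Fin.ofNat (m + 1) (m + 1) = 0 := by ext; simp
        rw [this, sub_self])
    (i := i) (i' := i) le_rfl hi
    (fun l hl => hlo _ (by simp [Nat.mod_eq_of_lt (hl.trans_le hi), hl]))
    (fun l hl hl' => hhi _ (by simp [Nat.mod_eq_of_lt hl', hl]))
    (fun l hl hl' => absurd hl (by omega)) (j := j.val) (by omega) (by omega) (by omega)
    (by rintro ⟨h1, h2⟩; apply hj; ext; simp [h1, h2])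
  rw [sum_range_edge, sum_range_edge, ofNat_val, cross_sub_right, cross_sub_right] at this
  rw [cross_sub_right]; linarith

/-- With `d` the direction of edge `i` itself, the minimal height is attained at the two endpoints
of this edge and nowhere else. -/
lemma Sorted.isCcwPolygon {e : Plane} (he : e ≠ 0) {z : Fin (m + 1) → Plane} (h : Sorted e z) :
    IsCcwPolygon z := by
  rw [ccw_iff]
  intro i j hji hji1
  have := cross_partial_lt he (h.1 i) (n := m + 1) (x := fun l => edge z (Fin.ofNat (m + 1) l))
    (fun l _ => h.1 _) h.key_lt_key
    (by rw [sum_range_edge]; have : Fin.ofNat (m + 1) (m + 1) = 0 := by ext; simp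
        rw [this, sub_self])
    (i := i.val) (i' := i.val + 1) (by omega) (by omega)
    (fun l hl => by
      have := h.key_lt_key l i.val hl i.isLt
      rwa [ofNat_val] at this)
    (fun l hl hl' => by
      have := h.key_lt_key i.val l (by omega) hl'
      rwa [ofNat_val] at this)
    (fun l hl hl' => by
      have : l = i.val := by omega
      rw [this, ofNat_val]) (j := j.val) (by omega)
    (by
      have h1 : j.val ≠ i.val := fun h => hji (Fin.ext h)
      have h2 : j.val ≠ i.val + 1 := fun h => hji1 (by
        ext; rw [Fin.val_add_one_of_lt']
        · exact h
        · omega)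
      omega) (by omega)
    (by
      rintro ⟨h1, h2⟩
      apply hji1
      have : i = Fin.last m := by ext; simp; omega
      rw [this, Fin.last_add_one]; ext; simpa using h1)
  rw [sum_range_edge, sum_range_edge, ofNat_val, ofNat_val, cross_sub_right, cross_sub_right] at this
  rw [cross_sub_right]; linarith

/-- Sorting points by the angles of supporting lines through them sorts the edges by angle. -/
lemma exists_sorted_of_support (hm : 1 ≤ m) {e : Plane} (he : e ≠ 0) (z d : Fin (m + 1) → Plane)
    (hd : ∀ i j, j ≠ i → 0 < cross (d i) (z j - z i)) {i₀ : Fin (m + 1)} (hi₀ : d i₀ = e) :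
    ∃ σ : Equiv.Perm (Fin (m + 1)), σ 0 = i₀ ∧ Sorted e (z ∘ σ) := by
  have : Nontrivial (Fin (m + 1)) := Fin.nontrivial_iff_two_le.mpr (by omega)
  have hd0 : ∀ i, d i ≠ 0 := by
    intro i hi
    obtain ⟨j, hj⟩ := exists_ne i
    have := hd i j hj
    simp [hi] at this
  set t : Fin (m + 1) → ℝ := fun i => key e (d i) with ht
  -- Two points with supporting lines of the same direction would each lie strictly to the left of
  -- the line through the other.
  have htinj : Function.Injective t := by
    intro i j hij
    by_contra hne
    obtain ⟨c, hc, hcd⟩ := eq_smul_of_key_eq he (hd0 i) (hd0 j) hij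
    have h1 := hd i j (Ne.symm hne)
    have h2 := hd j i hne
    rw [hcd, cross_smul_left] at h2
    have h3 := pos_of_mul_pos_right h2 hc.le
    rw [cross_sub_right] at h1 h3
    linarith
  set σ := Tuple.sort t with hσ
  have hmono : StrictMono (t ∘ σ) :=
    (Tuple.monotone_sort t).strictMono_of_injective (htinj.comp σ.injective)
  have ht0 : t i₀ = 0 := by simp only [ht, hi₀, key_self he]
  have hσ0 : σ 0 = i₀ := by
    by_contra hne
    have h1 : (0 : Fin (m + 1)) < σ.symm i₀ := by
      rw [Fin.pos_iff_ne_zero]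
      intro h; apply hne; rw [← h]; simp
    have h2 := hmono h1
    simp only [Function.comp, Equiv.apply_symm_apply, ht0] at h2
    exact absurd h2 (not_lt.mpr (key_nonneg _ _))
  have hne1 : ∀ i : Fin (m + 1), i + 1 ≠ i := fun i h => by simp at h; omega
  have hedge : ∀ i, edge (z ∘ σ) i ≠ 0 := by
    intro i hi
    have := hd (σ i) (σ (i + 1)) (σ.injective.ne (hne1 i))
    simp only [edge, Function.comp] at hi
    rw [hi, cross_zero_right] at this
    exact lt_irrefl _ this
  -- Each edge points to the left of the supporting direction at its start and to the right of the
  -- one at its end, so its angle lies between two consecutive sorted angles. The last edge ends at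
  -- `i₀`, whose direction has angle zero, and needs a separate argument.
  have hleft : ∀ i, 0 < Real.sin (key e (edge (z ∘ σ) i) - t (σ i)) := by
    intro i
    rw [← cross_pos_iff he (hd0 _) (hedge i)]
    exact hd (σ i) (σ (i + 1)) (σ.injective.ne (hne1 i))
  have hright : ∀ i, 0 < Real.sin (t (σ (i + 1)) - key e (edge (z ∘ σ) i)) := by
    intro i
    rw [← cross_pos_iff he (hedge i) (hd0 _)]
    have := hd (σ (i + 1)) (σ i) (σ.injective.ne (hne1 i).symm)
    rw [cross_comm]
    simp only [edge, Function.comp]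
    rw [cross_sub_right] at this ⊢
    linarith
  have hbetween : ∀ i j : Fin (m + 1), i.val + 1 = j.val →
      t (σ i) < key e (edge (z ∘ σ) i) ∧ key e (edge (z ∘ σ) i) < t (σ j) := by
    intro i j hij
    have hj : j = i + 1 := by
      ext; rw [Fin.val_add_one_of_lt' (by omega)]; exact hij.symm
    have hlt : i < j := by rw [Fin.lt_def]; omega
    have h2 := hright i
    rw [← hj] at h2
    exact between_of_sin_pos (key_nonneg _ _) (key_lt _ _) (key_nonneg _ _) (hmono hlt)
      (key_lt _ _) (hleft i) h2
  have hlow : ∀ i, t (σ i) < key e (edge (z ∘ σ) i) := by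
    intro i
    by_cases hi : i.val + 1 < m + 1
    · exact (hbetween i ⟨i.val + 1, hi⟩ rfl).1
    · have hlast : i = Fin.last m := by ext; simp; omega
      have h2 := hright i
      rw [hlast, Fin.last_add_one, hσ0, ht0, zero_sub, Real.sin_neg, ← hlast] at h2
      exact lt_of_sin_pos (key_nonneg _ _) (key_lt _ _) (key_nonneg _ _) (key_lt _ _) (hleft i)
        (by linarith)
  refine ⟨σ, hσ0, hedge, ?_⟩
  intro i j hij
  rw [Fin.lt_def] at hij
  have h1 := (hbetween i ⟨i.val + 1, by omega⟩ rfl).2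
  have h2 : t (σ ⟨i.val + 1, by omega⟩) ≤ t (σ j) :=
    hmono.monotone (by rw [Fin.le_def]; simp; omega)
  exact (h1.trans_le h2).trans (hlow j)

/-! ### Convex position -/

lemma add_one_ne (hm : 1 ≤ m) (i : Fin (m + 1)) : i + 1 ≠ i := fun h => by simp at h; omega

lemma sub_one_ne_add_one (hm : 2 ≤ m) (i : Fin (m + 1)) : i - 1 ≠ i + 1 := by
  intro h
  have h2 : i = i + 1 + 1 := by rw [← h]; simp
  have h3 : (1 : Fin (m + 1)) + 1 = 0 := by
    rw [add_assoc] at h2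
    exact (add_eq_left.mp h2.symm)
  have h4 := congrArg Fin.val h3
  rw [Fin.val_add] at h4
  have h5 : (1 : Fin (m + 1)).val = 1 := by
    rw [Fin.val_one', Nat.mod_eq_of_lt (by omega)]
  rw [h5, Nat.mod_eq_of_lt (by omega)] at h4
  simp at h4

/-- The line through a vertex parallel to the diagonal joining its two neighbours is a strict
supporting line. This makes `exists_sorted_of_support` available for counterclockwise polygons. -/
lemma IsCcwPolygon.cross_pos (hm : 2 ≤ m) {z : Fin (m + 1) → Plane} (h : IsCcwPolygon z)
    (i j : Fin (m + 1)) (hj : j ≠ i) :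
    0 < cross (edge z (i - 1) + edge z i) (z j - z i) := by
  rw [ccw_iff] at h
  rw [cross_add_left]
  have h1 : cross (edge z (i - 1)) (z j - z i) = cross (edge z (i - 1)) (z j - z (i - 1)) := by
    simp only [edge, sub_add_cancel]
    simp only [cross, PiLp.sub_apply]; ring
  rcases eq_or_ne j (i - 1) with rfl | hj1
  · rw [h1, sub_self, cross_zero_right, zero_add]
    exact h i _ hj (sub_one_ne_add_one hm i)
  · have h2 : 0 < cross (edge z (i - 1)) (z j - z i) := by
      rw [h1]; exact h (i - 1) j hj1 (by simpa using hj)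
    rcases eq_or_ne j (i + 1) with rfl | hj2
    · have : cross (edge z i) (z (i + 1) - z i) = 0 := cross_self _
      linarith
    · linarith [h i j hj hj2]

lemma convexIndependent_of_support {ι : Type*} {z d : ι → Plane}
    (hd : ∀ i j, j ≠ i → 0 < cross (d i) (z j - z i)) : ConvexIndependent ℝ z := by
  rw [convexIndependent_iff_notMem_convexHull_sdiff]
  intro i s hi
  have hsub : convexHull ℝ (z '' (s \ {i})) ⊆ {p | 0 < crossLin (d i) p - cross (d i) (z i)} := by
    apply convexHull_min
    · rintro _ ⟨j, hj, rfl⟩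
      have := hd i j hj.2
      rw [cross_sub_right] at this
      exact this
    · have := (convex_Ioi (cross (d i) (z i))).linear_preimage (crossLin (d i))
      convert this using 1
      ext p; simp
  have := hsub hi
  simp at this

lemma IsCcwPolygon.convexIndependent (hm : 2 ≤ m) {z : Fin (m + 1) → Plane}
    (h : IsCcwPolygon z) : ConvexIndependent ℝ z :=
  convexIndependent_of_support (d := fun i => edge z (i - 1) + edge z i) (h.cross_pos hm)

lemma exists_cross_eq_dual (f : Plane →L[ℝ] ℝ) : ∃ d : Plane, ∀ x, f x = cross d x := by
  refine ⟨!₂[f (EuclideanSpace.single 1 1), -f (EuclideanSpace.single 0 1)], fun x => ?_⟩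
  have hx : x = x 0 • EuclideanSpace.single 0 1 + x 1 • EuclideanSpace.single 1 1 := by
    apply plane_ext <;> simp
  conv_lhs => rw [hx]
  rw [map_add, map_smul, map_smul]
  simp [cross]
  ring

/-- A point outside of a closed convex set is separated from it by an oriented line. -/
lemma exists_cross_lt {p : Plane} {t : Set Plane} (ht : Convex ℝ t) (htc : IsClosed t)
    (hp : p ∉ t) : ∃ d : Plane, ∀ q ∈ t, 0 < cross d (q - p) := by
  obtain ⟨f, u, h1, h2⟩ := geometric_hahn_banach_point_closed ht htc hp
  obtain ⟨d, hd⟩ := exists_cross_eq_dual f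
  refine ⟨d, fun q hq => ?_⟩
  rw [← hd, map_sub]
  linarith [h2 q hq]

lemma exists_support_of_convexIndependent {ι : Type*} [Finite ι] {z : ι → Plane}
    (h : ConvexIndependent ℝ z) (i : ι) : ∃ d : Plane, ∀ j, j ≠ i → 0 < cross d (z j - z i) := by
  rw [convexIndependent_iff_notMem_convexHull_sdiff] at h
  have h1 := h i Set.univ
  obtain ⟨d, hd⟩ := exists_cross_lt (convex_convexHull ℝ _)
    ((Set.toFinite _).isClosed_convexHull ℝ) h1
  exact ⟨d, fun j hj => hd _ (subset_convexHull ℝ _ ⟨j, ⟨trivial, hj⟩, rfl⟩)⟩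

/-- Points in convex position can be sorted, provided that no two of them are on a line with
direction `e`. -/
lemma exists_sorted (hm : 1 ≤ m) {e : Plane} (he : e ≠ 0) {z : Fin (m + 1) → Plane}
    (h : ConvexIndependent ℝ z) (hgen : ∀ i j, i ≠ j → cross e (z i - z j) ≠ 0) :
    ∃ σ : Equiv.Perm (Fin (m + 1)), Sorted e (z ∘ σ) := by
  choose d hd using exists_support_of_convexIndependent h
  obtain ⟨i₀, hi₀⟩ := Finite.exists_min fun i => cross e (z i)
  -- At the lowest point with respect to `e`, the direction `e` is itself a strict supporting
  -- direction, since no two points are on a parallel to `e`. Using it there makes the sorting start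
  -- at that point.
  obtain ⟨σ, -, hσ⟩ := exists_sorted_of_support hm he z (Function.update d i₀ e) (by
    intro i j hij
    rcases eq_or_ne i i₀ with rfl | hi
    · rw [Function.update_self]
      have h1 := hi₀ j
      have h2 := hgen j i hij
      rw [cross_sub_right] at h2 ⊢
      exact lt_of_le_of_ne (by linarith) h2.symm
    · rw [Function.update_of_ne hi]
      exact hd i j hij) (Function.update_self i₀ e d)
  exact ⟨σ, hσ⟩

/-- The counterclockwise order of points in convex position is unique up to a cyclic shift. -/
lemma IsCcwPolygon.perm_add_one (hm : 1 ≤ m) {z : Fin (m + 1) → Plane}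
    {σ : Equiv.Perm (Fin (m + 1))} (h : IsCcwPolygon z) (h' : IsCcwPolygon (z ∘ σ))
    (i : Fin (m + 1)) : σ (i + 1) = σ i + 1 := by
  rw [ccw_iff] at h h'
  by_contra hne
  -- If the two orders gave different successors to `z (σ i)`, each successor would lie strictly to
  -- the left of the line from `z (σ i)` to the other.
  have h1 := h (σ i) (σ (i + 1)) (σ.injective.ne (add_one_ne hm i)) hne
  have h2 := h' i (σ.symm (σ i + 1))
    (by rw [Ne, Equiv.symm_apply_eq]; exact add_one_ne hm _)
    (by rw [Ne, Equiv.symm_apply_eq]; exact Ne.symm hne)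
  simp only [edge, Function.comp, Equiv.apply_symm_apply] at h1 h2
  rw [cross_comm] at h2
  linarith

lemma IsCcwPolygon.perm_eq_shift (hm : 1 ≤ m) {z : Fin (m + 1) → Plane}
    {σ : Equiv.Perm (Fin (m + 1))} (h : IsCcwPolygon z) (h' : IsCcwPolygon (z ∘ σ)) :
    σ = Equiv.addLeft (σ 0) := by
  ext1 i
  induction i using Fin.induction with
  | zero => simp
  | succ i ih =>
    rw [← Fin.coeSucc_eq_succ, h.perm_add_one hm h', ih]
    simp [add_assoc]

lemma IsCcwPolygon.shift {z : Fin (m + 1) → Plane} (h : IsCcwPolygon z) (c : Fin (m + 1)) :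
    IsCcwPolygon fun i => z (c + i) := by
  rw [ccw_iff] at h ⊢
  intro i j hj hj1
  have := h (c + i) (c + j) (by simpa using hj) (by
    intro h; apply hj1; rw [add_assoc] at h; exact add_left_cancel h)
  simpa [edge, add_assoc] using this

end Tuple

lemma cross_nonneg_iff {e x y : Plane} (he : e ≠ 0) (hx : x ≠ 0) (hy : y ≠ 0) :
    0 ≤ cross x y ↔ 0 ≤ Real.sin (key e y - key e x) := by
  obtain ⟨r, hr, h⟩ := exists_cross_eq_sin he hx hy
  rw [h, mul_nonneg_iff_of_pos_left hr]

/-! ### The sides of a convex polygon -/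

section Sides

variable {k : ℕ} {v : Fin (k + 1) → Plane}

/-- The unit vector in the direction of side `j`. -/
noncomputable def side (v : Fin (k + 1) → Plane) (j : Fin (k + 1)) : Plane :=
  (sideLength v j)⁻¹ • edge v j

lemma sideLength_eq (v : Fin (k + 1) → Plane) (j : Fin (k + 1)) :
    sideLength v j = ‖edge v j‖ := by
  rw [sideLength, edge, dist_comm, dist_eq_norm]

lemma edge_ne_zero (hk : 2 ≤ k) (hv : IsCcwPolygon v) (j : Fin (k + 1)) : edge v j ≠ 0 := by
  intro h
  have := (ccw_iff v).mp hv j (j - 1) (by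
    intro h
    have := add_one_ne (by omega : 1 ≤ k) (j - 1)
    rw [sub_add_cancel] at this
    exact this h.symm) (sub_one_ne_add_one hk j)
  rw [h, cross_zero_left] at this
  exact lt_irrefl _ this

lemma sideLength_pos (hk : 2 ≤ k) (hv : IsCcwPolygon v) (j : Fin (k + 1)) :
    0 < sideLength v j := by
  rw [sideLength_eq]; exact norm_pos_iff.mpr (edge_ne_zero hk hv j)

lemma edge_eq_smul_side (hk : 2 ≤ k) (hv : IsCcwPolygon v) (j : Fin (k + 1)) :
    edge v j = sideLength v j • side v j := by
  rw [side, smul_smul, mul_inv_cancel₀ (sideLength_pos hk hv j).ne', one_smul]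

lemma side_ne_zero (hk : 2 ≤ k) (hv : IsCcwPolygon v) (j : Fin (k + 1)) : side v j ≠ 0 := by
  intro h
  apply edge_ne_zero hk hv j
  rw [edge_eq_smul_side hk hv, h, smul_zero]

lemma norm_side (hk : 2 ≤ k) (hv : IsCcwPolygon v) (j : Fin (k + 1)) : ‖side v j‖ = 1 := by
  rw [side, norm_smul, norm_inv, sideLength_eq, norm_norm,
    inv_mul_cancel₀ (norm_pos_iff.mpr (edge_ne_zero hk hv j)).ne']

lemma dot_side_self (hk : 2 ≤ k) (hv : IsCcwPolygon v) (j : Fin (k + 1)) :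
    dot (side v j) (side v j) = 1 := by
  rw [dot_self_eq_norm_sq, norm_side hk hv, one_pow]

lemma lineDist_eq (v : Fin (k + 1) → Plane) (j : Fin (k + 1)) (p : Plane) :
    lineDist v j p = cross (side v j) (p - v j) := by
  rw [lineDist, side, cross_smul_left, edge, div_eq_inv_mul]

lemma lineDist_sub (v : Fin (k + 1) → Plane) (j : Fin (k + 1)) (p q : Plane) :
    lineDist v j p - lineDist v j q = cross (side v j) (p - q) := by
  rw [lineDist_eq, lineDist_eq]; simp only [cross_sub_right]; ring

lemma cross_edge_pos (hk : 2 ≤ k) (hv : IsCcwPolygon v) (j : Fin (k + 1)) :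
    0 < cross (edge v j) (edge v (j + 1)) := by
  have := (ccw_iff v).mp hv j (j + 1 + 1) (by
    intro h
    apply sub_one_ne_add_one hk (j + 1)
    rw [h]; simp) (add_one_ne (by omega) _)
  have h2 : v (j + 1 + 1) - v j = edge v j + edge v (j + 1) := by simp only [edge]; abel
  rwa [h2, cross_add_right, cross_self, zero_add] at this

lemma cross_side_pos (hk : 2 ≤ k) (hv : IsCcwPolygon v) (j : Fin (k + 1)) :
    0 < cross (side v j) (side v (j + 1)) := by
  rw [side, side, cross_smul_left, cross_smul_right]
  have h1 := sideLength_pos hk hv j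
  have h2 := sideLength_pos hk hv (j + 1)
  have h3 := cross_edge_pos hk hv j
  positivity

lemma innerAngle_eq (v : Fin (k + 1) → Plane) (j : Fin (k + 1)) :
    innerAngle v j = Real.pi - InnerProductGeometry.angle (edge v j) (edge v (j + 1)) := by
  rw [innerAngle, EuclideanGeometry.angle, ← InnerProductGeometry.angle_neg_left]
  simp [edge]

lemma cos_innerAngle (hk : 2 ≤ k) (hv : IsCcwPolygon v) (j : Fin (k + 1)) :
    Real.cos (innerAngle v j) = -dot (side v j) (side v (j + 1)) := by
  rw [innerAngle_eq, Real.cos_pi_sub, InnerProductGeometry.cos_angle, inner_eq_dot,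
    ← sideLength_eq, ← sideLength_eq]
  nth_rewrite 1 [edge_eq_smul_side hk hv j, edge_eq_smul_side hk hv (j + 1)]
  have h1 := sideLength_pos hk hv j
  have h2 := sideLength_pos hk hv (j + 1)
  simp only [dot, PiLp.smul_apply, smul_eq_mul]
  field_simp

lemma sin_innerAngle (hk : 2 ≤ k) (hv : IsCcwPolygon v) (j : Fin (k + 1)) :
    Real.sin (innerAngle v j) = cross (side v j) (side v (j + 1)) := by
  have h1 : 0 ≤ Real.sin (innerAngle v j) := by
    apply Real.sin_nonneg_of_nonneg_of_le_pi
    · exact EuclideanGeometry.angle_nonneg _ _ _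
    · exact EuclideanGeometry.angle_le_pi _ _ _
  have h2 := cross_sq_add_dot_sq (side v j) (side v (j + 1))
  rw [dot_side_self hk hv, dot_side_self hk hv] at h2
  have h3 := Real.sin_sq_add_cos_sq (innerAngle v j)
  rw [cos_innerAngle hk hv] at h3
  have h4 := cross_side_pos hk hv j
  nlinarith

lemma sin_innerAngle_pos (hk : 2 ≤ k) (hv : IsCcwPolygon v) (j : Fin (k + 1)) :
    0 < Real.sin (innerAngle v j) := by
  rw [sin_innerAngle hk hv]; exact cross_side_pos hk hv j

/-- The sides of a convex polygon are sorted by angle. -/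
lemma sorted_sides (hk : 2 ≤ k) (hv : IsCcwPolygon v) : Sorted (edge v 0) v := by
  set d : Fin (k + 1) → Plane := fun i => edge v (i - 1) + edge v i with hd
  have hd0 : d 0 ≠ 0 := by
    intro h
    have := hv.cross_pos hk 0 1 (by
      have := add_one_ne (by omega : 1 ≤ k) (0 : Fin (k + 1)); simpa using this)
    rw [show edge v (0 - 1) + edge v 0 = 0 from h, cross_zero_left] at this
    exact lt_irrefl _ this
  -- Sorting from the supporting direction at vertex `0` fixes this vertex. By uniqueness of the
  -- counterclockwise order the sorting permutation is the identity, and it remains to change the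
  -- reference direction to edge `0`.
  obtain ⟨σ, h0, hσ⟩ := exists_sorted_of_support (by omega) hd0 v d (hv.cross_pos hk) rfl
  have hs := hv.perm_eq_shift (by omega) (hσ.isCcwPolygon hd0)
  have h1 : v ∘ σ = v := by rw [hs, h0]; ext1 i; simp
  rw [h1] at hσ
  refine ⟨hσ.1, fun i j hij => ?_⟩
  simp only
  have hle : ∀ i, key (d 0) (edge v 0) ≤ key (d 0) (edge v i) := fun i =>
    hσ.2.monotone (Fin.zero_le i)
  rw [key_eq_key_sub hd0 (hσ.1 0) (hσ.1 i) (hle i),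
    key_eq_key_sub hd0 (hσ.1 0) (hσ.1 j) (hle j)]
  exact sub_lt_sub_right (hσ.2 hij) _

/-- The angle of side `j` with side `0`. -/
noncomputable def sideKey (v : Fin (k + 1) → Plane) (j : Fin (k + 1)) : ℝ :=
  key (edge v 0) (edge v j)

lemma sideKey_strictMono (hk : 2 ≤ k) (hv : IsCcwPolygon v) : StrictMono (sideKey v) :=
  (sorted_sides hk hv).2

lemma sideKey_zero (hk : 2 ≤ k) (hv : IsCcwPolygon v) : sideKey v 0 = 0 :=
  key_self (edge_ne_zero hk hv 0)

/-- The open cone between the directions of sides `j` and `j + 1`. -/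
def cone (v : Fin (k + 1) → Plane) (j : Fin (k + 1)) : Set Plane :=
  {x | 0 < cross (side v j) x ∧ 0 < cross x (side v (j + 1))}

lemma mem_cone_iff (hk : 2 ≤ k) (hv : IsCcwPolygon v) (j : Fin (k + 1)) (x : Plane) :
    x ∈ cone v j ↔ 0 < cross (edge v j) x ∧ 0 < cross x (edge v (j + 1)) := by
  rw [edge_eq_smul_side hk hv j, edge_eq_smul_side hk hv (j + 1), cross_smul_left,
    cross_smul_right, mul_pos_iff_of_pos_left (sideLength_pos hk hv j),
    mul_pos_iff_of_pos_left (sideLength_pos hk hv (j + 1))]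
  rfl

lemma ne_zero_of_mem_cone {j : Fin (k + 1)} {x : Plane} (hx : x ∈ cone v j) : x ≠ 0 := by
  rintro rfl; simp [cone] at hx

lemma sideKey_last (hk : 2 ≤ k) (hv : IsCcwPolygon v) :
    Real.pi < sideKey v (Fin.last k) := by
  have h := cross_edge_pos hk hv (Fin.last k)
  rw [Fin.last_add_one, cross_pos_iff (edge_ne_zero hk hv 0) (edge_ne_zero hk hv _)
    (edge_ne_zero hk hv _), key_self (edge_ne_zero hk hv 0), zero_sub] at h
  have h1 := key_nonneg (edge v 0) (edge v (Fin.last k))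
  have h2 := key_lt (edge v 0) (edge v (Fin.last k))
  rcases sin_pos_cases (by linarith) h with h3 | h3
  · linarith
  · unfold sideKey; linarith

lemma sideKey_add_one (hk : 2 ≤ k) (hv : IsCcwPolygon v) {j : Fin (k + 1)}
    (hj : j ≠ Fin.last k) :
    sideKey v j < sideKey v (j + 1) ∧ sideKey v (j + 1) < sideKey v j + Real.pi := by
  have hlt : j < j + 1 := by
    rw [Fin.lt_def, Fin.val_add_one_of_lt (Fin.lt_last_iff_ne_last.mpr hj)]; omega
  have h1 := sideKey_strictMono hk hv hlt
  refine ⟨h1, ?_⟩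
  have h := cross_edge_pos hk hv j
  rw [cross_pos_iff (edge_ne_zero hk hv 0) (edge_ne_zero hk hv _)
    (edge_ne_zero hk hv _)] at h
  have h2 := key_nonneg (edge v 0) (edge v j)
  have h3 := key_lt (edge v 0) (edge v (j + 1))
  unfold sideKey at h1 ⊢
  rcases sin_pos_cases (by linarith) h with h3 | h3 <;> linarith [Real.pi_pos]

/-- Consecutive sides turn by less than `π`, so the cones correspond to consecutive intervals of
angles. The last interval ends at `2π`, since side `0` has angle zero and cannot serve as an upper
bound. -/
lemma key_of_mem_cone (hk : 2 ≤ k) (hv : IsCcwPolygon v) {j : Fin (k + 1)} {x : Plane}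
    (hx : x ∈ cone v j) :
    sideKey v j < key (edge v 0) x ∧ ∀ j', j < j' → key (edge v 0) x < sideKey v j' := by
  have he := edge_ne_zero hk hv
  have hx0 := ne_zero_of_mem_cone hx
  rw [mem_cone_iff hk hv, cross_pos_iff (he 0) (he _) hx0, cross_pos_iff (he 0) hx0 (he _)] at hx
  rcases eq_or_ne j (Fin.last k) with rfl | hj
  · refine ⟨lt_of_sin_pos (key_nonneg _ _) (key_lt _ _) (key_nonneg _ _) (key_lt _ _) hx.1 ?_,
      fun j' hj' => absurd hj' (not_lt.mpr (Fin.le_last _))⟩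
    have := hx.2
    rw [Fin.last_add_one, key_self (he 0), zero_sub, Real.sin_neg] at this
    linarith
  · have hb := between_of_sin_pos (key_nonneg (edge v 0) x) (key_lt _ _) (key_nonneg _ _)
      (sideKey_add_one hk hv hj).1 (key_lt _ _) hx.1 hx.2
    refine ⟨hb.1, fun j' hj' => hb.2.trans_le ((sideKey_strictMono hk hv).monotone ?_)⟩
    rw [Fin.le_def, Fin.val_add_one_of_lt (Fin.lt_last_iff_ne_last.mpr hj)]
    exact hj'

lemma cone_unique (hk : 2 ≤ k) (hv : IsCcwPolygon v) {i j : Fin (k + 1)} {x : Plane}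
    (hi : x ∈ cone v i) (hj : x ∈ cone v j) : i = j := by
  by_contra hne
  rcases lt_or_gt_of_ne hne with h | h
  · linarith [(key_of_mem_cone hk hv hi).2 j h, (key_of_mem_cone hk hv hj).1]
  · linarith [(key_of_mem_cone hk hv hj).2 i h, (key_of_mem_cone hk hv hi).1]

/-- The index is that of the last side whose angle does not exceed the angle of `x`. -/
lemma exists_closed_cone (hk : 2 ≤ k) (hv : IsCcwPolygon v) {x : Plane} (hx : x ≠ 0) :
    ∃ j, 0 ≤ cross (edge v j) x ∧ 0 < cross x (edge v (j + 1)) := by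
  have he := edge_ne_zero hk hv
  have hp := Real.pi_pos
  have hlt := key_lt (edge v 0) x
  obtain ⟨j, hj, hmax⟩ := Finset.exists_max_image
    (Finset.univ.filter fun j => sideKey v j ≤ key (edge v 0) x) id
    ⟨0, by simpa [sideKey_zero hk hv] using key_nonneg _ _⟩
  simp only [Finset.mem_filter, Finset.mem_univ, true_and, id] at hj hmax
  refine ⟨j, ?_⟩
  rw [cross_nonneg_iff (he 0) (he _) hx, cross_pos_iff (he 0) hx (he _)]
  rcases eq_or_ne j (Fin.last k) with rfl | hjl
  · have h1 := sideKey_last hk hv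
    rw [Fin.last_add_one, key_self (he 0), zero_sub]
    unfold sideKey at h1 hj
    exact ⟨Real.sin_nonneg_of_nonneg_of_le_pi (by linarith) (by linarith),
      sin_pos_of_lt_neg_pi (by linarith) (by linarith)⟩
  · obtain ⟨h1, h2⟩ := sideKey_add_one hk hv hjl
    have h3 : key (edge v 0) x < sideKey v (j + 1) := by
      by_contra hc
      have := hmax (j + 1) (not_lt.mp hc)
      rw [Fin.le_def, Fin.val_add_one_of_lt (Fin.lt_last_iff_ne_last.mpr hjl)] at this
      omega
    unfold sideKey at h1 h2 h3 hj
    exact ⟨Real.sin_nonneg_of_nonneg_of_le_pi (by linarith) (by linarith),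
      Real.sin_pos_of_pos_of_lt_pi (by linarith) (by linarith)⟩

lemma exists_mem_cone (hk : 2 ≤ k) (hv : IsCcwPolygon v) {x : Plane} (hx : x ≠ 0)
    (hgen : ∀ j, cross (edge v j) x ≠ 0) : ∃ j, x ∈ cone v j := by
  obtain ⟨j, h1, h2⟩ := exists_closed_cone hk hv hx
  exact ⟨j, (mem_cone_iff hk hv j x).mpr ⟨lt_of_le_of_ne h1 (hgen j).symm, h2⟩⟩

/-- A convex polygon is the intersection of the half-planes defined by its sides. -/
lemma mem_polygon_iff (hk : 2 ≤ k) (hv : IsCcwPolygon v) (q : Plane) :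
    q ∈ polygon v ↔ ∀ j, 0 ≤ lineDist v j q := by
  have hpos : ∀ j, 0 ≤ lineDist v j q ↔ 0 ≤ cross (edge v j) (q - v j) := fun j => by
    rw [lineDist_eq, edge_eq_smul_side hk hv, cross_smul_left,
      mul_nonneg_iff_of_pos_left (sideLength_pos hk hv j)]
  simp only [hpos]
  constructor
  · intro hq j
    have hsub : polygon v ⊆ {p | cross (edge v j) (v j) ≤ crossLin (edge v j) p} := by
      apply convexHull_min
      · rintro _ ⟨i, rfl⟩
        rw [Set.mem_ofPred_eq, crossLin_apply]
        rcases eq_or_ne i j with rfl | hij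
        · exact le_rfl
        rcases eq_or_ne i (j + 1) with rfl | hij1
        · have : cross (edge v j) (edge v j) = 0 := cross_self _
          rw [show cross (edge v j) (edge v j) =
            cross (edge v j) (v (j + 1)) - cross (edge v j) (v j) from cross_sub_right _ _ _] at this
          linarith
        · have := (ccw_iff v).mp hv j i hij hij1
          rw [cross_sub_right] at this
          linarith
      · exact (convex_Ici (cross (edge v j) (v j))).linear_preimage (crossLin (edge v j))
    have := hsub hq
    rw [Set.mem_ofPred_eq, crossLin_apply] at this
    rw [cross_sub_right]; linarith
  · intro hq
    by_contra hc
    obtain ⟨d, hd⟩ := exists_cross_lt (convex_convexHull ℝ _)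
      ((Set.finite_range v).isClosed_convexHull ℝ) hc
    have hdv : ∀ i, 0 < cross d (v i - q) := fun i =>
      hd _ (subset_convexHull ℝ _ ⟨i, rfl⟩)
    have hd0 : d ≠ 0 := by
      rintro rfl; simpa using hdv 0
    -- The separating direction is a nonnegative combination of edges `j` and `j + 1`. Since `q`
    -- lies to the left of both of these sides, it is to the left of the line of direction `d`
    -- through their common vertex, whereas the separation puts it strictly to the right.
    obtain ⟨j, h1, h2⟩ := exists_closed_cone hk hv hd0
    have h3 := hq j
    have h4 := hq (j + 1)
    have h5 : cross (edge v j) (q - v (j + 1)) = cross (edge v j) (q - v j) := by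
      have : q - v (j + 1) = (q - v j) - edge v j := by simp only [edge]; abel
      rw [this, cross_sub_right, cross_self, sub_zero]
    have h6 := congrArg (fun y => cross y (q - v (j + 1)))
      (cross_smul_basis (edge v j) (edge v (j + 1)) d)
    simp only [cross_add_left, cross_smul_left, h5] at h6
    have h7 : cross d (q - v (j + 1)) = -cross d (v (j + 1) - q) := by
      rw [← cross_neg_right, neg_sub]
    have h8 := hdv (j + 1)
    have h9 := cross_edge_pos hk hv j
    have h10 := mul_nonneg h2.le h3
    have h11 := mul_nonneg h1 h4
    have h12 := mul_pos h9 h8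
    rw [h7] at h6
    linarith

end Sides

/-! ### Components of vectors along the sides -/

section Components

variable {k : ℕ} (v : Fin (k + 1) → Plane)

/-- The component along side `j` of a vector of the cone `j`. -/
noncomputable def compA (j : Fin (k + 1)) (x : Plane) : ℝ :=
  cross x (side v (j + 1)) / cross (side v j) (side v (j + 1))

/-- The component along side `j + 1` of a vector of the cone `j`. -/
noncomputable def compB (j : Fin (k + 1)) (x : Plane) : ℝ :=
  cross (side v j) x / cross (side v j) (side v (j + 1))

/-- The number of indices with value `j`. -/
def count {ι : Type*} [Fintype ι] (τ : ι → Fin (k + 1)) (j : Fin (k + 1)) : ℕ :=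
  (Finset.univ.filter fun i => τ i = j).card

/-- The sum of the components along side `j` of vectors `x i` of the cones `τ i`. -/
noncomputable def sideSum {ι : Type*} [Fintype ι] (τ : ι → Fin (k + 1)) (x : ι → Plane)
    (j : Fin (k + 1)) : ℝ :=
  ∑ i, ((if τ i = j then compA v (τ i) (x i) else 0)
    + (if τ i + 1 = j then compB v (τ i) (x i) else 0))

/-- The displacement from the contact point of side `0` to the contact point of side `j`. -/
noncomputable def contactOffset {ι : Type*} [Fintype ι] (τ : ι → Fin (k + 1)) (x : ι → Plane)
    (j : Fin (k + 1)) : Plane := ∑ i with τ i < j, x i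

/-- The part of side `0` that comes from the last cone. -/
noncomputable def lastSum {ι : Type*} [Fintype ι] (τ : ι → Fin (k + 1)) (x : ι → Plane) : ℝ :=
  ∑ i with τ i = Fin.last k, compB v (τ i) (x i)

variable {v}

lemma comp_decomp (hk : 2 ≤ k) (hv : IsCcwPolygon v) (j : Fin (k + 1)) (x : Plane) :
    compA v j x • side v j + compB v j x • side v (j + 1) = x := by
  have h := cross_smul_basis (side v j) (side v (j + 1)) x
  have h1 := (cross_side_pos hk hv j).ne'
  rw [compA, compB, div_eq_inv_mul, div_eq_inv_mul, mul_smul, mul_smul, ← smul_add, ← h, smul_smul,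
    inv_mul_cancel₀ h1, one_smul]

lemma compA_pos (hk : 2 ≤ k) (hv : IsCcwPolygon v) {j : Fin (k + 1)} {x : Plane}
    (hx : x ∈ cone v j) : 0 < compA v j x := div_pos hx.2 (cross_side_pos hk hv j)

lemma compB_pos (hk : 2 ≤ k) (hv : IsCcwPolygon v) {j : Fin (k + 1)} {x : Plane}
    (hx : x ∈ cone v j) : 0 < compB v j x := div_pos hx.1 (cross_side_pos hk hv j)

lemma sum_sideSum_smul {ι : Type*} [Fintype ι] (hk : 2 ≤ k) (hv : IsCcwPolygon v)
    (τ : ι → Fin (k + 1)) (x : ι → Plane) :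
    ∑ j, sideSum v τ x j • side v j = ∑ i, x i := by
  simp only [sideSum, Finset.sum_smul]
  rw [Finset.sum_comm]
  refine Finset.sum_congr rfl fun i _ => ?_
  simp only [add_smul, ite_smul, zero_smul, Finset.sum_add_distrib, Finset.sum_ite_eq,
    Finset.mem_univ, if_true]
  exact comp_decomp hk hv _ _

lemma sideSum_pos_iff {ι : Type*} [Fintype ι] (hk : 2 ≤ k) (hv : IsCcwPolygon v)
    {τ : ι → Fin (k + 1)} {x : ι → Plane} (hx : ∀ i, x i ∈ cone v (τ i)) (j : Fin (k + 1)) :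
    0 ≤ sideSum v τ x j ∧ (0 < sideSum v τ x j ↔ 0 < count τ j + count τ (j - 1)) := by
  have hnn : ∀ i ∈ Finset.univ, 0 ≤ ((if τ i = j then compA v (τ i) (x i) else 0)
      + (if τ i + 1 = j then compB v (τ i) (x i) else 0)) := by
    intro i _
    have h1 := compA_pos hk hv (hx i)
    have h2 := compB_pos hk hv (hx i)
    split_ifs <;> linarith
  refine ⟨Finset.sum_nonneg hnn, ?_⟩
  rw [sideSum, Finset.sum_pos_iff_of_nonneg hnn]
  have hc : 0 < count τ j + count τ (j - 1) ↔ ∃ i, τ i = j ∨ τ i + 1 = j := by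
    rw [add_pos_iff, count, count, Finset.card_pos, Finset.card_pos]
    simp only [Finset.Nonempty, Finset.mem_filter, Finset.mem_univ, true_and, exists_or,
      eq_sub_iff_add_eq]
  rw [hc]
  refine ⟨fun ⟨i, _, hi⟩ => ⟨i, ?_⟩, fun ⟨i, hi⟩ => ⟨i, Finset.mem_univ _, ?_⟩⟩
  · by_contra hne
    push Not at hne
    rw [if_neg hne.1, if_neg hne.2] at hi
    simp at hi
  · have h1 := compA_pos hk hv (hx i)
    have h2 := compB_pos hk hv (hx i)
    rcases hi with hi | hi
    · rw [if_pos hi]; split_ifs <;> linarith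
    · rw [if_pos hi]; split_ifs <;> linarith

/-- The contact point of side `j` is on the line through the vertex obtained by adding up the sides
with the lengths `sideSum`. -/
lemma cross_contactOffset {ι : Type*} [Fintype ι] (hk : 2 ≤ k) (hv : IsCcwPolygon v)
    (τ : ι → Fin (k + 1)) (x : ι → Plane) (j : Fin (k + 1)) :
    cross (side v j) (contactOffset τ x j) =
      cross (side v j) (-(lastSum v τ x • side v 0)
        + ∑ l ∈ Finset.Iio j, sideSum v τ x l • side v l) := by
  -- The identity holds edge by edge. An edge of a cone before `j - 1` appears with both components;
  -- for cone `j - 1` the component along side `j` is missing but is killed by `cross (side v j)`;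
  -- for the last cone the component along side `0` is removed by the `lastSum` term.
  have hstep : ∀ i, cross (side v j) (if τ i < j then x i else 0) =
      cross (side v j) (-((if τ i = Fin.last k then compB v (τ i) (x i) else 0) • side v 0)
        + ∑ l ∈ Finset.Iio j, ((if τ i = l then compA v (τ i) (x i) else 0)
          + (if τ i + 1 = l then compB v (τ i) (x i) else 0)) • side v l) := by
    intro i
    set t := τ i with ht
    simp only [add_smul, ite_smul, zero_smul, Finset.sum_add_distrib, Finset.sum_ite_eq,
      Finset.mem_Iio]
    by_cases htl : t = Fin.last k
    · rw [if_pos htl, htl, Fin.last_add_one, if_neg (not_lt.mpr (Fin.le_last j)),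
        if_neg (not_lt.mpr (Fin.le_last j)), zero_add]
      by_cases hj : 0 < j
      · rw [if_pos hj, neg_add_cancel]
      · have : j = 0 := by simpa using hj
        rw [this, if_neg (lt_irrefl _), add_zero, cross_neg_right, cross_smul_right, cross_self]
        simp
    · have h1 : (t + 1).val = t.val + 1 :=
        Fin.val_add_one_of_lt (Fin.lt_last_iff_ne_last.mpr htl)
      rw [if_neg htl, neg_zero, zero_add]
      by_cases hj : t < j
      · rw [if_pos hj, if_pos hj]
        by_cases hj1 : t + 1 < j
        · rw [if_pos hj1, comp_decomp hk hv]
        · have : j = t + 1 := by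
            ext; rw [Fin.lt_def] at hj hj1; omega
          rw [if_neg hj1, add_zero]
          conv_lhs => rw [← comp_decomp hk hv t (x i), cross_add_right, ← this]
          rw [cross_smul_right _ _ (side v j), cross_self, mul_zero, add_zero]
      · have hj1 : ¬ t + 1 < j := by
          rw [Fin.lt_def] at hj ⊢; omega
        rw [if_neg hj, if_neg hj, if_neg hj1, add_zero]
  have h := Finset.sum_congr rfl fun i (_ : i ∈ Finset.univ) => hstep i
  rw [← cross_sum_right, ← cross_sum_right, Finset.sum_add_distrib, Finset.sum_comm,
    Finset.sum_neg_distrib] at h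
  rw [contactOffset, Finset.sum_filter, h, lastSum, Finset.sum_filter, Finset.sum_smul]
  simp only [sideSum, Finset.sum_smul]

/-! ### Polygons with sides parallel to those of `v` -/

/-- The vertices of the polygon with side lengths `c`, from its first vertex `w`. -/
noncomputable def cornerPoint (v : Fin (k + 1) → Plane) (c : Fin (k + 1) → ℝ) (w : Plane)
    (j : Fin (k + 1)) : Plane := w + ∑ l ∈ Finset.Iio j, c l • side v l

lemma cornerPoint_add_one {c : Fin (k + 1) → ℝ} (hc : ∑ j, c j • side v j = 0) (w : Plane)
    (j : Fin (k + 1)) : cornerPoint v c w (j + 1) = cornerPoint v c w j + c j • side v j := by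
  rcases eq_or_ne j (Fin.last k) with rfl | hj
  · have h1 : Finset.Iio (0 : Fin (k + 1)) = ∅ := by ext i; simp
    have h2 : (Finset.univ : Finset (Fin (k + 1))) =
        insert (Fin.last k) (Finset.Iio (Fin.last k)) := by
      ext i
      simp only [Finset.mem_univ, Finset.mem_insert, Finset.mem_Iio, true_iff]
      exact le_iff_eq_or_lt.mp (Fin.le_last i)
    rw [h2, Finset.sum_insert (by simp)] at hc
    rw [Fin.last_add_one, cornerPoint, cornerPoint, h1, Finset.sum_empty, add_assoc,
      add_comm (∑ l ∈ _, _), hc]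
  · have h1 : Finset.Iio (j + 1) = insert j (Finset.Iio j) := by
      ext i
      simp only [Finset.mem_Iio, Finset.mem_insert, Fin.lt_def, Fin.ext_iff,
        Fin.val_add_one_of_lt (Fin.lt_last_iff_ne_last.mpr hj)]
      omega
    rw [cornerPoint, cornerPoint, h1, Finset.sum_insert (by simp)]; abel

/-- The length of side `j` of the polygon with distances `ℓ` to the sides of `v`. -/
noncomputable def width (v : Fin (k + 1) → Plane) (ℓ : Fin (k + 1) → ℝ) (j : Fin (k + 1)) : ℝ :=
  sideLength v j - ℓ (j - 1) / Real.sin (innerAngle v (j - 1))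
    - ℓ j * (Real.cot (innerAngle v (j - 1)) + Real.cot (innerAngle v j))
    - ℓ (j + 1) / Real.sin (innerAngle v j)

/-- The vertex `W j` lies on the lines of sides `j - 1` and `j`. In the orthonormal frame of side
`j`, the distances to sides `j - 1` and `j + 1` both involve the tangential coordinate of `W j`;
eliminating it leaves the length of side `j`. -/
lemma width_eq (hk : 2 ≤ k) (hv : IsCcwPolygon v) {W : Fin (k + 1) → Plane}
    {c ℓ : Fin (k + 1) → ℝ} (hW : ∀ j, W (j + 1) = W j + c j • side v j)
    (hℓ : ∀ j, ℓ j = lineDist v j (W j)) (j : Fin (k + 1)) : width v ℓ j = c j := by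
  have hj : j - 1 + 1 = j := sub_add_cancel _ _
  have hve : ∀ j, v (j + 1) = v j + sideLength v j • side v j := fun j => by
    rw [← edge_eq_smul_side hk hv, edge]; abel
  have h1 : ℓ (j - 1) = cross (side v (j - 1)) (W j - v j) := by
    have h2 := hW (j - 1)
    have h3 := hve (j - 1)
    rw [hj] at h2 h3
    rw [hℓ, lineDist_eq, h2, h3]
    simp only [cross_sub_right, cross_add_right, cross_smul_right, cross_self]; ring
  have h2 : ℓ (j + 1) = cross (side v (j + 1)) (W j - v j + (c j - sideLength v j) • side v j) := by
    rw [hℓ, lineDist_eq, hW, hve]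
    congr 1
    rw [sub_smul]; abel
  have h3 : ℓ j = cross (side v j) (W j - v j) := by rw [hℓ, lineDist_eq]
  have hs1 := sin_innerAngle hk hv (j - 1)
  have hs2 := sin_innerAngle hk hv j
  have hc1 := cos_innerAngle hk hv (j - 1)
  have hc2 := cos_innerAngle hk hv j
  have hp1 := sin_innerAngle_pos hk hv (j - 1)
  have hp2 := sin_innerAngle_pos hk hv j
  have hu := dot_side_self hk hv j
  rw [hj] at hs1 hc1
  rw [width, Real.cot_eq_cos_div_sin, Real.cot_eq_cos_div_sin]
  set s1 := Real.sin (innerAngle v (j - 1))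
  set s2 := Real.sin (innerAngle v j)
  set c1 := Real.cos (innerAngle v (j - 1))
  set c2 := Real.cos (innerAngle v j)
  set a := side v (j - 1)
  set u := side v j
  set b := side v (j + 1)
  set y := W j - v j
  have e1 : ℓ (j - 1) = s1 * dot u y - c1 * ℓ j := by
    rw [h1, h3, hs1, hc1]
    have : dot u u * cross a y = cross a u * dot u y + dot a u * cross u y := by
      simp only [cross, dot]; ring
    rw [hu] at this; linarith
  have e2 : ℓ (j + 1) = -s2 * dot u y - c2 * ℓ j - (c j - sideLength v j) * s2 := by
    rw [h2, h3, hs2, hc2, cross_add_right, cross_smul_right, cross_comm b u]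
    have : dot u u * cross b y = -(cross u b) * dot u y + dot u b * cross u y := by
      simp only [cross, dot]; ring
    rw [hu] at this; linarith
  rw [e1, e2]
  field_simp
  ring

/-- The sides of `v` are sorted by angle, and this is `cross_partial_le` with the side lengths as
coefficients. Lengths equal to zero are harmless. -/
lemma cross_cornerPoint_nonneg (hk : 2 ≤ k) (hv : IsCcwPolygon v) {W : Fin (k + 1) → Plane}
    {c : Fin (k + 1) → ℝ} (hW : ∀ j, W (j + 1) = W j + c j • side v j) (hc : ∀ j, 0 ≤ c j)
    (i j : Fin (k + 1)) : 0 ≤ cross (side v i) (W j - W i) := by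
  have hs := sorted_sides hk hv
  have he := edge_ne_zero hk hv
  set x : ℕ → Plane := fun l => edge v (Fin.ofNat (k + 1) l)
  set d : ℕ → ℝ := fun l => c (Fin.ofNat (k + 1) l) * (sideLength v (Fin.ofNat (k + 1) l))⁻¹
  have hsum : ∀ j : ℕ, ∑ l ∈ Finset.range j, d l • x l = W (Fin.ofNat (k + 1) j) - W 0 := by
    intro j
    induction j with
    | zero => simp
    | succ j ih =>
      have h1 : Fin.ofNat (k + 1) (j + 1) = Fin.ofNat (k + 1) j + 1 := by
        ext; simp [Fin.val_add]
      rw [Finset.sum_range_succ, ih, h1, hW, side, smul_smul]; abel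
  have hmono : ∀ l l', l ≤ l' → l' < k + 1 → key (edge v 0) (x l) ≤ key (edge v 0) (x l') := by
    intro l l' hl hl'
    rcases hl.eq_or_lt with rfl | hl
    · exact le_rfl
    · exact (hs.key_lt_key l l' hl hl').le
  have h := cross_partial_le (he 0) (side_ne_zero hk hv i) (n := k + 1) (x := x)
    (fun l _ => he _) (c := d)
    (fun l _ => mul_nonneg (hc _) (inv_nonneg.mpr (sideLength_pos hk hv _).le)) hmono
    (by rw [hsum]; have : Fin.ofNat (k + 1) (k + 1) = 0 := by ext; simp
        rw [this, sub_self])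
    (i := i.val) (by omega)
  have hkey : key (edge v 0) (side v i) = key (edge v 0) (edge v i) := by
    obtain ⟨r, hr, h1, h2⟩ := exists_polar (he 0) (he i)
    have hl := sideLength_pos hk hv i
    refine key_eq_of_polar (he 0) (side_ne_zero hk hv i) (r := (sideLength v i)⁻¹ * r)
      (by positivity) (key_nonneg _ _) (key_lt _ _) ?_ ?_
    · rw [mul_assoc, ← h1, side]; simp only [dot, PiLp.smul_apply, smul_eq_mul]; ring
    · rw [mul_assoc, ← h2, side, cross_smul_right]
  rw [hkey] at h
  have := h (fun l hl => by
      have := hmono l i.val hl.le i.isLt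
      simpa only [x, ofNat_val] using this)
    (fun l hl hl' => by
      have := hmono i.val l hl hl'
      simpa only [x, ofNat_val] using this) (j := j.val) (by omega)
  rw [hsum, hsum, ofNat_val, ofNat_val, cross_sub_right, cross_sub_right] at this
  rw [cross_sub_right]; linarith

/-- The set is the segment from `W j` to `W (j + 1)`: the constraints of the two neighbouring sides
already bound it, and the endpoints satisfy all constraints by `cross_cornerPoint_nonneg`. -/
lemma diam_side_eq (hk : 2 ≤ k) (hv : IsCcwPolygon v) {W : Fin (k + 1) → Plane}
    {c : Fin (k + 1) → ℝ} (hW : ∀ j, W (j + 1) = W j + c j • side v j) (hc : ∀ j, 0 ≤ c j)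
    (j : Fin (k + 1)) :
    Metric.diam {p | (∀ i, lineDist v i (W i) ≤ lineDist v i p)
      ∧ lineDist v j p = lineDist v j (W j)} = c j := by
  set T := {p | (∀ i, lineDist v i (W i) ≤ lineDist v i p)
      ∧ lineDist v j p = lineDist v j (W j)} with hT
  have hj : j - 1 + 1 = j := sub_add_cancel _ _
  have hseg : ∀ q ∈ T, ∃ t, 0 ≤ t ∧ t ≤ c j ∧ q = W j + t • side v j := by
    rintro q ⟨hq, hqj⟩
    have h1 := hq (j - 1)
    have h2 := hq (j + 1)
    rw [← sub_nonneg, lineDist_sub] at h1 h2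
    rw [← sub_eq_zero, lineDist_sub] at hqj
    have hb := cross_smul_basis (side v j) (side v (j + 1)) (q - W j)
    rw [hqj, zero_smul, add_zero] at hb
    have hpos := cross_side_pos hk hv j
    set t := cross (q - W j) (side v (j + 1)) / cross (side v j) (side v (j + 1)) with ht
    have hqt : q = W j + t • side v j := by
      rw [ht, div_eq_inv_mul, mul_smul, ← hb, smul_smul, inv_mul_cancel₀ hpos.ne', one_smul]
      abel
    refine ⟨t, ?_, ?_, hqt⟩
    · have h3 := hW (j - 1)
      rw [hj] at h3
      have h4 : q - W (j - 1) = c (j - 1) • side v (j - 1) + t • side v j := by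
        rw [hqt, h3]; abel
      rw [h4, cross_add_right, cross_smul_right, cross_self, mul_zero, zero_add,
        cross_smul_right] at h1
      have h5 := cross_side_pos hk hv (j - 1)
      rw [hj] at h5
      exact nonneg_of_mul_nonneg_left h1 h5
    · have h4 : q - W (j + 1) = (t - c j) • side v j := by
        rw [hqt, hW, sub_smul]; abel
      rw [h4, cross_smul_right, cross_comm] at h2
      nlinarith
  have hdist : ∀ t t' : ℝ, dist (W j + t • side v j) (W j + t' • side v j) = |t - t'| := by
    intro t t'
    rw [dist_add_left, dist_eq_norm, ← sub_smul, norm_smul, norm_side hk hv, mul_one,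
      Real.norm_eq_abs]
  have hle : ∀ p ∈ T, ∀ q ∈ T, dist p q ≤ c j := by
    intro p hp q hq
    obtain ⟨t, ht, ht', rfl⟩ := hseg p hp
    obtain ⟨t', hs, hs', rfl⟩ := hseg q hq
    rw [hdist, abs_le]
    constructor <;> linarith
  have hmem : ∀ i, (∀ i', lineDist v i' (W i') ≤ lineDist v i' (W i)) := by
    intro i i'
    rw [← sub_nonneg, lineDist_sub]
    exact cross_cornerPoint_nonneg hk hv hW hc i' i
  apply le_antisymm
  · exact Metric.diam_le_of_forall_dist_le (hc j) hle
  · have h1 : W j ∈ T := ⟨hmem j, rfl⟩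
    have h2 : W (j + 1) ∈ T := by
      refine ⟨hmem _, ?_⟩
      rw [← sub_eq_zero, lineDist_sub, hW, add_sub_cancel_left, cross_smul_right, cross_self,
        mul_zero]
    have h3 := Metric.dist_le_diam_of_mem
      (Metric.isBounded_iff.mpr ⟨c j, fun p hp q hq => hle p hp q hq⟩) h2 h1
    have h4 := hdist (c j) 0
    rw [zero_smul, add_zero, ← hW, sub_zero, abs_of_nonneg (hc j)] at h4
    linarith

end Components

/-! ### Contact points -/

section Contact

variable {k m : ℕ} {v : Fin (k + 1) → Plane}

/-- `a j` is the index of the only point of `z` at smallest distance from side `j`. -/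
def StrictContact (v : Fin (k + 1) → Plane) (z : Fin (m + 1) → Plane)
    (a : Fin (k + 1) → Fin (m + 1)) : Prop :=
  ∀ j l, l ≠ a j → lineDist v j (z (a j)) < lineDist v j (z l)

lemma StrictContact.sideDist_eq {z : Fin (m + 1) → Plane} {a : Fin (k + 1) → Fin (m + 1)}
    (h : StrictContact v z a) (j : Fin (k + 1)) : sideDist v z j = lineDist v j (z (a j)) := by
  apply le_antisymm
  · exact ciInf_le (Set.finite_range _).bddBelow (a j)
  · apply le_ciInf
    intro l
    rcases eq_or_ne l (a j) with rfl | hl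
    · exact le_rfl
    · exact (h j l hl).le

lemma sideDist_le (z : Fin (m + 1) → Plane) (j : Fin (k + 1)) (i : Fin (m + 1)) :
    sideDist v z j ≤ lineDist v j (z i) := ciInf_le (Set.finite_range _).bddBelow i

lemma StrictContact.isContact_iff {z : Fin (m + 1) → Plane} {a : Fin (k + 1) → Fin (m + 1)}
    (h : StrictContact v z a) (j : Fin (k + 1)) (i : Fin (m + 1)) :
    IsContact v z j i ↔ i = a j := by
  have hside : ∀ i, z i ∈ pcpSide v z j ↔ i = a j := by
    intro i
    constructor
    · rintro ⟨-, hi⟩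
      by_contra hne
      have := h j i hne
      rw [← h.sideDist_eq, hi] at this
      exact lt_irrefl _ this
    · rintro rfl
      exact ⟨fun j' => sideDist_le z j' _, (h.sideDist_eq j).symm⟩
  unfold IsContact
  simp only [hside]
  refine ⟨fun h => h.1, fun h => ⟨h, ?_⟩⟩
  rintro i' rfl
  rw [h]
  exact Or.inr ⟨rfl, le_rfl⟩

lemma StrictContact.contactIndex_eq {z : Fin (m + 1) → Plane} {a : Fin (k + 1) → Fin (m + 1)}
    (h : StrictContact v z a) (j : Fin (k + 1)) : contactIndex v z j = (a j).val := by
  have : {i : ℕ | ∃ h : i < m + 1, IsContact v z j ⟨i, h⟩} = {(a j).val} := by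
    ext i
    simp only [h.isContact_iff, Set.mem_ofPred_eq, Set.mem_singleton_iff, Fin.ext_iff]
    exact ⟨fun ⟨_, h⟩ => h, fun h => ⟨h ▸ (a j).isLt, h⟩⟩
  rw [contactIndex, this, csInf_singleton]

lemma StrictContact.sizeVector_eq {z : Fin (m + 1) → Plane} {a : Fin (k + 1) → Fin (m + 1)}
    (h : StrictContact v z a) (j : Fin (k + 1)) :
    sizeVector v z j = (a (j + 1) - a j).val := by
  rw [sizeVector, h.contactIndex_eq, h.contactIndex_eq, Fin.sub_def]
  simp only
  rw [add_comm]

lemma StrictContact.comp {z : Fin (m + 1) → Plane} {a : Fin (k + 1) → Fin (m + 1)}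
    (h : StrictContact v z a) (σ : Equiv.Perm (Fin (m + 1))) :
    StrictContact v (z ∘ σ) fun j => σ.symm (a j) := by
  intro j l hl
  simp only [Function.comp, Equiv.apply_symm_apply]
  exact h j (σ l) (by rwa [Ne, ← Equiv.eq_symm_apply])

lemma StrictContact.sizeVector_shift {z : Fin (m + 1) → Plane} {a : Fin (k + 1) → Fin (m + 1)}
    (h : StrictContact v z a) (c : Fin (m + 1)) :
    sizeVector v (z ∘ Equiv.addLeft c) = sizeVector v z := by
  ext j
  rw [(h.comp (Equiv.addLeft c)).sizeVector_eq, h.sizeVector_eq]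
  simp

lemma sideDist_comp (z : Fin (m + 1) → Plane) (σ : Equiv.Perm (Fin (m + 1))) :
    sideDist v (z ∘ σ) = sideDist v z := by
  ext j
  exact σ.iInf_comp (g := fun i => lineDist v j (z i))

lemma fullSided_iff (z : Fin (m + 1) → Plane) : FullSided v z ↔
    ∀ j, 0 < Metric.diam {p | (∀ i, sideDist v z i ≤ lineDist v i p)
      ∧ lineDist v j p = sideDist v z j} := Iff.rfl

lemma fullSided_comp (z : Fin (m + 1) → Plane) (σ : Equiv.Perm (Fin (m + 1))) :
    FullSided v (z ∘ σ) ↔ FullSided v z := by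
  rw [fullSided_iff, fullSided_iff, sideDist_comp]

lemma forall_mem_polygon_iff (hk : 2 ≤ k) (hv : IsCcwPolygon v) (z : Fin (m + 1) → Plane) :
    (∀ i, z i ∈ polygon v) ↔ ∀ j, 0 ≤ sideDist v z j := by
  simp only [mem_polygon_iff hk hv]
  exact ⟨fun h j => le_ciInf fun i => h i j, fun h i j => (h j).trans (sideDist_le z j i)⟩

end Contact

/-! ### Polygons sorted from the contact point of side `0` -/

section Good

variable {k m : ℕ} {v : Fin (k + 1) → Plane}

/-- The edges of `z` lie in the open cones defined by the sides, and are sorted by angle, starting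
from the direction of side `0`. -/
def Good (v : Fin (k + 1) → Plane) (z : Fin (m + 1) → Plane) : Prop :=
  (∀ i, ∃ j, edge z i ∈ cone v j) ∧ StrictMono fun i => key (edge v 0) (edge z i)

lemma Good.sorted {z : Fin (m + 1) → Plane} (h : Good v z) : Sorted (edge v 0) z :=
  ⟨fun i => by obtain ⟨j, hj⟩ := h.1 i; exact ne_zero_of_mem_cone hj, h.2⟩

lemma val_lt_card_iff {n : ℕ} (s : Finset (Fin n)) (hs : ∀ i j, i ≤ j → j ∈ s → i ∈ s)
    (i : Fin n) : i.val < s.card ↔ i ∈ s := by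
  constructor
  · intro h
    by_contra hi
    have : s ⊆ Finset.Iio i := by
      intro j hj
      rw [Finset.mem_Iio]
      by_contra hc
      exact hi (hs i j (not_lt.mp hc) hj)
    have := Finset.card_le_card this
    rw [Fin.card_Iio] at this
    omega
  · intro h
    have : Finset.Iic i ⊆ s := fun j hj => hs j i (Finset.mem_Iic.mp hj) h
    have := Finset.card_le_card this
    rw [Fin.card_Iic] at this
    omega

/-- The number of indices with value less than `j`. -/
def countLt (τ : Fin (m + 1) → Fin (k + 1)) (j : Fin (k + 1)) : ℕ :=
  (Finset.univ.filter fun i => τ i < j).card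

variable {τ : Fin (m + 1) → Fin (k + 1)}

lemma Good.cone_le (hk : 2 ≤ k) (hv : IsCcwPolygon v) {z : Fin (m + 1) → Plane} (h : Good v z)
    (hτ : ∀ i, edge z i ∈ cone v (τ i)) : Monotone τ := by
  intro i j hij
  by_contra hc
  rw [not_le] at hc
  have h1 := (key_of_mem_cone hk hv (hτ j)).2 _ hc
  have h2 := (key_of_mem_cone hk hv (hτ i)).1
  have h3 := h.2.monotone hij
  linarith

lemma countLt_le (τ : Fin (m + 1) → Fin (k + 1)) (j : Fin (k + 1)) : countLt τ j ≤ m + 1 := by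
  have := Finset.card_filter_le Finset.univ fun i => τ i < j
  rwa [Finset.card_univ, Fintype.card_fin] at this

lemma lt_countLt_iff (hτ : Monotone τ) (j : Fin (k + 1)) (i : Fin (m + 1)) :
    i.val < countLt τ j ↔ τ i < j := by
  rw [countLt, val_lt_card_iff]
  · simp
  · intro i i' hii hi'
    simp only [Finset.mem_filter, Finset.mem_univ, true_and] at hi' ⊢
    exact (hτ hii).trans_lt hi'

/-- The edge directions pass that of side `j` after the edges of the cones before `j`. The contact
is strict because the cones are open. If all edges precede side `j`, the index `m + 1` wraps around
to `0`. -/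
lemma Good.strictContact (hk : 2 ≤ k) (hv : IsCcwPolygon v) {z : Fin (m + 1) → Plane}
    (h : Good v z) (hτ : ∀ i, edge z i ∈ cone v (τ i)) :
    StrictContact v z fun j => Fin.ofNat (m + 1) (countLt τ j) := by
  intro j l hl
  have hmono := h.cone_le hk hv hτ
  have h1 := h.sorted.cross_pos (edge_ne_zero hk hv 0) (edge_ne_zero hk hv j) (countLt_le τ j)
    (fun l hl => (key_of_mem_cone hk hv (hτ l)).2 j ((lt_countLt_iff hmono j l).mp hl))
    (fun l hl => by
      have h2 : j ≤ τ l := by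
        by_contra hc
        exact absurd ((lt_countLt_iff hmono j l).mpr (not_le.mp hc)) (not_lt.mpr hl)
      exact ((sideKey_strictMono hk hv).monotone h2).trans_lt (key_of_mem_cone hk hv (hτ l)).1)
    l hl
  rw [← sub_pos, lineDist_sub, side, cross_smul_left]
  exact mul_pos (inv_pos.mpr (sideLength_pos hk hv j)) h1

lemma sum_range_ofNat_eq {M : Type*} [AddCommMonoid M] (f : Fin (m + 1) → M) {a : ℕ}
    (ha : a ≤ m + 1) :
    ∑ l ∈ Finset.range a, f (Fin.ofNat (m + 1) l) = ∑ i with i.val < a, f i := by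
  refine Finset.sum_nbij' (fun l => Fin.ofNat (m + 1) l) (fun i => i.val) ?_ ?_ ?_ ?_ ?_
  · intro l hl
    rw [Finset.mem_range] at hl
    simp [Nat.mod_eq_of_lt (hl.trans_le ha), hl]
  · intro i hi
    simpa using hi
  · intro l hl
    rw [Finset.mem_range] at hl
    simp [Nat.mod_eq_of_lt (hl.trans_le ha)]
  · intro i _
    exact ofNat_val i
  · intros; rfl

lemma Good.apply_contact (hk : 2 ≤ k) (hv : IsCcwPolygon v) {z : Fin (m + 1) → Plane}
    (h : Good v z) (hτ : ∀ i, edge z i ∈ cone v (τ i)) (j : Fin (k + 1)) :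
    z (Fin.ofNat (m + 1) (countLt τ j)) = z 0 + contactOffset τ (edge z) j := by
  have h1 := sum_range_edge z (countLt τ j)
  rw [sum_range_ofNat_eq (edge z) (countLt_le τ j)] at h1
  simp only [lt_countLt_iff (h.cone_le hk hv hτ)] at h1
  rw [contactOffset, h1]; abel

lemma Good.sideDist_eq (hk : 2 ≤ k) (hv : IsCcwPolygon v) {z : Fin (m + 1) → Plane}
    (h : Good v z) (hτ : ∀ i, edge z i ∈ cone v (τ i)) (j : Fin (k + 1)) :
    sideDist v z j = lineDist v j (z 0 + contactOffset τ (edge z) j) := by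
  rw [(h.strictContact hk hv hτ).sideDist_eq, h.apply_contact hk hv hτ]

/-- The parallel containing polygon is the polygon with side lengths `sideSum`. Side `j` collects
positive components from the edges of cones `j - 1` and `j` only. -/
lemma Good.fullSided_iff (hk : 2 ≤ k) (hv : IsCcwPolygon v) {z : Fin (m + 1) → Plane}
    (h : Good v z) (hτ : ∀ i, edge z i ∈ cone v (τ i)) :
    FullSided v z ↔ ∀ j, 0 < count τ j + count τ (j - 1) := by
  set C := sideSum v τ (edge z) with hC
  have hsum : ∑ j, C j • side v j = 0 := by rw [sum_sideSum_smul hk hv, sum_edge]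
  -- The point `z 0` is the contact point of side `0`; the part of this side behind it comes from
  -- the edges of the last cone.
  set W := cornerPoint v C (z 0 - lastSum v τ (edge z) • side v 0) with hWdef
  have hW := cornerPoint_add_one hsum (z 0 - lastSum v τ (edge z) • side v 0)
  rw [PCP.fullSided_iff]
  have hd : ∀ j, sideDist v z j = lineDist v j (W j) := by
    intro j
    rw [h.sideDist_eq hk hv hτ, ← sub_eq_zero, lineDist_sub]
    have := cross_contactOffset hk hv τ (edge z) j
    rw [hWdef, cornerPoint, sub_add, add_sub_sub_cancel, cross_add_right, this]
    simp only [cross_sub_right, cross_add_right, cross_neg_right]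
    rw [hC]; ring
  refine forall_congr' fun j => ?_
  simp only [hd]
  rw [diam_side_eq hk hv hW (fun j => (sideSum_pos_iff hk hv hτ j).1) j]
  exact (sideSum_pos_iff hk hv hτ j).2

lemma sum_count {ι : Type*} [Fintype ι] (τ : ι → Fin (k + 1)) :
    ∑ j, count τ j = Fintype.card ι := by
  have := Finset.card_eq_sum_card_fiberwise (f := τ) (s := Finset.univ) (t := Finset.univ)
    (fun _ _ => Finset.mem_coe.mpr (Finset.mem_univ _))
  rw [Finset.card_univ] at this
  exact this.symm

/-- With at least three sides, cones `j + 1` and `j + 2` differ from `j`, and together they contain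
an edge. Sizes are therefore determined by their residues modulo the number of points. -/
lemma count_lt (hk : 2 ≤ k) (hN : ∀ j, 0 < count τ j + count τ (j - 1)) (j : Fin (k + 1)) :
    count τ j < m + 1 := by
  have h1 := hN (j + 1 + 1)
  rw [add_sub_cancel_right] at h1
  have h2 : ∑ i ∈ {j, j + 1, j + 1 + 1}, count τ i ≤ m + 1 := by
    have h3 := sum_count τ
    rw [Fintype.card_fin] at h3
    exact (Finset.sum_le_sum_of_subset (Finset.subset_univ _)).trans h3.le
  have h3 : j + 1 ≠ j := add_one_ne (by omega) j
  have h4 : j + 1 + 1 ≠ j + 1 := add_one_ne (by omega) _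
  have h5 : j + 1 + 1 ≠ j := by
    have := sub_one_ne_add_one hk (j + 1)
    rw [add_sub_cancel_right] at this
    exact this.symm
  rw [Finset.sum_insert (by simp [h3.symm, h5.symm]), Finset.sum_insert (by simp [h4.symm]),
    Finset.sum_singleton] at h2
  omega

/-- Consecutive contact indices differ by the number of edges in the cone, modulo `m + 1`; by
`count_lt` no information is lost in the reduction. -/
lemma Good.sizeVector_eq (hk : 2 ≤ k) (hv : IsCcwPolygon v) {z : Fin (m + 1) → Plane}
    (h : Good v z) (hτ : ∀ i, edge z i ∈ cone v (τ i))
    (hN : ∀ j, 0 < count τ j + count τ (j - 1)) : sizeVector v z = count τ := by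
  ext j
  rw [(h.strictContact hk hv hτ).sizeVector_eq]
  have hadd : Fin.ofNat (m + 1) (countLt τ (j + 1)) =
      Fin.ofNat (m + 1) (countLt τ j + count τ j) := by
    rcases eq_or_ne j (Fin.last k) with rfl | hj
    · have h1 : countLt τ (Fin.last k) + count τ (Fin.last k) = m + 1 := by
        rw [countLt, count, ← Finset.card_union_of_disjoint, ← Finset.filter_or,
          Finset.filter_true_of_mem, Finset.card_univ, Fintype.card_fin]
        · intro i _
          exact (Fin.le_last (τ i)).lt_or_eq
        · rw [Finset.disjoint_filter]
          intro i _ h1 h2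
          exact absurd h2 h1.ne
      have h2 : countLt τ 0 = 0 := by simp [countLt]
      rw [h1, Fin.last_add_one, h2]
      ext; simp
    · congr 1
      rw [countLt, countLt, count, ← Finset.card_union_of_disjoint, ← Finset.filter_or]
      · congr 1
        ext i
        simp only [Finset.mem_filter, Finset.mem_univ, true_and, Fin.lt_def, Fin.ext_iff,
          Fin.val_add_one_of_lt (Fin.lt_last_iff_ne_last.mpr hj)]
        omega
      · rw [Finset.disjoint_filter]
        intro i _ h1 h2
        exact absurd h2 h1.ne
  have hval : Fin.ofNat (m + 1) (countLt τ (j + 1)) - Fin.ofNat (m + 1) (countLt τ j) =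
      Fin.ofNat (m + 1) (count τ j) := by
    rw [hadd, sub_eq_iff_eq_add]
    ext; simp [Fin.val_add, add_comm]
  rw [hval]
  simp [Nat.mod_eq_of_lt (count_lt hk hN j)]

end Good

/-! ### Measurability -/

section Measurability

variable {k m : ℕ} {v : Fin (k + 1) → Plane}

lemma continuous_cross_left (a : Plane) : Continuous fun x => cross a x := by
  unfold cross; fun_prop

lemma continuous_cross_right (a : Plane) : Continuous fun x => cross x a := by
  unfold cross; fun_prop

lemma measurable_cross {α : Type*} [MeasurableSpace α] {f g : α → Plane} (hf : Measurable f)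
    (hg : Measurable g) : Measurable fun x => cross (f x) (g x) := by
  unfold cross; fun_prop

lemma measurable_edge (i : Fin (m + 1)) : Measurable fun z : Fin (m + 1) → Plane => edge z i := by
  unfold edge; fun_prop

lemma measurableSet_cone (j : Fin (k + 1)) : MeasurableSet (cone v j) :=
  (isOpen_lt continuous_const (continuous_cross_left _)).measurableSet.inter
    (isOpen_lt continuous_const (continuous_cross_right _)).measurableSet

lemma continuous_lineDist (j : Fin (k + 1)) : Continuous (lineDist v j) := by
  unfold lineDist cross; fun_prop

lemma measurable_sideDist (j : Fin (k + 1)) {n : ℕ} :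
    Measurable fun z : Fin n → Plane => sideDist v z j := by
  unfold sideDist
  exact Measurable.iInf fun i => (continuous_lineDist j).measurable.comp (measurable_pi_apply i)

lemma measurable_sideDist_pi {n : ℕ} : Measurable fun z : Fin n → Plane => sideDist v z :=
  measurable_pi_lambda _ fun j => measurable_sideDist j

lemma measurableSet_isContact {n : ℕ} (j : Fin (k + 1)) (i : Fin n) :
    MeasurableSet {z : Fin n → Plane | IsContact v z j i} := by
  have hline : ∀ (j : Fin (k + 1)) (i : Fin n),
      Measurable fun z : Fin n → Plane => lineDist v j (z i) :=
    fun j i => (continuous_lineDist j).measurable.comp (measurable_pi_apply i)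
  have hcoord : ∀ (i : Fin n) (a : Fin 2), Measurable fun z : Fin n → Plane => z i a :=
    fun i a => by fun_prop
  have hside : ∀ i : Fin n, MeasurableSet {z : Fin n → Plane | z i ∈ pcpSide v z j} := by
    intro i
    have : {z : Fin n → Plane | z i ∈ pcpSide v z j} =
        (⋂ j', {z | sideDist v z j' ≤ lineDist v j' (z i)}) ∩
          {z | lineDist v j (z i) = sideDist v z j} := by
      ext z; simp [pcpSide, pcp]
    rw [this]
    exact (MeasurableSet.iInter fun j' =>
      measurableSet_le (measurable_sideDist j') (hline j' i)).inter
      (measurableSet_eq_fun (hline j i) (measurable_sideDist j))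
  have : {z : Fin n → Plane | IsContact v z j i} = {z | z i ∈ pcpSide v z j} ∩
      ⋂ i', ({z | z i' ∈ pcpSide v z j}ᶜ ∪ ({z | z i 0 < z i' 0} ∪
        ({z | z i 0 = z i' 0} ∩ {z | z i 1 ≤ z i' 1}))) := by
    ext z
    simp only [IsContact, LexLE, Set.mem_ofPred_eq, Set.mem_inter_iff, Set.mem_iInter,
      Set.mem_union, Set.mem_compl_iff, imp_iff_not_or]
  rw [this]
  refine (hside i).inter (MeasurableSet.iInter fun i' => (hside i').compl.union
    ((measurableSet_lt (hcoord i 0) (hcoord i' 0)).union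
    ((measurableSet_eq_fun (hcoord i 0) (hcoord i' 0)).inter
      (measurableSet_le (hcoord i 1) (hcoord i' 1)))))

lemma measurable_contactIndex {n : ℕ} (j : Fin (k + 1)) :
    Measurable fun z : Fin n → Plane => contactIndex v z j := by
  have h1 : Measurable fun z : Fin n → Plane => fun i : Fin n => IsContact v z j i :=
    measurable_pi_lambda _ fun i => measurableSet_setOfPred.mp (measurableSet_isContact j i)
  have h2 : Measurable fun P : Fin n → Prop => sInf {i : ℕ | ∃ h : i < n, P ⟨i, h⟩} :=
    measurable_of_countable _
  exact h2.comp h1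

lemma measurable_sizeVector {n : ℕ} : Measurable fun z : Fin n → Plane => sizeVector v z := by
  refine measurable_pi_lambda _ fun j => ?_
  have h : Measurable fun p : ℕ × ℕ => (p.1 + (n - p.2)) % n := measurable_of_countable _
  exact h.comp ((measurable_contactIndex (j + 1)).prodMk (measurable_contactIndex j))

lemma measurableSet_good : MeasurableSet {z : Fin (m + 1) → Plane | Good v z} := by
  have : {z : Fin (m + 1) → Plane | Good v z} =
      (⋂ i, ⋃ j, (fun z => edge z i) ⁻¹' cone v j) ∩
      ⋂ i, ⋂ i', {z | i < i' → key (edge v 0) (edge z i) < key (edge v 0) (edge z i')} := by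
    ext z; simp [Good, StrictMono]
  rw [this]
  refine (MeasurableSet.iInter fun i => MeasurableSet.iUnion fun j =>
    (measurable_edge i) (measurableSet_cone j)).inter (MeasurableSet.iInter fun i =>
    MeasurableSet.iInter fun i' => ?_)
  by_cases h : i < i'
  · simp only [h, true_imp_iff]
    exact measurableSet_lt ((measurable_key _).comp (measurable_edge i))
      ((measurable_key _).comp (measurable_edge i'))
  · simp [h]

/-- The polygons inscribed in `v`, sorted from the contact point of side `0`, with a full-sided
parallel containing polygon. -/
def goodSet (v : Fin (k + 1) → Plane) (m : ℕ) : Set (Fin (m + 1) → Plane) :=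
  {z | Good v z ∧ FullSided v z ∧ ∀ j, 0 ≤ sideDist v z j}

/-- On good polygons the condition on diameters becomes a condition on edges that is visibly
measurable. -/
lemma Good.fullSided_iff_exists (hk : 2 ≤ k) (hv : IsCcwPolygon v) {z : Fin (m + 1) → Plane}
    (h : Good v z) : FullSided v z ↔ ∀ j, ∃ i, edge z i ∈ cone v j ∪ cone v (j - 1) := by
  choose τ hτ using h.1
  rw [h.fullSided_iff hk hv hτ]
  refine forall_congr' fun j => ?_
  have : ∀ j i, edge z i ∈ cone v j ↔ τ i = j := fun j i =>
    ⟨fun h => cone_unique hk hv (hτ i) h, fun h => h ▸ hτ i⟩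
  simp only [Set.mem_union, this, add_pos_iff, count, Finset.card_pos, Finset.Nonempty,
    Finset.mem_filter, Finset.mem_univ, true_and, exists_or]

lemma measurableSet_goodSet (hk : 2 ≤ k) (hv : IsCcwPolygon v) :
    MeasurableSet (goodSet v m) := by
  have : goodSet v m = {z | Good v z} ∩
      ((⋂ j, ⋃ i, (fun z => edge z i) ⁻¹' (cone v j ∪ cone v (j - 1))) ∩
        ⋂ j, {z | 0 ≤ sideDist v z j}) := by
    ext z
    simp only [goodSet, Set.mem_ofPred_eq, Set.mem_inter_iff, Set.mem_iInter, Set.mem_iUnion,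
      Set.mem_preimage]
    refine and_congr_right fun h => ?_
    rw [h.fullSided_iff_exists hk hv]
  rw [this]
  exact measurableSet_good.inter ((MeasurableSet.iInter fun j => MeasurableSet.iUnion fun i =>
    (measurable_edge i) ((measurableSet_cone j).union (measurableSet_cone _))).inter
    (MeasurableSet.iInter fun j => measurableSet_le measurable_const (measurable_sideDist j)))

lemma measurableSet_ccw : MeasurableSet {z : Fin (m + 1) → Plane | IsCcwPolygon z} := by
  have : {z : Fin (m + 1) → Plane | IsCcwPolygon z} =
      ⋂ i, ⋂ j, {z | j ≠ i → j ≠ i + 1 → 0 < cross (edge z i) (z j - z i)} := by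
    ext z; simp [ccw_iff]
  rw [this]
  refine MeasurableSet.iInter fun i => MeasurableSet.iInter fun j => ?_
  by_cases h1 : j ≠ i
  · by_cases h2 : j ≠ i + 1
    · simp only [ne_eq, h1, not_false_eq_true, h2, forall_const]
      exact measurableSet_lt measurable_const
        (measurable_cross (measurable_edge i) (by fun_prop))
    · simp [not_not.mp h2]
  · simp [not_not.mp h1]

end Measurability

/-! ### Permutations of the points -/

section Perm

variable {k m : ℕ} {v : Fin (k + 1) → Plane}

lemma measurePreserving_comp_perm {ι : Type*} [Fintype ι] (σ : Equiv.Perm ι) :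
    MeasurePreserving (fun z : ι → Plane => z ∘ σ) :=
  volume_preserving_arrowCongr' σ.symm (MeasurableEquiv.refl Plane)
    (MeasurePreserving.id volume)

lemma lintegral_comp_perm {ι : Type*} [Fintype ι] (σ : Equiv.Perm ι)
    (F : (ι → Plane) → ENNReal) : ∫⁻ z, F (z ∘ σ) = ∫⁻ z, F z :=
  (measurePreserving_comp_perm σ).lintegral_comp_emb
    (MeasurableEquiv.arrowCongr' σ.symm (MeasurableEquiv.refl Plane)).measurableEmbedding F

/-- If almost every orbit under permutations of the points that meets `A` or `G` has exactly one
element in each, then invariant functions have the same integral over `A` and over `G`. -/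
lemma setLIntegral_eq_of_perm {ι : Type*} [Fintype ι] [DecidableEq ι] {A G : Set (ι → Plane)}
    (hA : MeasurableSet A) (hG : MeasurableSet G)
    {F : (ι → Plane) → ENNReal} (hF : Measurable F)
    (h1 : ∀ z ∈ A, ∃! σ : Equiv.Perm ι, z ∘ σ ∈ G)
    (h2 : ∀ z ∈ G, ∃! σ : Equiv.Perm ι, z ∘ σ ∈ A)
    (h3 : ∀ z (σ : Equiv.Perm ι), z ∈ G → z ∘ σ ∈ A → F (z ∘ σ) = F z) :
    ∫⁻ z in A, F z = ∫⁻ z in G, F z := by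
  classical
  have hsum : ∀ {A G : Set (ι → Plane)} (z : ι → Plane), z ∈ A →
      (∃! σ : Equiv.Perm ι, z ∘ σ ∈ G) →
      ∑ σ : Equiv.Perm ι, (if z ∈ A ∧ z ∘ σ ∈ G then F z else 0) = F z := by
    rintro A G z hz ⟨σ, hσ, huniq⟩
    rw [Finset.sum_eq_single σ, if_pos ⟨hz, hσ⟩]
    · intro σ' _ hne
      rw [if_neg fun h => hne (huniq σ' h.2)]
    · simp
  have hmeas : ∀ {A G : Set (ι → Plane)}, MeasurableSet A → MeasurableSet G →
      ∀ σ : Equiv.Perm ι, Measurable fun z : ι → Plane => if z ∈ A ∧ z ∘ σ ∈ G then F z else 0 :=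
    fun hA hG σ => Measurable.ite (hA.inter ((measurePreserving_comp_perm σ).measurable hG)) hF
      measurable_const
  have hint : ∀ {A G : Set (ι → Plane)}, MeasurableSet A → MeasurableSet G →
      (∀ z ∈ A, ∃! σ : Equiv.Perm ι, z ∘ σ ∈ G) → ∫⁻ z in A, F z =
        ∑ σ : Equiv.Perm ι, ∫⁻ z, (if z ∈ A ∧ z ∘ σ ∈ G then F z else 0) := by
    intro A G hA hG h
    rw [← lintegral_indicator hA, ← lintegral_finsetSum _ fun σ _ => hmeas hA hG σ]
    refine lintegral_congr fun z => ?_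
    by_cases hz : z ∈ A
    · rw [Set.indicator_of_mem hz, hsum z hz (h z hz)]
    · simp [hz]
  rw [hint hA hG h1, hint hG hA h2]
  -- Both integrals are now sums over pairs made of a tuple and a permutation of it, one in `A` and
  -- the other in `G`. Replacing `z` by `z ∘ σ⁻¹` exchanges the two roles.
  refine Fintype.sum_equiv (Equiv.inv _) _ _ fun σ => ?_
  rw [← lintegral_comp_perm σ⁻¹]
  refine lintegral_congr fun z => ?_
  have h4 : (z ∘ ⇑σ⁻¹) ∘ ⇑σ = z := by ext1 i; simp
  simp only [h4, Equiv.inv_apply]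
  by_cases h : z ∈ G ∧ z ∘ ⇑σ⁻¹ ∈ A
  · rw [if_pos h, if_pos h.symm, h3 z _ h.1 h.2]
  · rw [if_neg h, if_neg fun h' => h h'.symm]

lemma Good.contact_zero (hk : 2 ≤ k) (hv : IsCcwPolygon v) {z : Fin (m + 1) → Plane}
    (h : Good v z) {l : Fin (m + 1)} (hl : l ≠ 0) : lineDist v 0 (z 0) < lineDist v 0 (z l) := by
  choose τ hτ using h.1
  have := h.strictContact hk hv hτ 0 l
  have h0 : countLt τ 0 = 0 := by simp [countLt]
  simp only [h0] at this
  exact this hl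

lemma Good.isCcwPolygon (hk : 2 ≤ k) (hv : IsCcwPolygon v) {z : Fin (m + 1) → Plane}
    (h : Good v z) : IsCcwPolygon z := h.sorted.isCcwPolygon (edge_ne_zero hk hv 0)

/-- Two good orders are counterclockwise, hence differ by a cyclic shift, and both start at the
unique point closest to side `0`. -/
lemma Good.perm_unique (hk : 2 ≤ k) (hv : IsCcwPolygon v) (hm : 2 ≤ m)
    {z : Fin (m + 1) → Plane} {σ σ' : Equiv.Perm (Fin (m + 1))} (h : Good v (z ∘ σ))
    (h' : Good v (z ∘ σ')) : σ = σ' := by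
  have hz : (z ∘ σ) ∘ ⇑(σ⁻¹ * σ') = z ∘ σ' := by ext1 i; simp
  have hshift := (h.isCcwPolygon hk hv).perm_eq_shift (by omega : 1 ≤ m) (σ := σ⁻¹ * σ')
    (by rw [hz]; exact h'.isCcwPolygon hk hv)
  set ρ := σ⁻¹ * σ' with hρ
  have h0 : ρ 0 = 0 := by
    by_contra hne
    have h1 := h.contact_zero hk hv hne
    have h2 := h'.contact_zero hk hv (l := ρ.symm 0)
      (fun hc => hne (by rw [← hc]; simpa using hc.symm))
    rw [← hz] at h2
    simp only [Function.comp, Equiv.apply_symm_apply] at h1 h2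
    exact lt_asymm h1 h2
  rw [h0] at hshift
  have : ρ = 1 := by rw [hshift]; ext1 i; simp
  rw [hρ, inv_mul_eq_one] at this
  exact this

/-- `z` starts from its lowest point, the leftmost one of these. -/
def StartsLowest (z : Fin (m + 1) → Plane) : Prop :=
  ∀ i j : Fin (m + 1), i.val = 0 → z i 1 < z j 1 ∨ (z i 1 = z j 1 ∧ z i 0 ≤ z j 0)

lemma startsLowest_iff (z : Fin (m + 1) → Plane) : StartsLowest z ↔
    ∀ j, toLex (z 0 1, z 0 0) ≤ toLex (z j 1, z j 0) := by
  simp only [Prod.Lex.toLex_le_toLex]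
  refine ⟨fun h j => h 0 j rfl, fun h i j hi => ?_⟩
  have : i = 0 := Fin.ext hi
  rw [this]; exact h j

lemma measurableSet_startsLowest :
    MeasurableSet {z : Fin (m + 1) → Plane | StartsLowest z} := by
  have hcoord : ∀ (i : Fin (m + 1)) (a : Fin 2),
      Measurable fun z : Fin (m + 1) → Plane => z i a := fun i a => by fun_prop
  have : {z : Fin (m + 1) → Plane | StartsLowest z} =
      ⋂ j, ({z | z 0 1 < z j 1} ∪ ({z | z 0 1 = z j 1} ∩ {z | z 0 0 ≤ z j 0})) := by
    ext z
    rw [Set.mem_ofPred_eq, startsLowest_iff]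
    simp [Prod.Lex.toLex_le_toLex]
  rw [this]
  exact MeasurableSet.iInter fun j => (measurableSet_lt (hcoord 0 1) (hcoord j 1)).union
    ((measurableSet_eq_fun (hcoord 0 1) (hcoord j 1)).inter
      (measurableSet_le (hcoord 0 0) (hcoord j 0)))

lemma startsLowest_unique {z : Fin (m + 1) → Plane} (hz : Function.Injective z) :
    ∃! c : Fin (m + 1), StartsLowest (z ∘ Equiv.addLeft c) := by
  obtain ⟨c, hc⟩ := Finite.exists_min fun i => toLex (z i 1, z i 0)
  have hiff : ∀ c, StartsLowest (z ∘ Equiv.addLeft c) ↔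
      ∀ j, toLex (z c 1, z c 0) ≤ toLex (z j 1, z j 0) := by
    intro c
    rw [startsLowest_iff]
    simp only [Function.comp, Equiv.coe_addLeft, add_zero]
    exact ⟨fun h j => by simpa using h (-c + j), fun h j => h _⟩
  refine ⟨c, (hiff c).mpr hc, fun c' hc' => hz ?_⟩
  have h := le_antisymm ((hiff c').mp hc' c) (hc c')
  rw [toLex_inj, Prod.mk.injEq] at h
  exact plane_ext h.2 h.1

/-- A measurable version of the set of polygons in canonical order. -/
def canonSet (v : Fin (k + 1) → Plane) (m : ℕ) : Set (Fin (m + 1) → Plane) :=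
  {z | IsCcwPolygon z ∧ StartsLowest z ∧ ∃ σ : Equiv.Perm (Fin (m + 1)), z ∘ σ ∈ goodSet v m}

lemma measurableSet_exists_perm (hk : 2 ≤ k) (hv : IsCcwPolygon v) :
    MeasurableSet {z | ∃ σ : Equiv.Perm (Fin (m + 1)), z ∘ σ ∈ goodSet v m} := by
  have : {z | ∃ σ : Equiv.Perm (Fin (m + 1)), z ∘ σ ∈ goodSet v m} =
      ⋃ σ : Equiv.Perm (Fin (m + 1)), (fun z => z ∘ σ) ⁻¹' goodSet v m := by
    ext z; simp
  rw [this]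
  exact MeasurableSet.iUnion fun σ =>
    (measurePreserving_comp_perm σ).measurable (measurableSet_goodSet hk hv)

lemma measurableSet_canonSet (hk : 2 ≤ k) (hv : IsCcwPolygon v) :
    MeasurableSet (canonSet v m) :=
  measurableSet_ccw.inter (measurableSet_startsLowest.inter (measurableSet_exists_perm hk hv))

/-- The two sets choose different starting points in the same counterclockwise order, the lowest
point and the contact point of side `0`. Only cyclic shifts intervene, and these preserve the size
vector. -/
lemma setLIntegral_canonSet (hk : 2 ≤ k) (hv : IsCcwPolygon v) (hm : 2 ≤ m)
    {F : (Fin (k + 1) → ℝ) → (Fin (k + 1) → ℕ) → ENNReal}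
    (hF : Measurable (Function.uncurry F)) :
    ∫⁻ z in canonSet v m, F (sideDist v z) (sizeVector v z) =
      ∫⁻ z in goodSet v m, F (sideDist v z) (sizeVector v z) := by
  refine setLIntegral_eq_of_perm (measurableSet_canonSet hk hv) (measurableSet_goodSet hk hv)
    (hF.comp (measurable_sideDist_pi.prodMk measurable_sizeVector)) ?_ ?_ ?_
  · rintro z ⟨-, -, σ, hσ⟩
    exact ⟨σ, hσ, fun σ' hσ' => Good.perm_unique hk hv hm hσ'.1 hσ.1⟩
  · intro z hz
    have hccw := hz.1.isCcwPolygon hk hv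
    obtain ⟨c, hc, hcu⟩ := startsLowest_unique (hccw.convexIndependent hm).injective
    refine ⟨Equiv.addLeft c, ⟨hccw.shift c, hc, (Equiv.addLeft c)⁻¹, ?_⟩, ?_⟩
    · convert hz using 1
      ext1 i; simp
    · rintro σ ⟨h1, h2, -⟩
      have h3 := hccw.perm_eq_shift (by omega) h1
      rw [h3] at h2
      rw [h3, hcu _ h2]
  · rintro z σ hz ⟨h1, -, -⟩
    have hccw := hz.1.isCcwPolygon hk hv
    have h3 := hccw.perm_eq_shift (by omega) h1
    choose τ hτ using hz.1.1
    rw [sideDist_comp, h3, (hz.1.strictContact hk hv hτ).sizeVector_shift]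

/-- No two of the points are on a line parallel to a side. -/
def Generic (v : Fin (k + 1) → Plane) (z : Fin (m + 1) → Plane) : Prop :=
  ∀ i i', i ≠ i' → ∀ j, cross (edge v j) (z i - z i') ≠ 0

lemma exists_cross_ne_zero {a : Plane} (ha : a ≠ 0) : ∃ x, cross a x ≠ 0 := by
  refine ⟨!₂[-a 1, a 0], ?_⟩
  have := dot_self_pos ha
  simp only [cross, dot] at this ⊢
  simp
  nlinarith

lemma ae_generic (hk : 2 ≤ k) (hv : IsCcwPolygon v) :
    ∀ᵐ z : Fin (m + 1) → Plane, Generic v z := by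
  unfold Generic
  simp only [ae_all_iff]
  intro i i' hii j
  obtain ⟨x, hx⟩ := exists_cross_ne_zero (edge_ne_zero hk hv j)
  let L : (Fin (m + 1) → Plane) →ₗ[ℝ] ℝ :=
    crossLin (edge v j) ∘ₗ ((LinearMap.proj i : (Fin (m + 1) → Plane) →ₗ[ℝ] Plane) - LinearMap.proj i')
  have hL : LinearMap.ker L ≠ ⊤ := by
    intro h
    have h1 : Pi.single i x ∈ LinearMap.ker L := by rw [h]; trivial
    rw [LinearMap.mem_ker] at h1
    simp [L, hii.symm] at h1
    exact hx h1
  have := Measure.addHaar_submodule (volume : Measure (Fin (m + 1) → Plane)) (LinearMap.ker L) hL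
  rw [ae_iff]
  convert this using 2
  ext z
  simp [L]

lemma Generic.exists_good (hk : 2 ≤ k) (hv : IsCcwPolygon v) (hm : 2 ≤ m)
    {z : Fin (m + 1) → Plane} (h : Generic v z) (hz : InConvexPosition v z)
    (hfull : FullSided v z) : ∃ σ : Equiv.Perm (Fin (m + 1)), z ∘ σ ∈ goodSet v m := by
  obtain ⟨σ, hσ⟩ := exists_sorted (by omega : 1 ≤ m) (edge_ne_zero hk hv 0) hz.2
    fun i j hij => h i j hij 0
  refine ⟨σ, ⟨fun i => exists_mem_cone hk hv (hσ.1 i) fun j =>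
    h _ _ (σ.injective.ne (add_one_ne (by omega) i)) j, hσ.2⟩, (fullSided_comp z σ).mpr hfull, ?_⟩
  rw [sideDist_comp]
  exact (forall_mem_polygon_iff hk hv z).mp hz.1

lemma convexPosition_of_exists_good (hk : 2 ≤ k) (hv : IsCcwPolygon v) (hm : 2 ≤ m)
    {z : Fin (m + 1) → Plane} {σ : Equiv.Perm (Fin (m + 1))} (h : z ∘ σ ∈ goodSet v m) :
    InConvexPosition v z ∧ FullSided v z := by
  refine ⟨⟨?_, ?_⟩, (fullSided_comp z σ).mp h.2.1⟩
  · rw [forall_mem_polygon_iff hk hv, ← sideDist_comp z σ]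
    exact h.2.2
  · have := (h.1.isCcwPolygon hk hv).convexIndependent hm
    have h2 := this.comp_embedding σ.symm.toEmbedding
    have h3 : (z ∘ σ) ∘ ⇑σ.symm.toEmbedding = z := by ext1 i; simp
    rwa [h3] at h2

/-- The conditioning event is replaced by a measurable set; the two can differ only at tuples with
two points on a parallel to a side. -/
lemma canonical_ae_eq (hk : 2 ≤ k) (hv : IsCcwPolygon v) (hm : 2 ≤ m) :
    {z : Fin (m + 1) → Plane | InCanonicalOrder v z ∧ FullSided v z} =ᵐ[volume] canonSet v m := by
  filter_upwards [ae_generic (v := v) hk hv] with z hz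
  apply propext
  constructor
  · rintro ⟨⟨h1, h2, h3⟩, h4⟩
    exact ⟨h2, h3, hz.exists_good hk hv hm h1 h4⟩
  · rintro ⟨h1, h2, σ, h3⟩
    obtain ⟨h4, h5⟩ := convexPosition_of_exists_good hk hv hm h3
    exact ⟨⟨h4, h1, h2⟩, h5⟩

lemma convexPosition_ae_eq (hk : 2 ≤ k) (hv : IsCcwPolygon v) (hm : 2 ≤ m) :
    {z : Fin (m + 1) → Plane | InConvexPosition v z ∧ FullSided v z} =ᵐ[volume]
      {z | ∃ σ : Equiv.Perm (Fin (m + 1)), z ∘ σ ∈ goodSet v m} := by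
  filter_upwards [ae_generic (v := v) hk hv] with z hz
  apply propext
  constructor
  · rintro ⟨h1, h4⟩
    exact hz.exists_good hk hv hm h1 h4
  · rintro ⟨σ, h3⟩
    exact convexPosition_of_exists_good hk hv hm h3

/-- By `Good.perm_unique` the set is a disjoint union of images of `goodSet`, one for each
permutation. This factorial is the one to which Stirling's formula is applied at the end. -/
lemma volume_exists_perm (hk : 2 ≤ k) (hv : IsCcwPolygon v) (hm : 2 ≤ m) :
    volume {z | ∃ σ : Equiv.Perm (Fin (m + 1)), z ∘ σ ∈ goodSet v m} =
      (m + 1).factorial * volume (goodSet v m) := by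
  have : {z | ∃ σ : Equiv.Perm (Fin (m + 1)), z ∘ σ ∈ goodSet v m} =
      ⋃ σ : Equiv.Perm (Fin (m + 1)), (fun z => z ∘ σ) ⁻¹' goodSet v m := by
    ext z; simp
  rw [this, measure_iUnion]
  · simp_rw [fun σ : Equiv.Perm (Fin (m + 1)) =>
      (measurePreserving_comp_perm σ).measure_preimage
        (measurableSet_goodSet (m := m) hk hv).nullMeasurableSet]
    rw [tsum_fintype, Finset.sum_const, Finset.card_univ, Fintype.card_perm, Fintype.card_fin,
      nsmul_eq_mul]
  · intro σ σ' hne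
    rw [Function.onFun, Set.disjoint_left]
    intro z h1 h2
    exact hne (Good.perm_unique hk hv hm h1.1 h2.1)
  · exact fun σ => (measurePreserving_comp_perm σ).measurable (measurableSet_goodSet hk hv)

end Perm

/-! ### From points to edges -/

section Paths

variable {m : ℕ}

lemma lintegral_fin_snoc {n : ℕ} {E : Type*} [MeasureSpace E] [SigmaFinite (volume : Measure E)]
    {f : (Fin (n + 1) → E) → ENNReal} (hf : Measurable f) :
    ∫⁻ z, f z = ∫⁻ x : Fin n → E, ∫⁻ y, f (Fin.snoc x y) := by
  have h := volume_preserving_piFinSuccAbove (fun _ : Fin (n + 1) => E) (Fin.last n)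
  rw [← h.symm.lintegral_comp_emb (MeasurableEquiv.measurableEmbedding _)]
  have hf' : Measurable fun p : E × (Fin n → E) =>
      f ((MeasurableEquiv.piFinSuccAbove (fun _ : Fin (n + 1) => E) (Fin.last n)).symm p) :=
    hf.comp (MeasurableEquiv.measurable _)
  rw [Measure.volume_eq_prod, lintegral_prod_symm _ hf'.aemeasurable]
  refine lintegral_congr fun x => lintegral_congr fun y => ?_
  congr 1
  exact Fin.insertNth_last (α := fun _ => E) y x

/-- The points obtained from `p` by adding successively the vectors `x l`. -/
noncomputable def path (p : Plane) (x : Fin m → Plane) (i : Fin (m + 1)) : Plane :=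
  p + ∑ l with l.val < i.val, x l

lemma path_snoc (p : Plane) (x : Fin m → Plane) (y : Plane) :
    path p (Fin.snoc x y : Fin (m + 1) → Plane) =
      Fin.snoc (path p x) (path p x (Fin.last m) + y) := by
  ext1 i
  refine Fin.lastCases ?_ (fun i => ?_) i
  · rw [Fin.snoc_last, path, path]
    have h1 : ∀ l : Fin (m + 1), l.val < (Fin.last (m + 1)).val := fun l => l.isLt
    have h2 : ∀ l : Fin m, l.val < (Fin.last m).val := fun l => l.isLt
    simp only [h1, h2, Finset.filter_true, Fin.sum_univ_castSucc, Fin.snoc_castSucc, Fin.snoc_last]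
    abel
  · rw [Fin.snoc_castSucc, path, path]
    congr 1
    rw [Finset.sum_filter, Finset.sum_filter, Fin.sum_univ_castSucc]
    simp only [Fin.snoc_castSucc, Fin.snoc_last, Fin.val_castSucc, Fin.val_last]
    rw [if_neg (by omega), add_zero]

lemma path_zero (p : Plane) (x : Fin m → Plane) : path p x 0 = p := by
  simp [path]

lemma measurable_path {α : Type*} [MeasurableSpace α] {f : α → Plane} {g : α → Fin m → Plane}
    (hf : Measurable f) (hg : Measurable g) : Measurable fun a => path (f a) (g a) := by
  refine measurable_pi_lambda _ fun i => ?_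
  unfold path
  exact hf.add (Finset.measurable_sum _ fun l _ => (measurable_pi_apply l).comp hg)

/-- The passage from points to increments is unimodular: for fixed preceding points, the last one is
translated by its predecessor. -/
lemma lintegral_path {F : (Fin (m + 1) → Plane) → ENNReal} (hF : Measurable F) :
    ∫⁻ z, F z = ∫⁻ p, ∫⁻ x : Fin m → Plane, F (path p x) := by
  induction m with
  | zero =>
    refine ((volume_preserving_funUnique (Fin 1) Plane).symm.lintegral_comp_emb
      (MeasurableEquiv.measurableEmbedding _) F).symm.trans ?_
    refine lintegral_congr fun p => ?_
    rw [lintegral_unique, volume_pi, Measure.pi_of_empty, measure_univ, mul_one]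
    congr 1
    ext1 i
    rw [Subsingleton.elim i 0, path_zero]
    rfl
  | succ m ih =>
    have hsnoc : Measurable fun q : (Fin (m + 1) → Plane) × Plane =>
        (Fin.snoc q.1 q.2 : Fin (m + 2) → Plane) := by
      refine measurable_pi_lambda _ fun i => ?_
      refine Fin.lastCases ?_ (fun i => ?_) i
      · simpa using measurable_snd
      · simp only [Fin.snoc_castSucc]
        exact (measurable_pi_apply i).comp measurable_fst
    rw [lintegral_fin_snoc hF]
    have h1 : ∀ z : Fin (m + 1) → Plane, ∫⁻ y, F (Fin.snoc z y) =
        ∫⁻ y, F (Fin.snoc z (z (Fin.last m) + y)) := fun z =>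
      (lintegral_add_left_eq_self (fun y => F (Fin.snoc z y)) (z (Fin.last m))).symm
    simp_rw [h1]
    have h2 : Measurable fun z : Fin (m + 1) → Plane =>
        ∫⁻ y, F (Fin.snoc z (z (Fin.last m) + y)) :=
      Measurable.lintegral_prod_right' (f := fun q : (Fin (m + 1) → Plane) × Plane =>
        F (Fin.snoc q.1 (q.1 (Fin.last m) + q.2))) (hF.comp (hsnoc.comp
          (measurable_fst.prodMk (((measurable_pi_apply (Fin.last m)).comp measurable_fst).add
            measurable_snd))))
    rw [ih h2]
    refine lintegral_congr fun p => ?_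
    rw [lintegral_fin_snoc (f := fun x => F (path p x))
      (hF.comp (measurable_path measurable_const measurable_id))]
    refine lintegral_congr fun x => lintegral_congr fun y => ?_
    rw [path_snoc]

/-- The closed sequence of vectors that starts with `x`. -/
noncomputable def closed (x : Fin m → Plane) : Fin (m + 1) → Plane := Fin.snoc x (-∑ i, x i)

lemma sum_closed (x : Fin m → Plane) : ∑ i, closed x i = 0 := by
  rw [Fin.sum_univ_castSucc]
  simp [closed]

lemma closed_castSucc (x : Fin m → Plane) (i : Fin m) : closed x i.castSucc = x i := by
  simp [closed]

lemma closed_last (x : Fin m → Plane) : closed x (Fin.last m) = -∑ i, x i := by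
  simp [closed]

lemma measurable_closed : Measurable (closed : (Fin m → Plane) → Fin (m + 1) → Plane) := by
  refine measurable_pi_lambda _ fun i => ?_
  refine Fin.lastCases ?_ (fun i => ?_) i
  · simp only [closed_last]
    exact (Finset.measurable_sum _ fun l _ => measurable_pi_apply l).neg
  · simp only [closed_castSucc]
    exact measurable_pi_apply i

lemma edge_path (p : Plane) (x : Fin m → Plane) : edge (path p x) = closed x := by
  have hcs : ∀ i : Fin m, edge (path p x) i.castSucc = x i := by
    intro i
    rw [edge, path, path, add_sub_add_left_eq_sub]
    have h1 : (i.castSucc + 1 : Fin (m + 1)).val = i.val + 1 := by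
      rw [Fin.coeSucc_eq_succ]; simp
    have h2 : (Finset.univ.filter fun l : Fin m => l.val < (i.castSucc + 1 : Fin (m + 1)).val) =
        insert i (Finset.univ.filter fun l : Fin m => l.val < i.castSucc.val) := by
      ext l
      simp only [h1, Finset.mem_filter, Finset.mem_univ, true_and, Finset.mem_insert,
        Fin.val_castSucc, Fin.ext_iff]
      omega
    rw [h2, Finset.sum_insert (by simp), add_sub_cancel_right]
  ext1 i
  refine Fin.lastCases ?_ (fun i => ?_) i
  · have h1 := sum_edge (path p x)
    rw [Fin.sum_univ_castSucc] at h1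
    simp only [hcs] at h1
    rw [closed_last]
    exact eq_neg_of_add_eq_zero_right h1
  · rw [hcs, closed_castSucc]

lemma closed_add (x y : Fin m → Plane) : closed (x + y) = closed x + closed y := by
  ext1 i
  refine Fin.lastCases ?_ (fun j => ?_) i
  · simp [closed_last, Finset.sum_add_distrib, add_comm]
  · simp [closed_castSucc]

lemma closed_smul (c : ℝ) (x : Fin m → Plane) : closed (c • x) = c • closed x := by
  ext1 i
  refine Fin.lastCases ?_ (fun j => ?_) i
  · simp [closed_last, Finset.smul_sum]
  · simp [closed_castSucc]

/-- The permutation `σ` of a closed sequence of vectors, in terms of all vectors but the last. -/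
noncomputable def closedPerm (σ : Equiv.Perm (Fin (m + 1))) :
    (Fin m → Plane) →ₗ[ℝ] (Fin m → Plane) where
  toFun x i := closed x (σ i.castSucc)
  map_add' x y := by
    ext1 i; simp only [closed_add]; rfl
  map_smul' c x := by
    ext1 i; simp only [closed_smul]; rfl

lemma closed_closedPerm (σ : Equiv.Perm (Fin (m + 1))) (x : Fin m → Plane) :
    closed (closedPerm σ x) = closed x ∘ σ := by
  ext1 i
  refine Fin.lastCases ?_ (fun i => ?_) i
  · have h1 : ∑ i, closed x (σ i) = 0 := by rw [Equiv.sum_comp σ (closed x), sum_closed]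
    rw [Fin.sum_univ_castSucc] at h1
    rw [closed_last]
    exact (eq_neg_of_add_eq_zero_right h1).symm
  · rw [closed_castSucc]; rfl

lemma closedPerm_mul (σ τ : Equiv.Perm (Fin (m + 1))) :
    closedPerm (σ * τ) = closedPerm τ * closedPerm σ := by
  apply LinearMap.ext
  intro x
  ext1 i
  have h := congrFun (closed_closedPerm σ x) (τ i.castSucc)
  exact h.symm

lemma closedPerm_one : closedPerm (1 : Equiv.Perm (Fin (m + 1))) = 1 := by
  apply LinearMap.ext
  intro x
  ext1 i
  exact closed_castSucc x i

/-- Some power of `σ` is the identity and `closedPerm` reverses products, so a power of the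
determinant equals one. -/
lemma abs_det_closedPerm (σ : Equiv.Perm (Fin (m + 1))) :
    |LinearMap.det (closedPerm σ)| = 1 := by
  have hpow : ∀ n : ℕ, closedPerm (σ ^ n) = closedPerm σ ^ n := by
    intro n
    induction n with
    | zero => rw [pow_zero, pow_zero, closedPerm_one]
    | succ n ih => rw [pow_succ, closedPerm_mul, ih, pow_succ']
  have h := hpow (orderOf σ)
  rw [pow_orderOf_eq_one, closedPerm_one] at h
  have h2 := congrArg LinearMap.det h
  rw [map_pow, map_one] at h2
  have h3 : |LinearMap.det (closedPerm σ)| ^ orderOf σ = 1 := by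
    rw [← abs_pow, ← h2, abs_one]
  exact (pow_eq_one_iff_of_nonneg (abs_nonneg _) (orderOf_pos σ).ne').mp h3

lemma measurePreserving_closedPerm (σ : Equiv.Perm (Fin (m + 1))) :
    MeasurePreserving (closedPerm σ) := by
  refine ⟨(closedPerm σ).continuous_of_finiteDimensional.measurable, ?_⟩
  have h1 := abs_det_closedPerm σ
  have h2 : LinearMap.det (closedPerm σ) ≠ 0 := by
    intro h; rw [h] at h1; simp at h1
  rw [Measure.map_linearMap_addHaar_eq_smul_addHaar _ h2, abs_inv, h1]
  simp

lemma lintegral_closed_perm (σ : Equiv.Perm (Fin (m + 1)))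
    {F : (Fin (m + 1) → Plane) → ENNReal} (hF : Measurable F) :
    ∫⁻ x, F (closed x ∘ σ) = ∫⁻ x, F (closed x) := by
  have h := (measurePreserving_closedPerm σ).lintegral_comp (hF.comp measurable_closed)
  simp only [Function.comp_apply, closed_closedPerm] at h
  exact h

lemma exists_perm_pair {n : ℕ} {a b i j : Fin n} (hab : a ≠ b) (hij : i ≠ j) :
    ∃ σ : Equiv.Perm (Fin n), σ a = i ∧ σ b = j := by
  refine ⟨Equiv.swap (Equiv.swap a i b) j * Equiv.swap a i, ?_, ?_⟩
  · rw [Equiv.Perm.mul_apply, Equiv.swap_apply_left]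
    apply Equiv.swap_apply_of_ne_of_ne _ hij
    intro h
    have h2 := congrArg (Equiv.swap a i) h
    rw [Equiv.swap_apply_right, Equiv.swap_apply_self] at h2
    exact hab h2
  · rw [Equiv.Perm.mul_apply, Equiv.swap_apply_left]

lemma ae_cross_ne_zero : ∀ᵐ x : Fin (m + 2) → Plane, cross (x 0) (x 1) ≠ 0 := by
  have h := volume_preserving_piFinSuccAbove (fun _ : Fin (m + 2) => Plane) 0
  have hmeas : MeasurableSet {q : Plane × (Fin (m + 1) → Plane) | cross q.1 (q.2 0) = 0} :=
    measurableSet_eq_fun (measurable_cross measurable_fst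
      ((measurable_pi_apply _).comp measurable_snd)) measurable_const
  have h0 : volume {q : Plane × (Fin (m + 1) → Plane) | cross q.1 (q.2 0) = 0} = 0 := by
    rw [Measure.volume_eq_prod, Measure.measure_prod_null hmeas]
    have : ∀ᵐ y : Plane, y ≠ 0 := by simp [ae_iff]
    filter_upwards [this] with y hy
    let L : (Fin (m + 1) → Plane) →ₗ[ℝ] ℝ := crossLin y ∘ₗ LinearMap.proj 0
    have hL : LinearMap.ker L ≠ ⊤ := by
      intro h
      obtain ⟨x, hx⟩ := exists_cross_ne_zero hy
      have h1 : (fun _ => x) ∈ LinearMap.ker L := by rw [h]; trivial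
      exact hx h1
    have := Measure.addHaar_submodule (volume : Measure (Fin (m + 1) → Plane))
      (LinearMap.ker L) hL
    exact this
  rw [ae_iff]
  have h1 := h.measure_preimage hmeas.nullMeasurableSet
  rw [h0] at h1
  rw [← h1]
  congr 1
  ext x
  simp only [not_not, Set.mem_ofPred_eq, Set.mem_preimage]
  rfl

/-- Any two vectors of the closed family, including the last one, can be moved to the first two free
coordinates by a measure-preserving `closedPerm`. -/
lemma ae_cross_closed_ne_zero (hm : 2 ≤ m) :
    ∀ᵐ x : Fin m → Plane, ∀ i j, i ≠ j → cross (closed x i) (closed x j) ≠ 0 := by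
  obtain ⟨m, rfl⟩ : ∃ m', m = m' + 2 := ⟨m - 2, by omega⟩
  simp only [ae_all_iff]
  intro i j hij
  obtain ⟨σ, h0, h1⟩ := exists_perm_pair (a := (0 : Fin (m + 2)).castSucc)
    (b := (1 : Fin (m + 2)).castSucc) (by simp) hij
  have h := (measurePreserving_closedPerm σ).quasiMeasurePreserving.ae
    (ae_cross_ne_zero (m := m))
  filter_upwards [h] with x hx
  have h2 : closedPerm σ x 0 = closed x i := by rw [← h0]; rfl
  have h3 : closedPerm σ x 1 = closed x j := by rw [← h1]; rfl
  rwa [h2, h3] at hx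

end Paths

/-! ### Sorting the edges -/

section Sorting

variable {k m : ℕ} {v : Fin (k + 1) → Plane}

/-- If the fibres of `τ` and `τ'` have the same sizes, the permutations carrying one to the other
form a coset of the stabilizer of `τ`, a product of symmetric groups. -/
lemma card_perm_comp_eq {ι : Type*} [Fintype ι] [DecidableEq ι] (τ τ' : ι → Fin (k + 1)) :
    (Finset.univ.filter fun σ : Equiv.Perm ι => τ ∘ σ = τ').card =
      if count τ' = count τ then ∏ j, (count τ j).factorial else 0 := by
  have hcount : ∀ (τ : ι → Fin (k + 1)) j, count τ j = Fintype.card {i // τ i = j} := fun τ j => by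
    rw [count, Fintype.card_subtype]
  split_ifs with h
  · have h1 : ∀ j, Nonempty ({i // τ' i = j} ≃ {i // τ i = j}) := fun j =>
      ⟨Fintype.equivOfCardEq (by rw [← hcount, ← hcount, h])⟩
    have e : ∀ j, {i // τ' i = j} ≃ {i // τ i = j} := fun j => (h1 j).some
    set σ₀ : Equiv.Perm ι := Equiv.ofFiberEquiv e with hσ₀
    have hσ : τ ∘ σ₀ = τ' := by
      ext1 i; exact Equiv.ofFiberEquiv_map e i
    have h2 := DomMulAct.stabilizer_card τ
    simp only [hcount]
    rw [← h2, ← Fintype.card_subtype]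
    refine Fintype.card_congr ⟨fun σ => ⟨σ.1 * σ₀⁻¹, ?_⟩, fun σ => ⟨σ.1 * σ₀, ?_⟩, ?_, ?_⟩
    · have := σ.2
      ext1 i
      have h3 := congrFun (this.trans hσ.symm) (σ₀⁻¹ i)
      simpa using h3
    · rw [← hσ]
      have := σ.2
      ext1 i
      exact congrFun this (σ₀ i)
    · intro σ; simp
    · intro σ; simp
  · rw [Finset.card_eq_zero, Finset.filter_eq_empty_iff]
    intro σ _ hσ
    apply h
    ext j
    rw [← hσ, count, count]
    refine Finset.card_bij (fun i _ => σ i) ?_ ?_ ?_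
    · intro i hi; simpa using hi
    · intro i _ i' _ hii; exact σ.injective hii
    · intro i hi; exact ⟨σ.symm i, by simpa using hi, by simp⟩

/-- The vectors `y i` lie in the cones `τ i`. -/
def InCones (v : Fin (k + 1) → Plane) (τ : Fin m → Fin (k + 1)) (y : Fin m → Plane) : Prop :=
  ∀ i, y i ∈ cone v (τ i)

lemma measurableSet_inCones (τ : Fin m → Fin (k + 1)) : MeasurableSet {y | InCones v τ y} := by
  have : {y | InCones v τ y} = ⋂ i, (fun y => y i) ⁻¹' cone v (τ i) := by
    ext y; simp [InCones]
  rw [this]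
  exact MeasurableSet.iInter fun i => (measurable_pi_apply i) (measurableSet_cone _)

lemma InCones.unique (hk : 2 ≤ k) (hv : IsCcwPolygon v) {τ τ' : Fin m → Fin (k + 1)}
    {y : Fin m → Plane} (h : InCones v τ y) (h' : InCones v τ' y) : τ = τ' := by
  ext1 i; exact cone_unique hk hv (h i) (h' i)

/-- The angles of the vectors `y i` with side `0` increase. -/
def KeySorted (v : Fin (k + 1) → Plane) (y : Fin m → Plane) : Prop :=
  StrictMono fun i => key (edge v 0) (y i)

lemma measurableSet_keySorted : MeasurableSet {y : Fin m → Plane | KeySorted v y} := by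
  have : {y : Fin m → Plane | KeySorted v y} =
      ⋂ i, ⋂ i', {y | i < i' → key (edge v 0) (y i) < key (edge v 0) (y i')} := by
    ext y; simp [KeySorted, StrictMono]
  rw [this]
  refine MeasurableSet.iInter fun i => MeasurableSet.iInter fun i' => ?_
  by_cases h : i < i'
  · simp only [h, true_imp_iff]
    exact measurableSet_lt ((measurable_key _).comp (measurable_pi_apply i))
      ((measurable_key _).comp (measurable_pi_apply i'))
  · simp [h]

lemma existsUnique_keySorted_perm {y : Fin m → Plane}
    (h : Function.Injective fun i => key (edge v 0) (y i)) :
    ∃! σ : Equiv.Perm (Fin m), KeySorted v (y ∘ σ) := by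
  refine ⟨Tuple.sort fun i => key (edge v 0) (y i),
    (Tuple.monotone_sort _).strictMono_of_injective (h.comp (Equiv.injective _)), ?_⟩
  intro σ hσ
  have h1 := Tuple.unique_monotone (f := fun i => key (edge v 0) (y i)) hσ.monotone
    (Tuple.monotone_sort _)
  exact Equiv.ext fun i => h (congrFun h1 i)

end Sorting

/-! ### Integrals over polygons with prescribed numbers of edges in the cones -/

section ConeIntegral

variable {k m : ℕ} {v : Fin (k + 1) → Plane}

/-- The distances from the contact points to the sides, when the contact point of side `0` is `p`
and the edges `y i` are in the cones `τ i`. -/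
noncomputable def contactDist {ι : Type*} [Fintype ι] (v : Fin (k + 1) → Plane)
    (τ : ι → Fin (k + 1)) (p : Plane) (y : ι → Plane) (j : Fin (k + 1)) : ℝ :=
  lineDist v j (p + contactOffset τ y j)

/-- The union of the cones before side `j`. -/
def lowCones (v : Fin (k + 1) → Plane) (j : Fin (k + 1)) : Set Plane :=
  {x | ∃ j', j' < j ∧ x ∈ cone v j'}

/-- The distances from the contact points to the sides, when the contact point of side `0` is `p`
and the edges are the vectors `y i`, in increasing order of their angles. -/
noncomputable def edgeDist (v : Fin (k + 1) → Plane) (p : Plane) (y : Fin m → Plane)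
    (j : Fin (k + 1)) : ℝ :=
  lineDist v j (p + ∑ i, (lowCones v j).indicator id (y i))

/-- `edgeDist` reads the cones off the vectors instead of off `τ`, so it is invariant under all
permutations of the edges. It is the form in which the distances can be carried through a
reordering. -/
lemma edgeDist_eq (hk : 2 ≤ k) (hv : IsCcwPolygon v) {τ : Fin m → Fin (k + 1)}
    {y : Fin m → Plane} (h : InCones v τ y) (p : Plane) :
    edgeDist v p y = contactDist v τ p y := by
  ext1 j
  rw [edgeDist, contactDist, contactOffset, Finset.sum_filter]
  congr 3
  ext1 i
  have : y i ∈ lowCones v j ↔ τ i < j := by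
    constructor
    · rintro ⟨j', h1, h2⟩
      rwa [cone_unique hk hv (h i) h2]
    · exact fun h1 => ⟨τ i, h1, h i⟩
  simp only [Set.indicator, this, id]

lemma edgeDist_comp_perm (p : Plane) (y : Fin m → Plane) (σ : Equiv.Perm (Fin m)) :
    edgeDist v p (y ∘ σ) = edgeDist v p y := by
  ext1 j
  unfold edgeDist
  congr 2
  exact Equiv.sum_comp σ fun i => (lowCones v j).indicator id (y i)

lemma measurable_edgeDist {α : Type*} [MeasurableSpace α] {f : α → Plane}
    {g : α → Fin m → Plane} (hf : Measurable f) (hg : Measurable g) :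
    Measurable fun a => edgeDist v (f a) (g a) := by
  have hlow : ∀ j, MeasurableSet (lowCones v j) := by
    intro j
    have : lowCones v j = ⋃ j', ⋃ (_ : j' < j), cone v j' := by
      ext q; simp [lowCones]
    rw [this]
    exact MeasurableSet.iUnion fun j' => MeasurableSet.iUnion fun _ => measurableSet_cone j'
  refine measurable_pi_lambda _ fun j => (continuous_lineDist j).measurable.comp
    (hf.add (Finset.measurable_sum _ fun i _ => ?_))
  exact (measurable_id.indicator (hlow j)).comp ((measurable_pi_apply i).comp hg)

lemma inCones_comp_perm (τ : Fin m → Fin (k + 1)) (y : Fin m → Plane)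
    (σ : Equiv.Perm (Fin m)) : InCones v τ (y ∘ ⇑σ⁻¹) ↔ InCones v (τ ∘ σ) y :=
  ⟨fun h i => by simpa using h (σ i), fun h i => by simpa using h (σ⁻¹ i)⟩

open Classical in
/-- The integral of a function of the distances to the sides, over the polygons with edges in the
cones `τ i`. -/
noncomputable def coneIntegral (v : Fin (k + 1) → Plane) (τ : Fin (m + 1) → Fin (k + 1))
    (H : (Fin (k + 1) → ℝ) → ENNReal) : ENNReal :=
  ∫⁻ p, ∫⁻ x : Fin m → Plane,
    if InCones v τ (closed x) then H (contactDist v τ p (closed x)) else 0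

/-- The edges `y` are sorted by angle, with `s j` edges in each cone `j`. -/
def SortedType (v : Fin (k + 1) → Plane) (s : Fin (k + 1) → ℕ) (y : Fin m → Plane) : Prop :=
  KeySorted v y ∧ ∃ τ, InCones v τ y ∧ count τ = s

lemma measurableSet_sortedType (s : Fin (k + 1) → ℕ) :
    MeasurableSet {y : Fin m → Plane | SortedType v s y} := by
  have : {y : Fin m → Plane | SortedType v s y} = {y | KeySorted v y} ∩
      ⋃ τ : Fin m → Fin (k + 1), ⋃ (_ : count τ = s), {y | InCones v τ y} := by
    ext y; simp [SortedType, and_comm]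
  rw [this]
  exact measurableSet_keySorted.inter (MeasurableSet.iUnion fun τ =>
    MeasurableSet.iUnion fun _ => measurableSet_inCones τ)

-- Almost every closed family in the cones `τ` has exactly one sorting permutation `σ`. Summing over
-- `σ` and undoing it by invariance leaves a sorted family counted once for each `σ` such that `τ ∘
-- σ` is its own assignment; `card_perm_comp_eq` gives this number.
open Classical in
lemma lintegral_inCones_eq (hk : 2 ≤ k) (hv : IsCcwPolygon v) (hm : 2 ≤ m)
    (τ : Fin (m + 1) → Fin (k + 1)) (p : Plane) {H : (Fin (k + 1) → ℝ) → ENNReal}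
    (hH : Measurable H) :
    ∫⁻ x : Fin m → Plane, (if InCones v τ (closed x) then
        H (contactDist v τ p (closed x)) else 0) =
      (∏ j, (count τ j).factorial : ℕ) * ∫⁻ x : Fin m → Plane,
        if SortedType v (count τ) (closed x) then H (edgeDist v p (closed x)) else 0 := by
  have hHm : Measurable fun y : Fin (m + 1) → Plane => H (edgeDist v p y) :=
    hH.comp (measurable_edgeDist measurable_const measurable_id)
  have hperm : ∀ σ : Equiv.Perm (Fin (m + 1)),
      Measurable fun y : Fin (m + 1) → Plane => y ∘ σ :=
    fun σ => (measurePreserving_comp_perm σ).measurable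
  have hG : ∀ σ : Equiv.Perm (Fin (m + 1)), Measurable fun y : Fin (m + 1) → Plane =>
      if InCones v τ y ∧ KeySorted v (y ∘ σ) then H (edgeDist v p y) else 0 := fun σ =>
    Measurable.ite ((measurableSet_inCones τ).inter (hperm σ measurableSet_keySorted)) hHm
      measurable_const
  have hG' : ∀ σ : Equiv.Perm (Fin (m + 1)), Measurable fun y : Fin (m + 1) → Plane =>
      if InCones v (τ ∘ σ) y ∧ KeySorted v y then H (edgeDist v p y) else 0 := fun σ =>
    Measurable.ite ((measurableSet_inCones _).inter measurableSet_keySorted) hHm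
      measurable_const
  have hGc : ∀ σ : Equiv.Perm (Fin (m + 1)), Measurable fun x : Fin m → Plane =>
      if InCones v τ (closed x) ∧ KeySorted v (closed x ∘ σ) then H (edgeDist v p (closed x))
      else 0 := fun σ => (hG σ).comp measurable_closed
  have hGc' : ∀ σ : Equiv.Perm (Fin (m + 1)), Measurable fun x : Fin m → Plane =>
      if InCones v (τ ∘ σ) (closed x) ∧ KeySorted v (closed x) then H (edgeDist v p (closed x))
      else 0 := fun σ => (hG' σ).comp measurable_closed
  have hSc : Measurable fun x : Fin m → Plane =>
      if SortedType v (count τ) (closed x) then H (edgeDist v p (closed x)) else 0 :=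
    (Measurable.ite (measurableSet_sortedType _) hHm measurable_const).comp measurable_closed
  have h1 : ∫⁻ x : Fin m → Plane, (if InCones v τ (closed x) then
        H (contactDist v τ p (closed x)) else 0) =
      ∫⁻ x : Fin m → Plane, ∑ σ : Equiv.Perm (Fin (m + 1)),
        if InCones v τ (closed x) ∧ KeySorted v (closed x ∘ σ) then
          H (edgeDist v p (closed x)) else 0 := by
    refine lintegral_congr_ae ?_
    filter_upwards [ae_cross_closed_ne_zero hm] with x hx
    by_cases hc : InCones v τ (closed x)
    · obtain ⟨σ, hσ, huniq⟩ := existsUnique_keySorted_perm (v := v) (y := closed x) (by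
        intro i j hij
        by_contra hne
        obtain ⟨c, -, hcx⟩ := eq_smul_of_key_eq (edge_ne_zero hk hv 0)
          (ne_zero_of_mem_cone (hc i)) (ne_zero_of_mem_cone (hc j)) hij
        apply hx i j hne
        rw [hcx, cross_smul_right, cross_self, mul_zero])
      rw [if_pos hc, Finset.sum_eq_single σ, if_pos ⟨hc, hσ⟩, edgeDist_eq hk hv hc]
      · intro σ' _ hne
        exact if_neg fun h => hne (huniq σ' h.2)
      · simp
    · simp [hc]
  rw [h1, lintegral_finsetSum _ fun σ _ => hGc σ]
  have h2 : ∀ σ : Equiv.Perm (Fin (m + 1)), ∫⁻ x : Fin m → Plane,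
      (if InCones v τ (closed x) ∧ KeySorted v (closed x ∘ σ) then
        H (edgeDist v p (closed x)) else 0) = ∫⁻ x : Fin m → Plane,
      (if InCones v (τ ∘ σ) (closed x) ∧ KeySorted v (closed x) then
        H (edgeDist v p (closed x)) else 0) := by
    intro σ
    have h := lintegral_closed_perm (m := m) σ⁻¹ (hG σ)
    rw [← h]
    refine lintegral_congr fun x => ?_
    have h3 : (closed x ∘ ⇑σ⁻¹) ∘ ⇑σ = closed x := by ext1 i; simp
    rw [inCones_comp_perm, h3, edgeDist_comp_perm]
  simp_rw [h2]
  rw [← lintegral_finsetSum _ fun σ _ => hGc' σ, ← lintegral_const_mul _ hSc]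
  refine lintegral_congr fun x => ?_
  by_cases hs : KeySorted v (closed x)
  · by_cases hc : ∃ τ', InCones v τ' (closed x)
    · obtain ⟨τ', hτ'⟩ := hc
      have h3 : ∀ σ : Equiv.Perm (Fin (m + 1)), InCones v (τ ∘ σ) (closed x) ↔ τ ∘ σ = τ' :=
        fun σ => ⟨fun h => h.unique hk hv hτ', fun h => h ▸ hτ'⟩
      have h4 : SortedType v (count τ) (closed x) ↔ count τ' = count τ := by
        refine ⟨fun ⟨_, τ'', h5, h6⟩ => ?_, fun h => ⟨hs, τ', hτ', h⟩⟩
        rw [hτ'.unique hk hv h5, h6]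
      simp only [h3, hs, and_true, h4]
      rw [Finset.sum_ite, Finset.sum_const_zero, add_zero, Finset.sum_const, card_perm_comp_eq,
        nsmul_eq_mul]
      split_ifs <;> simp
    · have h3 : ∀ σ : Equiv.Perm (Fin (m + 1)), ¬ InCones v (τ ∘ σ) (closed x) :=
        fun σ h => hc ⟨_, h⟩
      have h4 : ¬ SortedType v (count τ) (closed x) := fun ⟨_, τ', h, _⟩ => hc ⟨τ', h⟩
      simp [h3, h4]
  · have h4 : ¬ SortedType v (count τ) (closed x) := fun h => hs h.1
    simp [hs, h4]

lemma exists_count_eq {s : Fin (k + 1) → ℕ} (hs : ∑ j, s j = m + 1) :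
    ∃ τ : Fin (m + 1) → Fin (k + 1), count τ = s := by
  have e : Fin (m + 1) ≃ Σ j, Fin (s j) := Fintype.equivOfCardEq (by simp [hs])
  refine ⟨fun i => (e i).1, ?_⟩
  ext j
  rw [count]
  have h1 : (Finset.univ.filter fun i => (e i).1 = j) =
      Finset.univ.image fun a : Fin (s j) => e.symm ⟨j, a⟩ := by
    ext i
    simp only [Finset.mem_filter, Finset.mem_univ, true_and, Finset.mem_image]
    constructor
    · rintro rfl
      exact ⟨(e i).2, by simp⟩
    · rintro ⟨a, rfl⟩
      simp
  rw [h1, Finset.card_image_of_injective _ (fun a b h => by simpa using h), Finset.card_univ,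
    Fintype.card_fin]

open Classical in
/-- Some assignment of cones to edges with `s j` edges in each cone `j`. -/
noncomputable def assignment (m : ℕ) (s : Fin (k + 1) → ℕ) : Fin (m + 1) → Fin (k + 1) :=
  if h : ∑ j, s j = m + 1 then (exists_count_eq h).choose else fun _ => 0

lemma count_assignment {s : Fin (k + 1) → ℕ} (hs : ∑ j, s j = m + 1) :
    count (assignment m s) = s := by
  rw [assignment, dif_pos hs]
  exact (exists_count_eq hs).choose_spec

/-- The possible size vectors of `n` points. -/
def ValidSize (n : ℕ) (s : Fin (k + 1) → ℕ) : Prop :=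
  ∑ j, s j = n ∧ ∀ j, 0 < s j + s (j - 1)

-- A good polygon is a starting point together with a sorted closed family of edges, and it has
-- exactly one vector of cone counts. Splitting by this vector and applying `lintegral_inCones_eq`
-- replaces sorted edges by edges with a fixed assignment, which can be integrated independently.
open Classical in
lemma setLIntegral_goodSet (hk : 2 ≤ k) (hv : IsCcwPolygon v) (hm : 2 ≤ m)
    {F : (Fin (k + 1) → ℝ) → (Fin (k + 1) → ℕ) → ENNReal}
    (hF : Measurable (Function.uncurry F)) :
    ∫⁻ z in goodSet v m, F (sideDist v z) (sizeVector v z) =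
      ∑' s : Fin (k + 1) → ℕ, if ValidSize (m + 1) s then
        ((∏ j, (s j).factorial : ℕ) : ENNReal)⁻¹ *
          coneIntegral v (assignment m s) fun ℓ => if ∀ j, 0 ≤ ℓ j then F ℓ s else 0
      else 0 := by
  set F' : (Fin (k + 1) → ℕ) → (Fin (k + 1) → ℝ) → ENNReal :=
    fun s ℓ => if ∀ j, 0 ≤ ℓ j then F ℓ s else 0 with hF'
  have hFs : ∀ s, Measurable (F' s) := fun s => by
    refine Measurable.ite ?_ (hF.comp measurable_prodMk_right) measurable_const
    have : {ℓ : Fin (k + 1) → ℝ | ∀ j, 0 ≤ ℓ j} = ⋂ j, {ℓ | 0 ≤ ℓ j} := by ext ℓ; simp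
    rw [this]
    exact MeasurableSet.iInter fun j => measurableSet_le measurable_const (measurable_pi_apply j)
  have hterm : ∀ s : Fin (k + 1) → ℕ, Measurable fun q : Plane × (Fin m → Plane) =>
      if ValidSize (m + 1) s then (if SortedType v s (closed q.2) then
        F' s (edgeDist v q.1 (closed q.2)) else 0) else 0 := by
    intro s
    split_ifs
    · have h1 : Measurable fun q : Plane × (Fin m → Plane) => closed q.2 :=
        measurable_closed.comp measurable_snd
      have h2 : Measurable fun q : Plane × (Fin m → Plane) => edgeDist v q.1 (closed q.2) :=
        measurable_edgeDist measurable_fst h1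
      exact Measurable.ite (h1 (measurableSet_sortedType s)) ((hFs s).comp h2) measurable_const
    · exact measurable_const
  have hpt : ∀ (p : Plane) (x : Fin m → Plane),
      (goodSet v m).indicator (fun z => F (sideDist v z) (sizeVector v z)) (path p x) =
      ∑' s : Fin (k + 1) → ℕ, if ValidSize (m + 1) s then (if SortedType v s (closed x) then
        F' s (edgeDist v p (closed x)) else 0) else 0 := by
    intro p x
    by_cases hg : Good v (path p x)
    · choose τ hτ using hg.1
      have hc : InCones v τ (closed x) := by rw [← edge_path p x]; exact hτ
      have hsd : sideDist v (path p x) = edgeDist v p (closed x) := by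
        rw [edgeDist_eq hk hv hc]
        ext1 j
        rw [hg.sideDist_eq hk hv hτ, path_zero, edge_path, contactDist]
      have hst : ∀ s, SortedType v s (closed x) ↔ count τ = s := by
        intro s
        refine ⟨fun ⟨_, τ', h1, h2⟩ => ?_, fun h => ⟨?_, τ, hc, h⟩⟩
        · rw [hc.unique hk hv h1, h2]
        · have := hg.2
          rwa [edge_path] at this
      simp only [hst]
      rw [tsum_eq_single (count τ) (fun s hs => by simp [hs.symm]), if_pos rfl]
      by_cases hN : ∀ j, 0 < count τ j + count τ (j - 1)
      · have hval : ValidSize (m + 1) (count τ) := ⟨by rw [sum_count, Fintype.card_fin], hN⟩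
        rw [if_pos hval]
        have hmem : path p x ∈ goodSet v m ↔ ∀ j, 0 ≤ edgeDist v p (closed x) j := by
          rw [← hsd]
          exact ⟨fun h => h.2.2, fun h => ⟨hg, (hg.fullSided_iff hk hv hτ).mpr hN, h⟩⟩
        by_cases h0 : ∀ j, 0 ≤ edgeDist v p (closed x) j
        · rw [Set.indicator_of_mem (hmem.mpr h0), hF']
          simp only [if_pos h0]
          rw [hsd, hg.sizeVector_eq hk hv hτ hN]
        · rw [Set.indicator_of_notMem (fun h => h0 (hmem.mp h)), hF']
          simp only [if_neg h0]
      · rw [if_neg fun h => hN h.2, Set.indicator_of_notMem]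
        exact fun h => hN ((hg.fullSided_iff hk hv hτ).mp h.2.1)
    · rw [Set.indicator_of_notMem fun h => hg h.1]
      symm
      rw [ENNReal.tsum_eq_zero]
      intro s
      have : ¬ SortedType v s (closed x) := by
        rintro ⟨h1, τ, h2, -⟩
        apply hg
        rw [← edge_path p x] at h1 h2
        exact ⟨fun i => ⟨τ i, h2 i⟩, h1⟩
      simp [this]
  have hFm : Measurable ((goodSet v m).indicator
      fun z => F (sideDist v z) (sizeVector v z)) :=
    (hF.comp (measurable_sideDist_pi.prodMk measurable_sizeVector)).indicator
      (measurableSet_goodSet hk hv)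
  rw [← lintegral_indicator (measurableSet_goodSet hk hv), lintegral_path hFm]
  simp_rw [hpt]
  have h1 : ∀ p : Plane, ∫⁻ x : Fin m → Plane, ∑' s : Fin (k + 1) → ℕ,
      (if ValidSize (m + 1) s then (if SortedType v s (closed x) then
        F' s (edgeDist v p (closed x)) else 0) else 0) =
      ∑' s : Fin (k + 1) → ℕ, ∫⁻ x : Fin m → Plane,
      (if ValidSize (m + 1) s then (if SortedType v s (closed x) then
        F' s (edgeDist v p (closed x)) else 0) else 0) := fun p =>
    lintegral_tsum fun s => ((hterm s).comp measurable_prodMk_left).aemeasurable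
  simp_rw [h1]
  rw [lintegral_tsum fun s => (Measurable.lintegral_prod_right' (hterm s)).aemeasurable]
  refine tsum_congr fun s => ?_
  by_cases hval : ValidSize (m + 1) s
  · simp only [if_pos hval]
    have h2 : ∀ p : Plane, ∫⁻ x : Fin m → Plane, (if SortedType v s (closed x) then
        F' s (edgeDist v p (closed x)) else 0) = ((∏ j, (s j).factorial : ℕ) : ENNReal)⁻¹ *
        ∫⁻ x : Fin m → Plane, (if InCones v (assignment m s) (closed x) then
          F' s (contactDist v (assignment m s) p (closed x)) else 0) := by
      intro p
      rw [lintegral_inCones_eq hk hv hm _ p (hFs s), count_assignment hval.1, ← mul_assoc,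
        ENNReal.inv_mul_cancel, one_mul]
      · exact_mod_cast Finset.prod_ne_zero_iff.mpr fun j _ => Nat.factorial_ne_zero _
      · exact ENNReal.natCast_ne_top _
    simp_rw [h2]
    rw [lintegral_const_mul']
    · rfl
    · apply ENNReal.inv_ne_top.mpr
      exact_mod_cast Finset.prod_ne_zero_iff.mpr fun j _ => Nat.factorial_ne_zero _
  · simp [if_neg hval]

end ConeIntegral

/-! ### Product measures and linear changes of variables -/

section ProductMeasures

variable {n : ℕ} {E : Type*} [MeasurableSpace E]

lemma lintegral_pi_insertNth (μ : Fin (n + 1) → Measure E) [∀ i, SigmaFinite (μ i)]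
    (i : Fin (n + 1)) {f : (Fin (n + 1) → E) → ENNReal} (hf : Measurable f) :
    ∫⁻ z, f z ∂Measure.pi μ = ∫⁻ y, ∫⁻ x : Fin n → E, f (i.insertNth y x)
      ∂Measure.pi (fun j => μ (i.succAbove j)) ∂μ i := by
  have h := measurePreserving_piFinSuccAbove μ i
  rw [← h.symm.lintegral_comp_emb (MeasurableEquiv.measurableEmbedding _)]
  have hf' : Measurable fun p : E × (Fin n → E) =>
      f ((MeasurableEquiv.piFinSuccAbove (fun _ : Fin (n + 1) => E) i).symm p) :=
    hf.comp (MeasurableEquiv.measurable _)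
  rw [lintegral_prod _ hf'.aemeasurable]
  rfl

lemma lintegral_pi_cons (μ : Fin (n + 1) → Measure E) [∀ i, SigmaFinite (μ i)]
    {f : (Fin (n + 1) → E) → ENNReal} (hf : Measurable f) :
    ∫⁻ z, f z ∂Measure.pi μ = ∫⁻ y, ∫⁻ x : Fin n → E, f (Fin.cons y x)
      ∂Measure.pi (fun j => μ j.succ) ∂μ 0 := by
  rw [lintegral_pi_insertNth μ 0 hf]
  simp only [Fin.insertNth_zero, Fin.succAbove_zero]
  rfl

lemma lintegral_pi_snoc (μ : Fin (n + 1) → Measure E) [∀ i, SigmaFinite (μ i)]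
    {f : (Fin (n + 1) → E) → ENNReal} (hf : Measurable f) :
    ∫⁻ z, f z ∂Measure.pi μ = ∫⁻ y, ∫⁻ x : Fin n → E, f (Fin.snoc x y)
      ∂Measure.pi (fun j => μ j.castSucc) ∂μ (Fin.last n) := by
  rw [lintegral_pi_insertNth μ (Fin.last n) hf]
  simp only [Fin.insertNth_last, Fin.succAbove_last]
  rfl

lemma lintegral_pi_prod (μ : Fin n → Measure E) [∀ i, SigmaFinite (μ i)]
    {f : Fin n → E → ENNReal} (hf : ∀ i, Measurable (f i)) :
    ∫⁻ z, ∏ i, f i (z i) ∂Measure.pi μ = ∏ i, ∫⁻ y, f i y ∂μ i := by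
  induction n with
  | zero => simp
  | succ n ih =>
    have hm : Measurable fun z : Fin (n + 1) → E => ∏ i, f i (z i) :=
      Finset.measurable_fun_prod _ fun i _ => (hf i).comp (measurable_pi_apply i)
    rw [lintegral_pi_cons μ hm, Fin.prod_univ_succ, ← ih (fun j => μ j.succ) fun i => hf i.succ,
      ← lintegral_mul_const _ (hf 0)]
    refine lintegral_congr fun y => ?_
    have hm' : Measurable fun x : Fin n → E => ∏ i, f i.succ (x i) :=
      Finset.measurable_fun_prod _ fun i _ => (hf i.succ).comp (measurable_pi_apply i)
    rw [← lintegral_const_mul _ hm']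
    simp only [Fin.prod_univ_succ, Fin.cons_zero, Fin.cons_succ]

lemma pi_withDensity (μ : Fin n → Measure E) [∀ i, SigmaFinite (μ i)]
    {f : Fin n → E → ENNReal} (hf : ∀ i, Measurable (f i))
    [∀ i, SigmaFinite ((μ i).withDensity (f i))] :
    Measure.pi (fun i => (μ i).withDensity (f i)) =
      (Measure.pi μ).withDensity fun z => ∏ i, f i (z i) := by
  refine Measure.pi_eq fun s hs => ?_
  rw [withDensity_apply _ (MeasurableSet.univ_pi hs), ← lintegral_indicator (MeasurableSet.univ_pi hs)]
  have h : ∀ z : Fin n → E, (Set.univ.pi s).indicator (fun z => ∏ i, f i (z i)) z =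
      ∏ i, (s i).indicator (f i) (z i) := by
    intro z
    by_cases hz : z ∈ Set.univ.pi s
    · rw [Set.indicator_of_mem hz]
      exact Finset.prod_congr rfl fun i _ => (Set.indicator_of_mem (hz i trivial) _).symm
    · rw [Set.indicator_of_notMem hz]
      simp only [Set.mem_univ_pi, not_forall] at hz
      obtain ⟨i, hi⟩ := hz
      exact (Finset.prod_eq_zero (Finset.mem_univ i) (Set.indicator_of_notMem hi _)).symm
  simp_rw [h]
  rw [lintegral_pi_prod μ fun i => (hf i).indicator (hs i)]
  refine Finset.prod_congr rfl fun i _ => ?_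
  rw [lintegral_indicator (hs i), withDensity_apply _ (hs i)]

lemma lintegral_mulVec {M : Matrix (Fin n) (Fin n) ℝ} (hM : M.det ≠ 0)
    {f : (Fin n → ℝ) → ENNReal} (hf : Measurable f) :
    ∫⁻ y, f y = ENNReal.ofReal |M.det| * ∫⁻ y, f (M.mulVec y) := by
  have h := Real.map_matrix_volume_pi_eq_smul_volume_pi hM
  have hm : Measurable (Matrix.toLin' M) := (LinearMap.continuous_of_finiteDimensional _).measurable
  have h1 : ∫⁻ y, f y ∂(Measure.map (Matrix.toLin' M) volume) = ∫⁻ y, f (M.mulVec y) := by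
    rw [lintegral_map hf hm]; simp
  rw [← h1, h, lintegral_smul_measure, smul_eq_mul, ← mul_assoc, ← ENNReal.ofReal_mul (abs_nonneg _),
    ← abs_mul, mul_inv_cancel₀ hM]
  simp

lemma lintegral_plane {a b : Plane} (h : 0 < cross a b) {f : Plane → ENNReal}
    (hf : Measurable f) :
    ∫⁻ y, f y = ENNReal.ofReal (cross a b) * ∫⁻ s : ℝ, ∫⁻ t : ℝ, f (s • a + t • b) := by
  have h1 := (PiLp.volume_preserving_toLp (Fin 2)).lintegral_comp_emb
    (MeasurableEquiv.toLp 2 (Fin 2 → ℝ)).measurableEmbedding f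
  have hg : Measurable fun y : Fin 2 → ℝ => f (WithLp.toLp 2 y) :=
    hf.comp (MeasurableEquiv.toLp 2 (Fin 2 → ℝ)).measurable
  set M : Matrix (Fin 2) (Fin 2) ℝ := !![a 0, b 0; a 1, b 1] with hMdef
  have hdet : M.det = cross a b := by rw [hMdef, Matrix.det_fin_two_of, cross]; ring
  have hMm : Measurable fun y : Fin 2 → ℝ => f (WithLp.toLp 2 (M.mulVec y)) := by
    have : Measurable (Matrix.toLin' M) :=
      (LinearMap.continuous_of_finiteDimensional _).measurable
    exact hg.comp this
  rw [← h1, lintegral_mulVec (M := M) (by rw [hdet]; exact h.ne') hg, hdet, abs_of_pos h]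
  congr 1
  rw [volume_pi, lintegral_pi_cons _ hMm]
  refine lintegral_congr fun s => ?_
  have hm2 : Measurable fun x : Fin 1 → ℝ =>
      f (WithLp.toLp 2 (M.mulVec (Fin.cons s x : Fin 2 → ℝ))) :=
    hMm.comp (measurable_pi_lambda _ fun i => by
      refine Fin.cases ?_ (fun i => ?_) i
      · simp
      · simpa using measurable_pi_apply i)
  have h2 := (volume_preserving_funUnique (Fin 1) ℝ).symm.lintegral_comp_emb
    (MeasurableEquiv.measurableEmbedding _) fun x : Fin 1 → ℝ =>
      f (WithLp.toLp 2 (M.mulVec (Fin.cons s x : Fin 2 → ℝ)))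
  refine h2.symm.trans ?_
  refine lintegral_congr fun t => ?_
  congr 1
  ext i
  fin_cases i <;> simp [hMdef, Matrix.mulVec, dotProduct, Fin.sum_univ_two, mul_comm,
    MeasurableEquiv.funUnique]

end ProductMeasures

/-! ### Laws of sums of components -/

section SideLaws

/-- The density at `t` of the sum of `N ≥ 1` variables ranging over the positive reals. -/
noncomputable def sumDens (N : ℕ) (t : ℝ) : ENNReal :=
  if 0 < t then ENNReal.ofReal (t ^ (N - 1) / (N - 1).factorial) else 0

lemma measurable_sumDens (N : ℕ) : Measurable (sumDens N) :=
  Measurable.ite measurableSet_Ioi (by fun_prop) measurable_const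

/-- The image of Lebesgue measure on `N` positive reals under the sum. -/
noncomputable def sumLaw : ℕ → Measure ℝ
  | 0 => Measure.dirac 0
  | N + 1 => volume.withDensity (sumDens (N + 1))

instance sigmaFinite_sumDens (N : ℕ) : SigmaFinite (volume.withDensity (sumDens N)) := by
  refine SigmaFinite.withDensity_of_ne_top (Eventually.of_forall fun t => ?_)
  unfold sumDens
  split_ifs <;> simp

instance sigmaFinite_sumLaw (N : ℕ) : SigmaFinite (sumLaw N) := by
  cases N with
  | zero => unfold sumLaw; infer_instance
  | succ N => exact sigmaFinite_sumDens _

lemma sumLaw_of_pos {N : ℕ} (h : 0 < N) : sumLaw N = volume.withDensity (sumDens N) := by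
  obtain ⟨N, rfl⟩ := Nat.exists_eq_succ_of_ne_zero h.ne'
  rfl

/-- Integrating `t ^ (N - 1) / (N - 1)!` up to `A` gives `A ^ N / N!`. The index goes up by one, as
if a last variable filled the remaining length up to `A`. -/
lemma sumLaw_Iio (N : ℕ) (A : ℝ) : sumLaw N (Set.Iio A) = sumDens (N + 1) A := by
  cases N with
  | zero =>
    rw [sumLaw, Measure.dirac_apply' _ measurableSet_Iio]
    by_cases h : 0 < A <;> simp [sumDens, h, Set.indicator]
  | succ N =>
    rw [sumLaw, withDensity_apply _ measurableSet_Iio, ← lintegral_indicator measurableSet_Iio]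
    have h : (Set.Iio A).indicator (sumDens (N + 1)) =
        (Set.Ioo 0 A).indicator fun t => ENNReal.ofReal (t ^ N / N.factorial) := by
      ext t
      simp only [Set.indicator, Set.mem_Iio, Set.mem_Ioo, sumDens, Nat.add_sub_cancel]
      split_ifs <;> simp_all
    rw [h, lintegral_indicator measurableSet_Ioo, sumDens]
    split_ifs with hA
    · have hint : IntegrableOn (fun t : ℝ => t ^ N / N.factorial) (Set.Ioo 0 A) := by
        refine (Continuous.integrableOn_Icc (a := 0) (b := A) (by fun_prop)).mono_set
          Set.Ioo_subset_Icc_self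
      rw [← ofReal_integral_eq_lintegral_ofReal hint, ← integral_Ioc_eq_integral_Ioo,
        ← intervalIntegral.integral_of_le hA.le, intervalIntegral.integral_div, integral_pow]
      · congr 1
        simp only [Nat.add_sub_cancel, Nat.factorial_succ, Nat.cast_mul, Nat.cast_add, Nat.cast_one,
          ne_eq, Nat.add_eq_zero_iff, one_ne_zero, and_false, not_false_eq_true, zero_pow, sub_zero]
        field_simp
      · filter_upwards [ae_restrict_mem measurableSet_Ioo] with t ht
        have := ht.1
        simp only [Pi.zero_apply]
        positivity
    · rw [Set.Ioo_eq_empty hA]; simp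

/-- The convolution of `sumLaw N` with Lebesgue measure on the positive reals has density `A ↦
sumLaw N (Iio A)`, given by `sumLaw_Iio`. -/
lemma lintegral_add_sumLaw (N : ℕ) {f : ℝ → ENNReal} (hf : Measurable f) :
    ∫⁻ a in Set.Ioi 0, ∫⁻ c, f (c + a) ∂sumLaw N = ∫⁻ c, f c ∂sumLaw (N + 1) := by
  cases N with
  | zero =>
    have h : ∀ a : ℝ, ∫⁻ c, f (c + a) ∂sumLaw 0 = f a := fun a => by
      have hm : Measurable fun c => f (c + a) := hf.comp (measurable_id.add_const a)
      rw [sumLaw, lintegral_dirac' _ hm, zero_add]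
    simp_rw [h]
    rw [sumLaw, lintegral_withDensity_eq_lintegral_mul _ (measurable_sumDens _) hf,
      ← lintegral_indicator measurableSet_Ioi]
    refine lintegral_congr fun a => ?_
    simp only [Set.indicator, Set.mem_Ioi, Pi.mul_apply, sumDens]
    split_ifs <;> simp
  | succ N =>
    have hd := measurable_sumDens (N + 1)
    have h : ∀ a : ℝ, ∫⁻ c, f (c + a) ∂sumLaw (N + 1) = ∫⁻ y, sumDens (N + 1) (y - a) * f y := by
      intro a
      have hm : Measurable fun c => f (c + a) := hf.comp (measurable_id.add_const a)
      rw [sumLaw, lintegral_withDensity_eq_lintegral_mul _ hd hm,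
        ← lintegral_add_right_eq_self (fun y => sumDens (N + 1) (y - a) * f y) a]
      simp
    simp_rw [h]
    have hm : Measurable fun q : ℝ × ℝ => sumDens (N + 1) (q.2 - q.1) * f q.2 :=
      (hd.comp (measurable_snd.sub measurable_fst)).mul (hf.comp measurable_snd)
    rw [lintegral_lintegral_swap hm.aemeasurable, sumLaw,
      lintegral_withDensity_eq_lintegral_mul _ (measurable_sumDens _) hf]
    refine lintegral_congr fun y => ?_
    have hm1 : Measurable fun a : ℝ => sumDens (N + 1) (y - a) :=
      hd.comp (measurable_const.sub measurable_id)
    rw [Pi.mul_apply, lintegral_mul_const _ hm1]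
    congr 1
    rw [← sumLaw_Iio, sumLaw, withDensity_apply _ measurableSet_Iio,
      ← lintegral_indicator measurableSet_Iio, ← lintegral_indicator measurableSet_Ioi,
      ← lintegral_sub_left_eq_self ((Set.Iio y).indicator (sumDens (N + 1))) y]
    refine lintegral_congr fun a => ?_
    simp [Set.indicator]

/-- Only coordinate `t` is convolved; the identity of measures is checked on boxes, where the other
factors separate. -/
lemma lintegral_pi_sumLaw {n : ℕ} {N N' : Fin n → ℕ} (t : Fin n)
    (hN : ∀ i, N' i = N i + if i = t then 1 else 0) {f : (Fin n → ℝ) → ENNReal}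
    (hf : Measurable f) :
    ∫⁻ a in Set.Ioi 0, ∫⁻ c, f (c + Pi.single t a) ∂Measure.pi (fun i => sumLaw (N i)) =
      ∫⁻ c, f c ∂Measure.pi fun i => sumLaw (N' i) := by
  have hm : Measurable fun q : ℝ × (Fin n → ℝ) => q.2 + Pi.single t q.1 :=
    measurable_snd.add (measurable_pi_lambda _ fun i => by
      by_cases h : i = t
      · subst h; simpa using measurable_fst
      · simp [h])
  have h : Measure.map (fun q : ℝ × (Fin n → ℝ) => q.2 + Pi.single t q.1)
      ((volume.restrict (Set.Ioi 0)).prod (Measure.pi fun i => sumLaw (N i))) =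
      Measure.pi fun i => sumLaw (N' i) := by
    symm
    refine Measure.pi_eq fun s hs => ?_
    rw [Measure.map_apply hm (MeasurableSet.univ_pi hs),
      Measure.prod_apply (hm (MeasurableSet.univ_pi hs))]
    have h1 : ∀ a : ℝ, Prod.mk a ⁻¹' ((fun q : ℝ × (Fin n → ℝ) => q.2 + Pi.single t q.1) ⁻¹'
        Set.univ.pi s) = Set.univ.pi fun i => if i = t then (fun c => c + a) ⁻¹' s i else s i := by
      intro a
      ext c
      simp only [Set.mem_preimage, Set.mem_univ_pi]
      refine forall_congr' fun i => ?_
      by_cases h : i = t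
      · subst h; simp
      · simp [h]
    simp_rw [h1, Measure.pi_pi]
    have h2 : ∀ a : ℝ, ∏ i, sumLaw (N i) (if i = t then (fun c => c + a) ⁻¹' s i else s i) =
        sumLaw (N t) ((fun c => c + a) ⁻¹' s t) * ∏ i ∈ Finset.univ.erase t, sumLaw (N i) (s i) := by
      intro a
      rw [← Finset.mul_prod_erase _ _ (Finset.mem_univ t), if_pos rfl]
      congr 1
      exact Finset.prod_congr rfl fun i hi => by rw [if_neg (Finset.ne_of_mem_erase hi)]
    have h3 := lintegral_add_sumLaw (N t) (measurable_const.indicator (hs t) (f := fun _ => (1 : ENNReal)))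
    have h4 : ∀ a : ℝ, ∫⁻ c, (s t).indicator (fun _ => (1 : ENNReal)) (c + a) ∂sumLaw (N t) =
        sumLaw (N t) ((fun c => c + a) ⁻¹' s t) := by
      intro a
      rw [← lintegral_indicator_one ((measurable_add_const a) (hs t))]
      rfl
    simp_rw [h4] at h3
    have hms : Measurable fun a : ℝ => sumLaw (N t) ((fun c => c + a) ⁻¹' s t) := by
      have : MeasurableSet {q : ℝ × ℝ | q.2 + q.1 ∈ s t} :=
        (measurable_snd.add measurable_fst) (hs t)
      exact measurable_measure_prodMk_left this
    simp_rw [h2]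
    rw [lintegral_mul_const _ hms, h3, lintegral_indicator_const (hs t), one_mul,
      ← Finset.mul_prod_erase _ _ (Finset.mem_univ t)]
    congr 1
    · rw [hN, if_pos rfl]
    · refine Finset.prod_congr rfl fun i hi => ?_
      rw [hN, if_neg (Finset.ne_of_mem_erase hi), add_zero]
  have hfm : Measurable fun q : ℝ × (Fin n → ℝ) => f (q.2 + Pi.single t q.1) := hf.comp hm
  rw [← h, lintegral_map hf hm, lintegral_prod _ hfm.aemeasurable]

end SideLaws

/-! ### The law of the side lengths -/

section SideSums

variable {k m : ℕ} {v : Fin (k + 1) → Plane}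

lemma compA_basis (hk : 2 ≤ k) (hv : IsCcwPolygon v) (j : Fin (k + 1)) (a b : ℝ) :
    compA v j (a • side v j + b • side v (j + 1)) = a := by
  have h := (cross_side_pos hk hv j).ne'
  rw [compA, cross_add_left, cross_smul_left, cross_smul_left, cross_self]
  field_simp
  ring

lemma compB_basis (hk : 2 ≤ k) (hv : IsCcwPolygon v) (j : Fin (k + 1)) (a b : ℝ) :
    compB v j (a • side v j + b • side v (j + 1)) = b := by
  have h := (cross_side_pos hk hv j).ne'
  rw [compB, cross_add_right, cross_smul_right, cross_smul_right, cross_self]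
  field_simp
  ring

lemma mem_cone_iff_comp (hk : 2 ≤ k) (hv : IsCcwPolygon v) (j : Fin (k + 1)) (x : Plane) :
    x ∈ cone v j ↔ 0 < compA v j x ∧ 0 < compB v j x := by
  have h := cross_side_pos hk hv j
  rw [compA, compB, div_pos_iff_of_pos_right h, div_pos_iff_of_pos_right h]
  exact and_comm

lemma measurable_compA (j : Fin (k + 1)) : Measurable (compA v j) :=
  (measurable_cross measurable_id measurable_const).div_const _

lemma measurable_compB (j : Fin (k + 1)) : Measurable (compB v j) :=
  (measurable_cross measurable_const measurable_id).div_const _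

open Classical in
lemma lintegral_cone (hk : 2 ≤ k) (hv : IsCcwPolygon v) (j : Fin (k + 1))
    {f : ℝ → ℝ → ENNReal} (hf : Measurable (Function.uncurry f)) :
    ∫⁻ y, (if y ∈ cone v j then f (compA v j y) (compB v j y) else 0) =
      ENNReal.ofReal (Real.sin (innerAngle v j)) *
        ∫⁻ a in Set.Ioi 0, ∫⁻ b in Set.Ioi 0, f a b := by
  have hm : Measurable fun y => if y ∈ cone v j then f (compA v j y) (compB v j y) else 0 := by
    have h1 : Measurable fun y => f (compA v j y) (compB v j y) :=
      hf.comp ((measurable_compA j).prodMk (measurable_compB j))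
    exact Measurable.ite (measurableSet_cone j) h1 measurable_const
  rw [lintegral_plane (cross_side_pos hk hv j) hm, sin_innerAngle hk hv,
    ← lintegral_indicator measurableSet_Ioi]
  congr 1
  refine lintegral_congr fun a => ?_
  by_cases ha : a ∈ Set.Ioi (0 : ℝ)
  · rw [Set.indicator_of_mem ha, ← lintegral_indicator measurableSet_Ioi]
    refine lintegral_congr fun b => ?_
    rw [mem_cone_iff_comp hk hv, compA_basis hk hv, compB_basis hk hv]
    have ha' : 0 < a := ha
    simp [Set.indicator, ha']
  · rw [Set.indicator_of_notMem ha]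
    have ha' : ¬ 0 < a := ha
    simp [mem_cone_iff_comp hk hv, compA_basis hk hv, ha']

lemma measurable_sideSum (τ : Fin m → Fin (k + 1)) : Measurable (sideSum v τ) := by
  refine measurable_pi_lambda _ fun j => ?_
  unfold sideSum
  refine Finset.measurable_sum _ fun i _ => ?_
  have h1 : Measurable fun x : Fin m → Plane => compA v (τ i) (x i) :=
    (measurable_compA _).comp (measurable_pi_apply i)
  have h2 : Measurable fun x : Fin m → Plane => compB v (τ i) (x i) :=
    (measurable_compB _).comp (measurable_pi_apply i)
  refine Measurable.add ?_ ?_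
  · split_ifs
    exacts [h1, measurable_const]
  · split_ifs
    exacts [h2, measurable_const]

lemma sideSum_snoc (τ : Fin (m + 1) → Fin (k + 1)) (x : Fin m → Plane) (y : Plane) :
    sideSum v τ (Fin.snoc x y : Fin (m + 1) → Plane) =
      sideSum v (fun i => τ i.castSucc) x +
        Pi.single (τ (Fin.last m)) (compA v (τ (Fin.last m)) y) +
        Pi.single (τ (Fin.last m) + 1) (compB v (τ (Fin.last m)) y) := by
  ext j
  simp only [sideSum, Fin.sum_univ_castSucc, Fin.snoc_castSucc, Fin.snoc_last, Pi.add_apply,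
    Pi.single_apply, eq_comm (a := j)]
  ring

lemma count_succ (τ : Fin (m + 1) → Fin (k + 1)) (j : Fin (k + 1)) :
    count τ j = count (fun i : Fin m => τ i.castSucc) j + if j = τ (Fin.last m) then 1 else 0 := by
  simp only [count, Finset.card_filter, Fin.sum_univ_castSucc, eq_comm (a := j)]

lemma measurable_add_single (t : Fin (k + 1)) : Measurable fun q : ℝ × (Fin (k + 1) → ℝ) =>
    q.2 + Pi.single t q.1 :=
  measurable_snd.add (measurable_pi_lambda _ fun i => by
    by_cases h : i = t
    · subst h; simpa using measurable_fst
    · simp [h])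

-- Induction on the number of edges: a new edge in cone `t` adds two independent positive Lebesgue
-- components, to sides `t` and `t + 1`, with Jacobian `sin (θ t)`. Every side thus gains one
-- variable for each edge of its two adjacent cones.
open Classical in
lemma lintegral_inCones_sideSum (hk : 2 ≤ k) (hv : IsCcwPolygon v) (τ : Fin m → Fin (k + 1))
    {Ψ : (Fin (k + 1) → ℝ) → ENNReal} (hΨ : Measurable Ψ) :
    ∫⁻ x : Fin m → Plane, (if InCones v τ x then Ψ (sideSum v τ x) else 0) =
      ENNReal.ofReal (∏ i, Real.sin (innerAngle v (τ i))) *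
        ∫⁻ c, Ψ c ∂Measure.pi fun j => sumLaw (count τ j + count τ (j - 1)) := by
  induction m generalizing Ψ with
  | zero =>
    have h1 : Measure.pi (fun j : Fin (k + 1) => sumLaw (count τ j + count τ (j - 1))) =
        Measure.dirac 0 := by
      refine Measure.pi_eq fun s hs => ?_
      rw [Measure.dirac_apply' _ (MeasurableSet.univ_pi hs)]
      have h2 : ∀ j, sumLaw (count τ j + count τ (j - 1)) (s j) = (s j).indicator 1 0 := by
        intro j
        have : count τ j + count τ (j - 1) = 0 := by simp [count]
        rw [this, sumLaw, Measure.dirac_apply' _ (hs j)]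
      simp_rw [h2]
      by_cases h : (0 : Fin (k + 1) → ℝ) ∈ Set.univ.pi s
      · rw [Set.indicator_of_mem h, Finset.prod_eq_one]
        · rfl
        · exact fun j _ => Set.indicator_of_mem (h j trivial) _
      · rw [Set.indicator_of_notMem h]
        simp only [Set.mem_univ_pi, not_forall] at h
        obtain ⟨j, hj⟩ := h
        exact (Finset.prod_eq_zero (Finset.mem_univ j) (Set.indicator_of_notMem hj _)).symm
    have h3 : ∀ x : Fin 0 → Plane, InCones v τ x := fun x i => i.elim0
    have h4 : ∀ x : Fin 0 → Plane, sideSum v τ x = 0 := fun x => by ext j; simp [sideSum]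
    simp_rw [h1, lintegral_dirac' _ hΨ, h3, h4]
    simp [volume_pi]
  | succ m ih =>
    set t := τ (Fin.last m) with ht
    set τ' : Fin m → Fin (k + 1) := fun i => τ i.castSucc with hτ'
    have hf : ∀ c : Fin (k + 1) → ℝ, Measurable (Function.uncurry fun a b =>
        Ψ (c + Pi.single t a + Pi.single (t + 1) b)) := by
      intro c
      have h1 : Measurable fun q : ℝ × ℝ => c + Pi.single t q.1 :=
        (measurable_add_single t).comp (measurable_fst.prodMk measurable_const)
      exact hΨ.comp ((measurable_add_single (t + 1)).comp (measurable_snd.prodMk h1))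
    set Φ : (Fin (k + 1) → ℝ) → ENNReal := fun c => ∫⁻ y, if y ∈ cone v t then
      Ψ (c + Pi.single t (compA v t y) + Pi.single (t + 1) (compB v t y)) else 0 with hΦ
    have hmm : Measurable fun q : (Fin (k + 1) → ℝ) × ℝ × ℝ =>
        Ψ (q.1 + Pi.single t q.2.1 + Pi.single (t + 1) q.2.2) := by
      have h1 : Measurable fun q : (Fin (k + 1) → ℝ) × ℝ × ℝ => q.1 + Pi.single t q.2.1 :=
        (measurable_add_single t).comp (measurable_snd.fst.prodMk measurable_fst)
      exact hΨ.comp ((measurable_add_single (t + 1)).comp (measurable_snd.snd.prodMk h1))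
    have hmy : Measurable fun q : (Fin (k + 1) → ℝ) × Plane => if q.2 ∈ cone v t then
        Ψ (q.1 + Pi.single t (compA v t q.2) + Pi.single (t + 1) (compB v t q.2)) else 0 := by
      refine Measurable.ite (measurable_snd (measurableSet_cone t)) ?_ measurable_const
      have h1 : Measurable fun q : (Fin (k + 1) → ℝ) × Plane =>
          (q.1, compA v t q.2, compB v t q.2) :=
        measurable_fst.prodMk (((measurable_compA t).comp measurable_snd).prodMk
          ((measurable_compB t).comp measurable_snd))
      exact hmm.comp h1
    have hΦm : Measurable Φ := Measurable.lintegral_prod_right' hmy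
    have hG : Measurable fun x : Fin (m + 1) → Plane =>
        if InCones v τ x then Ψ (sideSum v τ x) else 0 :=
      Measurable.ite (measurableSet_inCones τ) (hΨ.comp (measurable_sideSum τ)) measurable_const
    rw [lintegral_fin_snoc hG]
    have hin : ∀ x : Fin m → Plane, ∫⁻ y, (if InCones v τ (Fin.snoc x y : Fin (m + 1) → Plane) then
        Ψ (sideSum v τ (Fin.snoc x y : Fin (m + 1) → Plane)) else 0) =
        if InCones v τ' x then Φ (sideSum v τ' x) else 0 := by
      intro x
      have h1 : ∀ y, InCones v τ (Fin.snoc x y : Fin (m + 1) → Plane) ↔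
          InCones v τ' x ∧ y ∈ cone v t := by
        intro y
        simp [InCones, Fin.forall_fin_succ', hτ', ht]
      by_cases hx : InCones v τ' x
      · rw [if_pos hx]
        refine lintegral_congr fun y => ?_
        rw [sideSum_snoc]
        simp only [h1, hx, true_and]
        rfl
      · rw [if_neg hx]
        simp [h1, hx]
    simp_rw [hin]
    rw [ih τ' hΦm, Fin.prod_univ_castSucc,
      ENNReal.ofReal_mul (Finset.prod_nonneg fun i _ => (sin_innerAngle_pos hk hv _).le), mul_assoc]
    congr 1
    have hΦ' : ∀ c, Φ c = ENNReal.ofReal (Real.sin (innerAngle v t)) *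
        ∫⁻ a in Set.Ioi 0, ∫⁻ b in Set.Ioi 0, Ψ (c + Pi.single t a + Pi.single (t + 1) b) :=
      fun c => lintegral_cone hk hv t (hf c)
    have hm2 : Measurable fun q : (Fin (k + 1) → ℝ) × ℝ =>
        ∫⁻ b in Set.Ioi 0, Ψ (q.1 + Pi.single t q.2 + Pi.single (t + 1) b) := by
      have h1 : Measurable fun q : ((Fin (k + 1) → ℝ) × ℝ) × ℝ =>
          Ψ (q.1.1 + Pi.single t q.1.2 + Pi.single (t + 1) q.2) :=
        hmm.comp (measurable_fst.fst.prodMk (measurable_fst.snd.prodMk measurable_snd))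
      exact Measurable.lintegral_prod_right' h1
    simp_rw [hΦ']
    rw [lintegral_const_mul _ (Measurable.lintegral_prod_right' hm2)]
    congr 1
    rw [lintegral_lintegral_swap hm2.aemeasurable]
    have hsw : ∀ a : ℝ, ∫⁻ c, (∫⁻ b in Set.Ioi 0, Ψ (c + Pi.single t a + Pi.single (t + 1) b))
        ∂Measure.pi (fun j => sumLaw (count τ' j + count τ' (j - 1))) =
        ∫⁻ b in Set.Ioi 0, ∫⁻ c, Ψ (c + Pi.single (t + 1) b + Pi.single t a)
          ∂Measure.pi (fun j => sumLaw (count τ' j + count τ' (j - 1))) := by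
      intro a
      have h1 : Measurable fun q : (Fin (k + 1) → ℝ) × ℝ =>
          Ψ (q.1 + Pi.single t a + Pi.single (t + 1) q.2) :=
        hmm.comp (measurable_fst.prodMk (measurable_const.prodMk measurable_snd))
      rw [lintegral_lintegral_swap h1.aemeasurable]
      simp_rw [add_right_comm]
    simp_rw [hsw]
    have hstep : ∀ a : ℝ, ∫⁻ b in Set.Ioi 0, ∫⁻ c, Ψ (c + Pi.single (t + 1) b + Pi.single t a)
          ∂Measure.pi (fun j => sumLaw (count τ' j + count τ' (j - 1))) =
        ∫⁻ c, Ψ (c + Pi.single t a) ∂Measure.pi fun j =>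
          sumLaw (count τ' j + count τ' (j - 1) + if j = t + 1 then 1 else 0) := by
      intro a
      have h0 : Measurable fun c : Fin (k + 1) → ℝ => c + Pi.single t a :=
        (measurable_add_single t).comp (measurable_const.prodMk measurable_id)
      have h1 : Measurable fun c : Fin (k + 1) → ℝ => Ψ (c + Pi.single t a) := hΨ.comp h0
      exact lintegral_pi_sumLaw (t + 1) (fun j => rfl) h1
    simp_rw [hstep]
    refine lintegral_pi_sumLaw t (fun j => ?_) hΨ
    rw [count_succ τ j, count_succ τ (j - 1)]
    simp only [sub_eq_iff_eq_add]
    ring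

end SideSums

/-! ### Integration over the polygons with given directions of edges -/

section LastCone

variable {k m : ℕ} {v : Fin (k + 1) → Plane}

lemma lineDist_cornerPoint (c : Fin (k + 1) → ℝ) (w : Plane) (j : Fin (k + 1)) :
    lineDist v j (cornerPoint v c w j) = cross (side v j) w
      + (∑ l, if l < j then c l * cross (side v j) (side v l) else 0)
      - cross (side v j) (v j) := by
  rw [lineDist_eq, cornerPoint, cross_sub_right, cross_add_right, cross_sum_right,
    ← Finset.sum_filter]
  congr 2
  refine Finset.sum_congr ?_ fun l _ => cross_smul_right _ _ _
  ext l; simp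

/-- The lengths of the sides `0` and `k` that close up a polygon with other side lengths `c`. -/
noncomputable def closeUp {q : ℕ} (v : Fin (q + 2) → Plane) (c : Fin q → ℝ) : Fin (q + 2) → ℝ :=
  Fin.cons (compB v (Fin.last (q + 1)) (-∑ i, c i • side v i.castSucc.succ))
    (Fin.snoc c (compA v (Fin.last (q + 1)) (-∑ i, c i • side v i.castSucc.succ)) :
      Fin (q + 1) → ℝ)

lemma sum_cons_snoc_smul {q : ℕ} (v : Fin (q + 2) → Plane) (b a : ℝ) (c : Fin q → ℝ) :
    ∑ j, (Fin.cons b (Fin.snoc c a : Fin (q + 1) → ℝ) : Fin (q + 2) → ℝ) j • side v j =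
      b • side v 0 + (∑ i, c i • side v i.castSucc.succ) + a • side v (Fin.last (q + 1)) := by
  rw [Fin.sum_univ_succ, Fin.sum_univ_castSucc, ← Fin.succ_last q]
  simp only [Fin.cons_zero, Fin.cons_succ, Fin.snoc_castSucc, Fin.snoc_last]
  abel

lemma sum_closeUp {q : ℕ} {v : Fin (q + 2) → Plane} (hk : 2 ≤ q + 1) (hv : IsCcwPolygon v)
    (c : Fin q → ℝ) : ∑ j, closeUp v c j • side v j = 0 := by
  have h := comp_decomp hk hv (Fin.last (q + 1)) (-∑ i, c i • side v i.castSucc.succ)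
  rw [Fin.last_add_one] at h
  rw [closeUp, sum_cons_snoc_smul, add_assoc, add_comm, add_assoc, h, add_neg_cancel]

lemma measurable_closeUp {q : ℕ} {v : Fin (q + 2) → Plane} : Measurable (closeUp v) := by
  have h : Measurable fun c : Fin q → ℝ => -∑ i, c i • side v i.castSucc.succ := by fun_prop
  refine measurable_pi_lambda _ fun j => ?_
  unfold closeUp
  refine Fin.cases ?_ (fun j => ?_) j
  · simp only [Fin.cons_zero]
    exact (measurable_compB _).comp h
  · refine Fin.lastCases ?_ (fun j => ?_) j
    · simp only [Fin.cons_succ, Fin.snoc_last]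
      exact (measurable_compA _).comp h
    · simpa using measurable_pi_apply j

/-- The matrix giving the distances to the sides of `v` of the polygons with parallel sides. -/
noncomputable def distMatrix {q : ℕ} (v : Fin (q + 2) → Plane) :
    Matrix (Fin (q + 2)) (Fin (q + 2)) ℝ :=
  Matrix.of fun j => Fin.cons (cross (side v j) (side v 1)) fun i : Fin (q + 1) =>
    if i.castSucc < j then cross (side v j) (side v i.castSucc) else 0

/-- The coordinates are a displacement along side `1`, a displacement along side `0`, and the
lengths of the middle sides. In this order a coordinate affects only the distances to sides of index
at least its own, so the matrix is lower triangular. -/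
lemma det_distMatrix {q : ℕ} {v : Fin (q + 2) → Plane} (hk : 2 ≤ q + 1) (hv : IsCcwPolygon v) :
    |(distMatrix v).det| = Real.sin (innerAngle v 0) *
      ∏ i : Fin (q + 1), Real.sin (innerAngle v i.castSucc) := by
  have h1 : (distMatrix v).det = ∏ j, distMatrix v j j := by
    refine Matrix.det_of_isLowerTriangular _ fun j l hjl => ?_
    have hjl' : j < l := hjl
    obtain ⟨i, rfl⟩ := Fin.exists_succ_eq.mpr (ne_of_gt (lt_of_le_of_lt (Fin.zero_le j) hjl'))
    simp only [distMatrix, Matrix.of_apply, Fin.cons_succ]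
    rw [if_neg]
    rw [Fin.lt_def] at hjl' ⊢
    simp only [Fin.val_succ, Fin.val_castSucc] at hjl' ⊢
    omega
  have h2 : distMatrix v 0 0 = Real.sin (innerAngle v 0) := by
    rw [sin_innerAngle hk hv, zero_add]; simp [distMatrix]
  have h3 : ∀ i : Fin (q + 1), distMatrix v i.succ i.succ =
      -Real.sin (innerAngle v i.castSucc) := by
    intro i
    rw [sin_innerAngle hk hv, Fin.coeSucc_eq_succ, cross_comm]
    simp [distMatrix]
  rw [h1, Fin.prod_univ_succ, h2, abs_mul, abs_of_pos (sin_innerAngle_pos hk hv 0)]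
  simp_rw [h3]
  rw [Finset.abs_prod]
  simp only [abs_neg]
  congr 1
  exact Finset.prod_congr rfl fun i _ => abs_of_pos (sin_innerAngle_pos hk hv _)

lemma measurable_lineDist_cornerPoint {α : Type*} [MeasurableSpace α] {f : α → Fin (k + 1) → ℝ}
    {g : α → Plane} (hf : Measurable f) (hg : Measurable g) :
    Measurable fun a => fun j => lineDist v j (cornerPoint v (f a) (g a) j) := by
  refine measurable_pi_lambda _ fun j => (continuous_lineDist j).measurable.comp ?_
  unfold cornerPoint
  refine hg.add (Finset.measurable_sum _ fun l _ => ?_)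
  exact ((measurable_pi_apply l).comp hf).smul_const _

/-- The polygons parallel to `v` are parametrised by a vertex and the lengths of all sides but two,
or by their distances to the sides. Writing the vertex in the basis of sides `0` and `1` contributes
one factor `sin (θ 0)`, which removes the repetition of this factor in `det_distMatrix`. -/
lemma lintegral_closeUp {q : ℕ} {v : Fin (q + 2) → Plane} (hk : 2 ≤ q + 1) (hv : IsCcwPolygon v)
    {K : (Fin (q + 2) → ℝ) → ENNReal} (hK : Measurable K) :
    ENNReal.ofReal (∏ i : Fin (q + 1), Real.sin (innerAngle v i.castSucc)) *
      ∫⁻ c : Fin q → ℝ, ∫⁻ w, K (fun j => lineDist v j (cornerPoint v (closeUp v c) w j)) =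
      ∫⁻ ℓ, K ℓ := by
  set D : Fin (q + 2) → ℝ := fun j => -cross (side v j) (v j) with hD
  set L : (Fin q → ℝ) → Plane → Fin (q + 2) → ℝ := fun c w j => cross (side v j) w
    + (∑ i : Fin q, if i.castSucc.succ < j then c i * cross (side v j) (side v i.castSucc.succ)
        else 0) + (D j) with hL
  -- Moving the base point by the length of side `0` absorbs this length, which depends on `c`. The
  -- distances become affine in the new base point and in `c`, with the matrix `distMatrix`.
  have hL1 : ∀ c w, (fun j => lineDist v j (cornerPoint v (closeUp v c) w j)) =
      L c (w + closeUp v c 0 • side v 0) := by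
    intro c w
    ext j
    rw [lineDist_cornerPoint, hL, Fin.sum_univ_succ, Fin.sum_univ_castSucc]
    simp only [closeUp, Fin.cons_zero, Fin.cons_succ, Fin.snoc_castSucc, Fin.succ_last]
    rw [if_neg (not_lt.mpr (Fin.le_last j)), add_zero, cross_add_right, cross_smul_right, hD]
    by_cases hj : 0 < j
    · rw [if_pos hj]; ring
    · have : j = 0 := by simpa using hj
      subst this
      rw [if_neg (lt_irrefl _), cross_self]; ring
  have hLm : Measurable fun p : (Fin q → ℝ) × Plane => L p.1 p.2 := by
    refine measurable_pi_lambda _ fun j => ?_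
    refine ((measurable_cross measurable_const measurable_snd).add
      (Finset.measurable_sum _ fun i _ => ?_)).add measurable_const
    split_ifs
    · exact ((measurable_pi_apply i).comp measurable_fst).mul_const _
    · exact measurable_const
  have hL2 : ∀ (t s : ℝ) (c : Fin q → ℝ), L c (s • side v 0 + t • side v 1) =
      (distMatrix v).mulVec (Fin.cons t (Fin.cons s c : Fin (q + 1) → ℝ) : Fin (q + 2) → ℝ) + D := by
    intro t s c
    ext j
    simp only [hL, Pi.add_apply, Matrix.mulVec, dotProduct, Fin.sum_univ_succ, distMatrix,
      Matrix.of_apply, Fin.cons_zero, Fin.cons_succ, Fin.castSucc_zero, cross_add_right,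
      cross_smul_right, Fin.succ_castSucc]
    congr 1
    have h1 : ∀ x : ℝ, s * cross (side v j) (side v 0) + t * cross (side v j) (side v 1) + x =
        cross (side v j) (side v 1) * t +
          ((if 0 < j then cross (side v j) (side v 0) else 0) * s + x) := by
      intro x
      by_cases hj : 0 < j
      · rw [if_pos hj]; ring
      · have : j = 0 := by simpa using hj
        subst this
        rw [if_neg (lt_irrefl _), cross_self]; ring
    rw [h1]
    congr 2
    refine Finset.sum_congr rfl fun i _ => ?_
    split_ifs <;> ring
  have hs0 := sin_innerAngle_pos hk hv 0
  have hKL : Measurable fun p : (Fin q → ℝ) × Plane => K (L p.1 p.2) := hK.comp hLm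
  have h1 : ∫⁻ c : Fin q → ℝ, ∫⁻ w, K (fun j => lineDist v j (cornerPoint v (closeUp v c) w j)) =
      ∫⁻ w, ∫⁻ c : Fin q → ℝ, K (L c w) := by
    simp_rw [hL1]
    refine Eq.trans ?_ (lintegral_lintegral_swap (f := fun c w => K (L c w)) hKL.aemeasurable)
    refine lintegral_congr fun c => ?_
    exact lintegral_add_right_eq_self (fun w => K (L c w)) _
  have hm1 : Measurable fun w => ∫⁻ c : Fin q → ℝ, K (L c w) :=
    Measurable.lintegral_prod_left' hKL
  have h2 := lintegral_plane (cross_side_pos hk hv 0) hm1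
  rw [← sin_innerAngle hk hv, zero_add] at h2
  have hst : Measurable fun p : ℝ × ℝ => p.1 • side v 0 + p.2 • side v 1 := by fun_prop
  have hm2 : Measurable fun p : ℝ × ℝ =>
      ∫⁻ c : Fin q → ℝ, K (L c (p.1 • side v 0 + p.2 • side v 1)) := hm1.comp hst
  rw [lintegral_lintegral_swap (f := fun s t : ℝ =>
    ∫⁻ c : Fin q → ℝ, K (L c (s • side v 0 + t • side v 1))) hm2.aemeasurable] at h2
  have hKD : Measurable fun y => K (y + D) := hK.comp (measurable_id.add_const D)
  have hdet : (distMatrix v).det ≠ 0 := by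
    rw [← abs_pos, det_distMatrix hk hv]
    exact mul_pos hs0 (Finset.prod_pos fun i _ => sin_innerAngle_pos hk hv _)
  have hKM : Measurable fun y => K ((distMatrix v).mulVec y + D) := by
    have : Measurable (Matrix.toLin' (distMatrix v)) :=
      (LinearMap.continuous_of_finiteDimensional _).measurable
    exact hKD.comp this
  have h3 : ∫⁻ y, K ((distMatrix v).mulVec y + D) =
      ∫⁻ t : ℝ, ∫⁻ s : ℝ, ∫⁻ c : Fin q → ℝ, K (L c (s • side v 0 + t • side v 1)) := by
    rw [volume_pi, lintegral_pi_cons _ hKM]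
    refine lintegral_congr fun t => ?_
    have hc : Measurable fun x : Fin (q + 1) → ℝ =>
        K ((distMatrix v).mulVec (Fin.cons t x : Fin (q + 2) → ℝ) + D) :=
      hKM.comp (measurable_pi_lambda _ fun i => by
        refine Fin.cases ?_ (fun i => ?_) i
        · simp
        · simpa using measurable_pi_apply i)
    rw [lintegral_pi_cons _ hc]
    refine lintegral_congr fun s => ?_
    rw [← volume_pi]
    exact lintegral_congr fun c => by rw [hL2]
  rw [h1, h2, ← h3, ← mul_assoc, ← ENNReal.ofReal_mul
    (Finset.prod_nonneg fun i _ => (sin_innerAngle_pos hk hv _).le), mul_comm (∏ i, _),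
    ← det_distMatrix hk hv, ← lintegral_mulVec hdet hKD]
  exact lintegral_add_right_eq_self K D

end LastCone

/-! ### Evaluation of the cone integrals when the closing edge is in the last cone -/

section ConeIntegralEval

variable {k m : ℕ} {v : Fin (k + 1) → Plane}

open Classical in
/-- The integrand, in terms of the lengths `c` of the sides without the contribution of the last
edge. -/
noncomputable def openIntegrand (v : Fin (k + 1) → Plane) (H : (Fin (k + 1) → ℝ) → ENNReal)
    (w : Plane) (c : Fin (k + 1) → ℝ) : ENNReal :=
  if -∑ j, c j • side v j ∈ cone v (Fin.last k) then
    H fun j => lineDist v j (cornerPoint v c w j) else 0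

lemma measurable_openIntegrand {α : Type*} [MeasurableSpace α]
    {H : (Fin (k + 1) → ℝ) → ENNReal} (hH : Measurable H) {f : α → Plane}
    {g : α → Fin (k + 1) → ℝ} (hf : Measurable f) (hg : Measurable g) :
    Measurable fun a => openIntegrand v H (f a) (g a) := by
  have h1 : Measurable fun a => -∑ j, g a j • side v j := by fun_prop
  have h2 : Measurable fun a => fun j => lineDist v j (cornerPoint v (g a) (f a) j) :=
    measurable_lineDist_cornerPoint hg hf
  have h3 : Measurable fun a => H fun j => lineDist v j (cornerPoint v (g a) (f a) j) :=
    hH.comp h2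
  exact Measurable.ite (h1 (measurableSet_cone _)) h3 measurable_const

lemma measurable_lintegral_openIntegrand {H : (Fin (k + 1) → ℝ) → ENNReal} (hH : Measurable H) :
    Measurable fun c => ∫⁻ w, openIntegrand v H w c := by
  have h : Measurable fun p : Plane × (Fin (k + 1) → ℝ) => openIntegrand v H p.1 p.2 :=
    measurable_openIntegrand hH measurable_fst measurable_snd
  exact Measurable.lintegral_prod_left' h

lemma measurable_lastSum (τ : Fin m → Fin (k + 1)) : Measurable (lastSum v τ) := by
  unfold lastSum
  exact Finset.measurable_sum _ fun i _ => (measurable_compB _).comp (measurable_pi_apply i)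

-- The closing edge is minus the sum of the others and, being in the last cone, enters no contact
-- offset. After translating the base point by `lastSum`, the integrand depends on the other edges
-- only through their `sideSum`, whose law is known.
open Classical in
lemma coneIntegral_eq_openIntegrand (hk : 2 ≤ k) (hv : IsCcwPolygon v)
    {τ : Fin (m + 1) → Fin (k + 1)} (hτ : τ (Fin.last m) = Fin.last k)
    {H : (Fin (k + 1) → ℝ) → ENNReal} (hH : Measurable H) :
    coneIntegral v τ H = ENNReal.ofReal (∏ i : Fin m, Real.sin (innerAngle v (τ i.castSucc))) *
      ∫⁻ c, (∫⁻ w, openIntegrand v H w c) ∂Measure.pi fun j =>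
        sumLaw (count (fun i : Fin m => τ i.castSucc) j
          + count (fun i : Fin m => τ i.castSucc) (j - 1)) := by
  set τ' : Fin m → Fin (k + 1) := fun i => τ i.castSucc with hτ'
  have hpt : ∀ p (x : Fin m → Plane), (if InCones v τ (closed x) then
      H (contactDist v τ p (closed x)) else 0) = if InCones v τ' x then
        openIntegrand v H (p - lastSum v τ' x • side v 0) (sideSum v τ' x) else 0 := by
    intro p x
    have h1 : InCones v τ (closed x) ↔
        InCones v τ' x ∧ -∑ j, sideSum v τ' x j • side v j ∈ cone v (Fin.last k) := by
      rw [sum_sideSum_smul hk hv]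
      simp [InCones, Fin.forall_fin_succ', closed_castSucc, closed_last, hτ, hτ']
    have h2 : contactDist v τ p (closed x) = fun j => lineDist v j
        (cornerPoint v (sideSum v τ' x) (p - lastSum v τ' x • side v 0) j) := by
      ext j
      have h3 : contactOffset τ (closed x) j = contactOffset τ' x j := by
        rw [contactOffset, contactOffset, Finset.sum_filter, Finset.sum_filter,
          Fin.sum_univ_castSucc, hτ, if_neg (not_lt.mpr (Fin.le_last j)), add_zero]
        simp only [closed_castSucc, hτ']
      rw [contactDist, h3, lineDist_eq, lineDist_eq, cross_sub_right, cross_sub_right,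
        cross_add_right, cross_contactOffset hk hv, cornerPoint, ← cross_add_right]
      congr 2
      abel
    rw [openIntegrand, h2]
    by_cases hx : InCones v τ' x <;> simp [h1, hx]
  have hm : Measurable fun q : Plane × (Fin m → Plane) => if InCones v τ' q.2 then
        openIntegrand v H (q.1 - lastSum v τ' q.2 • side v 0) (sideSum v τ' q.2) else 0 := by
    have h1 : Measurable fun q : Plane × (Fin m → Plane) => q.1 - lastSum v τ' q.2 • side v 0 :=
      measurable_fst.sub (((measurable_lastSum τ').comp measurable_snd).smul_const _)
    have h2 : Measurable fun q : Plane × (Fin m → Plane) => sideSum v τ' q.2 :=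
      (measurable_sideSum τ').comp measurable_snd
    have h3 := measurable_openIntegrand (v := v) hH h1 h2
    have h4 : MeasurableSet {q : Plane × (Fin m → Plane) | InCones v τ' q.2} :=
      measurable_snd (measurableSet_inCones τ')
    exact Measurable.ite h4 h3 measurable_const
  have hΨ : Measurable fun c => ∫⁻ w, openIntegrand v H w c :=
    measurable_lintegral_openIntegrand hH
  rw [coneIntegral, ← lintegral_inCones_sideSum hk hv τ' hΨ]
  simp_rw [hpt]
  refine (lintegral_lintegral_swap (f := fun p (x : Fin m → Plane) => if InCones v τ' x then
        openIntegrand v H (p - lastSum v τ' x • side v 0) (sideSum v τ' x) else 0)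
        hm.aemeasurable).trans (lintegral_congr fun x => ?_)
  by_cases hx : InCones v τ' x
  · simp only [if_pos hx]
    exact lintegral_sub_right_eq_self (fun w => openIntegrand v H w (sideSum v τ' x)) _
  · simp [if_neg hx]

-- The closing edge has components `A - a` and `B - b` along sides `k` and `0`, so its cone
-- condition decouples into `a < A` and `b < B`. The distances involve `b` only through a
-- translation of the base point, and do not involve `a`.
open Classical in
lemma lintegral_openIntegrand {q : ℕ} {v : Fin (q + 2) → Plane} (hk : 2 ≤ q + 1)
    (hv : IsCcwPolygon v) (H : (Fin (q + 2) → ℝ) → ENNReal)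
    (b a : ℝ) (c : Fin q → ℝ) :
    ∫⁻ w, openIntegrand v H w (Fin.cons b (Fin.snoc c a : Fin (q + 1) → ℝ) : Fin (q + 2) → ℝ) =
      (Set.Iio (closeUp v c 0)).indicator 1 b *
        ((Set.Iio (closeUp v c (Fin.last (q + 1)))).indicator 1 a *
        ∫⁻ w, H fun j => lineDist v j (cornerPoint v (closeUp v c) w j)) := by
  set x := -∑ i, c i • side v i.castSucc.succ with hx
  set B := closeUp v c 0 with hB
  set A := closeUp v c (Fin.last (q + 1)) with hA
  have hB' : B = compB v (Fin.last (q + 1)) x := by simp [hB, closeUp, hx]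
  have hA' : A = compA v (Fin.last (q + 1)) x := by
    rw [hA, ← Fin.succ_last, closeUp, Fin.cons_succ, Fin.snoc_last]; rfl
  have h1 : -∑ j, (Fin.cons b (Fin.snoc c a : Fin (q + 1) → ℝ) : Fin (q + 2) → ℝ) j • side v j =
      (A - a) • side v (Fin.last (q + 1)) + (B - b) • side v (Fin.last (q + 1) + 1) := by
    have h := comp_decomp hk hv (Fin.last (q + 1)) x
    rw [← hA', ← hB'] at h
    rw [sum_cons_snoc_smul, sub_smul, sub_smul]
    rw [Fin.last_add_one] at h ⊢
    rw [← sub_eq_zero, ← sub_eq_zero.mpr h.symm, hx]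
    abel
  have h2 : -∑ j, (Fin.cons b (Fin.snoc c a : Fin (q + 1) → ℝ) : Fin (q + 2) → ℝ) j • side v j ∈
      cone v (Fin.last (q + 1)) ↔ b < B ∧ a < A := by
    rw [h1, mem_cone_iff_comp hk hv, compA_basis hk hv, compB_basis hk hv, sub_pos, sub_pos]
    exact and_comm
  have h3 : ∀ w, (fun j => lineDist v j (cornerPoint v
      (Fin.cons b (Fin.snoc c a : Fin (q + 1) → ℝ) : Fin (q + 2) → ℝ) w j)) =
      fun j => lineDist v j (cornerPoint v (closeUp v c) (w + (b - B) • side v 0) j) := by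
    intro w
    ext j
    have hsum : ∀ c' : Fin (q + 2) → ℝ,
        (∑ l, if l < j then c' l * cross (side v j) (side v l) else 0) =
        (if 0 < j then c' 0 * cross (side v j) (side v 0) else 0) + ∑ i : Fin q,
          if i.castSucc.succ < j then
            c' i.castSucc.succ * cross (side v j) (side v i.castSucc.succ) else 0 := by
      intro c'
      rw [Fin.sum_univ_succ, Fin.sum_univ_castSucc, Fin.succ_last,
        if_neg (not_lt.mpr (Fin.le_last j)), add_zero]
    have h4 : ∀ i : Fin q, closeUp v c i.castSucc.succ = c i := fun i => by simp [closeUp]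
    rw [lineDist_cornerPoint, lineDist_cornerPoint, hsum, hsum]
    simp only [Fin.cons_zero, Fin.cons_succ, Fin.snoc_castSucc, ← hB, h4, cross_add_right,
      cross_smul_right]
    by_cases hj : 0 < j
    · rw [if_pos hj, if_pos hj]; ring
    · have : j = 0 := by simpa using hj
      subst this
      rw [if_neg (lt_irrefl _), if_neg (lt_irrefl _), cross_self]; ring
  unfold openIntegrand
  simp_rw [h2, h3]
  by_cases hb : b < B
  · by_cases ha : a < A
    · simp only [hb, ha, and_self, if_true]
      rw [Set.indicator_of_mem (show b ∈ Set.Iio B from hb),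
        Set.indicator_of_mem (show a ∈ Set.Iio A from ha), Pi.one_apply, Pi.one_apply, one_mul,
        one_mul]
      exact lintegral_add_right_eq_self
        (fun w => H fun j => lineDist v j (cornerPoint v (closeUp v c) w j)) _
    · simp [ha]
  · simp [hb]

lemma pi_sumLaw {n : ℕ} {N : Fin n → ℕ} (hN : ∀ i, 0 < N i) :
    Measure.pi (fun i => sumLaw (N i)) = volume.withDensity fun c => ∏ i, sumDens (N i) (c i) := by
  have h : (fun i => sumLaw (N i)) = fun i => volume.withDensity (sumDens (N i)) := by
    ext1 i; exact sumLaw_of_pos (hN i)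
  rw [h, pi_withDensity _ fun i => measurable_sumDens (N i)]
  rfl

lemma continuous_width : Continuous (width v) := by
  refine continuous_pi fun j => ?_
  unfold width
  fun_prop

lemma measurable_prod_sumDens (N : Fin (k + 1) → ℕ) :
    Measurable fun ℓ => ∏ j, sumDens (N j) (width v ℓ j) :=
  Finset.measurable_fun_prod _ fun j _ => (measurable_sumDens _).comp
    ((continuous_apply j).comp continuous_width).measurable

lemma measurable_indicator_Iio_one {α : Type*} [MeasurableSpace α] {f g : α → ℝ}
    (hf : Measurable f) (hg : Measurable g) :
    Measurable fun a => (Set.Iio (f a)).indicator (1 : ℝ → ENNReal) (g a) := by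
  have : (fun a => (Set.Iio (f a)).indicator (1 : ℝ → ENNReal) (g a)) =
      {a | g a < f a}.indicator 1 := by
    ext a; simp [Set.indicator]
  rw [this]
  exact measurable_one.indicator (measurableSet_lt hg hf)

lemma lintegral_pi_cons_snoc {q : ℕ} (μ : Fin (q + 2) → Measure ℝ) [∀ i, SigmaFinite (μ i)]
    {f : (Fin (q + 2) → ℝ) → ENNReal} (hf : Measurable f) {A B : (Fin q → ℝ) → ℝ}
    {Θ : (Fin q → ℝ) → ENNReal} (hA : Measurable A) (hB : Measurable B) (hΘ : Measurable Θ)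
    (h : ∀ b a c, f (Fin.cons b (Fin.snoc c a : Fin (q + 1) → ℝ)) =
      (Set.Iio (B c)).indicator 1 b * ((Set.Iio (A c)).indicator 1 a * Θ c)) :
    ∫⁻ c, f c ∂Measure.pi μ = ∫⁻ c, μ 0 (Set.Iio (B c)) *
      (μ (Fin.last q).succ (Set.Iio (A c)) * Θ c) ∂Measure.pi fun i => μ i.castSucc.succ := by
  have hi : ∀ t : ℝ, Measurable ((Set.Iio t).indicator (1 : ℝ → ENNReal)) := fun t =>
    measurable_one.indicator measurableSet_Iio
  have e1 : Measurable fun p : ℝ × (Fin q → ℝ) =>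
      (Set.Iio (A p.2)).indicator (1 : ℝ → ENNReal) p.1 * Θ p.2 :=
    (measurable_indicator_Iio_one (hA.comp measurable_snd) measurable_fst).mul
      (hΘ.comp measurable_snd)
  have hμA : Measurable fun c => μ (Fin.last q).succ (Set.Iio (A c)) * Θ c := by
    have h1 := Measurable.lintegral_prod_left' (μ := μ (Fin.last q).succ) e1
    have h2 : ∀ c, ∫⁻ a, (Set.Iio (A c)).indicator (1 : ℝ → ENNReal) a * Θ c
        ∂μ (Fin.last q).succ = μ (Fin.last q).succ (Set.Iio (A c)) * Θ c := fun c => by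
      rw [lintegral_mul_const _ (hi _), lintegral_indicator_one measurableSet_Iio]
    simpa only [h2] using h1
  rw [lintegral_pi_cons _ hf]
  have h1 : ∀ b : ℝ, ∫⁻ x : Fin (q + 1) → ℝ, f (Fin.cons b x) ∂Measure.pi (fun j => μ j.succ) =
      ∫⁻ c, (Set.Iio (B c)).indicator 1 b * (μ (Fin.last q).succ (Set.Iio (A c)) * Θ c)
        ∂Measure.pi fun i => μ i.castSucc.succ := by
    intro b
    have hcons : Measurable fun x : Fin (q + 1) → ℝ => (Fin.cons b x : Fin (q + 2) → ℝ) :=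
      measurable_pi_lambda _ fun i => by
        refine Fin.cases ?_ (fun i => ?_) i
        · simp
        · simpa using measurable_pi_apply i
    have hm : Measurable fun x : Fin (q + 1) → ℝ => f (Fin.cons b x) := hf.comp hcons
    rw [lintegral_pi_snoc _ hm]
    simp_rw [h]
    have e2 : Measurable fun p : ℝ × (Fin q → ℝ) =>
        (Set.Iio (B p.2)).indicator (1 : ℝ → ENNReal) b :=
      measurable_indicator_Iio_one (hB.comp measurable_snd) measurable_const
    refine (lintegral_lintegral_swap (f := fun a c => (Set.Iio (B c)).indicator 1 b *
      ((Set.Iio (A c)).indicator 1 a * Θ c)) (e2.mul e1).aemeasurable).trans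
      (lintegral_congr fun c => ?_)
    rw [lintegral_const_mul _ ((hi _).mul_const _), lintegral_mul_const _ (hi _),
      lintegral_indicator_one measurableSet_Iio]
  simp_rw [h1]
  have e3 : Measurable fun p : ℝ × (Fin q → ℝ) =>
      (Set.Iio (B p.2)).indicator (1 : ℝ → ENNReal) p.1 *
        (μ (Fin.last q).succ (Set.Iio (A p.2)) * Θ p.2) :=
    (measurable_indicator_Iio_one (hB.comp measurable_snd) measurable_fst).mul
      (hμA.comp measurable_snd)
  refine (lintegral_lintegral_swap (f := fun b c => (Set.Iio (B c)).indicator 1 b *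
      (μ (Fin.last q).succ (Set.Iio (A c)) * Θ c)) e3.aemeasurable).trans
      (lintegral_congr fun c => ?_)
  rw [lintegral_mul_const _ (hi _), lintegral_indicator_one measurableSet_Iio]

/-- Integrating out the open parts of sides `0` and `k` raises their indices by one, through
`sumLaw_Iio`: this is the contribution of the closing edge. Before it, these two sides may have no
component at all, hence the Dirac mass in `sumLaw`. -/
lemma lintegral_pi_openIntegrand {q : ℕ} {v : Fin (q + 2) → Plane} (hk : 2 ≤ q + 1)
    (hv : IsCcwPolygon v) {H : (Fin (q + 2) → ℝ) → ENNReal} (hH : Measurable H)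
    {N' N : Fin (q + 2) → ℕ} (h0 : N 0 = N' 0 + 1)
    (hl : N (Fin.last (q + 1)) = N' (Fin.last (q + 1)) + 1)
    (hN : ∀ i : Fin q, N i.castSucc.succ = N' i.castSucc.succ) (hpos : ∀ j, 0 < N j) :
    ∫⁻ c, (∫⁻ w, openIntegrand v H w c) ∂Measure.pi (fun j => sumLaw (N' j)) =
      ∫⁻ c : Fin q → ℝ, ∫⁻ w, (fun ℓ => (∏ j, sumDens (N j) (width v ℓ j)) * H ℓ)
        (fun j => lineDist v j (cornerPoint v (closeUp v c) w j)) := by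
  have hd : Measurable fun p : (Fin q → ℝ) × Plane =>
      fun j => lineDist v j (cornerPoint v (closeUp v p.1) p.2 j) :=
    measurable_lineDist_cornerPoint (measurable_closeUp.comp measurable_fst) measurable_snd
  have hHd : Measurable fun p : (Fin q → ℝ) × Plane =>
      H fun j => lineDist v j (cornerPoint v (closeUp v p.1) p.2 j) := hH.comp hd
  have hΘm : Measurable fun c : Fin q → ℝ =>
      ∫⁻ w, H fun j => lineDist v j (cornerPoint v (closeUp v c) w j) :=
    Measurable.lintegral_prod_right' hHd
  have hBm : ∀ j, Measurable fun c : Fin q → ℝ => closeUp v c j := fun j =>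
    (measurable_pi_apply j).comp measurable_closeUp
  rw [lintegral_pi_cons_snoc _ (measurable_lintegral_openIntegrand hH) (hBm (Fin.last (q + 1)))
    (hBm 0) hΘm fun b a c => lintegral_openIntegrand hk hv H b a c]
  simp only [sumLaw_Iio, Fin.succ_last, ← hl, ← h0]
  have hfin : Measurable fun c : Fin q → ℝ => sumDens (N 0) (closeUp v c 0) *
        (sumDens (N (Fin.last (q + 1))) (closeUp v c (Fin.last (q + 1))) *
          ∫⁻ w, H fun j => lineDist v j (cornerPoint v (closeUp v c) w j)) :=
    ((measurable_sumDens _).comp (hBm 0)).mul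
      (((measurable_sumDens _).comp (hBm _)).mul hΘm)
  have hdens : Measurable fun c : Fin q → ℝ => ∏ i, sumDens (N' i.castSucc.succ) (c i) :=
    Finset.measurable_fun_prod _ fun i _ => (measurable_sumDens _).comp (measurable_pi_apply i)
  rw [pi_sumLaw (fun i => by rw [← hN]; exact hpos _),
    lintegral_withDensity_eq_lintegral_mul _ hdens hfin]
  refine lintegral_congr fun c => ?_
  have hw : ∀ w j, width v (fun j => lineDist v j (cornerPoint v (closeUp v c) w j)) j =
      closeUp v c j := fun w j =>
    width_eq hk hv (cornerPoint_add_one (sum_closeUp hk hv c) w) (fun _ => rfl) j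
  simp only [hw]
  have hdc : Measurable fun w => fun j => lineDist v j (cornerPoint v (closeUp v c) w j) :=
    measurable_lineDist_cornerPoint measurable_const measurable_id
  have hHc : Measurable fun w => H fun j => lineDist v j (cornerPoint v (closeUp v c) w j) :=
    hH.comp hdc
  rw [lintegral_const_mul _ hHc, Fin.prod_univ_succ, Fin.prod_univ_castSucc]
  have h4 : ∀ i : Fin q, closeUp v c i.castSucc.succ = c i := fun i => by simp [closeUp]
  simp only [h4, hN, Fin.succ_last, Pi.mul_apply]
  ring

lemma coneIntegral_of_last (hk : 2 ≤ k) (hv : IsCcwPolygon v)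
    {τ : Fin (m + 1) → Fin (k + 1)} (hτ : τ (Fin.last m) = Fin.last k)
    (hN : ∀ j, 0 < count τ j + count τ (j - 1)) {H : (Fin (k + 1) → ℝ) → ENNReal}
    (hH : Measurable H) :
    coneIntegral v τ H = ENNReal.ofReal ((∏ i, Real.sin (innerAngle v (τ i))) /
        ∏ j, Real.sin (innerAngle v j)) *
      ∫⁻ ℓ, (∏ j, sumDens (count τ j + count τ (j - 1)) (width v ℓ j)) * H ℓ := by
  obtain ⟨q, rfl⟩ : ∃ q, k = q + 1 := ⟨k - 1, by omega⟩
  set τ' : Fin m → Fin (q + 2) := fun i => τ i.castSucc with hτ'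
  have hc : ∀ j, count τ j = count τ' j + if j = Fin.last (q + 1) then 1 else 0 := by
    intro j; rw [count_succ, hτ]
  have hl0 : ∀ j : Fin (q + 2), j - 1 = Fin.last (q + 1) ↔ j = 0 := by
    intro j
    rw [sub_eq_iff_eq_add, Fin.last_add_one]
  have hlast : Fin.last (q + 1) ≠ 0 := (Fin.last_pos).ne'
  rw [coneIntegral_eq_openIntegrand hk hv hτ hH,
    lintegral_pi_openIntegrand hk hv hH (N := fun j => count τ j + count τ (j - 1))
      (N' := fun j => count τ' j + count τ' (j - 1)) ?_ ?_ ?_ hN]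
  · have hK : Measurable fun ℓ => (∏ j, sumDens (count τ j + count τ (j - 1)) (width v ℓ j)) * H ℓ :=
      (measurable_prod_sumDens _).mul hH
    rw [← lintegral_closeUp hk hv hK, ← mul_assoc, ← ENNReal.ofReal_mul]
    -- The last edge is in cone `k`, so its sine in the product over edges cancels against that of
    -- angle `k` in the product over sides.
    · congr 2
      rw [Fin.prod_univ_castSucc (f := fun i => Real.sin (innerAngle v (τ i))),
        Fin.prod_univ_castSucc (f := fun j => Real.sin (innerAngle v j)), hτ]
      have h1 := (sin_innerAngle_pos hk hv (Fin.last (q + 1))).ne'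
      have h2 : ∏ i : Fin (q + 1), Real.sin (innerAngle v i.castSucc) ≠ 0 :=
        Finset.prod_ne_zero_iff.mpr fun i _ => (sin_innerAngle_pos hk hv _).ne'
      field_simp
    · exact div_nonneg (Finset.prod_nonneg fun i _ => (sin_innerAngle_pos hk hv _).le)
        (Finset.prod_nonneg fun i _ => (sin_innerAngle_pos hk hv _).le)
  · simp only [hc, hl0]
    rw [if_neg hlast.symm, if_pos trivial]; ring
  · simp only [hc, hl0]
    rw [if_neg hlast, if_pos trivial]; ring
  · intro i
    simp only [hc, hl0]
    rw [if_neg, if_neg (Fin.succ_ne_zero _)]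
    · ring
    · rw [← Fin.succ_last, Fin.succ_inj]
      exact (Fin.castSucc_lt_last i).ne

end ConeIntegralEval

/-! ### Rotation of the numbering of the sides -/

section Rotation

variable {k m : ℕ} {v : Fin (k + 1) → Plane}

/-- The same polygon, with the numbering of its vertices shifted by `r`. -/
def shift (v : Fin (k + 1) → Plane) (r : Fin (k + 1)) (i : Fin (k + 1)) : Plane := v (r + i)

lemma edge_shift (r i : Fin (k + 1)) : edge (shift v r) i = edge v (r + i) := by
  simp [edge, shift, add_assoc]

lemma sideLength_shift (r i : Fin (k + 1)) : sideLength (shift v r) i = sideLength v (r + i) := by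
  simp [sideLength, shift, add_assoc]

lemma side_shift (r i : Fin (k + 1)) : side (shift v r) i = side v (r + i) := by
  rw [side, side, edge_shift, sideLength_shift]

lemma innerAngle_shift (r i : Fin (k + 1)) : innerAngle (shift v r) i = innerAngle v (r + i) := by
  simp [innerAngle, shift, add_assoc]

lemma lineDist_shift (r i : Fin (k + 1)) (p : Plane) :
    lineDist (shift v r) i p = lineDist v (r + i) p := by
  rw [lineDist_eq, lineDist_eq, side_shift]; rfl

lemma cone_shift (r i : Fin (k + 1)) : cone (shift v r) i = cone v (r + i) := by
  rw [cone, cone, side_shift, side_shift, add_assoc]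

lemma width_shift (r : Fin (k + 1)) (ℓ : Fin (k + 1) → ℝ) (i : Fin (k + 1)) :
    width (shift v r) (fun j => ℓ (r + j)) i = width v ℓ (r + i) := by
  simp only [width, sideLength_shift, innerAngle_shift, add_assoc, add_sub_assoc]

/-- Counting from side `r` instead of side `0` changes the indicator of `t < l` by a term that does
not depend on `l` and a term that does not depend on `t`. -/
lemma lt_add_lt_sub (t l r : Fin (k + 1)) :
    (if t < l then (1 : ℤ) else 0) = (if t < r then 1 else 0) + (if t - r < l - r then 1 else 0)
      - if l < r then 1 else 0 := by
  have h : ∀ a : Fin (k + 1), (a - r).val = if a < r then k + 1 + a.val - r.val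
      else a.val - r.val := by
    intro a
    split_ifs with ha
    · exact Fin.coe_sub_iff_lt.mpr ha
    · exact Fin.sub_val_of_le (not_lt.mp ha)
  have ht := t.isLt
  have hl := l.isLt
  have hr := r.isLt
  simp only [Fin.lt_def, h]
  split_ifs <;> omega

/-- In `lt_add_lt_sub`, the term independent of `l` moves the base point to the contact point of
side `r`, and the term independent of `t` multiplies the total of the edges, which vanishes. -/
lemma contactDist_shift {y : Fin m → Plane} (hy : ∑ i, y i = 0) (τ : Fin m → Fin (k + 1))
    (r : Fin (k + 1)) (p : Plane) :
    contactDist v τ p y = fun j =>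
      contactDist (shift v r) (fun i => τ i - r) (p + contactOffset τ y r) y (j - r) := by
  ext l
  rw [contactDist, contactDist, lineDist_shift, add_sub_cancel, add_assoc]
  congr 2
  rw [contactOffset, contactOffset, contactOffset, Finset.sum_filter, Finset.sum_filter,
    Finset.sum_filter, ← Finset.sum_add_distrib]
  have h : ∀ i, (if τ i < l then y i else 0) = ((if τ i < r then y i else 0) +
      if τ i - r < l - r then y i else 0) - if l < r then y i else 0 := by
    intro i
    have h1 := congrArg (fun a : ℤ => a • y i) (lt_add_lt_sub (τ i) l r)
    simp only [sub_smul, add_smul, ite_smul, one_smul, zero_smul] at h1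
    exact h1
  simp_rw [h]
  rw [Finset.sum_sub_distrib]
  split_ifs
  · rw [hy, sub_zero]
  · simp

lemma count_sub (τ : Fin m → Fin (k + 1)) (r j : Fin (k + 1)) :
    count (fun i => τ i - r) j = count τ (r + j) := by
  simp only [count, sub_eq_iff_eq_add, add_comm]

lemma measurable_contactDist {α : Type*} [MeasurableSpace α] (τ : Fin m → Fin (k + 1))
    {f : α → Plane} {g : α → Fin m → Plane} (hf : Measurable f) (hg : Measurable g) :
    Measurable fun a => contactDist v τ (f a) (g a) := by
  refine measurable_pi_lambda _ fun j => (continuous_lineDist j).measurable.comp (hf.add ?_)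
  unfold contactOffset
  exact Finset.measurable_sum _ fun i _ => (measurable_pi_apply i).comp hg

lemma measurable_comp_shift (r : Fin (k + 1)) :
    Measurable fun ℓ : Fin (k + 1) → ℝ => fun j => ℓ (j - r) := by fun_prop

lemma coneIntegral_shift (τ : Fin (m + 1) → Fin (k + 1)) (r : Fin (k + 1))
    {H : (Fin (k + 1) → ℝ) → ENNReal} (hH : Measurable H) :
    coneIntegral v τ H =
      coneIntegral (shift v r) (fun i => τ i - r) fun ℓ => H fun j => ℓ (j - r) := by
  classical
  set τ' : Fin (m + 1) → Fin (k + 1) := fun i => τ i - r with hτ'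
  have hc : ∀ y : Fin (m + 1) → Plane, InCones v τ y ↔ InCones (shift v r) τ' y := by
    intro y
    refine forall_congr' fun i => ?_
    rw [cone_shift, hτ', add_sub_cancel]
  have hm1 : Measurable fun q : Plane × (Fin m → Plane) => if InCones v τ (closed q.2) then
      H (contactDist v τ q.1 (closed q.2)) else 0 := by
    have h1 : Measurable fun q : Plane × (Fin m → Plane) => closed q.2 :=
      measurable_closed.comp measurable_snd
    have h2 : Measurable fun q : Plane × (Fin m → Plane) => contactDist v τ q.1 (closed q.2) :=
      measurable_contactDist τ measurable_fst h1
    exact Measurable.ite (h1 (measurableSet_inCones τ)) (hH.comp h2) measurable_const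
  have hm2 : Measurable fun q : Plane × (Fin m → Plane) =>
      if InCones (shift v r) τ' (closed q.2) then
      H (fun j => contactDist (shift v r) τ' q.1 (closed q.2) (j - r)) else 0 := by
    have h1 : Measurable fun q : Plane × (Fin m → Plane) => closed q.2 :=
      measurable_closed.comp measurable_snd
    have h2 : Measurable fun q : Plane × (Fin m → Plane) =>
        contactDist (shift v r) τ' q.1 (closed q.2) := measurable_contactDist τ' measurable_fst h1
    exact Measurable.ite (h1 (measurableSet_inCones τ'))
      ((hH.comp (measurable_comp_shift r)).comp h2) measurable_const
  rw [coneIntegral, coneIntegral]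
  refine (lintegral_lintegral_swap (f := fun p (x : Fin m → Plane) =>
    if InCones v τ (closed x) then H (contactDist v τ p (closed x)) else 0) hm1.aemeasurable).trans
    (Eq.trans (lintegral_congr fun x => ?_)
    (lintegral_lintegral_swap (f := fun p (x : Fin m → Plane) =>
      if InCones (shift v r) τ' (closed x) then
      H (fun j => contactDist (shift v r) τ' p (closed x) (j - r)) else 0) hm2.aemeasurable).symm)
  by_cases hx : InCones v τ (closed x)
  · simp only [if_pos hx, if_pos ((hc _).mp hx)]
    simp_rw [contactDist_shift (v := v) (sum_closed x) τ r]
    exact lintegral_add_right_eq_self (fun p => H fun j =>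
      contactDist (shift v r) τ' p (closed x) (j - r)) _
  · simp [if_neg hx, if_neg fun h => hx ((hc _).mpr h)]

lemma lintegral_comp_add_left (r : Fin (k + 1)) (F : (Fin (k + 1) → ℝ) → ENNReal) :
    ∫⁻ ℓ : Fin (k + 1) → ℝ, F (fun j => ℓ (r + j)) = ∫⁻ ℓ, F ℓ :=
  (volume_preserving_arrowCongr' (Equiv.addLeft r).symm (MeasurableEquiv.refl ℝ)
    (MeasurePreserving.id volume)).lintegral_comp_emb
    (MeasurableEquiv.arrowCongr' (Equiv.addLeft r).symm
      (MeasurableEquiv.refl ℝ)).measurableEmbedding F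

lemma coneIntegral_eq (hk : 2 ≤ k) (hv : IsCcwPolygon v) {τ : Fin (m + 1) → Fin (k + 1)}
    (hN : ∀ j, 0 < count τ j + count τ (j - 1)) {H : (Fin (k + 1) → ℝ) → ENNReal}
    (hH : Measurable H) :
    coneIntegral v τ H = ENNReal.ofReal (∏ j, (Real.sin (innerAngle v j) ^ count τ j
        / Real.sin (innerAngle v j))) *
      ∫⁻ ℓ, (∏ j, sumDens (count τ j + count τ (j - 1)) (width v ℓ j)) * H ℓ := by
  -- In the numbering shifted by `r`, the cone of the closing edge has index `-1`, which is the last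
  -- one; the previous computation then applies.
  set r := τ (Fin.last m) + 1 with hr
  have hv' : IsCcwPolygon (shift v r) := hv.shift r
  have hlast : (fun i => τ i - r) (Fin.last m) = Fin.last k := by
    show τ (Fin.last m) - r = Fin.last k
    rw [hr, sub_add_cancel_left, neg_eq_iff_add_eq_zero, add_comm (1 : Fin (k + 1)), Fin.last_add_one]
  have hH' : Measurable fun ℓ : Fin (k + 1) → ℝ => H fun j => ℓ (j - r) :=
    hH.comp (measurable_comp_shift r)
  rw [coneIntegral_shift τ r hH, coneIntegral_of_last hk hv' hlast ?_ hH']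
  · refine congrArg₂ (· * ·) (congrArg _ ?_) ?_
    · simp only [innerAngle_shift, add_sub_cancel]
      rw [Finset.prod_div_distrib, Fintype.prod_equiv (Equiv.addLeft r)
        (fun j => Real.sin (innerAngle v (r + j))) (fun j => Real.sin (innerAngle v j))
        fun j => rfl]
      congr 1
      rw [← Finset.prod_fiberwise' Finset.univ τ fun j => Real.sin (innerAngle v j)]
      exact Finset.prod_congr rfl fun j _ => by rw [Finset.prod_const, count]
    · rw [← lintegral_comp_add_left r]
      refine lintegral_congr fun ℓ => ?_
      simp only [width_shift, count_sub, add_sub_cancel, ← add_sub_assoc]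
      congr 1
      exact Fintype.prod_equiv (Equiv.addLeft r) _ (fun j =>
        sumDens (count τ j + count τ (j - 1)) (width v ℓ j)) fun j => rfl
  · intro j
    simp only [count_sub, ← add_sub_assoc]
    exact hN _

/-- The weight of the distances `ℓ` to the sides and of the size vector `s`. -/
noncomputable def weight (v : Fin (k + 1) → Plane) (s : Fin (k + 1) → ℕ)
    (ℓ : Fin (k + 1) → ℝ) : ENNReal :=
  ENNReal.ofReal (∏ j, (Real.sin (innerAngle v j) ^ s j / Real.sin (innerAngle v j)
    / (s j).factorial)) * ∏ j, sumDens (s j + s (j - 1)) (width v ℓ j)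

lemma measurable_weight (s : Fin (k + 1) → ℕ) : Measurable (weight v s) :=
  (measurable_prod_sumDens _).const_mul _

open Classical in
/-- The joint law of the distances to the sides and of the size vector. -/
theorem setLIntegral_goodSet_eq (hk : 2 ≤ k) (hv : IsCcwPolygon v) (hm : 2 ≤ m)
    {F : (Fin (k + 1) → ℝ) → (Fin (k + 1) → ℕ) → ENNReal}
    (hF : Measurable (Function.uncurry F)) :
    ∫⁻ z in goodSet v m, F (sideDist v z) (sizeVector v z) =
      ∑' s : Fin (k + 1) → ℕ, if ValidSize (m + 1) s then
        ∫⁻ ℓ in {ℓ | ∀ j, 0 ≤ ℓ j}, weight v s ℓ * F ℓ s else 0 := by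
  have hset : MeasurableSet {ℓ : Fin (k + 1) → ℝ | ∀ j, 0 ≤ ℓ j} := by
    have : {ℓ : Fin (k + 1) → ℝ | ∀ j, 0 ≤ ℓ j} = ⋂ j, {ℓ | 0 ≤ ℓ j} := by ext ℓ; simp
    rw [this]
    exact MeasurableSet.iInter fun j => measurableSet_le measurable_const (measurable_pi_apply j)
  rw [setLIntegral_goodSet hk hv hm hF]
  refine tsum_congr fun s => ?_
  by_cases hs : ValidSize (m + 1) s
  · rw [if_pos hs, if_pos hs]
    have hFs : Measurable fun ℓ => F ℓ s := hF.comp measurable_prodMk_right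
    have hH : Measurable fun ℓ : Fin (k + 1) → ℝ => if ∀ j, 0 ≤ ℓ j then F ℓ s else 0 :=
      Measurable.ite hset hFs measurable_const
    rw [coneIntegral_eq hk hv (by rw [count_assignment hs.1]; exact hs.2) hH,
      count_assignment hs.1, ← mul_assoc, ← lintegral_indicator hset]
    have hprod : Measurable fun ℓ : Fin (k + 1) → ℝ =>
        (∏ j, sumDens (s j + s (j - 1)) (width v ℓ j)) * if ∀ j, 0 ≤ ℓ j then F ℓ s else 0 :=
      (measurable_prod_sumDens _).mul hH
    rw [← lintegral_const_mul _ hprod]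
    refine lintegral_congr fun ℓ => ?_
    by_cases hℓ : ∀ j, 0 ≤ ℓ j
    · rw [Set.indicator_of_mem (by exact hℓ), if_pos hℓ, weight, ← mul_assoc]
      congr 2
      have h1 : ((∏ j, (s j).factorial : ℕ) : ENNReal)⁻¹ =
          ENNReal.ofReal ((∏ j, ((s j).factorial : ℝ))⁻¹) := by
        rw [ENNReal.ofReal_inv_of_pos (Finset.prod_pos fun j _ => by positivity)]
        congr 1
        rw [← Nat.cast_prod, ENNReal.ofReal_natCast]
      rw [h1, ← ENNReal.ofReal_mul (by positivity)]
      congr 1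
      simp only [Finset.prod_div_distrib]
      ring
    · rw [Set.indicator_of_notMem (by exact hℓ), if_neg hℓ, mul_zero, mul_zero]
  · rw [if_neg hs, if_neg hs]

end Rotation

/-! ### The laws in terms of Lebesgue measure -/

section Laws

variable {k m : ℕ} {v : Fin (k + 1) → Plane}

lemma isCompact_polygon (v : Fin (k + 1) → Plane) : IsCompact (polygon v) :=
  (Set.finite_range v).isCompact_convexHull ℝ

lemma measurableSet_polygon (v : Fin (k + 1) → Plane) : MeasurableSet (polygon v) :=
  (isCompact_polygon v).isClosed.measurableSet

lemma volume_polygon_ne_top (v : Fin (k + 1) → Plane) : volume (polygon v) ≠ ⊤ :=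
  (isCompact_polygon v).measure_lt_top.ne

lemma volume_polygon_ne_zero (hk : 2 ≤ k) (hv : IsCcwPolygon v) : volume (polygon v) ≠ 0 := by
  -- The barycentre of the vertices is an interior point: for each side `j`, vertex `j + 2`
  -- contributes strictly positively to its distance.
  set q : Plane := ((k + 1 : ℕ) : ℝ)⁻¹ • ∑ i, v i with hq
  have hpos : ∀ j, 0 < lineDist v j q := by
    intro j
    have h1 : q - v j = ((k + 1 : ℕ) : ℝ)⁻¹ • ∑ i, (v i - v j) := by
      rw [Finset.sum_sub_distrib, smul_sub, hq, Finset.sum_const, Finset.card_univ,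
        Fintype.card_fin, ← Nat.cast_smul_eq_nsmul ℝ, smul_smul, inv_mul_cancel₀ (by positivity),
        one_smul]
    rw [lineDist_eq, h1, cross_smul_right, cross_sum_right]
    refine mul_pos (by positivity) (Finset.sum_pos' (fun i _ => ?_) ⟨j + 1 + 1,
      Finset.mem_univ _, ?_⟩)
    · rw [← lineDist_eq]
      exact (mem_polygon_iff hk hv _).mp (subset_convexHull ℝ _ (Set.mem_range_self i)) j
    · have h2 : v (j + 1 + 1) - v j = sideLength v (j + 1) • side v (j + 1) +
          sideLength v j • side v j := by
        rw [← edge_eq_smul_side hk hv, ← edge_eq_smul_side hk hv, edge, edge]; abel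
      rw [h2, cross_add_right, cross_smul_right, cross_smul_right, cross_self, mul_zero, add_zero]
      exact mul_pos (sideLength_pos hk hv _) (cross_side_pos hk hv j)
  have hopen : IsOpen {p : Plane | ∀ j, 0 < lineDist v j p} := by
    have : {p : Plane | ∀ j, 0 < lineDist v j p} = ⋂ j, {p | 0 < lineDist v j p} := by
      ext p; simp
    rw [this]
    exact isOpen_iInter_of_finite fun j => isOpen_lt continuous_const (continuous_lineDist j)
  have hsub : {p : Plane | ∀ j, 0 < lineDist v j p} ⊆ polygon v := fun p hp =>
    (mem_polygon_iff hk hv p).mpr fun j => (hp j).le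
  exact ((hopen.measure_pos volume ⟨q, hpos⟩).trans_le (measure_mono hsub)).ne'

lemma area_pos (hk : 2 ≤ k) (hv : IsCcwPolygon v) : 0 < area v :=
  ENNReal.toReal_pos (volume_polygon_ne_zero hk hv) (volume_polygon_ne_top v)

lemma uniformLaw_eq (v : Fin (k + 1) → Plane) (n : ℕ) :
    uniformLaw v n = (volume (polygon v))⁻¹ ^ n •
      volume.restrict (Set.univ.pi fun _ => polygon v) := by
  refine Measure.pi_eq fun s hs => ?_
  rw [Measure.smul_apply, Measure.restrict_apply (MeasurableSet.univ_pi hs),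
    ← Set.pi_inter_distrib, volume_pi, Measure.pi_pi, smul_eq_mul]
  have h : ∀ i, cond volume (polygon v) (s i) =
      (volume (polygon v))⁻¹ * volume (s i ∩ polygon v) := fun i => by
    rw [cond_apply (measurableSet_polygon v), Set.inter_comm]
  simp_rw [h]
  rw [Finset.prod_mul_distrib, Finset.prod_const, Finset.card_univ, Fintype.card_fin]

lemma measurableSet_pi_polygon (v : Fin (k + 1) → Plane) (n : ℕ) :
    MeasurableSet (Set.univ.pi fun _ : Fin n => polygon v) :=
  MeasurableSet.univ_pi fun _ => measurableSet_polygon v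

lemma fullSidedProb_eq (hk : 2 ≤ k) (hv : IsCcwPolygon v) (hm : 2 ≤ m) :
    fullSidedProb v (m + 1) =
      (m + 1).factorial * (volume (goodSet v m)).toReal / area v ^ (m + 1) := by
  have hsub : {z : Fin (m + 1) → Plane | InConvexPosition v z ∧ FullSided v z} ⊆
      Set.univ.pi fun _ => polygon v := fun z hz i _ => hz.1.1 i
  rw [fullSidedProb, uniformLaw_eq, measureReal_def, Measure.smul_apply,
    Measure.restrict_apply' (measurableSet_pi_polygon v _), Set.inter_eq_left.mpr hsub,
    measure_congr (convexPosition_ae_eq hk hv hm), volume_exists_perm hk hv hm, smul_eq_mul,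
    ENNReal.toReal_mul, ENNReal.toReal_mul, ENNReal.toReal_pow, ENNReal.toReal_inv,
    ENNReal.toReal_natCast, area, measureReal_def, inv_pow, mul_comm]
  rfl

lemma conditionedLaw_eq (hk : 2 ≤ k) (hv : IsCcwPolygon v) (hm : 2 ≤ m) :
    conditionedLaw v (m + 1) =
      (volume (canonSet v m))⁻¹ • volume.restrict (canonSet v m) := by
  have hsub : {z : Fin (m + 1) → Plane | InCanonicalOrder v z ∧ FullSided v z} ⊆
      Set.univ.pi fun _ => polygon v := fun z hz i _ => hz.1.1.1 i
  have h0 : (volume (polygon v))⁻¹ ^ (m + 1) ≠ 0 :=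
    pow_ne_zero _ (ENNReal.inv_ne_zero.mpr (volume_polygon_ne_top v))
  have ht : (volume (polygon v))⁻¹ ^ (m + 1) ≠ ⊤ :=
    ENNReal.pow_ne_top (ENNReal.inv_ne_top.mpr (volume_polygon_ne_zero hk hv))
  rw [conditionedLaw, ProbabilityTheory.cond, uniformLaw_eq, Measure.smul_apply,
    Measure.restrict_apply' (measurableSet_pi_polygon v _), Set.inter_eq_left.mpr hsub,
    Measure.restrict_smul, Measure.restrict_restrict'
      (measurableSet_pi_polygon v _), Set.inter_eq_left.mpr hsub,
    measure_congr (canonical_ae_eq hk hv hm), Measure.restrict_congr_set (canonical_ae_eq hk hv hm),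
    smul_smul, smul_eq_mul]
  congr 1
  rw [ENNReal.mul_inv (Or.inl h0) (Or.inl ht), mul_right_comm, ENNReal.inv_mul_cancel h0 ht, one_mul]

lemma measurable_rescaled (g : Fin (k + 1) → ℝ) (n : ℕ) : Measurable (rescaled v g n) := by
  unfold rescaled
  refine Measurable.prodMk ?_ ?_
  · exact measurable_pi_lambda _ fun j => (measurable_sideDist j).const_mul _
  · refine (MeasurableEquiv.toLp 2 (Fin k → ℝ)).measurable.comp (measurable_pi_lambda _ fun a => ?_)
    refine Measurable.div_const (Measurable.sub_const ?_ _) _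
    exact (measurable_of_countable (fun i : ℕ => (i : ℝ))).comp
      ((measurable_pi_apply a.castSucc).comp measurable_sizeVector)

/-- The rescaled distances to the sides and size vector. -/
noncomputable def rescale (g : Fin (k + 1) → ℝ) (n : ℕ) (ℓ : Fin (k + 1) → ℝ)
    (s : Fin (k + 1) → ℕ) : (Fin (k + 1) → ℝ) × EuclideanSpace ℝ (Fin k) :=
  (fun j => n * ℓ j, WithLp.toLp 2 fun a =>
      ((s a.castSucc : ℝ) - n * g a.castSucc) / Real.sqrt n)

lemma measurable_rescale (g : Fin (k + 1) → ℝ) (n : ℕ) :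
    Measurable (Function.uncurry (rescale g n)) := by
  refine measurable_from_prod_countable_left fun s => ?_
  change Measurable fun ℓ => rescale g n ℓ s
  unfold rescale
  refine Measurable.prodMk ?_ measurable_const
  exact measurable_pi_lambda _ fun j => (measurable_pi_apply j).const_mul _

/-- The rescaled variables depend only on the distances and the size vector, so polygons in
canonical order can be replaced by good ones. -/
lemma map_conditionedLaw (hk : 2 ≤ k) (hv : IsCcwPolygon v) (hm : 2 ≤ m) (g : Fin (k + 1) → ℝ) :
    (conditionedLaw v (m + 1)).map (rescaled v g (m + 1)) =
      (volume (goodSet v m))⁻¹ • (volume.restrict (goodSet v m)).map (rescaled v g (m + 1)) := by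
  have hR := measurable_rescaled (v := v) g (m + 1)
  have h1 : volume (canonSet v m) = volume (goodSet v m) := by
    have := setLIntegral_canonSet hk hv hm (F := fun _ _ => 1) measurable_const
    simpa using this
  rw [conditionedLaw_eq hk hv hm, Measure.map_smul, h1]
  congr 1
  refine Measure.ext_of_lintegral _ fun f hf => ?_
  rw [lintegral_map hf hR, lintegral_map hf hR]
  exact setLIntegral_canonSet hk hv hm (F := fun ℓ s => f (rescale g (m + 1) ℓ s))
    (hf.comp (measurable_rescale g (m + 1)))

end Laws

/-! ### Sums over size vectors as integrals -/

section Rescaling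

variable {k m : ℕ} {v : Fin (k + 1) → Plane}

/-- Each lattice point carries a unit cube. Sums over size vectors thereby become integrals over a
fixed space, to which dominated convergence applies. -/
lemma lintegral_floor {d : ℕ} (G : (Fin d → ℤ) → ENNReal) :
    ∫⁻ y : Fin d → ℝ, G (fun a => ⌊y a⌋) = ∑' z, G z := by
  have hm : Measurable fun y : Fin d → ℝ => fun a => ⌊y a⌋ :=
    measurable_pi_lambda _ fun a => Int.measurable_floor.comp (measurable_pi_apply a)
  rw [← lintegral_map (measurable_of_countable G) hm, lintegral_countable']
  refine tsum_congr fun z => ?_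
  rw [Measure.map_apply hm (measurableSet_singleton z)]
  have h : (fun y : Fin d → ℝ => fun a => ⌊y a⌋) ⁻¹' {z} =
      Set.univ.pi fun a => Set.Ico (z a : ℝ) (z a + 1) := by
    ext y
    simp only [Set.mem_preimage, Set.mem_singleton_iff, funext_iff, Int.floor_eq_iff,
      Set.mem_univ_pi, Set.mem_Ico]
  rw [h, volume_pi, Measure.pi_pi]
  simp

lemma lintegral_scale {d : ℕ} (b : Fin d → ℝ) {c : ℝ} (hc : 0 < c) {f : (Fin d → ℝ) → ENNReal}
    (hf : Measurable f) :
    ∫⁻ y, f y = ENNReal.ofReal (c ^ d) * ∫⁻ x : Fin d → ℝ, f fun a => b a + c * x a := by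
  have hdet : (Matrix.diagonal fun _ : Fin d => c).det = c ^ d := by simp
  have h1 : Measurable fun y => f (b + y) := hf.comp (measurable_const_add b)
  rw [← lintegral_add_left_eq_self f b,
    lintegral_mulVec (M := Matrix.diagonal fun _ => c) (by rw [hdet]; positivity) h1, hdet,
    abs_of_pos (by positivity)]
  congr 1
  refine lintegral_congr fun x => ?_
  congr 1
  ext a
  simp

/-- The size vector whose first entries are the `z a`, and whose sum is `n`. -/
def sizeOfIndex (n : ℕ) (z : Fin k → ℤ) : Fin (k + 1) → ℕ :=
  Fin.snoc (fun a => (z a).toNat) ((n : ℤ) - ∑ a, z a).toNat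

/-- The indices that correspond to possible size vectors. -/
def ValidIndex (n : ℕ) (z : Fin k → ℤ) : Prop :=
  (∀ a, 0 ≤ z a) ∧ ∑ a, z a ≤ n ∧ ∀ j, 0 < sizeOfIndex n z j + sizeOfIndex n z (j - 1)

lemma ValidIndex.validSize {n : ℕ} {z : Fin k → ℤ} (h : ValidIndex n z) :
    ValidSize n (sizeOfIndex n z) := by
  refine ⟨?_, h.2.2⟩
  rw [Fin.sum_univ_castSucc]
  simp only [sizeOfIndex, Fin.snoc_castSucc, Fin.snoc_last]
  zify
  have h1 : ∀ a, ((z a).toNat : ℤ) = z a := fun a => Int.toNat_of_nonneg (h.1 a)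
  simp only [h1]
  rw [Int.toNat_of_nonneg (by linarith [h.2.1])]
  ring

lemma ValidSize.sizeOfIndex {n : ℕ} {s : Fin (k + 1) → ℕ} (h : ValidSize n s) :
    PCP.sizeOfIndex n (fun a => (s a.castSucc : ℤ)) = s := by
  ext j
  have h1 := h.1
  rw [Fin.sum_univ_castSucc] at h1
  refine Fin.lastCases ?_ (fun a => ?_) j
  · simp only [PCP.sizeOfIndex, Fin.snoc_last]
    zify at h1
    rw [← h1]; simp
  · simp [PCP.sizeOfIndex]

lemma ValidSize.validIndex {n : ℕ} {s : Fin (k + 1) → ℕ} (h : ValidSize n s) :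
    ValidIndex n fun a => (s a.castSucc : ℤ) := by
  refine ⟨fun a => Int.natCast_nonneg _, ?_, ?_⟩
  · have h1 := h.1
    rw [Fin.sum_univ_castSucc] at h1
    zify at h1
    rw [← h1]; simp
  · rw [h.sizeOfIndex]; exact h.2

open Classical in
lemma tsum_validSize (n : ℕ) (h : (Fin (k + 1) → ℕ) → ENNReal) :
    ∑' s, (if ValidSize n s then h s else 0) =
      ∑' z : Fin k → ℤ, if ValidIndex n z then h (sizeOfIndex n z) else 0 := by
  have h1 := (Subtype.val_injective (p := ValidSize (k := k) n)).tsum_eq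
    (f := fun s => if ValidSize n s then h s else 0) (by
      intro s hs
      simp only [Function.mem_support, ne_eq, ite_eq_right_iff, Classical.not_imp] at hs
      exact ⟨⟨s, hs.1⟩, rfl⟩)
  have hinj : Function.Injective fun (s : {s : Fin (k + 1) → ℕ // ValidSize n s}) (a : Fin k) =>
      (s.1 a.castSucc : ℤ) := by
    intro s s' hss
    apply Subtype.ext
    rw [← s.2.sizeOfIndex, ← s'.2.sizeOfIndex]
    exact congrArg _ hss
  have h2 := hinj.tsum_eq (f := fun z => if ValidIndex n z then h (sizeOfIndex n z) else 0) (by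
      intro z hz
      simp only [Function.mem_support, ne_eq, ite_eq_right_iff, Classical.not_imp] at hz
      refine ⟨⟨sizeOfIndex n z, hz.1.validSize⟩, ?_⟩
      ext a
      simp [sizeOfIndex, hz.1.1 a])
  rw [← h1, ← h2]
  refine tsum_congr fun s => ?_
  rw [if_pos s.2, if_pos s.2.validIndex, s.2.sizeOfIndex]

/-- The index of the size vector close to `n * g + √n * x`. -/
noncomputable def indexAt (g : Fin (k + 1) → ℝ) (n : ℕ) (x : Fin k → ℝ) (a : Fin k) : ℤ :=
  ⌊n * g a.castSucc + Real.sqrt n * x a⌋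

lemma measurable_indexAt (g : Fin (k + 1) → ℝ) (n : ℕ) : Measurable (indexAt g n) := by
  unfold indexAt
  exact measurable_pi_lambda _ fun a => Int.measurable_floor.comp (by fun_prop)

lemma tsum_index {n : ℕ} (hn : 0 < n) (g : Fin (k + 1) → ℝ) (G : (Fin k → ℤ) → ENNReal) :
    ∑' z, G z = ENNReal.ofReal (Real.sqrt n ^ k) * ∫⁻ x, G (indexAt g n x) := by
  have hm : Measurable fun y : Fin k → ℝ => fun a => ⌊y a⌋ :=
    measurable_pi_lambda _ fun a => Int.measurable_floor.comp (measurable_pi_apply a)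
  have hc : 0 < Real.sqrt n := Real.sqrt_pos.mpr (Nat.cast_pos.mpr hn)
  have hG : Measurable fun y : Fin k → ℝ => G fun a => ⌊y a⌋ := (measurable_of_countable G).comp hm
  rw [← lintegral_floor, lintegral_scale (fun a : Fin k => n * g a.castSucc) hc hG]
  rfl

-- Two changes of scale produce the prefactor: `√n ^ k` from the index `n * g + √n * x`, and `n⁻¹ ^
-- (k + 1)` from the distances `l / n`.
open Classical in
lemma lintegral_rescaled (hk : 2 ≤ k) (hv : IsCcwPolygon v) (hm : 2 ≤ m) (g : Fin (k + 1) → ℝ)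
    {f : (Fin (k + 1) → ℝ) × EuclideanSpace ℝ (Fin k) → ENNReal} (hf : Measurable f) :
    ∫⁻ z in goodSet v m, f (rescaled v g (m + 1) z) =
      ENNReal.ofReal (Real.sqrt (m + 1 : ℕ) ^ k * (((m + 1 : ℕ) : ℝ)⁻¹) ^ (k + 1)) *
        ∫⁻ x : Fin k → ℝ, if ValidIndex (m + 1) (indexAt g (m + 1) x) then
          ∫⁻ l : Fin (k + 1) → ℝ, if ∀ j, 0 ≤ l j then
            weight v (sizeOfIndex (m + 1) (indexAt g (m + 1) x))
              (fun j => ((m + 1 : ℕ) : ℝ)⁻¹ * l j) *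
            f (l, WithLp.toLp 2 fun a => ((sizeOfIndex (m + 1) (indexAt g (m + 1) x) a.castSucc : ℝ)
              - (m + 1 : ℕ) * g a.castSucc) / Real.sqrt (m + 1 : ℕ)) else 0 else 0 := by
  set n := m + 1 with hn
  have hn0 : (0 : ℝ) < (n : ℝ)⁻¹ := inv_pos.mpr (Nat.cast_pos.mpr (by omega))
  have hn1 : (n : ℝ) ≠ 0 := by positivity
  have hF : Measurable (Function.uncurry fun ℓ s => f (rescale g n ℓ s)) :=
    hf.comp (measurable_rescale g n)
  have h1 := setLIntegral_goodSet_eq (v := v) hk hv hm hF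
  have h2 : ∀ z : Fin (m + 1) → Plane, f (rescaled v g n z) =
      f (rescale g n (sideDist v z) (sizeVector v z)) := fun z => rfl
  rw [lintegral_congr h2, h1, tsum_validSize, tsum_index (by omega : 0 < m + 1) g, mul_comm (Real.sqrt _ ^ k),
    ENNReal.ofReal_mul (by positivity), mul_comm (ENNReal.ofReal ((n : ℝ)⁻¹ ^ (k + 1))), mul_assoc]
  congr 1
  rw [← lintegral_const_mul' _ _ ENNReal.ofReal_ne_top]
  refine lintegral_congr fun x => ?_
  split_ifs with hx
  · have hset : MeasurableSet {ℓ : Fin (k + 1) → ℝ | ∀ j, 0 ≤ ℓ j} := by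
      have : {ℓ : Fin (k + 1) → ℝ | ∀ j, 0 ≤ ℓ j} = ⋂ j, {ℓ | 0 ≤ ℓ j} := by ext ℓ; simp
      rw [this]
      exact MeasurableSet.iInter fun j =>
        measurableSet_le measurable_const (measurable_pi_apply j)
    have hmeas : Measurable fun ℓ : Fin (k + 1) → ℝ =>
        weight v (sizeOfIndex (m + 1) (indexAt g (m + 1) x)) ℓ *
          f (rescale g n ℓ (sizeOfIndex (m + 1) (indexAt g (m + 1) x))) :=
      (measurable_weight _).mul (hF.comp measurable_prodMk_right)
    rw [← lintegral_indicator hset, lintegral_scale 0 hn0 (hmeas.indicator hset)]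
    congr 1
    refine lintegral_congr fun l => ?_
    have h3 : ∀ j, 0 ≤ (n : ℝ)⁻¹ * l j ↔ 0 ≤ l j := fun j => by
      rw [mul_nonneg_iff_of_pos_left hn0]
    simp only [Set.indicator, Set.mem_ofPred_eq, Pi.zero_apply, zero_add, h3]
    split_ifs
    · congr 2
      unfold rescale
      congr 1
      ext j
      rw [mul_inv_cancel_left₀ hn1]
    · rfl
  · simp

end Rescaling

/-! ### The weights as products of Poisson probabilities -/

section PoissonWeights

variable {k m : ℕ} {v : Fin (k + 1) → Plane}

/-- The probability of `a` under the Poisson law of parameter `t`. -/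
noncomputable def poisson (t : ℝ) (a : ℕ) : ℝ := Real.exp (-t) * t ^ a / a.factorial

lemma poisson_nonneg {t : ℝ} (ht : 0 ≤ t) (a : ℕ) : 0 ≤ poisson t a := by
  unfold poisson; positivity

/-- The parameter of the Poisson law attached to side `j`. -/
noncomputable def sideParam (v : Fin (k + 1) → Plane) (g : Fin (k + 1) → ℝ) (n : ℕ)
    (l : Fin (k + 1) → ℝ) (j : Fin (k + 1)) : ℝ :=
  n * ((g j + g (j - 1)) / sideLength v j * width v (fun i => (n : ℝ)⁻¹ * l i) j)

open Classical in
/-- The joint density, up to a constant factor, of the rescaled distances to the sides and of the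
size vector. -/
noncomputable def scaledDensity (v : Fin (k + 1) → Plane) (g : Fin (k + 1) → ℝ) (n : ℕ)
    (s : Fin (k + 1) → ℕ) (l : Fin (k + 1) → ℝ) : ℝ :=
  if ∀ j, 0 < width v (fun i => (n : ℝ)⁻¹ * l i) j then
    Real.exp (-∑ j, rate v g j * l j) * ∏ j, ((Real.sqrt n * poisson (n * g j) (s j)) *
      (Real.sqrt n * poisson (sideParam v g n l j) (s j + s (j - 1) - 1)))
  else 0

lemma sum_normalize {f : Fin (k + 1) → ℝ} (hf : ∀ j, 0 < f j) : ∑ j, normalize f j = 1 := by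
  simp only [normalize]
  rw [← Finset.sum_div, div_self (Finset.sum_pos (fun j _ => hf j) Finset.univ_nonempty).ne']

lemma normalize_pos {f : Fin (k + 1) → ℝ} (hf : ∀ j, 0 < f j) (j : Fin (k + 1)) :
    0 < normalize f j :=
  div_pos (hf j) (Finset.sum_pos (fun j _ => hf j) Finset.univ_nonempty)

lemma sum_add_one {M : Type*} [AddCommMonoid M] (f : Fin (k + 1) → M) :
    ∑ j, f (j + 1) = ∑ j, f j :=
  Fintype.sum_equiv (Equiv.addRight 1) _ _ fun _ => rfl

lemma sum_sub_one {M : Type*} [AddCommMonoid M] (f : Fin (k + 1) → M) :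
    ∑ j, f (j - 1) = ∑ j, f j :=
  Fintype.sum_equiv (Equiv.subRight 1) _ _ fun _ => rfl

/-- The length of side `j` depends on the distances of indices `j - 1`, `j` and `j + 1`. Collecting
the coefficient of `l j` after a cyclic change of index gives the three terms of `rate`; this is
where the exponential rates come from. -/
lemma sum_sideParam (hk : 2 ≤ k) (hv : IsCcwPolygon v) {g : Fin (k + 1) → ℝ} {n : ℕ} (hn : 0 < n)
    (l : Fin (k + 1) → ℝ) :
    ∑ j, sideParam v g n l j = 2 * n * ∑ j, g j - ∑ j, rate v g j * l j := by
  have hn1 : (n : ℝ) ≠ 0 := by positivity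
  have h1 : ∀ j, sideParam v g n l j = n * (g j + g (j - 1))
      - (g j + g (j - 1)) / sideLength v j * (l (j - 1) / Real.sin (innerAngle v (j - 1)))
      - (g j + g (j - 1)) / sideLength v j *
        (l j * (Real.cot (innerAngle v (j - 1)) + Real.cot (innerAngle v j)))
      - (g j + g (j - 1)) / sideLength v j * (l (j + 1) / Real.sin (innerAngle v j)) := by
    intro j
    have hr := (sideLength_pos hk hv j).ne'
    rw [sideParam, width]
    field_simp
  simp_rw [h1, Finset.sum_sub_distrib]
  have e1 := sum_sub_one fun j => (g (j + 1) + g j) / sideLength v (j + 1) *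
    (l j / Real.sin (innerAngle v j))
  have e2 := sum_add_one fun j => (g (j - 1) + g (j - 1 - 1)) / sideLength v (j - 1) *
    (l j / Real.sin (innerAngle v (j - 1)))
  simp only [sub_add_cancel] at e1
  simp only [add_sub_cancel_right] at e2
  have h2 : ∀ j, rate v g j * l j =
      (g (j + 1) + g j) / sideLength v (j + 1) * (l j / Real.sin (innerAngle v j))
      + (g j + g (j - 1)) / sideLength v j *
        (l j * (Real.cot (innerAngle v (j - 1)) + Real.cot (innerAngle v j)))
      + (g (j - 1) + g (j - 1 - 1)) / sideLength v (j - 1) *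
        (l j / Real.sin (innerAngle v (j - 1))) := by
    intro j
    rw [rate]
    have hr := (sideLength_pos hk hv j).ne'
    have hr1 := (sideLength_pos hk hv (j + 1)).ne'
    have hr2 := (sideLength_pos hk hv (j - 1)).ne'
    have hs := (sin_innerAngle_pos hk hv j).ne'
    have hs1 := (sin_innerAngle_pos hk hv (j - 1)).ne'
    field_simp
    ring
  simp_rw [h2]
  rw [e1, e2, ← Finset.mul_sum, Finset.sum_add_distrib, sum_sub_one, Finset.sum_add_distrib,
    Finset.sum_add_distrib]
  ring

/-- The constant factor of the density of the rescaled distances and of the size vector. -/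
noncomputable def scaleConst (v : Fin (k + 1) → Plane) (f : Fin (k + 1) → ℝ) (n : ℕ) : ℝ :=
  Real.exp (3 * n) * (∑ j, f j) ^ (3 * n) / (n : ℝ) ^ (3 * n) *
    ∏ j, ((normalize f j + normalize f (j - 1)) / (sideLength v j * Real.sin (innerAngle v j)))

lemma scaleConst_pos (hk : 2 ≤ k) (hv : IsCcwPolygon v) {f : Fin (k + 1) → ℝ}
    (hf : ∀ j, 0 < f j) {n : ℕ} (hn : 0 < n) : 0 < scaleConst v f n := by
  have h1 : 0 < ∑ j, f j := Finset.sum_pos (fun j _ => hf j) Finset.univ_nonempty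
  have hn' : (0 : ℝ) < n := Nat.cast_pos.mpr hn
  refine mul_pos (by positivity) (Finset.prod_pos fun j _ => div_pos
    (add_pos (normalize_pos hf _) (normalize_pos hf _))
    (mul_pos (sideLength_pos hk hv j) (sin_innerAngle_pos hk hv j)))

/-- With `A j = n * (g j + g (j - 1)) / r j`, the system reads `n * g j * A j * A (j + 1) = (n / ∑
f) ^ 3 * sin (θ j)`. Raising this to the power `s j` and multiplying, the constants combine to `(n /
∑ f) ^ (3 * n)` because the sizes add up to `n`. -/
lemma prod_sin_eq (hk : 2 ≤ k) (hv : IsCcwPolygon v) {f : Fin (k + 1) → ℝ}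
    (hf : IsPSSolution v f) {n : ℕ} (hn : 0 < n) {s : Fin (k + 1) → ℕ} (hs : ValidSize n s) :
    ∏ j, (Real.sin (innerAngle v j) ^ s j / Real.sin (innerAngle v j)) =
      (∑ j, f j) ^ (3 * n) / (n : ℝ) ^ (3 * n) *
      ∏ j, ((normalize f j + normalize f (j - 1)) / (sideLength v j * Real.sin (innerAngle v j)) *
        n * (n * normalize f j) ^ s j *
          (n * ((normalize f j + normalize f (j - 1)) / sideLength v j)) ^ (s j + s (j - 1) - 1)) := by
  set F := ∑ j, f j with hF
  set g := normalize f with hg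
  have hF0 : 0 < F := Finset.sum_pos (fun j _ => hf.1 j) Finset.univ_nonempty
  have hn' : (0 : ℝ) < n := Nat.cast_pos.mpr hn
  set A : Fin (k + 1) → ℝ := fun j => n * ((g j + g (j - 1)) / sideLength v j) with hA
  have h1 : ∀ j, (g j + g (j - 1)) / (sideLength v j * Real.sin (innerAngle v j)) *
        n * (n * g j) ^ s j * A j ^ (s j + s (j - 1) - 1) =
      (Real.sin (innerAngle v j))⁻¹ * (n * g j) ^ s j * A j ^ s j * A j ^ s (j - 1) := by
    intro j
    -- The exponent is one less than the number of components. The missing factor `A j` is supplied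
    -- by the prefactor, which equals `A j / sin (θ j)`.
    obtain ⟨N, hN⟩ : ∃ N, s j + s (j - 1) = N + 1 := ⟨s j + s (j - 1) - 1, by have := hs.2 j; omega⟩
    rw [mul_assoc _ (A j ^ s j), ← pow_add, hN, Nat.add_sub_cancel, pow_succ]
    have e : (g j + g (j - 1)) / (sideLength v j * Real.sin (innerAngle v j)) * n =
        (Real.sin (innerAngle v j))⁻¹ * A j := by
      rw [hA]
      have hr := (sideLength_pos hk hv j).ne'
      have hs := (sin_innerAngle_pos hk hv j).ne'
      field_simp
    rw [e]; ring
  have h2 : ∏ j, A j ^ s (j - 1) = ∏ j, A (j + 1) ^ s j :=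
    (Fintype.prod_equiv (Equiv.addRight 1) (fun j => A (j + 1) ^ s j) (fun j => A j ^ s (j - 1))
      fun j => by simp).symm
  refine Eq.trans ?_ (congrArg _ (Finset.prod_congr rfl fun j _ => h1 j).symm)
  rw [Finset.prod_mul_distrib, h2, ← Finset.prod_mul_distrib]
  have h3 : ∀ j, (Real.sin (innerAngle v j))⁻¹ * (n * g j) ^ s j * A j ^ s j * A (j + 1) ^ s j =
      ((n / F) ^ 3) ^ s j * (Real.sin (innerAngle v j) ^ s j / Real.sin (innerAngle v j)) := by
    intro j
    -- The only place in the limit theorem where the equations of the system themselves are used.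
    have e : n * g j * A j * A (j + 1) = (n / F) ^ 3 * Real.sin (innerAngle v j) := by
      have h4 := hf.2 j
      have hr := (sideLength_pos hk hv j).ne'
      have hr1 := (sideLength_pos hk hv (j + 1)).ne'
      have h5 : n * g j * A j * A (j + 1) = (n / F) ^ 3 *
          (f j * (f j + f (j - 1)) * (f j + f (j + 1))) / (sideLength v j * sideLength v (j + 1)) := by
        simp only [hA, hg, normalize, ← hF, add_sub_cancel_right]
        field_simp
        ring
      rw [h5, h4]
      field_simp
    rw [mul_assoc, mul_assoc, ← mul_pow, ← mul_pow, ← mul_assoc, e, mul_pow]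
    ring
  simp_rw [h3]
  rw [Finset.prod_mul_distrib (f := fun j => ((n / F) ^ 3) ^ s j), Finset.prod_pow_eq_pow_sum, hs.1,
    ← pow_mul, ← mul_assoc, ← div_pow, ← mul_pow, div_mul_div_cancel₀ hn'.ne', div_self hF0.ne',
    one_pow, one_mul]

/-- The powers of sines are redistributed by `prod_sin_eq` into the powers required by the Poisson
probabilities. Their exponentials multiply to `exp (-3 n + ∑ m j * l j)`, whence the factors `exp (3
n)` and `exp (-∑ m j * l j)`. The two factors `√n` for each side account for one factor `n` of
`prod_sin_eq`. -/
lemma weight_eq (hk : 2 ≤ k) (hv : IsCcwPolygon v) {f : Fin (k + 1) → ℝ}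
    (hf : IsPSSolution v f) {n : ℕ} (hn : 0 < n) {s : Fin (k + 1) → ℕ} (hs : ValidSize n s)
    (l : Fin (k + 1) → ℝ) :
    weight v s (fun j => (n : ℝ)⁻¹ * l j) =
      ENNReal.ofReal (scaleConst v f n * scaledDensity v (normalize f) n s l) := by
  have hn' : (0 : ℝ) < n := Nat.cast_pos.mpr hn
  rw [weight, scaledDensity]
  set c := width v fun j => (n : ℝ)⁻¹ * l j with hc
  by_cases h : ∀ j, 0 < c j
  swap
  · rw [if_neg h, mul_zero, ENNReal.ofReal_zero]
    push Not at h
    obtain ⟨j, hj⟩ := h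
    have h0 : ∏ j, sumDens (s j + s (j - 1)) (c j) = 0 :=
      Finset.prod_eq_zero (Finset.mem_univ j) (if_neg (not_lt.mpr hj))
    rw [h0, mul_zero]
  · rw [if_pos h]
    have h1 : ∀ j, sumDens (s j + s (j - 1)) (c j) = ENNReal.ofReal
        (c j ^ (s j + s (j - 1) - 1) / (s j + s (j - 1) - 1).factorial) := fun j => by
      rw [sumDens, if_pos (h j)]
    have hcn : ∀ j, 0 ≤ c j ^ (s j + s (j - 1) - 1) / (s j + s (j - 1) - 1).factorial := fun j =>
      div_nonneg (pow_nonneg (h j).le _) (Nat.cast_nonneg _)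
    simp_rw [h1]
    rw [← ENNReal.ofReal_prod_of_nonneg fun j _ => hcn j, ← ENNReal.ofReal_mul
      (Finset.prod_nonneg fun j _ => by have := sin_innerAngle_pos hk hv j; positivity)]
    congr 1
    rw [Finset.prod_div_distrib, prod_sin_eq hk hv hf hn hs]
    set g := normalize f with hg
    have h2 : ∀ j, Real.sqrt n * poisson (n * g j) (s j) *
        (Real.sqrt n * poisson (sideParam v g n l j) (s j + s (j - 1) - 1)) =
        Real.exp (-(n * g j)) * Real.exp (-sideParam v g n l j) *
        (n * (n * g j) ^ s j * (n * ((g j + g (j - 1)) / sideLength v j)) ^ (s j + s (j - 1) - 1) *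
          (((s j).factorial : ℝ)⁻¹ *
            (c j ^ (s j + s (j - 1) - 1) / (s j + s (j - 1) - 1).factorial))) := by
      intro j
      have e : sideParam v g n l j = n * ((g j + g (j - 1)) / sideLength v j) * c j := by
        rw [sideParam, hc]; ring
      have e' : poisson (sideParam v g n l j) (s j + s (j - 1) - 1) =
          Real.exp (-sideParam v g n l j) * (n * ((g j + g (j - 1)) / sideLength v j) * c j) ^
            (s j + s (j - 1) - 1) / (s j + s (j - 1) - 1).factorial := by rw [← e, poisson]
      rw [e', poisson, mul_pow _ (c j)]
      have hsq : Real.sqrt n * Real.sqrt n = n := Real.mul_self_sqrt hn'.le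
      field_simp
      rw [sq, hsq]
    simp_rw [h2]
    have hexp : ∏ j, (Real.exp (-(n * g j)) * Real.exp (-sideParam v g n l j)) =
        Real.exp (-(3 * n) + ∑ j, rate v g j * l j) := by
      rw [Finset.prod_mul_distrib, ← Real.exp_sum, ← Real.exp_sum, ← Real.exp_add]
      congr 1
      rw [Finset.sum_neg_distrib, Finset.sum_neg_distrib, sum_sideParam hk hv hn, ← Finset.mul_sum,
        hg, sum_normalize hf.1]
      ring
    rw [Finset.prod_mul_distrib (f := fun j => Real.exp (-(n * g j)) * _), hexp, scaleConst]
    have hcancel : Real.exp (3 * n) * (Real.exp (-∑ j, rate v g j * l j) *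
        Real.exp (-(3 * n) + ∑ j, rate v g j * l j)) = 1 := by
      rw [← Real.exp_add, ← Real.exp_add, ← Real.exp_zero]
      congr 1; ring
    simp only [Finset.prod_mul_distrib, Finset.prod_inv_distrib]
    calc _ = 1 * ((∑ j, f j) ^ (3 * n) / (n : ℝ) ^ (3 * n) *
          ((∏ j, (g j + g (j - 1)) / (sideLength v j * Real.sin (innerAngle v j))) *
            (∏ _j : Fin (k + 1), (n : ℝ)) * (∏ j, (n * g j) ^ s j) *
              ∏ j, (n * ((g j + g (j - 1)) / sideLength v j)) ^ (s j + s (j - 1) - 1)) *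
            ((∏ j, ((s j).factorial : ℝ))⁻¹ *
              ∏ j, c j ^ (s j + s (j - 1) - 1) / (s j + s (j - 1) - 1).factorial)) := by ring
      _ = _ := by rw [← hcancel]; ring

end PoissonWeights

/-! ### Estimates for Poisson probabilities -/

section Poisson

/-- With `y = √(t / a)`, the inequality `y ≤ exp (y - 1)` bounds `t ^ a` and Stirling's lower bound
controls the factorial. In the variables `√a` and `√t` the Gaussian bound is uniform in the
parameter. -/
lemma poisson_le {t : ℝ} (ht : 0 ≤ t) (a : ℕ) :
    poisson t a ≤ Real.exp (-(Real.sqrt a - Real.sqrt t) ^ 2) / Real.sqrt (a + 1) := by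
  rcases Nat.eq_zero_or_pos a with rfl | ha
  · simp [poisson, Real.sq_sqrt ht]
  have ha' : (0 : ℝ) < a := Nat.cast_pos.mpr ha
  have ha1 : (1 : ℝ) ≤ a := Nat.one_le_cast.mpr ha
  set y := Real.sqrt t / Real.sqrt a with hy
  have hsa : 0 < Real.sqrt a := Real.sqrt_pos.mpr ha'
  have h1 : t ^ a ≤ (a : ℝ) ^ a * Real.exp (2 * a * (y - 1)) := by
    have h2 : t = a * y ^ 2 := by
      rw [hy, div_pow, Real.sq_sqrt ht, Real.sq_sqrt ha'.le]; field_simp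
    have h3 : y ≤ Real.exp (y - 1) := by linarith [Real.add_one_le_exp (y - 1)]
    have hy0 : 0 ≤ y := by positivity
    rw [h2, mul_pow]
    refine mul_le_mul_of_nonneg_left ?_ (by positivity)
    calc (y ^ 2) ^ a = y ^ (2 * a) := by rw [pow_mul]
      _ ≤ Real.exp (y - 1) ^ (2 * a) := pow_le_pow_left₀ hy0 h3 _
      _ = _ := by rw [← Real.exp_nat_mul]; push_cast; ring_nf
  have h4 := Stirling.le_factorial_stirling a
  have h5 : Real.sqrt (a + 1) * (a / Real.exp 1) ^ a ≤ a.factorial := by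
    refine le_trans (mul_le_mul_of_nonneg_right (Real.sqrt_le_sqrt ?_) (by positivity)) h4
    nlinarith [Real.pi_gt_three]
  have h6 : (a : ℝ) ^ a = (a / Real.exp 1) ^ a * Real.exp a := by
    rw [div_pow, ← Real.exp_nat_mul, mul_one]
    field_simp
  have h7 : Real.exp (-t) * Real.exp a * Real.exp (2 * a * (y - 1)) =
      Real.exp (-(Real.sqrt a - Real.sqrt t) ^ 2) := by
    rw [← Real.exp_add, ← Real.exp_add]
    congr 1
    have h8 : (a : ℝ) * y = Real.sqrt a * Real.sqrt t := by
      rw [hy]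
      nth_rewrite 1 [← Real.mul_self_sqrt ha'.le]
      field_simp
    have h9 := Real.sq_sqrt ha'.le
    have h10 := Real.sq_sqrt ht
    linear_combination 2 * h8 + h9 + h10
  have hs1 : 0 < Real.sqrt (a + 1) := Real.sqrt_pos.mpr (by positivity)
  rw [poisson, div_le_div_iff₀ (by positivity) hs1, ← h7]
  calc Real.exp (-t) * t ^ a * Real.sqrt (a + 1)
      ≤ Real.exp (-t) * ((a : ℝ) ^ a * Real.exp (2 * a * (y - 1))) * Real.sqrt (a + 1) := by gcongr
    _ = Real.exp (-t) * Real.exp a * Real.exp (2 * a * (y - 1)) *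
        (Real.sqrt (a + 1) * (a / Real.exp 1) ^ a) := by rw [h6]; ring
    _ ≤ _ := by gcongr

/-- With `x = (a - t) / a` the exponent is `a * (x + log (1 - x))`, close to `-a * x ^ 2 / 2`; this
isolates the Gaussian term. -/
lemma poisson_eq_stirling {t : ℝ} (ht : 0 < t) {a : ℕ} (ha : 0 < a) :
    poisson t a = (Stirling.stirlingSeq a)⁻¹ * (Real.sqrt (2 * a))⁻¹ *
      Real.exp (a * ((a - t) / a + Real.log (1 - (a - t) / a))) := by
  have ha' : (0 : ℝ) < a := Nat.cast_pos.mpr ha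
  have hf : (0 : ℝ) < a.factorial := by positivity
  have h1 : (1 : ℝ) - (a - t) / a = t / a := by field_simp; ring
  have h2 : Real.exp (a * ((a - t) / a + Real.log (1 - (a - t) / a))) =
      Real.exp (-t) * t ^ a / (a / Real.exp 1) ^ a := by
    rw [h1, mul_add, mul_div_cancel₀ _ ha'.ne', Real.exp_add, sub_eq_add_neg, Real.exp_add,
      Real.exp_nat_mul, Real.exp_log (by positivity), div_pow, div_pow, ← Real.exp_nat_mul, mul_one]
    field_simp
  have hs : 0 < Real.sqrt (2 * a) := Real.sqrt_pos.mpr (by positivity)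
  rw [h2, Stirling.stirlingSeq, poisson]
  field_simp

/-- The local limit theorem for Poisson laws. -/
lemma tendsto_poisson {ι : Type*} {L : Filter ι} {N t : ι → ℝ} {a : ι → ℕ} {μ y : ℝ} (hμ : 0 < μ)
    (hN : Tendsto N L atTop) (ht : Tendsto (fun i => t i / N i) L (𝓝 μ))
    (ha : Tendsto (fun i => (a i - t i) / Real.sqrt (N i)) L (𝓝 y)) :
    Tendsto (fun i => Real.sqrt (N i) * poisson (t i) (a i)) L
      (𝓝 (Real.exp (-y ^ 2 / (2 * μ)) / Real.sqrt (2 * Real.pi * μ))) := by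
  have hNpos : ∀ᶠ i in L, 0 < N i := hN.eventually_gt_atTop 0
  have hsq : Tendsto (fun i => Real.sqrt (N i)) L atTop := Real.tendsto_sqrt_atTop.comp hN
  have hinv : Tendsto (fun i => (Real.sqrt (N i))⁻¹) L (𝓝 0) := tendsto_inv_atTop_zero.comp hsq
  have haN : Tendsto (fun i => (a i : ℝ) / N i) L (𝓝 μ) := by
    have h1 := ht.add (ha.mul hinv)
    rw [mul_zero, add_zero] at h1
    refine h1.congr' ?_
    filter_upwards [hNpos] with i hi
    have := Real.mul_self_sqrt hi.le
    have h0 : 0 < Real.sqrt (N i) := Real.sqrt_pos.mpr hi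
    rw [div_mul_eq_mul_div, ← div_eq_mul_inv, div_div, this]
    ring
  have hat : Tendsto (fun i => (a i : ℝ)) L atTop := by
    refine (haN.pos_mul_atTop hμ hN).congr' ?_
    filter_upwards [hNpos] with i hi
    field_simp
  have hat' : Tendsto a L atTop := tendsto_natCast_atTop_iff.mp hat
  have hapos : ∀ᶠ i in L, 0 < a i := hat'.eventually_gt_atTop 0
  have htpos : ∀ᶠ i in L, 0 < t i := by
    filter_upwards [ht.eventually_const_lt hμ, hNpos] with i h1 h2
    exact (div_pos_iff_of_pos_right h2).mp h1
  have hNa : Tendsto (fun i => N i / a i) L (𝓝 μ⁻¹) := by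
    refine (haN.inv₀ hμ.ne').congr fun i => ?_
    rw [inv_div]
  set x : ι → ℝ := fun i => (a i - t i) / a i with hx
  have hax2 : Tendsto (fun i => a i * x i ^ 2) L (𝓝 (y ^ 2 * μ⁻¹)) := by
    refine ((ha.pow 2).mul hNa).congr' ?_
    filter_upwards [hNpos, hapos] with i h1 h2
    have h3 : (0 : ℝ) < a i := Nat.cast_pos.mpr h2
    simp only [hx]
    rw [div_pow, Real.sq_sqrt h1.le]
    field_simp
  have hx0 : Tendsto x L (𝓝 0) := by
    have h1 := (ha.mul hNa).mul hinv
    rw [mul_zero] at h1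
    refine h1.congr' ?_
    filter_upwards [hNpos, hapos] with i h1 h2
    have h3 : (0 : ℝ) < a i := Nat.cast_pos.mpr h2
    have h4 : 0 < Real.sqrt (N i) := Real.sqrt_pos.mpr h1
    have h5 := Real.sq_sqrt h1.le
    simp only [hx]
    field_simp
    rw [h5]
  have hlog : Tendsto (fun i => a i * (x i + Real.log (1 - x i))) L (𝓝 (-y ^ 2 / (2 * μ))) := by
    -- The Taylor remainder of order three is at most `a * x ^ 2 * |x| / (1 - |x|)`, where `a * x ^
    -- 2` converges and `x` tends to zero.
    have herr : Tendsto (fun i => a i * (x i + x i ^ 2 / 2 + Real.log (1 - x i))) L (𝓝 0) := by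
      have hb : Tendsto (fun i => a i * x i ^ 2 * (|x i| / (1 - |x i|))) L (𝓝 0) := by
        have h1 := hx0.abs
        rw [abs_zero] at h1
        have h2 := hax2.mul (h1.div (h1.const_sub 1) (by norm_num))
        simpa using h2
      refine squeeze_zero_norm' ?_ hb
      have hx1 : ∀ᶠ i in L, |x i| < 1 := by
        have h1 := hx0.abs
        rw [abs_zero] at h1
        exact h1.eventually_lt_const (by norm_num)
      filter_upwards [hx1] with i hi
      have h1 := Real.abs_log_sub_add_sum_range_le hi 2
      simp only [Finset.sum_range_succ, Finset.sum_range_zero] at h1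
      norm_num at h1
      rw [norm_mul, Real.norm_eq_abs, Real.norm_eq_abs, Nat.abs_cast, mul_assoc]
      refine mul_le_mul_of_nonneg_left (h1.trans_eq ?_) (Nat.cast_nonneg _)
      rw [← sq_abs (x i)]; ring
    have h2 := herr.sub (hax2.div_const 2)
    have h3 : (0 : ℝ) - y ^ 2 * μ⁻¹ / 2 = -y ^ 2 / (2 * μ) := by field_simp; ring
    rw [h3] at h2
    refine h2.congr fun i => ?_
    ring
  have hst : Tendsto (fun i => (Stirling.stirlingSeq (a i))⁻¹) L (𝓝 (Real.sqrt Real.pi)⁻¹) :=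
    (Stirling.tendsto_stirlingSeq_sqrt_pi.comp hat').inv₀ (Real.sqrt_pos.mpr Real.pi_pos).ne'
  have hsq2 : Tendsto (fun i => Real.sqrt (N i / a i / 2)) L (𝓝 (Real.sqrt (μ⁻¹ / 2))) :=
    (Real.continuous_sqrt.tendsto _).comp (hNa.div_const 2)
  have hfin := (hst.mul hsq2).mul ((Real.continuous_exp.tendsto _).comp hlog)
  have hval : (Real.sqrt Real.pi)⁻¹ * Real.sqrt (μ⁻¹ / 2) * Real.exp (-y ^ 2 / (2 * μ)) =
      Real.exp (-y ^ 2 / (2 * μ)) / Real.sqrt (2 * Real.pi * μ) := by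
    rw [← Real.sqrt_inv, ← Real.sqrt_mul (by positivity), div_eq_mul_inv _ (Real.sqrt _),
      ← Real.sqrt_inv, mul_comm]
    congr 2
    field_simp
  rw [hval] at hfin
  refine hfin.congr' ?_
  filter_upwards [hNpos, hapos, htpos] with i h1 h2 h3
  have h4 : (0 : ℝ) < a i := Nat.cast_pos.mpr h2
  rw [poisson_eq_stirling h3 h2, div_div, mul_comm (a i : ℝ) 2, Real.sqrt_div h1.le]
  simp only [Function.comp, hx]
  ring

/-- Either `s + 1` is at least `n * g / 2`, and the quotient is bounded, or `s` is so far below `n *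
g` that `√n` itself is at most a constant times `|X| + K`. -/
lemma sqrt_div_sqrt_le {n : ℝ} (hn : 1 ≤ n) {g K X s : ℝ} (hg : 0 < g) (hs : 0 ≤ s) (hK : 0 ≤ K)
    (h : |s - n * g - Real.sqrt n * X| ≤ K) :
    Real.sqrt n / Real.sqrt (s + 1) ≤ (Real.sqrt (2 / g) + 2 / g * (1 + K)) * (1 + |X|) := by
  have hn0 : 0 < n := by linarith
  have hsn : 1 ≤ Real.sqrt n := Real.one_le_sqrt.mpr hn
  have hss : 1 ≤ Real.sqrt (s + 1) := Real.one_le_sqrt.mpr (by linarith)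
  have hX := abs_nonneg X
  have h2g : 0 < 2 / g := by positivity
  by_cases hc : n * g / 2 ≤ s + 1
  · have h1 : Real.sqrt n / Real.sqrt (s + 1) ≤ Real.sqrt (2 / g) := by
      rw [← Real.sqrt_div hn0.le]
      refine Real.sqrt_le_sqrt ?_
      rw [div_le_div_iff₀ (by linarith) hg]
      linarith
    have h2 := Real.sqrt_nonneg (2 / g)
    have h3 : 0 ≤ 2 / g * (1 + K) := by positivity
    nlinarith [mul_nonneg h3 hX, mul_nonneg h2 hX]
  · push Not at hc
    have h1 : Real.sqrt n / Real.sqrt (s + 1) ≤ Real.sqrt n :=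
      div_le_self (by linarith) hss
    have h2 : Real.sqrt n * Real.sqrt n = n := Real.mul_self_sqrt hn0.le
    have h3 : Real.sqrt n * (g / 2) ≤ |X| + K := by
      have h4 := (abs_le.mp h).1
      have h5 := neg_abs_le X
      by_contra hcon
      push Not at hcon
      have h6 : Real.sqrt n * (|X| + K) < n * g / 2 := by
        rw [← h2]
        nlinarith
      nlinarith [mul_nonneg (by linarith : 0 ≤ Real.sqrt n - 1) hK,
        mul_le_mul_of_nonneg_left h5 (by linarith : 0 ≤ Real.sqrt n)]
    have h4 : Real.sqrt n ≤ 2 / g * (|X| + K) := by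
      rw [div_mul_eq_mul_div, le_div_iff₀ hg]
      linarith
    have h5 := Real.sqrt_nonneg (2 / g)
    have h6 : 2 / g * (|X| + K) ≤ 2 / g * (1 + K) * (1 + |X|) := by
      rw [mul_assoc]
      refine mul_le_mul_of_nonneg_left ?_ h2g.le
      nlinarith [mul_nonneg hK hX]
    nlinarith [mul_nonneg h5 hX]

/-- The Gaussian factor is discarded, so the bound holds for every parameter `t`. This is needed for
the factors whose parameter depends on the distances, over which there is no uniform control. -/
lemma sqrt_mul_poisson_le {n : ℝ} (hn : 1 ≤ n) {g K X t : ℝ} {s : ℕ} (hg : 0 < g) (hK : 0 ≤ K)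
    (h : |s - n * g - Real.sqrt n * X| ≤ K) (ht : 0 ≤ t) :
    Real.sqrt n * poisson t s ≤ (Real.sqrt (2 / g) + 2 / g * (1 + K)) * Real.exp |X| := by
  have h1 := poisson_le ht s
  have h2 : Real.exp (-(Real.sqrt s - Real.sqrt t) ^ 2) ≤ 1 :=
    Real.exp_le_one_iff.mpr (by nlinarith [sq_nonneg (Real.sqrt s - Real.sqrt t)])
  have h3 := sqrt_div_sqrt_le hn hg (Nat.cast_nonneg s) hK h
  calc Real.sqrt n * poisson t s ≤ Real.sqrt n * (1 / Real.sqrt (s + 1)) := by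
        refine mul_le_mul_of_nonneg_left (h1.trans ?_) (Real.sqrt_nonneg _)
        gcongr
    _ = Real.sqrt n / Real.sqrt (s + 1) := by ring
    _ ≤ _ := h3
    _ ≤ _ := by
      refine mul_le_mul_of_nonneg_left ?_ (by positivity)
      linarith [Real.add_one_le_exp |X|]

/-- Since `s ≤ n` and `g ≤ 1`, the difference of square roots is at least `u / 2` in absolute value,
with `u = |s - n * g| / √n`. Then `u ^ 2 / 4 ≥ A * u - A ^ 2` gives exponential decay at any
prescribed rate. -/
lemma sqrt_mul_poisson_le' {n : ℝ} (hn : 1 ≤ n) {g K X A : ℝ} {s : ℕ} (hg : 0 < g) (hg1 : g ≤ 1)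
    (hK : 0 ≤ K) (h : |s - n * g - Real.sqrt n * X| ≤ K) (hs : s ≤ n) (hA : 0 ≤ A) :
    Real.sqrt n * poisson (n * g) s ≤
      (Real.sqrt (2 / g) + 2 / g * (1 + K)) * Real.exp |X| *
        (Real.exp (A ^ 2 + A * K) * Real.exp (-(A * |X|))) := by
  have hn0 : 0 < n := by linarith
  have ht : 0 ≤ n * g := by positivity
  have h1 := poisson_le ht s
  have h3 := sqrt_div_sqrt_le hn hg (Nat.cast_nonneg s) hK h
  have hsn : 1 ≤ Real.sqrt n := Real.one_le_sqrt.mpr hn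
  have hsq := Real.mul_self_sqrt hn0.le
  have h2 : Real.exp (-(Real.sqrt s - Real.sqrt (n * g)) ^ 2) ≤
      Real.exp (A ^ 2 + A * K) * Real.exp (-(A * |X|)) := by
    rw [← Real.exp_add]
    refine Real.exp_le_exp.mpr ?_
    set u := |(s : ℝ) - n * g| / Real.sqrt n with hu
    have hu0 : 0 ≤ u := by positivity
    have hX : |X| ≤ u + K := by
      have h4 : Real.sqrt n * |X| ≤ |(s : ℝ) - n * g| + K := by
        have h5 := abs_sub_abs_le_abs_sub (Real.sqrt n * X) (s - n * g)
        rw [abs_mul, abs_of_pos (by linarith : 0 < Real.sqrt n),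
          abs_sub_comm (Real.sqrt n * X)] at h5
        linarith
      have h6 : Real.sqrt n * (u + K) = |(s : ℝ) - n * g| + Real.sqrt n * K := by
        rw [hu]; field_simp
      have h7 : Real.sqrt n * |X| ≤ Real.sqrt n * (u + K) := by
        rw [h6]; nlinarith
      exact le_of_mul_le_mul_left h7 (by linarith)
    have h8 : u ^ 2 / 4 ≤ (Real.sqrt s - Real.sqrt (n * g)) ^ 2 := by
      have e1 : (s : ℝ) - n * g =
          (Real.sqrt s - Real.sqrt (n * g)) * (Real.sqrt s + Real.sqrt (n * g)) := by
        have := Real.sq_sqrt (Nat.cast_nonneg (α := ℝ) s)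
        have := Real.sq_sqrt ht
        nlinarith
      have e2 : Real.sqrt s + Real.sqrt (n * g) ≤ 2 * Real.sqrt n := by
        have := Real.sqrt_le_sqrt hs
        have := Real.sqrt_le_sqrt (show n * g ≤ n by nlinarith)
        linarith
      have e3 : 0 ≤ Real.sqrt s + Real.sqrt (n * g) := by positivity
      have e4 : (Real.sqrt s + Real.sqrt (n * g)) ^ 2 ≤ 4 * n := by
        nlinarith
      rw [hu, div_pow, Real.sq_sqrt hn0.le, sq_abs, e1, mul_pow, div_div, div_le_iff₀ (by positivity)]
      nlinarith [sq_nonneg (Real.sqrt s - Real.sqrt (n * g))]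
    nlinarith [sq_nonneg (u / 2 - A), mul_le_mul_of_nonneg_left hX hA]
  calc Real.sqrt n * poisson (n * g) s ≤ Real.sqrt n * ((Real.exp (A ^ 2 + A * K) *
          Real.exp (-(A * |X|))) / Real.sqrt (s + 1)) := by
        refine mul_le_mul_of_nonneg_left (h1.trans ?_) (Real.sqrt_nonneg _)
        gcongr
    _ = Real.sqrt n / Real.sqrt (s + 1) *
        (Real.exp (A ^ 2 + A * K) * Real.exp (-(A * |X|))) := by ring
    _ ≤ _ := by
      refine mul_le_mul_of_nonneg_right (h3.trans ?_) (by positivity)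
      refine mul_le_mul_of_nonneg_left ?_ (by positivity)
      linarith [Real.add_one_le_exp |X|]

end Poisson

/-! ### The limit of the density of the rescaled variables -/

section DensityLimit

variable {k : ℕ} {v : Fin (k + 1) → Plane}

/-- The vector with entries `x`, completed by a last entry so that the sum is zero. -/
noncomputable def extend (x : Fin k → ℝ) : Fin (k + 1) → ℝ := Fin.snoc x (-∑ a, x a)

lemma extend_castSucc (x : Fin k → ℝ) (a : Fin k) : extend x a.castSucc = x a := by simp [extend]

lemma extend_last (x : Fin k → ℝ) : extend x (Fin.last k) = -∑ a, x a := by simp [extend]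

lemma abs_extend_le (x : Fin k → ℝ) (j : Fin (k + 1)) : |extend x j| ≤ ∑ a, |x a| := by
  refine Fin.lastCases ?_ (fun a => ?_) j
  · rw [extend_last, abs_neg]
    exact Finset.abs_sum_le_sum_abs _ _
  · rw [extend_castSucc]
    exact Finset.single_le_sum (f := fun a => |x a|) (fun _ _ => abs_nonneg _) (Finset.mem_univ a)

/-- Each integer part costs at most one; the last entry, determined by the sum, accumulates the `k`
errors. -/
lemma sizeOfIndex_close (hk : 1 ≤ k) {g : Fin (k + 1) → ℝ} (hg : ∑ j, g j = 1) {n : ℕ}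
    {x : Fin k → ℝ} (h : ValidIndex n (indexAt g n x)) (j : Fin (k + 1)) :
    |(sizeOfIndex n (indexAt g n x) j : ℝ) - n * g j - Real.sqrt n * extend x j| ≤ k := by
  have hk' : (1 : ℝ) ≤ k := Nat.one_le_cast.mpr hk
  have hz : ∀ a, n * g a.castSucc + Real.sqrt n * x a - 1 < indexAt g n x a ∧
      (indexAt g n x a : ℝ) ≤ n * g a.castSucc + Real.sqrt n * x a := fun a =>
    ⟨Int.sub_one_lt_floor _, Int.floor_le _⟩
  refine Fin.lastCases ?_ (fun a => ?_) j
  · have h1 : (sizeOfIndex n (indexAt g n x) (Fin.last k) : ℝ) =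
        n - ∑ a, (indexAt g n x a : ℝ) := by
      rw [sizeOfIndex, Fin.snoc_last]
      have := Int.toNat_of_nonneg (show 0 ≤ (n : ℤ) - ∑ a, indexAt g n x a by linarith [h.2.1])
      have := congrArg (fun z : ℤ => (z : ℝ)) this
      push_cast at this
      exact this
    have h2 : g (Fin.last k) = 1 - ∑ a : Fin k, g a.castSucc := by
      rw [Fin.sum_univ_castSucc] at hg; linarith
    have h3 : (n : ℝ) - ∑ a, (indexAt g n x a : ℝ) - n * g (Fin.last k)
        - Real.sqrt n * extend x (Fin.last k) =
        ∑ a, (n * g a.castSucc + Real.sqrt n * x a - indexAt g n x a) := by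
      rw [extend_last, h2, Finset.sum_sub_distrib, Finset.sum_add_distrib, ← Finset.mul_sum,
        ← Finset.mul_sum]
      ring
    rw [h1, h3]
    refine (Finset.abs_sum_le_sum_abs _ _).trans ?_
    calc ∑ a, |n * g a.castSucc + Real.sqrt n * x a - indexAt g n x a| ≤ ∑ _a : Fin k, (1 : ℝ) :=
          Finset.sum_le_sum fun a _ => abs_le.mpr ⟨by linarith [(hz a).2], by linarith [(hz a).1]⟩
      _ = k := by simp
  · have h1 : (sizeOfIndex n (indexAt g n x) a.castSucc : ℝ) = indexAt g n x a := by
      rw [sizeOfIndex, Fin.snoc_castSucc]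
      exact_mod_cast congrArg (fun z : ℤ => (z : ℝ)) (Int.toNat_of_nonneg (h.1 a))
    rw [h1, extend_castSucc]
    exact abs_le.mpr ⟨by linarith [(hz a).1], by linarith [(hz a).2]⟩

lemma pairSum_close (hk : 1 ≤ k) {g : Fin (k + 1) → ℝ} (hg : ∑ j, g j = 1) {n : ℕ}
    {x : Fin k → ℝ} (h : ValidIndex n (indexAt g n x)) (j : Fin (k + 1)) :
    |((sizeOfIndex n (indexAt g n x) j + sizeOfIndex n (indexAt g n x) (j - 1) - 1 : ℕ) : ℝ)
      - n * (g j + g (j - 1)) - Real.sqrt n * (extend x j + extend x (j - 1))| ≤ 2 * k + 1 := by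
  have h1 := abs_le.mp (sizeOfIndex_close hk hg h j)
  have h2 := abs_le.mp (sizeOfIndex_close hk hg h (j - 1))
  have h3 : 1 ≤ sizeOfIndex n (indexAt g n x) j + sizeOfIndex n (indexAt g n x) (j - 1) := h.2.2 j
  rw [Nat.cast_sub h3, Nat.cast_add, Nat.cast_one, abs_le]
  constructor <;> nlinarith

lemma scaledDensity_nonneg (hk : 2 ≤ k) (hv : IsCcwPolygon v) {g : Fin (k + 1) → ℝ}
    (hg : ∀ j, 0 < g j) (n : ℕ) (s : Fin (k + 1) → ℕ) (l : Fin (k + 1) → ℝ) :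
    0 ≤ scaledDensity v g n s l := by
  rw [scaledDensity]
  split_ifs with h
  · refine mul_nonneg (Real.exp_pos _).le (Finset.prod_nonneg fun j _ => mul_nonneg
      (mul_nonneg (Real.sqrt_nonneg _) (poisson_nonneg ?_ _))
      (mul_nonneg (Real.sqrt_nonneg _) (poisson_nonneg ?_ _)))
    · exact mul_nonneg (Nat.cast_nonneg _) (hg j).le
    · have := hg j
      have := hg (j - 1)
      have := sideLength_pos hk hv j
      have := h j
      unfold sideParam
      positivity
  · exact le_rfl

/-- All factors are allowed to grow exponentially in `S = ∑ |x a|`, and this growth is beaten by the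
decay of the Poisson factors of the first `k` sizes, whose rate is free. -/
lemma scaledDensity_le (hk : 2 ≤ k) (hv : IsCcwPolygon v) {g : Fin (k + 1) → ℝ}
    (hg : ∀ j, 0 < g j) (hg1 : ∑ j, g j = 1) : ∃ C : ℝ, 0 < C ∧ ∀ (n : ℕ) (x : Fin k → ℝ)
      (l : Fin (k + 1) → ℝ), 0 < n → ValidIndex n (indexAt g n x) →
      scaledDensity v g n (sizeOfIndex n (indexAt g n x)) l ≤
        C * (Real.exp (-∑ j, rate v g j * l j) * Real.exp (-∑ a, |x a|)) := by
  set c : Fin (k + 1) → ℝ := fun j => Real.sqrt (2 / g j) + 2 / g j * (1 + k) with hc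
  set c' : Fin (k + 1) → ℝ := fun j =>
    Real.sqrt (2 / (g j + g (j - 1))) + 2 / (g j + g (j - 1)) * (1 + (2 * k + 1)) with hc'
  have hcpos : ∀ j, 0 < c j := fun j => by have := hg j; simp only [hc]; positivity
  have hc'pos : ∀ j, 0 < c' j := fun j => by
    have := hg j; have := hg (j - 1); simp only [hc']; positivity
  -- Each of the `k + 1` sides costs `exp (3 * S)`: one `S` for the size and two for the sum of
  -- adjacent sizes. The decay `exp (-A * S)` leaves exactly `exp (-S)`.
  set A : ℝ := 3 * (k + 1) + 1 with hA
  set E : ℝ := Real.exp (A ^ 2 + A * k) with hE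
  refine ⟨(∏ a : Fin k, c a.castSucc * c' a.castSucc * E) * (c (Fin.last k) * c' (Fin.last k)),
    ?_, fun n x l hn hx => ?_⟩
  · exact mul_pos (Finset.prod_pos fun a _ => mul_pos (mul_pos (hcpos _) (hc'pos _))
      (Real.exp_pos _)) (mul_pos (hcpos _) (hc'pos _))
  have hn1 : (1 : ℝ) ≤ n := Nat.one_le_cast.mpr hn
  set s := sizeOfIndex n (indexAt g n x) with hs
  set S := ∑ a, |x a| with hS
  have hRHS : 0 ≤ (∏ a : Fin k, c a.castSucc * c' a.castSucc * E) *
      (c (Fin.last k) * c' (Fin.last k)) *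
      (Real.exp (-∑ j, rate v g j * l j) * Real.exp (-S)) := by
    refine mul_nonneg (mul_nonneg (Finset.prod_nonneg fun a _ => ?_) ?_) (by positivity)
    · exact mul_nonneg (mul_nonneg (hcpos _).le (hc'pos _).le) (Real.exp_pos _).le
    · exact mul_nonneg (hcpos _).le (hc'pos _).le
  rw [scaledDensity]
  split_ifs with hw
  swap
  · exact hRHS
  have hpar : ∀ j, 0 ≤ sideParam v g n l j := fun j => by
    have := hg j
    have := hg (j - 1)
    have := sideLength_pos hk hv j
    have := hw j
    unfold sideParam
    positivity
  have hs1 : ∀ j, (s j : ℝ) ≤ n := fun j => by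
    have h1 := hx.validSize.1
    have h2 := Finset.single_le_sum (f := s) (fun _ _ => Nat.zero_le _) (Finset.mem_univ j)
    rw [h1] at h2
    exact_mod_cast h2
  have hgle : ∀ j, g j ≤ 1 := fun j => by
    rw [← hg1]; exact Finset.single_le_sum (fun i _ => (hg i).le) (Finset.mem_univ j)
  have hS2 : ∀ j, |extend x j + extend x (j - 1)| ≤ 2 * S := fun j => by
    have h1 := abs_extend_le x j
    have h2 := abs_extend_le x (j - 1)
    have h3 := abs_add_le (extend x j) (extend x (j - 1))
    linarith
  have hp1 : ∀ j, 0 ≤ Real.sqrt n * poisson (n * g j) (s j) := fun j =>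
    mul_nonneg (Real.sqrt_nonneg _) (poisson_nonneg (mul_nonneg (Nat.cast_nonneg _) (hg j).le) _)
  have hp2 : ∀ j, 0 ≤ Real.sqrt n * poisson (sideParam v g n l j) (s j + s (j - 1) - 1) := fun j =>
    mul_nonneg (Real.sqrt_nonneg _) (poisson_nonneg (hpar j) _)
  have hb2 : ∀ j, Real.sqrt n * poisson (sideParam v g n l j) (s j + s (j - 1) - 1) ≤
      c' j * Real.exp (2 * S) := fun j => by
    refine (sqrt_mul_poisson_le hn1 (add_pos (hg j) (hg (j - 1))) (by positivity)
      (pairSum_close (by omega) hg1 hx j) (hpar j)).trans ?_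
    exact mul_le_mul_of_nonneg_left (Real.exp_le_exp.mpr (hS2 j)) (hc'pos j).le
  have hb1 : ∀ j, Real.sqrt n * poisson (n * g j) (s j) ≤ c j * Real.exp S := fun j => by
    refine (sqrt_mul_poisson_le hn1 (hg j) (Nat.cast_nonneg k)
      (sizeOfIndex_close (by omega) hg1 hx j) (mul_nonneg (by linarith) (hg j).le)).trans ?_
    exact mul_le_mul_of_nonneg_left (Real.exp_le_exp.mpr (abs_extend_le x j)) (hcpos j).le
  have hb3 : ∀ a : Fin k, Real.sqrt n * poisson (n * g a.castSucc) (s a.castSucc) ≤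
      c a.castSucc * Real.exp S * (E * Real.exp (-(A * |x a|))) := fun a => by
    have h1 := sqrt_mul_poisson_le' hn1 (A := A) (hg a.castSucc) (hgle _) (Nat.cast_nonneg k)
      (sizeOfIndex_close (by omega) hg1 hx a.castSucc) (hs1 _) (by positivity)
    have h2 := abs_extend_le x a.castSucc
    rw [extend_castSucc] at h1 h2
    refine h1.trans (mul_le_mul_of_nonneg_right ?_ (by positivity))
    exact mul_le_mul_of_nonneg_left (Real.exp_le_exp.mpr h2) (hcpos _).le
  have hprod : ∏ j, ((Real.sqrt n * poisson (n * g j) (s j)) *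
      (Real.sqrt n * poisson (sideParam v g n l j) (s j + s (j - 1) - 1))) ≤
      (∏ a : Fin k, (c a.castSucc * c' a.castSucc * E) *
        (Real.exp (3 * S) * Real.exp (-(A * |x a|)))) *
        (c (Fin.last k) * c' (Fin.last k) * Real.exp (3 * S)) := by
    have e3 : Real.exp (3 * S) = Real.exp S * Real.exp (2 * S) := by
      rw [← Real.exp_add]; congr 1; ring
    rw [Fin.prod_univ_castSucc]
    refine mul_le_mul (Finset.prod_le_prod (fun a _ => mul_nonneg (hp1 _) (hp2 _)) fun a _ => ?_)
      ?_ (mul_nonneg (hp1 _) (hp2 _)) (Finset.prod_nonneg fun a _ => ?_)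
    · refine (mul_le_mul (hb3 a) (hb2 _) (hp2 _) ?_).trans_eq ?_
      · have := hcpos a.castSucc; positivity
      · rw [e3]; ring
    · refine (mul_le_mul (hb1 _) (hb2 _) (hp2 _) ?_).trans_eq ?_
      · have := hcpos (Fin.last k); positivity
      · rw [e3]; ring
    · have := hcpos a.castSucc; have := hc'pos a.castSucc; positivity
  have hexp : (∏ a : Fin k, Real.exp (3 * S) * Real.exp (-(A * |x a|))) * Real.exp (3 * S) =
      Real.exp (-S) := by
    rw [Finset.prod_mul_distrib, Finset.prod_const, Finset.card_univ, Fintype.card_fin,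
      ← Real.exp_nat_mul, ← Real.exp_sum, ← Real.exp_add, ← Real.exp_add, Finset.sum_neg_distrib,
      ← Finset.mul_sum, hA]
    congr 1
    ring
  calc _ ≤ Real.exp (-∑ j, rate v g j * l j) * _ :=
        mul_le_mul_of_nonneg_left hprod (Real.exp_pos _).le
    _ = _ := by
      rw [← hexp, Finset.prod_mul_distrib (f := fun a : Fin k => c a.castSucc * c' a.castSucc * E)]
      ring

/-- The limit of the densities. -/
noncomputable def limitFactor (v : Fin (k + 1) → Plane) (g : Fin (k + 1) → ℝ)
    (l : Fin (k + 1) → ℝ) (x : Fin k → ℝ) : ℝ :=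
  Real.exp (-∑ j, rate v g j * l j) * ∏ j,
    (Real.exp (-extend x j ^ 2 / (2 * g j)) / Real.sqrt (2 * Real.pi * g j) *
      (Real.exp (-(extend x j + extend x (j - 1)) ^ 2 / (2 * (g j + g (j - 1)))) /
        Real.sqrt (2 * Real.pi * (g j + g (j - 1)))))

lemma tendsto_sqrt_natCast : Tendsto (fun n : ℕ => Real.sqrt n) atTop atTop :=
  Real.tendsto_sqrt_atTop.comp tendsto_natCast_atTop_atTop

lemma eventually_validIndex {g : Fin (k + 1) → ℝ} (hg : ∀ j, 0 < g j)
    (hg1 : ∑ j, g j = 1) (x : Fin k → ℝ) : ∀ᶠ n : ℕ in atTop, ValidIndex n (indexAt g n x) := by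
  have hdiv : Tendsto (fun n : ℕ => (Real.sqrt n)⁻¹) atTop (𝓝 0) :=
    tendsto_inv_atTop_zero.comp tendsto_sqrt_natCast
  have hlim : ∀ a : Fin k, Tendsto (fun n : ℕ => g a.castSucc + (Real.sqrt n)⁻¹ * x a) atTop
      (𝓝 (g a.castSucc)) := fun a => by
    have := (hdiv.mul_const (x a)).const_add (g a.castSucc)
    simpa using this
  -- Entries at least one, rather than nonnegative, also give positive sums of adjacent sizes.
  have h1 : ∀ a : Fin k, ∀ᶠ n : ℕ in atTop, 1 ≤ indexAt g n x a := by
    intro a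
    have h2 : Tendsto (fun n : ℕ => (n : ℝ) * (g a.castSucc + (Real.sqrt n)⁻¹ * x a)) atTop atTop :=
      tendsto_natCast_atTop_atTop.atTop_mul_pos (hg _) (hlim a)
    filter_upwards [h2.eventually_ge_atTop 1, eventually_gt_atTop 0] with n hn hn0
    rw [indexAt, Int.le_floor]
    have hn' : (0 : ℝ) < n := Nat.cast_pos.mpr hn0
    have h3 : (n : ℝ) * (Real.sqrt n)⁻¹ = Real.sqrt n := by
      rw [← div_eq_mul_inv]; exact Real.div_sqrt
    rw [mul_add, ← mul_assoc, h3] at hn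
    simpa using hn
  have h4 : ∀ᶠ n : ℕ in atTop, ∑ a, indexAt g n x a < n := by
    have h5 : Tendsto (fun n : ℕ => ∑ a : Fin k, (g a.castSucc + (Real.sqrt n)⁻¹ * x a)) atTop
        (𝓝 (∑ a : Fin k, g a.castSucc)) := tendsto_finsetSum _ fun a _ => hlim a
    have h6 : ∑ a : Fin k, g a.castSucc < 1 := by
      rw [Fin.sum_univ_castSucc] at hg1; linarith [hg (Fin.last k)]
    filter_upwards [h5.eventually_lt_const h6, eventually_gt_atTop 0] with n hn hn0
    have hn' : (0 : ℝ) < n := Nat.cast_pos.mpr hn0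
    have h7 : ((∑ a, indexAt g n x a : ℤ) : ℝ) < n := by
      push_cast
      calc ∑ a, (indexAt g n x a : ℝ) ≤ ∑ a : Fin k, (n * g a.castSucc + Real.sqrt n * x a) :=
            Finset.sum_le_sum fun a _ => Int.floor_le _
        _ = n * ∑ a : Fin k, (g a.castSucc + (Real.sqrt n)⁻¹ * x a) := by
            rw [Finset.mul_sum]
            refine Finset.sum_congr rfl fun a _ => ?_
            rw [mul_add, ← mul_assoc, ← div_eq_mul_inv, Real.div_sqrt]
        _ < n * 1 := mul_lt_mul_of_pos_left hn hn'
        _ = n := mul_one _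
    exact_mod_cast h7
  filter_upwards [eventually_all.mpr h1, h4] with n hn hn'
  refine ⟨fun a => by linarith [hn a], hn'.le, fun j => Nat.add_pos_left ?_ _⟩
  refine Fin.lastCases ?_ (fun a => ?_) j
  · rw [sizeOfIndex, Fin.snoc_last]; omega
  · rw [sizeOfIndex, Fin.snoc_castSucc]; have := hn a; omega

lemma tendsto_div_sqrt {u : ℕ → ℝ} {w X K : ℝ}
    (h : ∀ᶠ n : ℕ in atTop, |u n - n * w - Real.sqrt n * X| ≤ K) :
    Tendsto (fun n : ℕ => (u n - n * w) / Real.sqrt n) atTop (𝓝 X) := by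
  have hdiv : Tendsto (fun n : ℕ => K * (Real.sqrt n)⁻¹) atTop (𝓝 0) := by
    simpa using (tendsto_inv_atTop_zero.comp tendsto_sqrt_natCast).const_mul K
  rw [← tendsto_sub_nhds_zero_iff]
  refine squeeze_zero_norm' ?_ hdiv
  filter_upwards [h, eventually_gt_atTop 0] with n hn hn0
  have hs : 0 < Real.sqrt n := Real.sqrt_pos.mpr (Nat.cast_pos.mpr hn0)
  have : (u n - n * w) / Real.sqrt n - X = (u n - n * w - Real.sqrt n * X) * (Real.sqrt n)⁻¹ := by
    field_simp
  rw [this, norm_mul, Real.norm_eq_abs, Real.norm_eq_abs, abs_of_pos (inv_pos.mpr hs)]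
  exact mul_le_mul_of_nonneg_right hn (inv_pos.mpr hs).le

lemma tendsto_scaledDensity (hk : 2 ≤ k) (hv : IsCcwPolygon v) {g : Fin (k + 1) → ℝ}
    (hg : ∀ j, 0 < g j) (hg1 : ∑ j, g j = 1) (l : Fin (k + 1) → ℝ) (x : Fin k → ℝ) :
    Tendsto (fun n : ℕ => scaledDensity v g n (sizeOfIndex n (indexAt g n x)) l) atTop
      (𝓝 (limitFactor v g l x)) := by
  have hvalid := eventually_validIndex hg hg1 x
  have hinv : Tendsto (fun n : ℕ => (n : ℝ)⁻¹) atTop (𝓝 0) := tendsto_inv_atTop_nhds_zero_nat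
  have hwidth : ∀ j, Tendsto (fun n : ℕ => width v (fun i => (n : ℝ)⁻¹ * l i) j) atTop
      (𝓝 (sideLength v j)) := by
    intro j
    have h1 : Tendsto (fun n : ℕ => fun i => (n : ℝ)⁻¹ * l i) atTop (𝓝 (0 : Fin (k + 1) → ℝ)) := by
      rw [tendsto_pi_nhds]
      intro i
      simpa using hinv.mul_const (l i)
    have h2 := (((continuous_apply j).comp (continuous_width (v := v))).tendsto 0).comp h1
    have h3 : width v 0 j = sideLength v j := by simp [width]
    simpa only [Function.comp_def, h3] using h2
  have hwpos : ∀ᶠ n : ℕ in atTop, ∀ j, 0 < width v (fun i => (n : ℝ)⁻¹ * l i) j :=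
    eventually_all.mpr fun j => (hwidth j).eventually_const_lt (sideLength_pos hk hv j)
  have hN : Tendsto (fun n : ℕ => (n : ℝ)) atTop atTop := tendsto_natCast_atTop_atTop
  have hf1 : ∀ j, Tendsto (fun n : ℕ => Real.sqrt n *
      poisson (n * g j) (sizeOfIndex n (indexAt g n x) j)) atTop
      (𝓝 (Real.exp (-extend x j ^ 2 / (2 * g j)) / Real.sqrt (2 * Real.pi * g j))) := by
    intro j
    refine tendsto_poisson (hg j) hN ?_ ?_
    · refine tendsto_const_nhds.congr' ?_
      filter_upwards [eventually_gt_atTop 0] with n hn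
      have : (n : ℝ) ≠ 0 := by positivity
      field_simp
    · refine tendsto_div_sqrt (K := k) ?_
      filter_upwards [hvalid] with n hn
      exact sizeOfIndex_close (by omega) hg1 hn j
  have hf2 : ∀ j, Tendsto (fun n : ℕ => Real.sqrt n * poisson (sideParam v g n l j)
      (sizeOfIndex n (indexAt g n x) j + sizeOfIndex n (indexAt g n x) (j - 1) - 1)) atTop
      (𝓝 (Real.exp (-(extend x j + extend x (j - 1)) ^ 2 / (2 * (g j + g (j - 1)))) /
        Real.sqrt (2 * Real.pi * (g j + g (j - 1))))) := by
    intro j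
    have hr := sideLength_pos hk hv j
    set G := g j + g (j - 1) with hG
    have hGpos : 0 < G := add_pos (hg j) (hg _)
    have hpar : ∀ᶠ n : ℕ in atTop, sideParam v g n l j =
        n * G - G / sideLength v j * (sideLength v j - width v l j) := by
      filter_upwards [eventually_gt_atTop 0] with n hn
      have : (n : ℝ) ≠ 0 := by positivity
      simp only [sideParam, width]
      field_simp
      ring
    refine tendsto_poisson hGpos hN ?_ ?_
    · have h1 := (hwidth j).const_mul (G / sideLength v j)
      rw [div_mul_cancel₀ _ hr.ne'] at h1
      refine h1.congr' ?_
      filter_upwards [eventually_gt_atTop 0] with n hn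
      have : (n : ℝ) ≠ 0 := by positivity
      rw [sideParam]
      field_simp
      rw [hG, mul_comm]
    -- The distances `l / n` shift the Poisson parameter `n * G` by the constant `D`, invisible at
    -- the scale `√n`; the centred sizes keep the limit they would have without it.
    · set D := G / sideLength v j * (sideLength v j - width v l j) with hD
      have h1 := tendsto_div_sqrt (K := 2 * k + 1 + |D|) (w := G)
        (X := extend x j + extend x (j - 1)) (u := fun n =>
          ((sizeOfIndex n (indexAt g n x) j + sizeOfIndex n (indexAt g n x) (j - 1) - 1 : ℕ) : ℝ)
            + D) (by
          filter_upwards [hvalid] with n hn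
          have h2 := abs_le.mp (pairSum_close (by omega) hg1 hn j)
          have h3 := le_abs_self D
          have h4 := neg_abs_le D
          rw [abs_le]
          constructor <;> linarith [h2.1, h2.2])
      refine h1.congr' ?_
      filter_upwards [hpar] with n hn
      rw [hn]; ring
  have hmain := (tendsto_const_nhds (x := Real.exp (-∑ j, rate v g j * l j))).mul
    (tendsto_finsetProd Finset.univ fun j _ => (hf1 j).mul (hf2 j))
  refine hmain.congr' ?_
  filter_upwards [hwpos] with n hn
  rw [scaledDensity, if_pos hn]

end DensityLimit

/-! ### Convergence of integrals against the densities -/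

section DominatedConvergence

variable {k : ℕ} {v : Fin (k + 1) → Plane}

open Classical in
/-- The density of the rescaled distances and of the smoothed size vector, up to a constant. -/
noncomputable def densityAt (v : Fin (k + 1) → Plane) (g : Fin (k + 1) → ℝ) (n : ℕ)
    (p : (Fin (k + 1) → ℝ) × (Fin k → ℝ)) : ℝ :=
  if (∀ j, 0 ≤ p.1 j) ∧ ValidIndex n (indexAt g n p.2) then
    scaledDensity v g n (sizeOfIndex n (indexAt g n p.2)) p.1
  else 0

open Classical in
/-- The limit of `densityAt`. -/
noncomputable def limitAt (v : Fin (k + 1) → Plane) (g : Fin (k + 1) → ℝ)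
    (p : (Fin (k + 1) → ℝ) × (Fin k → ℝ)) : ℝ :=
  if ∀ j, 0 ≤ p.1 j then limitFactor v g p.1 p.2 else 0

/-- The rescaled distances and fluctuations, in terms of the smoothed variables. -/
noncomputable def scaleMap (g : Fin (k + 1) → ℝ) (n : ℕ) (p : (Fin (k + 1) → ℝ) × (Fin k → ℝ)) :
    (Fin (k + 1) → ℝ) × EuclideanSpace ℝ (Fin k) :=
  (p.1, WithLp.toLp 2 fun a =>
    ((sizeOfIndex n (indexAt g n p.2) a.castSucc : ℝ) - n * g a.castSucc) / Real.sqrt n)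

lemma measurable_comp_index {E : Type*} [MeasurableSpace E] (g : Fin (k + 1) → ℝ) (n : ℕ)
    {F : (Fin k → ℤ) → (Fin (k + 1) → ℝ) → E} (hF : ∀ z, Measurable (F z)) :
    Measurable fun p : (Fin (k + 1) → ℝ) × (Fin k → ℝ) => F (indexAt g n p.2) p.1 := by
  have h1 : Measurable fun q : (Fin k → ℤ) × (Fin (k + 1) → ℝ) => F q.1 q.2 :=
    measurable_from_prod_countable_right hF
  have h2 : Measurable fun p : (Fin (k + 1) → ℝ) × (Fin k → ℝ) => (indexAt g n p.2, p.1) :=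
    ((measurable_indexAt g n).comp measurable_snd).prodMk measurable_fst
  exact h1.comp h2

lemma measurableSet_nonneg : MeasurableSet {l : Fin (k + 1) → ℝ | ∀ j, 0 ≤ l j} := by
  rw [show {l : Fin (k + 1) → ℝ | ∀ j, 0 ≤ l j} = ⋂ j, {l | 0 ≤ l j} by ext; simp]
  exact MeasurableSet.iInter fun j => measurableSet_le measurable_const (measurable_pi_apply j)

lemma measurable_scaledDensity (v : Fin (k + 1) → Plane) (g : Fin (k + 1) → ℝ) (n : ℕ)
    (s : Fin (k + 1) → ℕ) : Measurable (scaledDensity v g n s) := by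
  have hw : ∀ j, Measurable fun l : Fin (k + 1) → ℝ => width v (fun i => (n : ℝ)⁻¹ * l i) j := by
    intro j
    have h1 : Measurable fun l : Fin (k + 1) → ℝ => fun i => (n : ℝ)⁻¹ * l i := by fun_prop
    have h2 : Measurable fun l : Fin (k + 1) → ℝ => width v l j :=
      ((continuous_apply j).comp (continuous_width (v := v))).measurable
    exact h2.comp h1
  unfold scaledDensity
  refine Measurable.ite ?_ ?_ measurable_const
  · rw [show {l : Fin (k + 1) → ℝ | ∀ j, 0 < width v (fun i => (n : ℝ)⁻¹ * l i) j} =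
      ⋂ j, {l | 0 < width v (fun i => (n : ℝ)⁻¹ * l i) j} by ext; simp]
    exact MeasurableSet.iInter fun j => measurableSet_lt measurable_const (hw j)
  · refine Measurable.mul (by fun_prop) (Finset.measurable_fun_prod _ fun j _ => ?_)
    have : Measurable fun l : Fin (k + 1) → ℝ => sideParam v g n l j := by
      unfold sideParam
      exact ((hw j).const_mul _).const_mul _
    unfold poisson
    fun_prop

lemma measurable_densityAt (v : Fin (k + 1) → Plane) (g : Fin (k + 1) → ℝ) (n : ℕ) :
    Measurable (densityAt v g n) := by
  classical
  refine measurable_comp_index g n (F := fun z l =>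
    if (∀ j, 0 ≤ l j) ∧ ValidIndex n z then scaledDensity v g n (sizeOfIndex n z) l else 0) ?_
  intro z
  refine Measurable.ite ?_ (measurable_scaledDensity v g n _) measurable_const
  exact measurableSet_nonneg.inter (MeasurableSet.const _)

lemma measurable_scaleMap (g : Fin (k + 1) → ℝ) (n : ℕ) : Measurable (scaleMap (k := k) g n) := by
  have h := measurable_comp_index g n (F := fun z (_ : Fin (k + 1) → ℝ) =>
    (WithLp.toLp 2 fun a => ((sizeOfIndex n z a.castSucc : ℝ) - n * g a.castSucc) / Real.sqrt n :
      EuclideanSpace ℝ (Fin k))) fun _ => measurable_const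
  exact measurable_fst.prodMk h

lemma densityAt_nonneg (hk : 2 ≤ k) (hv : IsCcwPolygon v) {g : Fin (k + 1) → ℝ}
    (hg : ∀ j, 0 < g j) (n : ℕ) (p : (Fin (k + 1) → ℝ) × (Fin k → ℝ)) :
    0 ≤ densityAt v g n p := by
  unfold densityAt
  split_ifs
  · exact scaledDensity_nonneg hk hv hg _ _ _
  · exact le_rfl

lemma integrable_exp_neg_abs : Integrable fun x : ℝ => Real.exp (-|x|) := by
  refine (integrable_inv_one_add_sq.const_mul 2).mono' (by fun_prop) (ae_of_all _ fun x => ?_)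
  rw [Real.norm_eq_abs, Real.abs_exp, Real.exp_neg, ← div_eq_mul_inv, ← one_div,
    div_le_div_iff₀ (Real.exp_pos _) (by positivity)]
  have h := Real.quadratic_le_exp_of_nonneg (abs_nonneg x)
  rw [sq_abs] at h
  nlinarith [abs_nonneg x]

/-- The function dominating the densities. -/
noncomputable def dominant (m : Fin (k + 1) → ℝ) (p : (Fin (k + 1) → ℝ) × (Fin k → ℝ)) : ℝ :=
  (∏ j, (Set.Ici (0 : ℝ)).indicator (fun t => Real.exp (-m j * t)) (p.1 j)) *
    ∏ a, Real.exp (-|p.2 a|)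

lemma integrable_dominant {m : Fin (k + 1) → ℝ} (hm : ∀ j, 0 < m j) :
    Integrable (dominant (k := k) m) := by
  have h1 : Integrable fun l : Fin (k + 1) → ℝ =>
      ∏ j, (Set.Ici (0 : ℝ)).indicator (fun t => Real.exp (-m j * t)) (l j) := by
    refine Integrable.fintype_prod (f := fun j => (Set.Ici (0 : ℝ)).indicator
      (fun t => Real.exp (-m j * t))) fun j => ?_
    rw [integrable_indicator_iff measurableSet_Ici, integrableOn_Ici_iff_integrableOn_Ioi]
    exact exp_neg_integrableOn_Ioi 0 (hm j)
  have h2 : Integrable fun x : Fin k → ℝ => ∏ a, Real.exp (-|x a|) :=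
    Integrable.fintype_prod (f := fun _ : Fin k => fun t : ℝ => Real.exp (-|t|))
      fun _ => integrable_exp_neg_abs
  exact h1.mul_prod h2

lemma dominant_eq {m : Fin (k + 1) → ℝ} {p : (Fin (k + 1) → ℝ) × (Fin k → ℝ)}
    (hp : ∀ j, 0 ≤ p.1 j) :
    dominant m p = Real.exp (-∑ j, m j * p.1 j) * Real.exp (-∑ a, |p.2 a|) := by
  rw [dominant, ← Finset.sum_neg_distrib, ← Finset.sum_neg_distrib, Real.exp_sum, Real.exp_sum]
  congr 1
  refine Finset.prod_congr rfl fun j _ => ?_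
  rw [Set.indicator_of_mem (show p.1 j ∈ Set.Ici (0 : ℝ) from hp j), neg_mul]

lemma dominant_nonneg (m : Fin (k + 1) → ℝ) (p : (Fin (k + 1) → ℝ) × (Fin k → ℝ)) :
    0 ≤ dominant m p :=
  mul_nonneg (Finset.prod_nonneg fun _ _ => Set.indicator_nonneg (fun _ _ => (Real.exp_pos _).le) _)
    (Finset.prod_nonneg fun _ _ => (Real.exp_pos _).le)

lemma exists_densityAt_le (hk : 2 ≤ k) (hv : IsCcwPolygon v) {g : Fin (k + 1) → ℝ}
    (hg : ∀ j, 0 < g j) (hg1 : ∑ j, g j = 1) : ∃ C : ℝ, 0 < C ∧ ∀ n : ℕ, 0 < n → ∀ p,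
      densityAt v g n p ≤ C * dominant (rate v g) p := by
  obtain ⟨C, hC, h⟩ := scaledDensity_le hk hv hg hg1
  refine ⟨C, hC, fun n hn p => ?_⟩
  rw [densityAt]
  split_ifs with hp
  · rw [dominant_eq hp.1]
    exact h n p.2 p.1 hn hp.2
  · exact mul_nonneg hC.le (dominant_nonneg _ _)

lemma tendsto_densityAt (hk : 2 ≤ k) (hv : IsCcwPolygon v) {g : Fin (k + 1) → ℝ}
    (hg : ∀ j, 0 < g j) (hg1 : ∑ j, g j = 1) (p : (Fin (k + 1) → ℝ) × (Fin k → ℝ)) :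
    Tendsto (fun n => densityAt v g n p) atTop (𝓝 (limitAt v g p)) := by
  by_cases hp : ∀ j, 0 ≤ p.1 j
  · rw [limitAt, if_pos hp]
    refine (tendsto_scaledDensity hk hv hg hg1 p.1 p.2).congr' ?_
    filter_upwards [eventually_validIndex hg hg1 p.2] with n hn
    rw [densityAt, if_pos ⟨hp, hn⟩]
  · rw [limitAt, if_neg hp]
    refine tendsto_const_nhds.congr fun n => ?_
    rw [densityAt, if_neg fun h => hp h.1]

lemma tendsto_scaleMap (hk : 2 ≤ k) {g : Fin (k + 1) → ℝ}
    (hg : ∀ j, 0 < g j) (hg1 : ∑ j, g j = 1) (p : (Fin (k + 1) → ℝ) × (Fin k → ℝ)) :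
    Tendsto (fun n => scaleMap g n p) atTop (𝓝 (p.1, WithLp.toLp 2 p.2)) := by
  refine tendsto_const_nhds.prodMk_nhds ?_
  refine ((PiLp.continuous_toLp 2 (fun _ : Fin k => ℝ)).tendsto p.2).comp ?_
  rw [tendsto_pi_nhds]
  intro a
  refine tendsto_div_sqrt (K := k) (u := fun n => sizeOfIndex n (indexAt g n p.2) a.castSucc) ?_
  filter_upwards [eventually_validIndex hg hg1 p.2] with n hn
  have := sizeOfIndex_close (by omega) hg1 hn a.castSucc
  rwa [extend_castSucc] at this

/-- Dominated convergence; the dominating function is integrable over nonnegative distances because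
all rates are positive. -/
lemma tendsto_integral_densityAt (hk : 2 ≤ k) (hv : IsCcwPolygon v) {g : Fin (k + 1) → ℝ}
    (hg : ∀ j, 0 < g j) (hg1 : ∑ j, g j = 1) (hm : ∀ j, 0 < rate v g j)
    (φ : (Fin (k + 1) → ℝ) × EuclideanSpace ℝ (Fin k) →ᵇ ℝ) :
    Tendsto (fun n => ∫ p, densityAt v g n p * φ (scaleMap g n p)) atTop
      (𝓝 (∫ p, limitAt v g p * φ (p.1, WithLp.toLp 2 p.2))) := by
  obtain ⟨C, hC, hle⟩ := exists_densityAt_le hk hv hg hg1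
  refine tendsto_integral_filter_of_dominated_convergence
    (fun p => C * dominant (rate v g) p * ‖φ‖) ?_ ?_
    (((integrable_dominant hm).const_mul C).mul_const _) (ae_of_all _ fun p => ?_)
  · refine Eventually.of_forall fun n => Measurable.aestronglyMeasurable ?_
    have h1 : Measurable fun p => φ (scaleMap g n p) :=
      φ.continuous.measurable.comp (measurable_scaleMap g n)
    exact (measurable_densityAt v g n).mul h1
  · filter_upwards [eventually_gt_atTop 0] with n hn
    refine ae_of_all _ fun p => ?_
    rw [norm_mul, Real.norm_of_nonneg (densityAt_nonneg hk hv hg n p)]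
    exact mul_le_mul (hle n hn p) (φ.norm_coe_le_norm _) (norm_nonneg _)
      (mul_nonneg hC.le (dominant_nonneg _ _))
  · exact (tendsto_densityAt hk hv hg hg1 p).mul
      ((φ.continuous.tendsto _).comp (tendsto_scaleMap hk hg hg1 p))

end DominatedConvergence

/-! ### The law of the rescaled variables -/

section RescaledLaw

variable {k m : ℕ} {v : Fin (k + 1) → Plane}

/-- The constant in front of the density of the law of the rescaled variables. -/
noncomputable def normConst (v : Fin (k + 1) → Plane) (f : Fin (k + 1) → ℝ) (n : ℕ) : ℝ :=
  Real.sqrt n ^ k * ((n : ℝ)⁻¹) ^ (k + 1) * scaleConst v f n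

lemma normConst_pos (hk : 2 ≤ k) (hv : IsCcwPolygon v) {f : Fin (k + 1) → ℝ}
    (hf : ∀ j, 0 < f j) {n : ℕ} (hn : 0 < n) : 0 < normConst v f n := by
  have := scaleConst_pos hk hv hf hn
  have hn' : (0 : ℝ) < n := Nat.cast_pos.mpr hn
  unfold normConst
  positivity

/-- This combines `lintegral_rescaled` with `weight_eq`. All dependence on `n` that does not
converge is gathered in `normConst`, which cancels in the conditioned law and reappears in the
probability. -/
lemma map_restrict_goodSet (hk : 2 ≤ k) (hv : IsCcwPolygon v) (hm : 2 ≤ m)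
    {f : Fin (k + 1) → ℝ} (hf : IsPSSolution v f) :
    (volume.restrict (goodSet v m)).map (rescaled v (normalize f) (m + 1)) =
      ENNReal.ofReal (normConst v f (m + 1)) •
        ((volume.withDensity fun p => ENNReal.ofReal
          (densityAt v (normalize f) (m + 1) p)).map (scaleMap (normalize f) (m + 1))) := by
  set g := normalize f with hg
  have hg0 : ∀ j, 0 < g j := fun j => normalize_pos hf.1 j
  refine Measure.ext_of_lintegral _ fun F hF => ?_
  have hFs : Measurable fun p => F (scaleMap g (m + 1) p) := hF.comp (measurable_scaleMap g (m + 1))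
  have hd : Measurable fun p => ENNReal.ofReal (densityAt v g (m + 1) p) :=
    (measurable_densityAt v g (m + 1)).ennreal_ofReal
  rw [lintegral_map hF (measurable_rescaled g (m + 1)), lintegral_rescaled hk hv hm g hF,
    lintegral_smul_measure, lintegral_map hF (measurable_scaleMap g (m + 1)),
    lintegral_withDensity_eq_lintegral_mul _ hd hFs]
  have h1 : Measurable fun p => ENNReal.ofReal (densityAt v g (m + 1) p) * F (scaleMap g (m + 1) p) :=
    hd.mul hFs
  have h2 : ∫⁻ p, ENNReal.ofReal (densityAt v g (m + 1) p) * F (scaleMap g (m + 1) p) =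
      ∫⁻ x, ∫⁻ l, ENNReal.ofReal (densityAt v g (m + 1) (l, x)) * F (scaleMap g (m + 1) (l, x)) := by
    rw [Measure.volume_eq_prod, lintegral_prod_symm' _ h1]
  simp only [Pi.mul_apply]
  have hsc := (scaleConst_pos hk hv hf.1 (Nat.succ_pos m)).le
  have hK : ENNReal.ofReal (normConst v f (m + 1)) =
      ENNReal.ofReal (Real.sqrt (m + 1 : ℕ) ^ k * (((m + 1 : ℕ) : ℝ)⁻¹) ^ (k + 1)) *
        ENNReal.ofReal (scaleConst v f (m + 1)) := by
    rw [normConst, ENNReal.ofReal_mul (by positivity)]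
  rw [h2, smul_eq_mul, hK, mul_assoc,
    ← lintegral_const_mul' (ENNReal.ofReal (scaleConst v f (m + 1))) _ ENNReal.ofReal_ne_top]
  congr 1
  refine lintegral_congr fun x => ?_
  rw [← lintegral_const_mul' _ _ ENNReal.ofReal_ne_top]
  split_ifs with hx
  · refine lintegral_congr fun l => ?_
    split_ifs with hl
    · rw [weight_eq hk hv hf (Nat.succ_pos m) hx.validSize, densityAt, if_pos ⟨hl, hx⟩,
        ENNReal.ofReal_mul hsc, mul_assoc]
      rfl
    · rw [densityAt, if_neg fun h => hl h.1]
      simp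
  · rw [eq_comm, lintegral_eq_zero_iff' (by
      refine Measurable.aemeasurable ?_
      refine Measurable.const_mul ?_ _
      have h3 : Measurable fun l : Fin (k + 1) → ℝ => (l, x) := by fun_prop
      exact h1.comp h3)]
    refine ae_of_all _ fun l => ?_
    simp only [densityAt, if_neg fun h : (∀ j, 0 ≤ l j) ∧ ValidIndex (m + 1) (indexAt g (m + 1) x) =>
      hx h.2]
    simp

lemma integral_map_restrict (hk : 2 ≤ k) (hv : IsCcwPolygon v) (hm : 2 ≤ m)
    {f : Fin (k + 1) → ℝ} (hf : IsPSSolution v f)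
    (φ : (Fin (k + 1) → ℝ) × EuclideanSpace ℝ (Fin k) →ᵇ ℝ) :
    ∫ p, φ p ∂((volume.restrict (goodSet v m)).map (rescaled v (normalize f) (m + 1))) =
      normConst v f (m + 1) * ∫ p, densityAt v (normalize f) (m + 1) p *
        φ (scaleMap (normalize f) (m + 1) p) := by
  have hg0 : ∀ j, 0 < normalize f j := fun j => normalize_pos hf.1 j
  rw [map_restrict_goodSet hk hv hm hf, integral_smul_measure,
    ENNReal.toReal_ofReal (normConst_pos hk hv hf.1 (Nat.succ_pos m)).le, smul_eq_mul,
    integral_map (measurable_scaleMap _ _).aemeasurable φ.continuous.measurable.aestronglyMeasurable,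
    integral_withDensity_eq_integral_toReal_smul
      (measurable_densityAt v _ (m + 1)).ennreal_ofReal (ae_of_all _ fun _ => ENNReal.ofReal_lt_top)]
  congr 1
  refine integral_congr_ae (ae_of_all _ fun p => ?_)
  simp only [smul_eq_mul]
  rw [ENNReal.toReal_ofReal (densityAt_nonneg hk hv hg0 _ p)]

lemma toReal_volume_goodSet (hk : 2 ≤ k) (hv : IsCcwPolygon v) (hm : 2 ≤ m)
    {f : Fin (k + 1) → ℝ} (hf : IsPSSolution v f) :
    (volume (goodSet v m)).toReal =
      normConst v f (m + 1) * ∫ p, densityAt v (normalize f) (m + 1) p := by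
  have h := integral_map_restrict hk hv hm hf (BoundedContinuousFunction.const _ 1)
  simp only [BoundedContinuousFunction.const_apply, mul_one, integral_const, smul_eq_mul] at h
  rw [← h, measureReal_def, Measure.map_apply (measurable_rescaled _ _) MeasurableSet.univ,
    Set.preimage_univ, Measure.restrict_apply_univ]

lemma tendsto_integral_conditionedLaw (hk : 2 ≤ k) (hv : IsCcwPolygon v)
    {f : Fin (k + 1) → ℝ} (hf : IsPSSolution v f) (hr : ∀ j, 0 < rate v (normalize f) j)
    (hI : 0 < ∫ p, limitAt v (normalize f) p)
    (φ : (Fin (k + 1) → ℝ) × EuclideanSpace ℝ (Fin k) →ᵇ ℝ) :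
    Tendsto (fun n => ∫ p, φ p ∂((conditionedLaw v n).map (rescaled v (normalize f) n))) atTop
      (𝓝 ((∫ p, limitAt v (normalize f) p)⁻¹ *
        ∫ p, limitAt v (normalize f) p * φ (p.1, WithLp.toLp 2 p.2))) := by
  have hg0 : ∀ j, 0 < normalize f j := fun j => normalize_pos hf.1 j
  have h1 := tendsto_integral_densityAt hk hv hg0 (sum_normalize hf.1) hr φ
  have h2 := tendsto_integral_densityAt hk hv hg0 (sum_normalize hf.1) hr
    (BoundedContinuousFunction.const _ 1)
  simp only [BoundedContinuousFunction.const_apply, mul_one] at h2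
  refine ((h2.inv₀ hI.ne').mul h1).congr' ?_
  -- Uniqueness of the counterclockwise order and the genericity arguments need three points;
  -- smaller `n` do not affect the limit.
  filter_upwards [eventually_ge_atTop 3] with n hn
  obtain ⟨m, rfl⟩ : ∃ m, n = m + 1 := ⟨n - 1, by omega⟩
  have hm : 2 ≤ m := by omega
  rw [map_conditionedLaw hk hv hm, integral_smul_measure, integral_map_restrict hk hv hm hf,
    ENNReal.toReal_inv, toReal_volume_goodSet hk hv hm hf, smul_eq_mul]
  have := (normConst_pos hk hv hf.1 (Nat.succ_pos m)).ne'
  rw [mul_inv, mul_mul_mul_comm, inv_mul_cancel₀ this, one_mul]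

lemma tendsto_integral_densityAt_one (hk : 2 ≤ k) (hv : IsCcwPolygon v)
    {f : Fin (k + 1) → ℝ} (hf : IsPSSolution v f) (hr : ∀ j, 0 < rate v (normalize f) j) :
    Tendsto (fun n => ∫ p, densityAt v (normalize f) n p) atTop
      (𝓝 (∫ p, limitAt v (normalize f) p)) := by
  have hg0 : ∀ j, 0 < normalize f j := fun j => normalize_pos hf.1 j
  have h2 := tendsto_integral_densityAt hk hv hg0 (sum_normalize hf.1) hr
    (BoundedContinuousFunction.const _ 1)
  simpa only [BoundedContinuousFunction.const_apply, mul_one] using h2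

end RescaledLaw

/-! ### The quadratic form of the precision matrix -/

section Precision

variable {k : ℕ}

/-- The cyclic matrix of the quadratic form, in all variables. -/
noncomputable def cyclicMatrix (g : Fin (k + 1) → ℝ) (i j : Fin (k + 1)) : ℝ :=
  (if i = j then 1 / g i + 1 / (g i + g (i + 1)) + 1 / (g (i - 1) + g i) else 0)
    + (if i + 1 = j then 1 / (g i + g (i + 1)) else 0)
    + (if i = j + 1 then 1 / (g j + g (j + 1)) else 0)

lemma sum_cyclicMatrix (g X : Fin (k + 1) → ℝ) :
    ∑ i, ∑ j, X i * cyclicMatrix g i j * X j =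
      ∑ j, (X j ^ 2 / g j + (X j + X (j - 1)) ^ 2 / (g j + g (j - 1))) := by
  have h1 : ∀ i, ∑ j, X i * cyclicMatrix g i j * X j =
      X i ^ 2 / g i + (X i ^ 2 + X i * X (i + 1)) / (g i + g (i + 1))
        + (X i ^ 2 + X i * X (i - 1)) / (g (i - 1) + g i) := by
    intro i
    have e : ∀ j, (i = j + 1) = (i - 1 = j) := fun j => propext sub_eq_iff_eq_add.symm
    simp only [cyclicMatrix, e, mul_add, add_mul, Finset.sum_add_distrib, mul_ite, ite_mul, mul_zero,
      zero_mul, Finset.sum_ite_eq, Finset.mem_univ, if_true, sub_add_cancel]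
    ring
  have h2 := sum_sub_one fun i => (X i ^ 2 + X i * X (i + 1)) / (g i + g (i + 1))
  simp only [sub_add_cancel] at h2
  simp_rw [h1]
  rw [Finset.sum_add_distrib, Finset.sum_add_distrib, ← h2, ← Finset.sum_add_distrib,
    ← Finset.sum_add_distrib]
  refine Finset.sum_congr rfl fun j _ => ?_
  rw [add_comm (g j) (g (j - 1))]
  ring

/-- Substituting `x k = -∑ x a` in the cyclic quadratic form gives `M a b - M a k - M k b + M k k`.
The indicators in `precision` record which of these entries vanish when `a` or `b` is not adjacent
to the last index. -/
lemma precision_eq (hk : 2 ≤ k) (g : Fin (k + 1) → ℝ) (a b : Fin k) :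
    precision g a b = cyclicMatrix g a.castSucc b.castSucc - cyclicMatrix g a.castSucc (Fin.last k)
      - cyclicMatrix g (Fin.last k) b.castSucc + cyclicMatrix g (Fin.last k) (Fin.last k) := by
  have hL0 : Fin.last k ≠ 0 := by rw [Ne, Fin.ext_iff]; simp; omega
  have e1 : ∀ a : Fin k, a.castSucc + 1 = a.succ := fun a => Fin.coeSucc_eq_succ
  have e2 : ∀ a b : Fin k, (a.succ = b.castSucc) = (b.val = a.val + 1) := fun a b => by
    rw [Fin.ext_iff]; simp [eq_comm]
  have e2' : ∀ a b : Fin k, (b.castSucc = a.succ) = (b.val = a.val + 1) := fun a b => by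
    rw [Fin.ext_iff]; simp
  have e3 : ∀ a : Fin k, (a.succ = Fin.last k) = (a.val + 1 = k) := fun a => by
    rw [Fin.ext_iff]; simp
  have e3' : ∀ a : Fin k, (Fin.last k = a.succ) = (a.val + 1 = k) := fun a => by
    rw [Fin.ext_iff]; simp [eq_comm]
  have e4 : ∀ a : Fin k, (a.castSucc = 0) = (a.val = 0) := fun a => by
    rw [Fin.ext_iff]; simp
  have e4' : ∀ a : Fin k, (0 = a.castSucc) = (a.val = 0) := fun a => by
    rw [Fin.ext_iff]; simp [eq_comm]
  have e5 : ∀ a : Fin k, (a.castSucc = Fin.last k) = False := fun a => by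
    simp [Fin.ext_iff, a.isLt.ne]
  have e5' : ∀ a : Fin k, (Fin.last k = a.castSucc) = False := fun a => by
    simp [Fin.ext_iff, a.isLt.ne']
  have e6 : Fin.last k + 1 = 0 := Fin.last_add_one k
  have e7 : ∀ a : Fin k, a.val + 1 = k → a.castSucc = Fin.last k - 1 := fun a h => by
    rw [eq_sub_iff_add_eq, e1, e3]; exact h
  have e8 : ∀ a : Fin k, a.val = 0 → a.castSucc = 0 := fun a h => by rw [e4]; exact h
  have e9 : (0 : Fin (k + 1)) - 1 = Fin.last k := by rw [sub_eq_iff_eq_add, e6]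
  have e10 : ∀ a : Fin k, a.val + 1 = k → a.succ = Fin.last k := fun a h => by rw [e3]; exact h
  simp only [precision, cyclicMatrix, Matrix.of_apply, e1, e2, e2', e3, e3', e4, e4', e5, e5', e6,
    hL0, hL0.symm, if_true, if_false, Fin.castSucc_inj]
  have h6 : ∀ a b : Fin k, (if b.val = a.val + 1 then 1 / (g a.castSucc + g a.succ) else 0) =
      if b.val = a.val + 1 then 1 / (g a.castSucc + g b.castSucc) else 0 := fun a b =>
    if_ctx_congr Iff.rfl (fun h => by rw [← e2 a b] at h; rw [h]) fun _ => rfl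
  have h7 : ∀ b : Fin k, (if b.val + 1 = k then 1 / (g b.castSucc + g b.succ) else 0) =
      if b.val + 1 = k then 1 / (g (Fin.last k - 1) + g (Fin.last k)) else 0 := fun b =>
    if_ctx_congr Iff.rfl (fun h => by rw [e7 b h, e10 b h]) fun _ => rfl
  rcases lt_trichotomy a b with h | rfl | h
  · have h' : a.val < b.val := h
    have h3 : ¬ a.val = b.val + 1 := by omega
    have h4 : ¬ a.val + 1 = k := by have := b.isLt; omega
    have h5 : ¬ b.val = 0 := by omega
    simp only [h.ne, min_eq_left h.le, max_eq_right h.le, h3, h4, h5, h6, h7, if_false]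
    by_cases c1 : a.val = 0 <;> by_cases c2 : b.val + 1 = k <;>
      simp only [c1, c2, ne_eq, not_true, not_false_iff, if_true, if_false] <;> ring
  · have h9 : ¬ a.val = a.val + 1 := by omega
    simp only [h9, h7, if_true, if_false]
    by_cases c1 : a.val = 0 <;> by_cases c2 : a.val + 1 = k
    · omega
    · simp only [c2, ne_eq, not_false_iff, if_true, if_false]
      simp only [c1, e8 a c1, e9, ← e1, not_true, if_true, if_false]
      ring
    · simp only [c1, c2, e7 a c2, e10 a c2, ne_eq, not_true, not_false_iff, if_true, if_false]
      ring
    · simp only [c1, c2, ne_eq, not_false_iff, if_true, if_false]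
      rw [← e1]
      ring
  · have h' : b.val < a.val := h
    have h3 : ¬ b.val = a.val + 1 := by omega
    have h4 : ¬ b.val + 1 = k := by have := a.isLt; omega
    have h5 : ¬ a.val = 0 := by omega
    simp only [h.ne', min_eq_right h.le, max_eq_left h.le, h3, h4, h5, h6, h7, if_false]
    by_cases c1 : b.val = 0 <;> by_cases c2 : a.val + 1 = k <;>
      simp only [c1, c2, ne_eq, not_true, not_false_iff, if_true, if_false] <;> ring

lemma dotProduct_precision (hk : 2 ≤ k) (g : Fin (k + 1) → ℝ) (x : Fin k → ℝ) :
    x ⬝ᵥ (precision g).mulVec x = ∑ j, (extend x j ^ 2 / g j +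
      (extend x j + extend x (j - 1)) ^ 2 / (g j + g (j - 1))) := by
  rw [← sum_cyclicMatrix]
  simp only [Fin.sum_univ_castSucc, extend_castSucc, extend_last, dotProduct, Matrix.mulVec,
    precision_eq hk g, Finset.mul_sum]
  set M := cyclicMatrix g
  have h : ∀ a b, x a * ((M (Fin.castSucc a) (Fin.castSucc b) - M (Fin.castSucc a) (Fin.last k)
      - M (Fin.last k) (Fin.castSucc b) + M (Fin.last k) (Fin.last k)) * x b) =
      x a * M (Fin.castSucc a) (Fin.castSucc b) * x b - x a * M (Fin.castSucc a) (Fin.last k) * x b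
        - x a * (M (Fin.last k) (Fin.castSucc b) * x b) + x a * (M (Fin.last k) (Fin.last k) * x b) :=
    fun a b => by ring
  simp only [h, Finset.sum_add_distrib, Finset.sum_sub_distrib, ← Finset.mul_sum, ← Finset.sum_mul,
    mul_assoc]
  have h' : ∀ c, ∑ a, x a * (M (Fin.castSucc a) (Fin.last k) * c) =
      (∑ a, x a * M (Fin.castSucc a) (Fin.last k)) * c := fun c => by
    rw [Finset.sum_mul]
    exact Finset.sum_congr rfl fun a _ => by ring
  simp only [h']
  ring

lemma precision_posDef (hk : 2 ≤ k) {g : Fin (k + 1) → ℝ} (hg : ∀ j, 0 < g j) :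
    (precision g).PosDef := by
  refine Matrix.PosDef.of_dotProduct_mulVec_pos ?_ fun x hx => ?_
  · ext a b
    simp only [Matrix.conjTranspose_apply, star_trivial, precision, Matrix.of_apply, min_comm b a,
      max_comm b a, eq_comm (a := b) (b := a)]
    split_ifs with h <;> simp_all
  · rw [star_trivial, dotProduct_precision hk]
    obtain ⟨a, ha⟩ := Function.ne_iff.mp hx
    have hnn : ∀ j, 0 ≤ extend x j ^ 2 / g j +
      (extend x j + extend x (j - 1)) ^ 2 / (g j + g (j - 1)) := fun j => by
        have := hg j
        have := hg (j - 1)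
        positivity
    refine Finset.sum_pos' (fun j _ => hnn j) ⟨a.castSucc, Finset.mem_univ _, ?_⟩
    have := hg a.castSucc
    have := hg (a.castSucc - 1)
    have ha' : x a ≠ 0 := ha
    rw [extend_castSucc]
    positivity

end Precision

/-! ### The density of the limit law -/

section LimitLaw

variable {k : ℕ}

-- `multivariateGaussian` is the image of the standard Gaussian under the square root of the
-- covariance. This root transforms the form `Q` into the standard one and has determinant `±1 /
-- √(det Q)`, the Jacobian needed for the density.
open scoped MatrixOrder in
lemma exists_sqrt_inv {Q : Matrix (Fin k) (Fin k) ℝ} (hQ : Q.PosDef) :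
    ∃ R : Matrix (Fin k) (Fin k) ℝ, R = CFC.sqrt Q⁻¹ ∧ R.transpose * Q * R = 1 ∧
      |R.det| * Real.sqrt Q.det = 1 := by
  have hS : (Q⁻¹).PosSemidef := hQ.inv.posSemidef
  have hR : CFC.sqrt Q⁻¹ * CFC.sqrt Q⁻¹ = Q⁻¹ := CFC.sqrt_mul_sqrt_self _ hS.nonneg
  have hT : (CFC.sqrt Q⁻¹).transpose = CFC.sqrt Q⁻¹ := by
    have h : (CFC.sqrt Q⁻¹).conjTranspose = CFC.sqrt Q⁻¹ := (CFC.sqrt_nonneg Q⁻¹).isSelfAdjoint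
    rwa [Matrix.conjTranspose_eq_transpose_of_trivial] at h
  have hu : IsUnit Q.det := hQ.det_pos.ne'.isUnit
  have h1 : Q * CFC.sqrt Q⁻¹ * CFC.sqrt Q⁻¹ = 1 := by
    rw [Matrix.mul_assoc, hR, Matrix.mul_nonsing_inv _ hu]
  refine ⟨_, rfl, ?_, ?_⟩
  · rw [hT, Matrix.mul_assoc]
    exact mul_eq_one_comm.mp h1
  · have h2 := congrArg Matrix.det h1
    rw [Matrix.det_mul, Matrix.det_mul, Matrix.det_one] at h2
    rw [← Real.sqrt_sq_eq_abs, ← Real.sqrt_mul (sq_nonneg _), Real.sqrt_eq_one]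
    linarith

lemma prod_gaussianPDF (y : Fin k → ℝ) :
    ∏ a, gaussianPDF 0 1 (y a) =
      ENNReal.ofReal ((Real.sqrt ((2 * Real.pi) ^ k))⁻¹ * Real.exp (-(1 / 2) * (y ⬝ᵥ y))) := by
  simp only [gaussianPDF]
  rw [← ENNReal.ofReal_prod_of_nonneg fun a _ => gaussianPDFReal_nonneg _ _ _]
  congr 1
  simp only [gaussianPDFReal, sub_zero, NNReal.coe_one, mul_one]
  rw [Finset.prod_mul_distrib, Finset.prod_const, Finset.card_univ, Fintype.card_fin,
    ← Real.exp_sum, inv_pow]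
  congr 2
  · symm
    rw [Real.sqrt_eq_iff_mul_self_eq (by positivity) (by positivity), ← mul_pow,
      Real.mul_self_sqrt (by positivity)]
  · rw [dotProduct, Finset.mul_sum]
    exact Finset.sum_congr rfl fun a _ => by ring

/-- The change of variables `x = R y` carries the product of standard Gaussian densities to the
stated one, by the two identities of `exists_sqrt_inv`. -/
lemma multivariateGaussian_eq_withDensity {Q : Matrix (Fin k) (Fin k) ℝ} (hQ : Q.PosDef) :
    multivariateGaussian 0 Q⁻¹ = (volume : Measure (EuclideanSpace ℝ (Fin k))).withDensity
      fun x => ENNReal.ofReal (Real.sqrt (Q.det / (2 * Real.pi) ^ k) *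
        Real.exp (-(1 / 2) * ((fun a => x a) ⬝ᵥ Q.mulVec (fun a => x a)))) := by
  obtain ⟨R, hR, hRQ, hdet⟩ := exists_sqrt_inv hQ
  have hR0 : R.det ≠ 0 := fun h => by rw [h] at hdet; simp at hdet
  refine Measure.ext_of_lintegral _ fun F hF => ?_
  have hto : Measurable (WithLp.toLp 2 : (Fin k → ℝ) → EuclideanSpace ℝ (Fin k)) :=
    (PiLp.continuous_toLp 2 (fun _ : Fin k => ℝ)).measurable
  have hmv : Measurable fun y : Fin k → ℝ => R.mulVec y :=
    (Continuous.matrix_mulVec continuous_const continuous_id).measurable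
  have hd : Measurable fun x : EuclideanSpace ℝ (Fin k) =>
      ENNReal.ofReal (Real.sqrt (Q.det / (2 * Real.pi) ^ k) *
        Real.exp (-(1 / 2) * ((fun a => x a) ⬝ᵥ Q.mulVec (fun a => x a)))) := by
    simp only [dotProduct, Matrix.mulVec]
    fun_prop
  have hL : ∫⁻ x, F x ∂(multivariateGaussian 0 Q⁻¹) =
      ∫⁻ y : Fin k → ℝ, (∏ a, gaussianPDF 0 1 (y a)) * F (WithLp.toLp 2 (R.mulVec y)) := by
    have h1 : Measurable fun y : Fin k → ℝ => F (WithLp.toLp 2 (R.mulVec y)) :=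
      hF.comp (hto.comp hmv)
    have h2 : Measurable fun x : EuclideanSpace ℝ (Fin k) =>
      (0 : EuclideanSpace ℝ (Fin k)) + Matrix.toEuclideanCLM (𝕜 := ℝ) R x := by fun_prop
    have h6 : Measurable fun x : EuclideanSpace ℝ (Fin k) =>
      F ((0 : EuclideanSpace ℝ (Fin k)) + Matrix.toEuclideanCLM (𝕜 := ℝ) R x) := hF.comp h2
    have h3 : Measurable fun y : Fin k → ℝ => ∏ a, gaussianPDF 0 1 (y a) :=
      Finset.measurable_fun_prod _ fun a _ =>
        (measurable_gaussianPDF 0 1).comp (measurable_pi_apply a)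
    have h4 : Measure.pi (fun _ : Fin k => gaussianReal 0 1) =
        (volume : Measure (Fin k → ℝ)).withDensity fun y => ∏ a, gaussianPDF 0 1 (y a) := by
      have : SigmaFinite ((volume : Measure ℝ).withDensity (gaussianPDF 0 1)) := by
        rw [← gaussianReal_of_var_ne_zero 0 one_ne_zero]; infer_instance
      rw [gaussianReal_of_var_ne_zero 0 one_ne_zero,
        pi_withDensity (fun _ => volume) fun _ => measurable_gaussianPDF 0 1]
      rfl
    rw [multivariateGaussian, ← hR, lintegral_map hF h2, ← map_pi_eq_stdGaussian,
      lintegral_map h6 hto, h4]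
    simp only [zero_add, Matrix.toEuclideanCLM_toLp]
    rw [lintegral_withDensity_eq_lintegral_mul _ h3 h1]
    rfl
  have hRR : ∀ y : Fin k → ℝ, R.mulVec y ⬝ᵥ Q.mulVec (R.mulVec y) = y ⬝ᵥ y := fun y => by
    rw [Matrix.mulVec_mulVec, ← Matrix.vecMul_transpose, ← Matrix.dotProduct_mulVec,
      Matrix.mulVec_mulVec, ← Matrix.mul_assoc, hRQ, Matrix.one_mulVec]
  have h5 : Measurable fun x : Fin k → ℝ => ENNReal.ofReal (Real.sqrt (Q.det / (2 * Real.pi) ^ k) *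
      Real.exp (-(1 / 2) * (x ⬝ᵥ Q.mulVec x))) * F (WithLp.toLp 2 x) := (hd.mul hF).comp hto
  rw [hL, lintegral_withDensity_eq_lintegral_mul _ hd hF,
    ← (PiLp.volume_preserving_toLp (Fin k)).lintegral_comp (hd.mul hF)]
  simp only [Pi.mul_apply]
  rw [lintegral_mulVec hR0 h5, ← lintegral_const_mul' _ _ ENNReal.ofReal_ne_top]
  refine lintegral_congr fun y => ?_
  rw [hRR, prod_gaussianPDF, ← mul_assoc, ← ENNReal.ofReal_mul (abs_nonneg _)]
  congr 2
  rw [Real.sqrt_div hQ.det_pos.le, ← mul_assoc, mul_div_assoc', hdet, inv_eq_one_div]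

lemma limitLaw_eq {m : Fin (k + 1) → ℝ} (hm : ∀ j, 0 < m j) {Q : Matrix (Fin k) (Fin k) ℝ}
    (hQ : Q.PosDef) :
    limitLaw m Q = volume.withDensity fun p => ENNReal.ofReal (limitDensity m Q p) := by
  have hexp : ∀ j, expMeasure (m j) = volume.withDensity (exponentialPDF (m j)) := fun _ => rfl
  have hsf : ∀ j, SigmaFinite ((volume : Measure ℝ).withDensity (exponentialPDF (m j))) := fun j => by
    have := isProbabilityMeasure_expMeasure (hm j)
    rw [← hexp]; infer_instance
  have hpdf : ∀ r, Measurable (exponentialPDF r) := fun r =>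
    (measurable_exponentialPDFReal r).ennreal_ofReal
  have h1 : Measure.pi (fun j => expMeasure (m j)) =
      (volume : Measure (Fin (k + 1) → ℝ)).withDensity fun l => ∏ j, exponentialPDF (m j) (l j) := by
    simp only [hexp]
    rw [pi_withDensity (fun _ => volume) fun j => hpdf (m j)]
    rfl
  have hl : Measurable fun l : Fin (k + 1) → ℝ => ∏ j, exponentialPDF (m j) (l j) :=
    Finset.measurable_fun_prod _ fun j _ => (hpdf (m j)).comp (measurable_pi_apply j)
  have hd : Measurable fun x : EuclideanSpace ℝ (Fin k) =>
      ENNReal.ofReal (Real.sqrt (Q.det / (2 * Real.pi) ^ k) *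
        Real.exp (-(1 / 2) * ((fun a => x a) ⬝ᵥ Q.mulVec (fun a => x a)))) := by
    simp only [dotProduct, Matrix.mulVec]
    fun_prop
  rw [limitLaw, h1, multivariateGaussian_eq_withDensity hQ, prod_withDensity hl hd,
    Measure.volume_eq_prod]
  congr 1
  ext p
  have h2 : ∀ j, 0 ≤ if 0 ≤ p.1 j then m j * Real.exp (-(m j * p.1 j)) else 0 := fun j => by
    have := hm j
    split_ifs <;> positivity
  simp only [exponentialPDF_eq]
  rw [← ENNReal.ofReal_prod_of_nonneg fun j _ => h2 j,
    ← ENNReal.ofReal_mul (Finset.prod_nonneg fun j _ => h2 j), limitDensity, mul_assoc]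

end LimitLaw

/-! ### The limit theorem, given a solution of the system -/

section LimitTheorem

variable {k : ℕ} {v : Fin (k + 1) → Plane}

/-- The total mass of the limit of the densities. -/
noncomputable def limitMass (v : Fin (k + 1) → Plane) (g : Fin (k + 1) → ℝ) : ℝ :=
  (∏ j, (Real.sqrt (2 * Real.pi * g j) * Real.sqrt (2 * Real.pi * (g j + g (j - 1))))⁻¹) /
    ((∏ j, rate v g j) * Real.sqrt ((precision g).det / (2 * Real.pi) ^ k))

lemma limitMass_pos (hk : 2 ≤ k) {g : Fin (k + 1) → ℝ} (hg : ∀ j, 0 < g j)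
    (hm : ∀ j, 0 < rate v g j) : 0 < limitMass v g := by
  have h1 := (precision_posDef hk hg).det_pos
  refine div_pos (Finset.prod_pos fun j _ => ?_)
    (mul_pos (Finset.prod_pos fun j _ => hm j) (by positivity))
  have := hg j
  have := hg (j - 1)
  positivity

lemma limitAt_eq (hk : 2 ≤ k) {g : Fin (k + 1) → ℝ} (hg : ∀ j, 0 < g j)
    (hm : ∀ j, 0 < rate v g j) (p : (Fin (k + 1) → ℝ) × (Fin k → ℝ)) :
    limitAt v g p = limitMass v g *
      limitDensity (rate v g) (precision g) (p.1, WithLp.toLp 2 p.2) := by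
  have h1 := (precision_posDef hk hg).det_pos
  rw [limitAt, limitDensity]
  split_ifs with hp
  · have h2 : limitFactor v g p.1 p.2 =
        (∏ j, (Real.sqrt (2 * Real.pi * g j) * Real.sqrt (2 * Real.pi * (g j + g (j - 1))))⁻¹) *
        (Real.exp (-∑ j, rate v g j * p.1 j) *
          Real.exp (-(1 / 2) * (p.2 ⬝ᵥ (precision g).mulVec p.2))) := by
      rw [dotProduct_precision hk, Finset.mul_sum, Real.exp_sum, limitFactor, mul_left_comm,
        ← Finset.prod_mul_distrib]
      congr 1
      refine Finset.prod_congr rfl fun j _ => ?_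
      rw [mul_add (-(1 / 2) : ℝ), Real.exp_add, mul_inv]
      have e1 : -extend p.2 j ^ 2 / (2 * g j) = -(1 / 2) * (extend p.2 j ^ 2 / g j) := by ring
      have e2 : -(extend p.2 j + extend p.2 (j - 1)) ^ 2 / (2 * (g j + g (j - 1))) =
          -(1 / 2) * ((extend p.2 j + extend p.2 (j - 1)) ^ 2 / (g j + g (j - 1))) := by
        have := add_pos (hg j) (hg (j - 1))
        field_simp
      rw [e1, e2]
      ring
    have h3 : ∏ j, (if 0 ≤ p.1 j then rate v g j * Real.exp (-(rate v g j * p.1 j)) else 0) =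
        (∏ j, rate v g j) * Real.exp (-∑ j, rate v g j * p.1 j) := by
      rw [← Finset.sum_neg_distrib, Real.exp_sum, ← Finset.prod_mul_distrib]
      exact Finset.prod_congr rfl fun j _ => if_pos (hp j)
    have h4 : 0 < ∏ j, rate v g j := Finset.prod_pos fun j _ => hm j
    have h5 : 0 < Real.sqrt ((precision g).det / (2 * Real.pi) ^ k) := by positivity
    rw [h2, h3, limitMass]
    field_simp
  · push Not at hp
    obtain ⟨j, hj⟩ := hp
    rw [Finset.prod_eq_zero (Finset.mem_univ j) (if_neg (not_le.mpr hj)), zero_mul, zero_mul, mul_zero]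

lemma limitDensity_nonneg {m : Fin (k + 1) → ℝ} (hm : ∀ j, 0 < m j) (Q : Matrix (Fin k) (Fin k) ℝ)
    (p : (Fin (k + 1) → ℝ) × EuclideanSpace ℝ (Fin k)) : 0 ≤ limitDensity m Q p := by
  refine mul_nonneg (mul_nonneg (Finset.prod_nonneg fun j _ => ?_) (Real.sqrt_nonneg _))
    (Real.exp_pos _).le
  have := hm j
  split_ifs <;> positivity

lemma measurable_limitDensity (m : Fin (k + 1) → ℝ) (Q : Matrix (Fin k) (Fin k) ℝ) :
    Measurable (limitDensity m Q) := by
  have h : ∀ j, Measurable fun p : (Fin (k + 1) → ℝ) × EuclideanSpace ℝ (Fin k) =>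
      if 0 ≤ p.1 j then m j * Real.exp (-(m j * p.1 j)) else 0 := fun j =>
    Measurable.ite (measurableSet_le measurable_const (by fun_prop)) (by fun_prop) measurable_const
  unfold limitDensity
  refine ((Finset.measurable_fun_prod _ fun j _ => h j).mul_const _).mul ?_
  simp only [dotProduct, Matrix.mulVec]
  fun_prop

lemma integral_limitAt (hk : 2 ≤ k) {g : Fin (k + 1) → ℝ} (hg : ∀ j, 0 < g j)
    (hm : ∀ j, 0 < rate v g j) (φ : (Fin (k + 1) → ℝ) × EuclideanSpace ℝ (Fin k) →ᵇ ℝ) :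
    ∫ p, limitAt v g p * φ (p.1, WithLp.toLp 2 p.2) =
      limitMass v g * ∫ p, φ p ∂(limitLaw (rate v g) (precision g)) := by
  have hd := measurable_limitDensity (rate v g) (precision g)
  have hmp : MeasurePreserving (fun p : (Fin (k + 1) → ℝ) × (Fin k → ℝ) =>
      ((p.1, WithLp.toLp 2 p.2) : (Fin (k + 1) → ℝ) × EuclideanSpace ℝ (Fin k))) :=
    (MeasurePreserving.id (volume : Measure (Fin (k + 1) → ℝ))).prod
      (PiLp.volume_preserving_toLp (Fin k))
  have h1 : Measurable fun p : (Fin (k + 1) → ℝ) × EuclideanSpace ℝ (Fin k) =>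
      limitDensity (rate v g) (precision g) p * φ p := hd.mul φ.continuous.measurable
  rw [limitLaw_eq hm (precision_posDef hk hg), integral_withDensity_eq_integral_toReal_smul
    hd.ennreal_ofReal (ae_of_all _ fun _ => ENNReal.ofReal_lt_top), ← integral_const_mul]
  have h2 : ∀ p, (ENNReal.ofReal (limitDensity (rate v g) (precision g) p)).toReal • φ p =
      limitDensity (rate v g) (precision g) p * φ p := fun p => by
    rw [ENNReal.toReal_ofReal (limitDensity_nonneg hm _ p), smul_eq_mul]
  simp only [h2]
  rw [← hmp.map_eq, integral_map hmp.measurable.aemeasurable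
    (h1.const_mul _).aestronglyMeasurable]
  simp only [limitAt_eq hk hg hm, mul_assoc]

lemma integral_limitAt_one (hk : 2 ≤ k) {g : Fin (k + 1) → ℝ} (hg : ∀ j, 0 < g j)
    (hm : ∀ j, 0 < rate v g j) : ∫ p, limitAt v g p = limitMass v g := by
  have h := integral_limitAt hk hg hm (BoundedContinuousFunction.const _ 1)
  have h1 : ∀ j, IsProbabilityMeasure (expMeasure (rate v g j)) := fun j =>
    isProbabilityMeasure_expMeasure (hm j)
  have h2 : IsProbabilityMeasure (limitLaw (rate v g) (precision g)) := by
    unfold limitLaw; infer_instance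
  simpa using h

lemma convergesWeakly_map_conditionedLaw (hk : 2 ≤ k) (hv : IsCcwPolygon v) {f : Fin (k + 1) → ℝ}
    (hf : IsPSSolution v f) (hm : ∀ j, 0 < rate v (normalize f) j) :
    ConvergesWeakly (fun n => (conditionedLaw v n).map (rescaled v (normalize f) n))
      (limitLaw (rate v (normalize f)) (precision (normalize f))) := by
  intro φ
  have hg : ∀ j, 0 < normalize f j := fun j => normalize_pos hf.1 j
  have hI := limitMass_pos hk hg hm
  have h := tendsto_integral_conditionedLaw hk hv hf hm (by rwa [integral_limitAt_one hk hg hm]) φ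
  rwa [integral_limitAt_one hk hg hm, integral_limitAt hk hg hm, ← mul_assoc,
    inv_mul_cancel₀ hI.ne', one_mul] at h

/-- Bookkeeping of the powers of `2π`. The factor `√(2π)` on the right is the one that Stirling's
formula brings with `n!`. -/
lemma equivConst_eq (hk : 2 ≤ k) (v : Fin (k + 1) → Plane) {f : Fin (k + 1) → ℝ}
    (hf : ∀ j, 0 < f j) :
    equivConst v f = Real.sqrt (2 * Real.pi) * (∏ j, ((normalize f j + normalize f (j - 1)) /
      (sideLength v j * Real.sin (innerAngle v j)))) * limitMass v (normalize f) := by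
  have hg : ∀ j, 0 < normalize f j := fun j => normalize_pos hf j
  set q := Real.sqrt (2 * Real.pi) with hq
  have hq0 : 0 < q := Real.sqrt_pos.mpr (by positivity)
  have h1 : (2 * Real.pi) ^ (((k : ℝ) + 1) / 2) = q ^ (k + 1) := by
    rw [hq, Real.sqrt_eq_rpow, ← Real.rpow_natCast, ← Real.rpow_mul (by positivity)]
    congr 1
    push_cast
    ring
  have h2 : Real.sqrt ((precision (normalize f)).det / (2 * Real.pi) ^ k) =
      Real.sqrt (precision (normalize f)).det / q ^ k := by
    rw [Real.sqrt_div (precision_posDef hk hg).det_pos.le]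
    congr 1
    rw [Real.sqrt_eq_iff_mul_self_eq (by positivity) (by positivity), ← mul_pow,
      Real.mul_self_sqrt (by positivity)]
  have h3 : ∀ j, Real.sqrt ((f j + f (j - 1)) / f j) =
      (normalize f j + normalize f (j - 1)) * (q * q) *
        (Real.sqrt (2 * Real.pi * normalize f j) *
          Real.sqrt (2 * Real.pi * (normalize f j + normalize f (j - 1))))⁻¹ := by
    intro j
    have hG : 0 < normalize f j + normalize f (j - 1) := add_pos (hg j) (hg _)
    have e : (f j + f (j - 1)) / f j = (normalize f j + normalize f (j - 1)) / normalize f j := by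
      have hF : 0 < ∑ i, f i := Finset.sum_pos (fun j _ => hf j) Finset.univ_nonempty
      have := hf j
      simp only [normalize]
      field_simp
    rw [e, Real.sqrt_mul (show 0 ≤ 2 * Real.pi by positivity),
      Real.sqrt_mul (show 0 ≤ 2 * Real.pi by positivity), ← hq,
      Real.sqrt_div hG.le]
    have e1 : 0 < Real.sqrt (normalize f j) := Real.sqrt_pos.mpr (hg j)
    have e2 : 0 < Real.sqrt (normalize f j + normalize f (j - 1)) := Real.sqrt_pos.mpr hG
    have e3 := Real.mul_self_sqrt hG.le
    field_simp
    rw [sq, e3]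
  rw [equivConst, h1, limitMass, h2]
  simp only [h3, Finset.prod_div_distrib, Finset.prod_mul_distrib, Finset.prod_const,
    Finset.card_univ, Fintype.card_fin]
  have hD : 0 < Real.sqrt (precision (normalize f)).det :=
    Real.sqrt_pos.mpr (precision_posDef hk hg).det_pos
  set D := Real.sqrt (precision (normalize f)).det
  set A := ∏ j, (normalize f j + normalize f (j - 1))
  set B := ∏ j, (Real.sqrt (2 * Real.pi * normalize f j) *
          Real.sqrt (2 * Real.pi * (normalize f j + normalize f (j - 1))))⁻¹
  field_simp
  ring

/-- The probability is `n!` times `normConst` times a convergent integral, divided by `area ^ n`.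
Stirling's formula turns `exp (3 n) / n ^ (3 n)` into `exp (2 n) / n ^ (2 n)`, and the remaining
powers `√n * √n ^ k / n ^ (k + 1)` into `n ^ (-(k + 1) / 2)`. -/
lemma isEquivalent_fullSidedProb (hk : 2 ≤ k) (hv : IsCcwPolygon v) {f : Fin (k + 1) → ℝ}
    (hf : IsPSSolution v f) (hm : ∀ j, 0 < rate v (normalize f) j) :
    (fun n : ℕ => fullSidedProb v n) ~[atTop]
      (fun n : ℕ => equivConst v f * Real.exp (2 * n) * (∑ j, f j) ^ (3 * n)
        / (area v ^ n * (n : ℝ) ^ (2 * (n : ℝ) + ((k : ℝ) + 1) / 2))) := by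
  have hg : ∀ j, 0 < normalize f j := fun j => normalize_pos hf.1 j
  have hI := limitMass_pos hk hg hm
  have h1 := tendsto_integral_densityAt_one hk hv hf hm
  rw [integral_limitAt_one hk hg hm] at h1
  have h2 : (fun n : ℕ => ∫ p, densityAt v (normalize f) n p) ~[atTop]
      (fun _ => limitMass v (normalize f)) := (isEquivalent_const_iff_tendsto hI.ne').mpr h1
  have h3 := (Stirling.factorial_isEquivalent_stirling.mul h2).mul
    (IsEquivalent.refl (u := fun n : ℕ => normConst v f n / area v ^ n))
  refine (h3.congr_left ?_).congr_right ?_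
  · filter_upwards [eventually_ge_atTop 3] with n hn
    obtain ⟨m, rfl⟩ : ∃ m, n = m + 1 := ⟨n - 1, by omega⟩
    rw [fullSidedProb_eq hk hv (by omega), toReal_volume_goodSet hk hv (by omega) hf]
    simp only [Pi.mul_apply]
    ring
  · filter_upwards [eventually_gt_atTop 0] with n hn
    have hn' : (0 : ℝ) < n := Nat.cast_pos.mpr hn
    simp only [Pi.mul_apply]
    have hs : 0 < Real.sqrt n := Real.sqrt_pos.mpr hn'
    have hss : Real.sqrt n * Real.sqrt n = n := Real.mul_self_sqrt hn'.le
    have e1 : (n : ℝ) ^ (2 * (n : ℝ) + ((k : ℝ) + 1) / 2) = (n : ℝ) ^ (2 * n) * Real.sqrt n ^ (k + 1) := by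
      rw [Real.rpow_add hn', Real.sqrt_eq_rpow, ← Real.rpow_natCast, ← Real.rpow_natCast,
        ← Real.rpow_mul hn'.le]
      congr 2
      · push_cast; ring
      · push_cast; ring
    have e2 : Real.exp (3 * n) = Real.exp (2 * n) * Real.exp 1 ^ n := by
      rw [← Real.exp_nat_mul, ← Real.exp_add]; congr 1; ring
    have e3 : Real.sqrt (2 * n * Real.pi) = Real.sqrt (2 * Real.pi) * Real.sqrt n := by
      rw [← Real.sqrt_mul (by positivity)]; congr 1; ring
    have ha := area_pos hk hv
    rw [e1, e3, equivConst_eq hk v hf.1, normConst, scaleConst, e2, div_pow, inv_pow]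
    have he : 0 < Real.exp 1 ^ n := by positivity
    have e4 : (n : ℝ) ^ (3 * n) = (n : ℝ) ^ n * (n : ℝ) ^ (2 * n) := by rw [← pow_add]; congr 1; ring
    have e5 : (n : ℝ) ^ (k + 1) = Real.sqrt n ^ (k + 1) * Real.sqrt n ^ (k + 1) := by
      rw [← mul_pow, hss]
    have hnn : 0 < (n : ℝ) ^ n := by positivity
    have hnn' : 0 < (n : ℝ) ^ (2 * n) := by positivity
    rw [e4, e5]
    generalize (n : ℝ) ^ n = N at *
    generalize (n : ℝ) ^ (2 * n) = N' at *
    field_simp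
    rw [pow_succ' (Real.sqrt n) k]

end LimitTheorem

/-! ### The system of equations -/

section System

variable {k : ℕ}

/-- A primitive of the logarithm. -/
noncomputable def entropy (t : ℝ) : ℝ := t * Real.log t - t

lemma continuous_entropy : Continuous entropy := Real.continuous_mul_log.sub continuous_id

/-- Strict convexity in tangent form, with slope `log x`. The value `y = 0` is included because
minimisers may a priori lie on the boundary of the cube. -/
lemma entropy_lt {x y : ℝ} (hx : 0 < x) (hy : 0 ≤ y) (h : y ≠ x) :
    entropy x + (y - x) * Real.log x < entropy y := by
  unfold entropy
  rcases hy.eq_or_lt with rfl | hy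
  · simp; linarith
  · have h1 := Real.log_lt_sub_one_of_pos (div_pos hx hy) (by
      rw [Ne, div_eq_one_iff_eq hy.ne']; exact fun e => h e.symm)
    rw [Real.log_div hx.ne' hy.ne'] at h1
    have h2 := mul_lt_mul_of_pos_left h1 hy
    rw [mul_sub, mul_sub, mul_div_cancel₀ _ hy.ne'] at h2
    nlinarith

lemma entropy_le {x y : ℝ} (hx : 0 < x) (hy : 0 ≤ y) :
    entropy x + (y - x) * Real.log x ≤ entropy y := by
  rcases eq_or_ne y x with rfl | h
  · simp
  · exact (entropy_lt hx hy h).le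

/-- The convex function whose critical points are the solutions of the system. -/
noncomputable def potential (c f : Fin (k + 1) → ℝ) : ℝ :=
  ∑ j, (entropy (f j) + entropy (f j + f (j - 1)) - f j * Real.log (c j))

lemma continuous_potential (c : Fin (k + 1) → ℝ) : Continuous (potential c) := by
  have := continuous_entropy
  unfold potential
  fun_prop

lemma log_system {c f : Fin (k + 1) → ℝ} (hf : ∀ j, 0 < f j)
    (h : ∀ j, f j * (f j + f (j - 1)) * (f j + f (j + 1)) = c j) (j : Fin (k + 1)) :
    Real.log (c j) = Real.log (f j) + Real.log (f j + f (j - 1)) + Real.log (f (j + 1) + f j) := by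
  have h1 := hf j
  have h2 := hf (j - 1)
  have h3 := hf (j + 1)
  rw [← h j, Real.log_mul (by positivity) (by positivity), Real.log_mul (by positivity) (by positivity),
    add_comm (f (j + 1))]

/-- The tangent inequalities are added up. After a cyclic change of index their linear parts cancel
against the logarithms of `c`, by the system in the form `log_system`; strictness comes from a
coordinate where `f` and `f'` differ. -/
lemma potential_lt {c f f' : Fin (k + 1) → ℝ} (hf : ∀ j, 0 < f j)
    (h : ∀ j, f j * (f j + f (j - 1)) * (f j + f (j + 1)) = c j) (hf' : ∀ j, 0 < f' j)
    (hne : f' ≠ f) : potential c f < potential c f' := by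
  obtain ⟨i, hi⟩ := Function.ne_iff.mp hne
  have h1 : ∑ j, (entropy (f j) + (f' j - f j) * Real.log (f j)) < ∑ j, entropy (f' j) :=
    Finset.sum_lt_sum (fun j _ => entropy_le (hf j) (hf' j).le)
      ⟨i, Finset.mem_univ i, entropy_lt (hf i) (hf' i).le hi⟩
  have h2 : ∑ j, (entropy (f j + f (j - 1)) +
      (f' j + f' (j - 1) - (f j + f (j - 1))) * Real.log (f j + f (j - 1))) ≤
      ∑ j, entropy (f' j + f' (j - 1)) :=
    Finset.sum_le_sum fun j _ => entropy_le (add_pos (hf j) (hf _)) (add_pos (hf' j) (hf' _)).le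
  have h3 := sum_sub_one fun j => (f' j - f j) * Real.log (f (j + 1) + f j)
  simp only [sub_add_cancel] at h3
  have h4 : ∀ j, (f' j + f' (j - 1) - (f j + f (j - 1))) * Real.log (f j + f (j - 1)) =
      (f' j - f j) * Real.log (f j + f (j - 1)) +
        (f' (j - 1) - f (j - 1)) * Real.log (f j + f (j - 1)) := fun j => by ring
  simp only [h4, Finset.sum_add_distrib] at h1 h2
  rw [h3] at h2
  have h5 : ∑ j, (f' j - f j) * Real.log (c j) = ∑ j, (f' j - f j) * Real.log (f j) +
      ∑ j, (f' j - f j) * Real.log (f j + f (j - 1)) +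
      ∑ j, (f' j - f j) * Real.log (f (j + 1) + f j) := by
    rw [← Finset.sum_add_distrib, ← Finset.sum_add_distrib]
    exact Finset.sum_congr rfl fun j _ => by rw [log_system hf h j]; ring
  simp only [sub_mul _ _ (Real.log (c _)), Finset.sum_sub_distrib] at h5
  simp only [potential, Finset.sum_sub_distrib, Finset.sum_add_distrib]
  linarith

lemma exists_root {a b c M : ℝ} (ha : 0 ≤ a) (hb : 0 ≤ b) (hc : 0 < c) (hM : 0 < M)
    (hcM : c < M * M * M) : ∃ t, 0 < t ∧ t ≤ M ∧ t * (t + a) * (t + b) = c := by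
  have hcont : ContinuousOn (fun t : ℝ => t * (t + a) * (t + b)) (Set.Icc 0 M) := by fun_prop
  have hmem : c ∈ Set.Icc ((fun t : ℝ => t * (t + a) * (t + b)) 0)
      ((fun t : ℝ => t * (t + a) * (t + b)) M) := by
    refine ⟨by simpa using hc.le, hcM.le.trans ?_⟩
    change M * M * M ≤ M * (M + a) * (M + b)
    gcongr <;> linarith
  obtain ⟨t, ht, h⟩ := intermediate_value_Icc hM.le hcont hmem
  refine ⟨t, ht.1.lt_of_ne ?_, ht.2, h⟩
  rintro rfl
  simp at h
  exact hc.ne h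

/-- At a minimiser of the potential on a cube, each coordinate must be the root of its own equation
with the other coordinates fixed: replacing it by this root would otherwise decrease the potential.
The argument needs no derivative and also rules out boundary minimisers, since the root is positive.
-/
lemma exists_system (hk : 1 ≤ k) {c : Fin (k + 1) → ℝ} (hc : ∀ j, 0 < c j) :
    ∃ f : Fin (k + 1) → ℝ, (∀ j, 0 < f j) ∧
      ∀ j, f j * (f j + f (j - 1)) * (f j + f (j + 1)) = c j := by
  -- As `M` exceeds both `1` and every `c j`, each `c j` is less than `M ^ 3`. The root for a single
  -- coordinate therefore stays in the cube, whatever the other coordinates are.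
  set M : ℝ := 1 + ∑ j, c j with hM
  have hS : 0 < ∑ j, c j := Finset.sum_pos (fun j _ => hc j) Finset.univ_nonempty
  have hM0 : 0 < M := by linarith
  have hcM : ∀ j, c j < M * M * M := fun j => by
    have h1 := Finset.single_le_sum (fun i _ => (hc i).le) (Finset.mem_univ j)
    have h2 : c j < M := by linarith
    nlinarith
  obtain ⟨f, hf, hmin⟩ := (isCompact_Icc (a := (0 : Fin (k + 1) → ℝ)) (b := fun _ => M)).exists_isMinOn
    ⟨0, Set.left_mem_Icc.mpr fun _ => hM0.le⟩ (continuous_potential c).continuousOn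
  have hf0 : ∀ j, 0 ≤ f j := hf.1
  have key : ∀ j, ∃ t, 0 < t ∧ t * (t + f (j - 1)) * (t + f (j + 1)) = c j ∧ f j = t := by
    intro j
    obtain ⟨t, ht, htM, hroot⟩ := exists_root (hf0 (j - 1)) (hf0 (j + 1)) (hc j) hM0 (hcM j)
    refine ⟨t, ht, hroot, ?_⟩
    by_contra hne
    have hj : (1 : Fin (k + 1)) ≠ 0 := by
      obtain ⟨d, rfl⟩ : ∃ d, k = d + 1 := ⟨k - 1, by omega⟩
      exact one_ne_zero
    have hj1 : j ≠ j + 1 := fun e => hj (left_eq_add.mp e)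
    have hj2 : j - 1 ≠ j := fun e => hj (sub_eq_self.mp e)
    set f' := Function.update f j t with hf'
    have e1 : f' j = t := Function.update_self ..
    have e2 : ∀ i, i ≠ j → f' i = f i := fun i hi => Function.update_of_ne hi ..
    have hle : potential c f ≤ potential c f' := hmin ⟨fun i => by
        rcases eq_or_ne i j with rfl | hi
        · rw [e1]; exact ht.le
        · rw [e2 i hi]; exact hf.1 i, fun i => by
        rcases eq_or_ne i j with rfl | hi
        · rw [e1]; exact htM
        · rw [e2 i hi]; exact hf.2 i⟩
    have s1 : ∑ i, (entropy (f i) - entropy (f' i)) = entropy (f j) - entropy t := by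
      rw [Fintype.sum_eq_single j fun i hi => by rw [e2 i hi, sub_self], e1]
    have s2 : ∑ i, (entropy (f i + f (i - 1)) - entropy (f' i + f' (i - 1))) =
        (entropy (f j + f (j - 1)) - entropy (t + f (j - 1))) +
        (entropy (f (j + 1) + f j) - entropy (f (j + 1) + t)) := by
      rw [Fintype.sum_eq_add j (j + 1) hj1 fun i hi => by
        rw [e2 i hi.1, e2 (i - 1) fun e => hi.2 (by rw [← e, sub_add_cancel]), sub_self]]
      rw [add_sub_cancel_right, e1, e2 _ hj2, e2 _ hj1.symm]
    have s3 : ∑ i, (f i * Real.log (c i) - f' i * Real.log (c i)) = (f j - t) * Real.log (c j) := by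
      rw [Fintype.sum_eq_single j fun i hi => by rw [e2 i hi, sub_self], e1]
      ring
    have h1 := entropy_lt ht (hf0 j) hne
    have h2 := entropy_le (add_pos_of_pos_of_nonneg ht (hf0 (j - 1))) (add_nonneg (hf0 j) (hf0 (j - 1)))
    have h3 := entropy_le (add_pos_of_nonneg_of_pos (hf0 (j + 1)) ht) (add_nonneg (hf0 (j + 1)) (hf0 j))
    have h4 : Real.log (c j) = Real.log t + Real.log (t + f (j - 1)) + Real.log (f (j + 1) + t) := by
      have := hf0 (j - 1)
      have := hf0 (j + 1)
      rw [← hroot, Real.log_mul (by positivity) (by positivity),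
        Real.log_mul (by positivity) (by positivity), add_comm t (f (j + 1))]
    rw [Finset.sum_sub_distrib] at s1 s2 s3
    rw [h4] at s3
    simp only [potential, Finset.sum_sub_distrib, Finset.sum_add_distrib] at hle
    nlinarith
  have hpos : ∀ j, 0 < f j := fun j => by
    obtain ⟨t, ht, -, e⟩ := key j
    rwa [e]
  refine ⟨f, hpos, fun j => ?_⟩
  obtain ⟨t, -, h, e⟩ := key j
  rw [e]
  exact h

lemma system_unique {c f f' : Fin (k + 1) → ℝ} (hf : ∀ j, 0 < f j)
    (h : ∀ j, f j * (f j + f (j - 1)) * (f j + f (j + 1)) = c j) (hf' : ∀ j, 0 < f' j)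
    (h' : ∀ j, f' j * (f' j + f' (j - 1)) * (f' j + f' (j + 1)) = c j) : f' = f := by
  by_contra hne
  exact (potential_lt hf h hf' hne).asymm (potential_lt hf' h' hf fun e => hne e.symm)

lemma exists_unique_isPSSolution (hk : 2 ≤ k) {v : Fin (k + 1) → Plane} (hv : IsCcwPolygon v) :
    ∃ f, IsPSSolution v f ∧ ∀ f', IsPSSolution v f' → f' = f := by
  obtain ⟨f, hf, h⟩ := exists_system (k := k) (by omega) (c := fun j =>
    sideLength v j * sideLength v (j + 1) * Real.sin (innerAngle v j)) fun j =>
      mul_pos (mul_pos (sideLength_pos hk hv j) (sideLength_pos hk hv _)) (sin_innerAngle_pos hk hv j)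
  exact ⟨f, ⟨hf, h⟩, fun f' h' => system_unique hf h h'.1 h'.2⟩

end System

end PCP

/-! ### Assembly of the main theorem -/

theorem mainTheorem4 (k : ℕ) (hk : 2 ≤ k) (v : Fin (k + 1) → PCP.Plane)
    (hv : PCP.IsCcwPolygon v) :
    ∃ f : Fin (k + 1) → ℝ,
      PCP.IsPSSolution v f ∧ (∀ f', PCP.IsPSSolution v f' → f' = f) ∧
      ((∀ j, 0 < PCP.rate v (PCP.normalize f) j) →
        -- the limit of the rescaled side-distances and size vector
        PCP.ConvergesWeakly
          (fun n => (PCP.conditionedLaw v n).map (PCP.rescaled v (PCP.normalize f) n))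
          (PCP.limitLaw (PCP.rate v (PCP.normalize f)) (PCP.precision (PCP.normalize f))) ∧
        (PCP.precision (PCP.normalize f)).PosDef ∧
        PCP.limitLaw (PCP.rate v (PCP.normalize f)) (PCP.precision (PCP.normalize f)) =
          volume.withDensity (fun p => ENNReal.ofReal
            (PCP.limitDensity (PCP.rate v (PCP.normalize f))
              (PCP.precision (PCP.normalize f)) p)) ∧
        -- the asymptotic equivalent
        (fun n : ℕ => PCP.fullSidedProb v n) ~[atTop]
          (fun n : ℕ => PCP.equivConst v f * Real.exp (2 * n) * (∑ j, f j) ^ (3 * n)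
            / (PCP.area v ^ n * (n : ℝ) ^ (2 * (n : ℝ) + ((k : ℝ) + 1) / 2)))) := by
  obtain ⟨f, hf, huniq⟩ := PCP.exists_unique_isPSSolution hk hv
  have hg : ∀ j, 0 < PCP.normalize f j := fun j => PCP.normalize_pos hf.1 j
  exact ⟨f, hf, huniq, fun hm => ⟨PCP.convergesWeakly_map_conditionedLaw hk hv hf hm,
    PCP.precision_posDef hk hg, PCP.limitLaw_eq hm (PCP.precision_posDef hk hg),
    PCP.isEquivalent_fullSidedProb hk hv hf hm⟩⟩
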